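/- Let $G=(V,E)$ be a graph on $n$ vertices $0,\dots,n-1$ with nonnegative integer edge weights $c$, let $\mathcal W$ be the sum of the weights of all edges, and let a rooted tree decomposition of $G$ be given, with a tree of $N$ nodes, of width $w\ge 1$ (size of the largest bag minus one) and depth $d$ (the maximum number of distinct vertices in the union of the bags on a path from the root to a leaf). Then the Traveling Salesman problem for $G$, i.e. finding a Hamiltonian cycle of minimum total weight together with its weight, or reporting that $G$ has no Hamiltonian cycle, can be solved in time $O\big((4w)^d\cdot \mathrm{poly}(n,N)\big)$ and, simultaneously, in space $O\big(\max(\mathcal W,1)\, d\, w\, n\log n+\log N\big)$ bits. More precisely, there are one program for a random access machine (integer registers; addition, subtraction, multiplication, division with remainder, left shift, number of binary digits; indirect addressing; read-only input and write-only output) and absolute constants $C,k$ such that, for every such input, the program halts with a correct answer after at most $C(4w)^d(n+N)^k$ steps, which cost at most $C(4w)^d(n+N+\mathcal W)^k$ bit operations, and at every moment the nonzero registers (contents and register numbers) occupy at most $C\,(\max(\mathcal W,1)\, d\, w\, n\log n+\log N)$ bits. -/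

import Mathlib

/-! ## Tree decompositions -/

/-- A rooted tree decomposition, with `N` nodes, of a graph `G` on the vertices `0, …, n - 1`. -/
structure TreeDecomposition {n : ℕ} (G : SimpleGraph (Fin n)) (N : ℕ) where
  /-- the underlying tree -/
  tree : SimpleGraph (Fin N)
  isTree : tree.IsTree
  root : Fin N
  /-- the bag of a node -/
  bag : Fin N → Finset (Fin n)
  /-- the bags cover all vertices -/
  vertex_mem : ∀ v, ∃ x, v ∈ bag x
  /-- every edge lies in some bag -/
  edge_mem : ∀ u v, G.Adj u v → ∃ x, u ∈ bag x ∧ v ∈ bag x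
  /-- if `z` is on the path connecting `x` and `y`, then `bag x ∩ bag y ⊆ bag z` -/
  inter_subset : ∀ (x y z : Fin N) (p : tree.Walk x y), p.IsPath → z ∈ p.support →
    bag x ∩ bag y ⊆ bag z

namespace TreeDecomposition

variable {n N : ℕ} {G : SimpleGraph (Fin n)}

/-- The width: the size of a largest bag, minus one. -/
def width (D : TreeDecomposition G N) : ℕ :=
  (Finset.univ.sup fun x => (D.bag x).card) - 1

/-- The path in the tree from the node `x` to the root. -/
noncomputable def toRoot (D : TreeDecomposition G N) (x : Fin N) : D.tree.Walk x D.root :=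
  (D.isTree.existsUnique_path x D.root).choose

/-- The parent of a node; the root is its own parent. -/
noncomputable def parent (D : TreeDecomposition G N) (x : Fin N) : Fin N :=
  (D.toRoot x).snd

/-- The depth: the maximum number of distinct vertices in the union of all bags on a path going
down from the root. (The union grows along such a path, so the maximum is attained at a leaf.) -/
noncomputable def depth (D : TreeDecomposition G N) : ℕ :=
  Finset.univ.sup fun x => ((D.toRoot x).support.toFinset.biUnion D.bag).card

end TreeDecomposition

/-! ## The Traveling Salesman problem -/

namespace TSP

/-- The sum of the weights of all edges. -/
noncomputable def totalWeight {n : ℕ} (G : SimpleGraph (Fin n)) (c : Sym2 (Fin n) → ℕ) : ℕ :=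
  open Classical in ∑ e ∈ Finset.univ.filter (fun e => e ∈ G.edgeSet), c e

/-- The cost of a walk. -/
def cost {n : ℕ} {G : SimpleGraph (Fin n)} (c : Sym2 (Fin n) → ℕ) {a b : Fin n}
    (p : G.Walk a b) : ℕ :=
  (p.edges.map c).sum

/-- `out` is a correct answer for the weighted graph `(G, c)`: either it consists of the cost of a
minimum cost Hamiltonian cycle followed by the vertices of that cycle in cyclic order (each vertex
listed once), or there is no Hamiltonian cycle and it is empty. -/
def IsAnswer {n : ℕ} (G : SimpleGraph (Fin n)) (c : Sym2 (Fin n) → ℕ) (out : List ℤ) : Prop :=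
  (∃ (a : Fin n) (p : G.Walk a a), p.IsHamiltonianCycle ∧
      (∀ (b : Fin n) (q : G.Walk b b), q.IsHamiltonianCycle → cost c p ≤ cost c q) ∧
      out = (cost c p : ℤ) :: p.support.tail.map (fun v => ((v : ℕ) : ℤ))) ∨
  ((∀ (a : Fin n) (p : G.Walk a a), ¬ p.IsHamiltonianCycle) ∧ out = [])

/-- The input of the algorithm, a sequence of natural numbers:
* `n` and the number `N` of nodes of the tree;
* the `n × n` matrix, row by row, with entry `0` for a non-edge and `c {u, v} + 1` for an edge;
* the parent of each of the `N` nodes of the tree (the root is its own parent);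
* the `N × n` incidence matrix, row by row, with entry `1` if the vertex is in the bag. -/
noncomputable def encode {n N : ℕ} (G : SimpleGraph (Fin n)) (c : Sym2 (Fin n) → ℕ)
    (D : TreeDecomposition G N) : List ℕ :=
  open Classical in
  [n, N]
    ++ List.ofFn (fun k : Fin (n * n) =>
        if G.Adj k.divNat k.modNat then c s(k.divNat, k.modNat) + 1 else 0)
    ++ List.ofFn (fun x : Fin N => (D.parent x : ℕ))
    ++ List.ofFn (fun k : Fin (N * n) => if k.modNat ∈ D.bag k.divNat then 1 else 0)

end TSP

/-! ## Random access machines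

Structured programs for a random access machine: the memory consists of registers `0, 1, 2, …`
that hold integers and are `0` at the start; there are a read-only random access input and a
write-only output. -/

namespace RAM

/-- The number of bits of an integer, sign included (and at least one). -/
def len (z : ℤ) : ℕ := z.natAbs.size + 1

/-- Arithmetic operations. -/
inductive Op
  | add | sub | mul | div | mod
  /-- `a * 2 ^ b` -/
  | shl
  /-- the number of binary digits of the first operand; the second operand is not used -/
  | size

/-- The result of an operation. -/
def Op.eval : Op → ℤ → ℤ → ℤ
  | .add, a, b => a + b
  | .sub, a, b => a - b
  | .mul, a, b => a * b
  | .div, a, b => a / b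
  | .mod, a, b => a % b
  | .shl, a, b => a * 2 ^ b.toNat
  | .size, a, _ => (a.natAbs.size : ℤ)

/-- The number of bit operations charged for an operation: that of the schoolbook method for
multiplication and division, and the total length of operands and result otherwise. -/
def Op.bitCost : Op → ℤ → ℤ → ℕ
  | .mul, a, b => len a * len b
  | .div, a, b => len a * len b
  | .mod, a, b => len a * len b
  | o, a, b => len a + len b + len (o.eval a b)

/-- Instructions; register numbers are natural numbers. -/
inductive Instr
  /-- `R[r] := z` -/
  | const (r : ℕ) (z : ℤ)
  /-- `R[r] := R[a] ∘ R[b]` -/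
  | op (o : Op) (r a b : ℕ)
  /-- `R[r] := R[R[a]]` -/
  | load (r a : ℕ)
  /-- `R[R[a]] := R[b]` -/
  | store (a b : ℕ)
  /-- `R[r] := ` the input number at position `R[a]` (`0` beyond the end of the input) -/
  | read (r a : ℕ)
  /-- append `R[a]` to the output -/
  | write (a : ℕ)

/-- Programs. The tests are `0 < R[a]`. -/
inductive Prog
  | instr (i : Instr)
  | seq (p q : Prog)
  | ite (a : ℕ) (p q : Prog)
  | loop (a : ℕ) (p : Prog)

/-- The contents of the memory, and the output written so far. -/
structure State where
  mem : ℕ →₀ ℤ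
  out : List ℤ

/-- The initial state. -/
noncomputable def State.start : State := ⟨0, []⟩

/-- The space occupied in a state, in bits: every nonzero register is charged for its number and
for its contents. (The input is read-only and the output write-only; they are not charged.) -/
noncomputable def State.space (s : State) : ℕ :=
  s.mem.sum fun r z => len (r : ℤ) + len z

/-- The effect of an instruction on the input `inp`. -/
noncomputable def Instr.exec (inp : List ℕ) (s : State) : Instr → State
  | .const r z => { s with mem := s.mem.update r z }
  | .op o r a b => { s with mem := s.mem.update r (o.eval (s.mem a) (s.mem b)) }
  | .load r a => { s with mem := s.mem.update r (s.mem (s.mem a).toNat) }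
  | .store a b => { s with mem := s.mem.update (s.mem a).toNat (s.mem b) }
  | .read r a => { s with mem := s.mem.update r (inp.getD (s.mem a).toNat 0 : ℕ) }
  | .write a => { s with out := s.out ++ [s.mem a] }

/-- The number of bit operations charged for an instruction: the lengths of all register numbers
and data involved, with the cost of the operation in the arithmetic case. -/
noncomputable def Instr.bitCost (inp : List ℕ) (s : State) : Instr → ℕ
  | .const r z => len r + len z
  | .op o r a b => len r + len a + len b + o.bitCost (s.mem a) (s.mem b)
  | .load r a => len r + len a + len (s.mem a) + len (s.mem (s.mem a).toNat)
  | .store a b => len a + len b + len (s.mem a) + len (s.mem b)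
  | .read r a => len r + len a + len (s.mem a) + len (inp.getD (s.mem a).toNat 0 : ℕ)
  | .write a => len a + len (s.mem a)

/-- The number of bit operations charged for a test of register `a`. -/
noncomputable def testCost (s : State) (a : ℕ) : ℕ := len a + len (s.mem a)

/-- `Run inp p s f t b m`: on the input `inp`, the program `p`, started in state `s`, halts in
state `f` after `t` steps (every instruction and every test is one step) and `b` bit operations,
and `m` is the maximum space occupied in a state that it went through. Programs have no recursion,
so the position in the program takes a constant amount of space, which is not counted. -/
inductive Run (inp : List ℕ) : Prog → State → State → ℕ → ℕ → ℕ → Prop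
  | instr (i : Instr) (s : State) :
      Run inp (.instr i) s (i.exec inp s) 1 (i.bitCost inp s)
        (max s.space (i.exec inp s).space)
  | seq {p q : Prog} {s f g : State} {t₁ t₂ b₁ b₂ m₁ m₂ : ℕ} :
      Run inp p s f t₁ b₁ m₁ → Run inp q f g t₂ b₂ m₂ →
      Run inp (.seq p q) s g (t₁ + t₂) (b₁ + b₂) (max m₁ m₂)
  | ite_pos {a : ℕ} {p q : Prog} {s f : State} {t b m : ℕ} :
      0 < s.mem a → Run inp p s f t b m →
      Run inp (.ite a p q) s f (t + 1) (b + testCost s a) m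
  | ite_neg {a : ℕ} {p q : Prog} {s f : State} {t b m : ℕ} :
      ¬ 0 < s.mem a → Run inp q s f t b m →
      Run inp (.ite a p q) s f (t + 1) (b + testCost s a) m
  | loop_done {a : ℕ} {p : Prog} {s : State} :
      ¬ 0 < s.mem a → Run inp (.loop a p) s s 1 (testCost s a) s.space
  | loop_step {a : ℕ} {p : Prog} {s f g : State} {t₁ t₂ b₁ b₂ m₁ m₂ : ℕ} :
      0 < s.mem a → Run inp p s f t₁ b₁ m₁ → Run inp (.loop a p) f g t₂ b₂ m₂ →
      Run inp (.loop a p) s g (t₁ + t₂ + 1) (b₁ + b₂ + testCost s a) (max m₁ m₂)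

end RAM

/-!
The vertices of the graph are eliminated in the order of the depths of the top nodes of their
subtrees in the decomposition. The predecessors `S v` of a vertex `v` in the bag of its top node form
a clique of the elimination order (`TreeDecomposition.IsOrder.chordal`), contain all its neighbours
among the earlier vertices, and number at most `w`; the forest in which the parent of `v` is the
last vertex of `S v` has depth at most `d` (`TreeDecomposition.IsOrder.lev_le`). Everything that is
computed is a sum of products of local weights that factors along this forest, so that it can be
evaluated by a depth-first traversal that keeps one partial sum and one partial product per level.

**Counting.** A Hamiltonian cycle is a connected graph with `n` edges on the `n` vertices in which
all degrees are even. To detect such edge sets, every vertex is given a colour and a sign, the ends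
of an edge used must agree in colour, and the edge contributes the product of the two signs. Summing
over the signs cancels the graphs with odd degrees. Summing over `q` colours without further weights
gives `q` to the number of components. The coefficient of `q`, which detects connectedness, is
obtained with all colours new to `S v` merged into a single one, whose weight is minus the number of
colours on `S v`, while those have weight `1` (`Elim.total_cw_test`). Therefore at most
`2 * (w + 1) ≤ 4 * w` options of a vertex have nonzero weight, which accounts for the time
`(4 * w) ^ d`. With weight `z` for the edges used, the value of the forest is the sum over the
connected even edge sets `H` of `2 ^ n * z ^ #H` times the weights of the unused edges
(`Elim.prod_subval`), and an alternating binomial sum over `z = 1, …, #E + 1` extracts those with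
`n` edges (`Elim.combine_eq_sum_hams`).

**Optimization.** An unused edge of cost `c` has weight `2 ^ (K * c)`. There are fewer than `2 ^ K`
Hamiltonian cycles for `K = 2 * n * size n`, so that the number of binary digits of the sum gives the
largest total cost of unused edges, and thereby the least cost of a cycle (`Elim.size_sum_pow`). If
the weight of an unused edge is set to `0`, the edge is prescribed. In this way an optimal cycle is
grown vertex by vertex, since a path that is part of an optimal cycle can be prolonged within one
(`Elim.TwoRegular.extend`).

**Space.** The sum over all options of the absolute values has `O(max(W, 1) * w * n * log n)` binary
digits, and this bounds every partial sum and product. There are `O(d)` of these, and all other data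
are `O(n * w)` numbers of `O(log n)` digits, a bounded number of scalars, and the numbers of nodes of
the decomposition, of `O(log N)` digits.

**The machine.** The program is written in a language with variables, arrays, expressions and loops,
which is compiled to the random access machine. The predicate `RAM.Ok` states total correctness with
time and space bounds, and its rules are those of a Hoare logic; since the traversal is a single loop
with an explicit state, its correctness is stated in terms of continuations (`RAM.Enters`). The parts
of the program are treated in `RAM.preP_ok` (the elimination order), `RAM.evalP_ok` (the value of the
forest), `RAM.solveP_ok` (the extraction of the cycles) and `RAM.Setup.tspP_ok` (the whole search),
`RAM.exists_setup` bounds the space, and the number of bit operations of a step is quadratic in the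
space (`RAM.Run.bits_le`).
-/

set_option linter.constructorNameAsVariable false

/-! ### A small language on top of the random access machine -/

namespace RAM

/-- The scalar variables of the algorithm. -/
inductive Var
  | n | N | cnt | M | W | lv | x | y | dp | a | j | pr
  | K | T | b | z | q | i
  | lev | v | u | mode | wt | c | k | cc | hit | found | e | g
  | best | cur | go | w
  deriving DecidableEq

/-- The arrays of the algorithm. -/
inductive Arr
  | ord | par | S | opt | nxt | acc | prod
  deriving DecidableEq

/-- Memory is divided into blocks of 64 registers. Block `i` holds the entries with index `i` of all
arrays; block `0` holds in addition the scalar variables and sixteen temporaries. -/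
def Arr.reg (k : Arr) : ℕ := k.ctorIdx

/-- The register of a scalar variable. -/
def Var.reg (x : Var) : ℕ := 8 + x.ctorIdx

theorem Arr.reg_lt (k : Arr) : k.reg < 8 := by cases k <;> decide
theorem Var.reg_ge (x : Var) : 8 ≤ x.reg := Nat.le_add_right _ _
theorem Var.reg_lt (x : Var) : x.reg < 48 := by cases x <;> decide

theorem Arr.reg_inj {k l : Arr} (h : k.reg = l.reg) : k = l := by
  have h1 := Arr.ofNat_ctorIdx k
  have h2 := Arr.ofNat_ctorIdx l
  rw [← h1, ← h2]; exact congrArg _ h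

theorem Var.reg_inj {x y : Var} (h : x.reg = y.reg) : x = y := by
  have h1 := Var.ofNat_ctorIdx x
  have h2 := Var.ofNat_ctorIdx y
  have h3 : x.ctorIdx = y.ctorIdx := by unfold Var.reg at h; omega
  rw [← h1, ← h2]; exact congrArg _ h3

/-- All arrays. -/
def Arr.all : Finset Arr := (Finset.range 8).image Arr.ofNat

theorem Arr.mem_all (k : Arr) : k ∈ Arr.all :=
  Finset.mem_image.2 ⟨k.ctorIdx, Finset.mem_range.2 k.reg_lt, Arr.ofNat_ctorIdx k⟩

/-- The memory as seen by the algorithm: values of variables and arrays, and the output. -/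
structure St where
  v : Var → ℤ
  a : Arr → ℕ → ℤ
  out : List ℤ

/-- Assignment to a variable. -/
def St.setv (σ : St) (x : Var) (z : ℤ) : St := { σ with v := Function.update σ.v x z }

/-- Assignment to an array entry. -/
def St.seta (σ : St) (k : Arr) (i : ℕ) (z : ℤ) : St :=
  { σ with a := Function.update σ.a k (Function.update (σ.a k) i z) }

/-- Output of a number. -/
def St.put (σ : St) (z : ℤ) : St := { σ with out := σ.out ++ [z] }

@[simp] theorem St.setv_v (σ : St) (x y : Var) (z : ℤ) :
    (σ.setv x z).v y = if y = x then z else σ.v y := by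
  simp [St.setv, Function.update_apply]
@[simp] theorem St.setv_a (σ : St) (x : Var) (z : ℤ) : (σ.setv x z).a = σ.a := rfl
@[simp] theorem St.setv_out (σ : St) (x : Var) (z : ℤ) : (σ.setv x z).out = σ.out := rfl
@[simp] theorem St.seta_v (σ : St) (k : Arr) (i : ℕ) (z : ℤ) : (σ.seta k i z).v = σ.v := rfl
@[simp] theorem St.seta_out (σ : St) (k : Arr) (i : ℕ) (z : ℤ) :
    (σ.seta k i z).out = σ.out := rfl
@[simp] theorem St.seta_a (σ : St) (k l : Arr) (i m : ℕ) (z : ℤ) :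
    (σ.seta k i z).a l m = if l = k ∧ m = i then z else σ.a l m := by
  by_cases h : l = k
  · subst h; simp [St.seta, Function.update_apply]
  · simp [St.seta, h]
@[simp] theorem St.put_v (σ : St) (z : ℤ) : (σ.put z).v = σ.v := rfl
@[simp] theorem St.put_a (σ : St) (z : ℤ) : (σ.put z).a = σ.a := rfl
@[simp] theorem St.put_out (σ : St) (z : ℤ) : (σ.put z).out = σ.out ++ [z] := rfl

/-- Expressions: constants, variables, array entries, input entries and machine operations. -/
inductive Exp
  | c (z : ℤ)
  | v (x : Var)
  | arr (k : Arr) (e : Exp)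
  | inp (e : Exp)
  | bin (o : Op) (e f : Exp)

instance (m : ℕ) : OfNat Exp m := ⟨Exp.c m⟩
instance : Add Exp := ⟨Exp.bin .add⟩
instance : Sub Exp := ⟨Exp.bin .sub⟩
instance : Mul Exp := ⟨Exp.bin .mul⟩
instance : Div Exp := ⟨Exp.bin .div⟩
instance : Mod Exp := ⟨Exp.bin .mod⟩

/-- The value of an expression on the input `inp`. -/
def Exp.eval (inp : List ℕ) (σ : St) : Exp → ℤ
  | .c z => z
  | .v x => σ.v x
  | .arr k e => σ.a k (e.eval inp σ).toNat
  | .inp e => (inp.getD (e.eval inp σ).toNat 0 : ℕ)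
  | .bin o e f => o.eval (e.eval inp σ) (f.eval inp σ)

/-- Array indices are nonnegative. -/
def Exp.ok (inp : List ℕ) (σ : St) : Exp → Prop
  | .c _ => True
  | .v _ => True
  | .arr _ e => e.ok inp σ ∧ 0 ≤ e.eval inp σ
  | .inp e => e.ok inp σ
  | .bin _ e f => e.ok inp σ ∧ f.ok inp σ

/-- The number of binary digits. -/
def Exp.size (e : Exp) : Exp := .bin .size e (.c 0)

section eval

variable {inp : List ℕ} {σ : St} {e f : Exp}

@[simp] theorem eval_zero : (0 : Exp).eval inp σ = 0 := rfl
@[simp] theorem eval_one : (1 : Exp).eval inp σ = 1 := rfl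
@[simp] theorem eval_two : (2 : Exp).eval inp σ = 2 := rfl
@[simp] theorem eval_v {x : Var} : (Exp.v x).eval inp σ = σ.v x := rfl
@[simp] theorem eval_arr {k : Arr} :
    (Exp.arr k e).eval inp σ = σ.a k (e.eval inp σ).toNat := rfl
@[simp] theorem eval_inp :
    (Exp.inp e).eval inp σ = (inp.getD (e.eval inp σ).toNat 0 : ℕ) := rfl
@[simp] theorem eval_add : (e + f).eval inp σ = e.eval inp σ + f.eval inp σ := rfl
@[simp] theorem eval_sub : (e - f).eval inp σ = e.eval inp σ - f.eval inp σ := rfl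
@[simp] theorem eval_mul : (e * f).eval inp σ = e.eval inp σ * f.eval inp σ := rfl
@[simp] theorem eval_div : (e / f).eval inp σ = e.eval inp σ / f.eval inp σ := rfl
@[simp] theorem eval_mod : (e % f).eval inp σ = e.eval inp σ % f.eval inp σ := rfl
@[simp] theorem eval_size : e.size.eval inp σ = ((e.eval inp σ).natAbs.size : ℤ) := rfl
@[simp] theorem ok_zero : (0 : Exp).ok inp σ := trivial
@[simp] theorem ok_one : (1 : Exp).ok inp σ := trivial
@[simp] theorem ok_two : (2 : Exp).ok inp σ := trivial
@[simp] theorem ok_v {x : Var} : (Exp.v x).ok inp σ := trivial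
@[simp] theorem ok_arr {k : Arr} :
    (Exp.arr k e).ok inp σ ↔ e.ok inp σ ∧ 0 ≤ e.eval inp σ := Iff.rfl
@[simp] theorem ok_inp : (Exp.inp e).ok inp σ ↔ e.ok inp σ := Iff.rfl
@[simp] theorem ok_add : (e + f).ok inp σ ↔ e.ok inp σ ∧ f.ok inp σ := Iff.rfl
@[simp] theorem ok_sub : (e - f).ok inp σ ↔ e.ok inp σ ∧ f.ok inp σ := Iff.rfl
@[simp] theorem ok_mul : (e * f).ok inp σ ↔ e.ok inp σ ∧ f.ok inp σ := Iff.rfl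
@[simp] theorem ok_div : (e / f).ok inp σ ↔ e.ok inp σ ∧ f.ok inp σ := Iff.rfl
@[simp] theorem ok_mod : (e % f).ok inp σ ↔ e.ok inp σ ∧ f.ok inp σ := Iff.rfl
@[simp] theorem ok_size : e.size.ok inp σ ↔ e.ok inp σ := (⟨fun h => h.1, fun h => ⟨h, trivial⟩⟩)

end eval

/-- An expression can be evaluated with the temporaries from number `j` on; shifts, whose results
may be long, are not allowed. -/
def Exp.wf : Exp → ℕ → Bool
  | .c z, j => j < 16 && z.natAbs ≤ 64
  | .v _, j => j < 16
  | .arr _ e, j => e.wf j && j < 15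
  | .inp e, j => e.wf j
  | .bin .shl _ _, _ => false
  | .bin _ e f, j => e.wf j && f.wf (j + 1)

/-- The size of an expression. -/
def Exp.wt : Exp → ℕ
  | .c _ => 1
  | .v _ => 1
  | .arr _ e => e.wt + 2
  | .inp e => e.wt + 1
  | .bin _ e f => e.wt + f.wt + 1

/-- Evaluation of an expression into temporary `j`. -/
def comp : Exp → ℕ → Prog
  | .c z, j => .instr (.const (48 + j) z)
  | .v x, j => .seq (.instr (.const (48 + j) 0)) (.instr (.op .add (48 + j) x.reg (48 + j)))
  | .arr k e, j => .seq (comp e j) (.seq (.instr (.const (49 + j) 64))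
      (.seq (.instr (.op .mul (48 + j) (48 + j) (49 + j)))
      (.seq (.instr (.const (49 + j) k.reg))
      (.seq (.instr (.op .add (48 + j) (48 + j) (49 + j))) (.instr (.load (48 + j) (48 + j)))))))
  | .inp e, j => .seq (comp e j) (.instr (.read (48 + j) (48 + j)))
  | .bin o e f, j => .seq (comp e j) (.seq (comp f (j + 1))
      (.instr (.op o (48 + j) (48 + j) (49 + j))))

/-- `x := e` -/
def setP (x : Var) (e : Exp) : Prog :=
  .seq (comp e 0) (.seq (.instr (.const x.reg 0)) (.instr (.op .add x.reg x.reg 48)))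

/-- `k[e] := f` -/
def stoP (k : Arr) (e f : Exp) : Prog :=
  .seq (comp e 0) (.seq (.instr (.const 49 64)) (.seq (.instr (.op .mul 48 48 49))
    (.seq (.instr (.const 49 k.reg)) (.seq (.instr (.op .add 48 48 49))
    (.seq (comp f 1) (.instr (.store 48 49)))))))

/-- `x := e * 2 ^ f` -/
def shlP (x : Var) (e f : Exp) : Prog :=
  .seq (comp e 0) (.seq (comp f 1) (.instr (.op .shl x.reg 48 49)))

/-- Output of the value of `e`. -/
def writeP (e : Exp) : Prog := .seq (comp e 0) (.instr (.write 48))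

/-- Conditional: the test is `0 < e`. -/
def iteP (e : Exp) (p q : Prog) : Prog := .seq (comp e 0) (.ite 48 p q)

/-- Repeat `p` while `0 < e`. -/
def loopP (e : Exp) (p : Prog) : Prog :=
  .seq (comp e 0) (.loop 48 (.seq p (comp e 0)))

/-- No operation. -/
def skipP : Prog := .instr (.const 48 0)

/-- The setting in which a program is run: the input, a bound `2 ^ β` for the variables, and bounds
for the entries of the arrays. The bounds of an array vanish outside a finite set. -/
structure Ctx where
  inp : List ℕ
  β : ℕ
  seven_le : 7 ≤ β
  inp_le : ∀ i, inp.getD i 0 ≤ 2 ^ β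
  ab : Arr → ℕ → ℕ
  sup : Arr → Finset ℕ
  ab_le : ∀ k i, ab k i ≤ 2 ^ β
  ab_zero : ∀ k i, i ∉ sup k → ab k i = 0

/-- A bound for the space occupied within the bounds of `C`. -/
def Ctx.M (C : Ctx) : ℕ :=
  64 * (9 + 100 * C.β) +
    ∑ k ∈ Arr.all, ∑ i ∈ C.sup k, (len ((64 * i + k.reg : ℕ) : ℤ) + ((C.ab k i).size + 1))

/-- The values are within the bounds of `C`. -/
structure Fits (C : Ctx) (σ : St) : Prop where
  v_le : ∀ x, |σ.v x| ≤ 2 ^ C.β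
  a_le : ∀ k i, |σ.a k i| ≤ C.ab k i

/-- The machine state `s` represents `σ`, within the bounds of `C`. -/
structure Rel (C : Ctx) (s : State) (σ : St) : Prop extends Fits C σ where
  var : ∀ x : Var, s.mem x.reg = σ.v x
  arr : ∀ (k : Arr) i, s.mem (64 * i + k.reg) = σ.a k i
  tmp : ∀ j < 16, |s.mem (48 + j)| ≤ 2 ^ (100 * C.β)
  zero : ∀ r, s.mem r ≠ 0 → (∃ x : Var, r = x.reg) ∨ (∃ (k : Arr) (i : ℕ), r = 64 * i + k.reg) ∨
    ∃ j < 16, r = 48 + j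
  out_eq : s.out = σ.out

variable {C : Ctx} {s : State} {σ : St}

theorem size_le_of_abs_le {z : ℤ} {m : ℕ} (h : |z| ≤ m) : z.natAbs.size ≤ m.size :=
  Nat.size_le_size (by zify; exact h)

theorem size_le_of_abs_le_pow {z : ℤ} {m : ℕ} (h : |z| ≤ 2 ^ m) : z.natAbs.size ≤ m + 1 :=
  Nat.size_le.2 (lt_of_le_of_lt (by zify; exact h) (Nat.pow_lt_pow_right (by norm_num) (by omega)))

theorem len_le_of_lt {r m : ℕ} (h : r < 2 ^ m) : len (r : ℤ) ≤ m + 1 := by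
  unfold len
  exact Nat.succ_le_succ (Nat.size_le.2 (by simpa using h))

theorem sum_biUnion_le_sum {ι κ : Type*} [DecidableEq ι] [DecidableEq κ] (s : Finset ι)
    (t : ι → Finset κ) (f : κ → ℕ) : ∑ x ∈ s.biUnion t, f x ≤ ∑ i ∈ s, ∑ x ∈ t i, f x := by
  induction s using Finset.induction_on with
  | empty => simp
  | insert a s ha ih =>
    rw [Finset.biUnion_insert, Finset.sum_insert ha]
    have := Finset.sum_union_inter (s₁ := t a) (s₂ := s.biUnion t) (f := f)
    omega

/-- The registers `8, …, 63` hold the variables and the temporaries; all other nonzero registers hold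
array entries, whose lengths are charged by the bounds of the arrays. -/
theorem Rel.space_le (h : Rel C s σ) : s.space ≤ C.M := by
  classical
  set f : ℕ → ℕ := fun r => len (r : ℤ) + len (s.mem r) with hf
  have hsub : s.mem.support ⊆ Finset.Ico 8 64 ∪
      Arr.all.biUnion fun k => (C.sup k).image fun i => 64 * i + k.reg := by
    intro r hr
    have hr := Finsupp.mem_support_iff.1 hr
    rcases h.zero r hr with ⟨x, rfl⟩ | ⟨k, i, rfl⟩ | ⟨j, hj, rfl⟩
    · have := x.reg_lt; have := x.reg_ge
      exact Finset.mem_union_left _ (Finset.mem_Ico.2 ⟨by omega, by omega⟩)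
    · refine Finset.mem_union_right _ (Finset.mem_biUnion.2 ⟨k, k.mem_all,
        Finset.mem_image.2 ⟨i, ?_, rfl⟩⟩)
      by_contra hi
      have h1 := h.a_le k i
      rw [C.ab_zero k i hi, ← h.arr k i] at h1
      exact hr (abs_nonpos_iff.1 (by simpa using h1))
    · exact Finset.mem_union_left _ (Finset.mem_Ico.2 ⟨by omega, by omega⟩)
  have h1 : s.space ≤ ∑ r ∈ Finset.Ico 8 64, f r +
      ∑ k ∈ Arr.all, ∑ i ∈ C.sup k, f (64 * i + k.reg) := by
    calc s.space = ∑ r ∈ s.mem.support, f r := rfl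
      _ ≤ _ := Finset.sum_le_sum_of_subset hsub
      _ ≤ _ := (le_add_of_nonneg_right (Nat.zero_le (Finset.sum (_ ∩ _) f))).trans
        (Finset.sum_union_inter).le
      _ ≤ _ := by
        gcongr
        refine (sum_biUnion_le_sum _ _ _).trans (Finset.sum_le_sum fun k _ => ?_)
        rw [Finset.sum_image]
        intro a _ b _ hab
        simpa using hab
  refine h1.trans (add_le_add ?_ (Finset.sum_le_sum fun k _ => Finset.sum_le_sum fun i _ => ?_))
  · refine (Finset.sum_le_card_nsmul _ _ (9 + 100 * C.β) fun r hr => ?_).trans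
      (by simp only [Nat.card_Ico, smul_eq_mul]; gcongr; norm_num)
    obtain ⟨h8, h64⟩ := Finset.mem_Ico.1 hr
    have hl : len (r : ℤ) ≤ 7 := len_le_of_lt (m := 6) (by omega)
    have hm : |s.mem r| ≤ 2 ^ (100 * C.β) := by
      by_cases hz : s.mem r = 0
      · rw [hz]; simp
      rcases h.zero r hz with ⟨x, rfl⟩ | ⟨k, i, rfl⟩ | ⟨j, hj, rfl⟩
      · rw [h.var]
        exact (h.v_le x).trans (pow_le_pow_right₀ (by norm_num) (by omega))
      · rw [h.arr]
        refine (h.a_le k i).trans ?_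
        have := C.ab_le k i
        have h3 : 2 ^ C.β ≤ 2 ^ (100 * C.β) := Nat.pow_le_pow_right (by norm_num) (by omega)
        exact_mod_cast this.trans h3
      · exact h.tmp j hj
    have := size_le_of_abs_le_pow hm
    simp only [hf]
    have h4 : len (s.mem r) ≤ 100 * C.β + 2 := by unfold len; omega
    omega
  · simp only [hf]
    have := size_le_of_abs_le (h.a_le k i)
    rw [← h.arr] at this
    have h4 : len (s.mem (64 * i + k.reg)) ≤ (C.ab k i).size + 1 := by unfold len; omega
    omega

/-- The program `p` leads from `s` to `f` in at most `T` steps and within the space bound. -/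
def Runs (C : Ctx) (p : Prog) (s f : State) (T : ℕ) : Prop :=
  ∃ t b m, Run C.inp p s f t b m ∧ t ≤ T ∧ m ≤ C.M

theorem Runs.mono {p : Prog} {s f : State} {T T' : ℕ} (h : Runs C p s f T) (hT : T ≤ T') :
    Runs C p s f T' := by
  obtain ⟨t, b, m, h1, h2, h3⟩ := h
  exact ⟨t, b, m, h1, h2.trans hT, h3⟩

theorem Runs.seq {p q : Prog} {s f g : State} {T T' : ℕ} (h : Runs C p s f T)
    (h' : Runs C q f g T') : Runs C (.seq p q) s g (T + T') := by
  obtain ⟨t, b, m, h1, h2, h3⟩ := h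
  obtain ⟨t', b', m', h1', h2', h3'⟩ := h'
  exact ⟨_, _, _, .seq h1 h1', by omega, max_le h3 h3'⟩

theorem Runs.instr {σ τ : St} (i : Instr) (h : Rel C s σ) (h' : Rel C (i.exec C.inp s) τ) :
    Runs C (.instr i) s (i.exec C.inp s) 1 :=
  ⟨1, _, _, .instr i s, le_rfl, max_le h.space_le h'.space_le⟩

theorem Rel.set_tmp (h : Rel C s σ) {j : ℕ} (hj : j < 16) {z : ℤ} (hz : |z| ≤ 2 ^ (100 * C.β)) :
    Rel C { s with mem := s.mem.update (48 + j) z } σ where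
  toFits := h.toFits
  var x := by
    have := x.reg_lt
    rw [Finsupp.coe_update, Function.update_of_ne (by omega), h.var]
  arr k i := by
    have := k.reg_lt
    rw [Finsupp.coe_update, Function.update_of_ne (by omega), h.arr]
  tmp l hl := by
    rw [Finsupp.coe_update]
    by_cases hlj : l = j
    · subst hlj; simpa using hz
    · rw [Function.update_of_ne (by omega)]; exact h.tmp l hl
  zero r hr := by
    rw [Finsupp.coe_update] at hr
    by_cases hrj : r = 48 + j
    · exact .inr (.inr ⟨j, hj, hrj⟩)
    · rw [Function.update_of_ne hrj] at hr; exact h.zero r hr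
  out_eq := h.out_eq

theorem Rel.set_var (h : Rel C s σ) (x : Var) {z : ℤ} (hz : |z| ≤ 2 ^ C.β) :
    Rel C { s with mem := s.mem.update x.reg z } (σ.setv x z) where
  v_le y := by
    rw [St.setv_v]; split
    · exact hz
    · exact h.v_le y
  a_le := h.a_le
  var y := by
    rw [Finsupp.coe_update, St.setv_v]
    by_cases hy : y = x
    · subst hy; simp
    · rw [Function.update_of_ne (fun e => hy (Var.reg_inj e)), if_neg hy, h.var]
  arr k i := by
    have := x.reg_lt; have := x.reg_ge; have := k.reg_lt
    rw [Finsupp.coe_update, Function.update_of_ne (by omega), h.arr]; rfl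
  tmp j hj := by
    have := x.reg_lt
    rw [Finsupp.coe_update, Function.update_of_ne (by omega)]; exact h.tmp j hj
  zero r hr := by
    rw [Finsupp.coe_update] at hr
    by_cases hrx : r = x.reg
    · exact .inl ⟨x, hrx⟩
    · rw [Function.update_of_ne hrx] at hr; exact h.zero r hr
  out_eq := h.out_eq

theorem Rel.set_arr (h : Rel C s σ) (k : Arr) (i : ℕ) {z : ℤ} (hz : |z| ≤ C.ab k i) :
    Rel C { s with mem := s.mem.update (64 * i + k.reg) z } (σ.seta k i z) where
  v_le := h.v_le
  a_le l m := by
    rw [St.seta_a]; split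
    · rename_i hlm; rw [hlm.1, hlm.2]; exact hz
    · exact h.a_le l m
  var y := by
    have := y.reg_lt; have := y.reg_ge; have := k.reg_lt
    rw [Finsupp.coe_update, Function.update_of_ne (by omega), h.var]; rfl
  arr l m := by
    have h1 := k.reg_lt; have h2 := l.reg_lt
    rw [Finsupp.coe_update, St.seta_a]
    by_cases hy : l = k ∧ m = i
    · rw [hy.1, hy.2]; simp
    · rw [if_neg hy, Function.update_of_ne, h.arr]
      intro he
      exact hy ⟨Arr.reg_inj (by omega), by omega⟩
  tmp j hj := by
    have := k.reg_lt
    rw [Finsupp.coe_update, Function.update_of_ne (by omega)]; exact h.tmp j hj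
  zero r hr := by
    rw [Finsupp.coe_update] at hr
    by_cases hrx : r = 64 * i + k.reg
    · exact .inr (.inl ⟨k, i, hrx⟩)
    · rw [Function.update_of_ne hrx] at hr; exact h.zero r hr
  out_eq := h.out_eq

theorem Op.abs_eval_le {o : Op} (ho : o ≠ .shl) {a b : ℤ} {p q : ℕ} (hp : 1 ≤ p) (hq : 1 ≤ q)
    (ha : |a| ≤ 2 ^ p) (hb : |b| ≤ 2 ^ q) :
    |o.eval a b| ≤ 2 ^ (p + q) := by
  have h2p : (2 : ℤ) ≤ 2 ^ p := by
    calc (2 : ℤ) = 2 ^ 1 := by norm_num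
      _ ≤ _ := pow_le_pow_right₀ (by norm_num) hp
  have h2q : (2 : ℤ) ≤ 2 ^ q := by
    calc (2 : ℤ) = 2 ^ 1 := by norm_num
      _ ≤ _ := pow_le_pow_right₀ (by norm_num) hq
  have e : (2 : ℤ) ^ (p + q) = 2 ^ p * 2 ^ q := pow_add _ _ _
  have hs : |a| + |b| ≤ 2 ^ (p + q) := by rw [e]; nlinarith
  have ha' := abs_nonneg a
  have hb' := abs_nonneg b
  cases o with
  | add => exact (abs_add_le a b).trans hs
  | sub => exact (abs_sub a b).trans hs
  | mul => simp only [Op.eval, abs_mul, e]; gcongr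
  | div =>
    have : |a / b| ≤ |a| := by
      rw [Int.abs_eq_natAbs, Int.abs_eq_natAbs]; exact_mod_cast Int.natAbs_ediv_le_natAbs a b
    simp only [Op.eval]; omega
  | mod =>
    simp only [Op.eval]
    rcases eq_or_ne b 0 with rfl | hb0
    · simp only [Int.emod_zero]; omega
    · have h1 := Int.emod_nonneg a hb0
      have h3 := Int.emod_lt_abs a hb0
      rw [abs_of_nonneg h1]; omega
  | shl => exact absurd rfl ho
  | size =>
    simp only [Op.eval, Nat.abs_cast]
    have h1 : a.natAbs.size ≤ a.natAbs := Nat.size_le.2 Nat.lt_two_pow_self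
    have : ((a.natAbs.size : ℕ) : ℤ) ≤ |a| := by rw [Int.abs_eq_natAbs]; exact_mod_cast h1
    omega

theorem Exp.one_le_wt (e : Exp) : 1 ≤ e.wt := by cases e <;> simp only [Exp.wt] <;> omega

/-- An expression of size `m` has a value of at most `m * β` bits, since no operation other than a shift
yields more bits than its two operands have together. -/
theorem Exp.abs_eval_le (h : Fits C σ) (e : Exp) : ∀ j, e.wf j →
    |e.eval C.inp σ| ≤ 2 ^ (C.β * e.wt) := by
  have h7 := C.seven_le
  have mono : ∀ {m : ℕ}, 1 ≤ m → (2 : ℤ) ^ C.β ≤ 2 ^ (C.β * m) := fun {m} hm =>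
    pow_le_pow_right₀ (by norm_num) (Nat.le_mul_of_pos_right _ hm)
  induction e with
  | c z =>
    intro j hj
    simp only [Exp.wf, Bool.and_eq_true, decide_eq_true_eq] at hj
    simp only [Exp.eval, Exp.wt, mul_one]
    have h1 : |z| ≤ 64 := by rw [Int.abs_eq_natAbs]; exact_mod_cast hj.2
    have h2 : (2 : ℤ) ^ 7 ≤ 2 ^ C.β := pow_le_pow_right₀ (by norm_num) h7
    linarith
  | v x => intro j _; simpa [Exp.eval, Exp.wt] using h.v_le x
  | arr k e ih =>
    intro j _
    refine ((h.a_le _ _).trans ?_).trans (mono (Exp.one_le_wt _))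
    exact_mod_cast C.ab_le _ _
  | inp e ih =>
    intro j _
    refine le_trans ?_ (mono (Exp.one_le_wt _))
    simp only [Exp.eval, Nat.abs_cast]
    exact_mod_cast C.inp_le _
  | bin o e f ihe ihf =>
    intro j hj
    have ho : o ≠ .shl := by rintro rfl; simp [Exp.wf] at hj
    have hj' : e.wf j ∧ f.wf (j + 1) := by
      cases o <;> simp_all [Exp.wf]
    have h1 := e.one_le_wt
    have h2 := f.one_le_wt
    refine (Op.abs_eval_le ho (Nat.mul_pos (by omega) h1) (Nat.mul_pos (by omega) h2)
      (ihe _ hj'.1) (ihf _ hj'.2)).trans (pow_le_pow_right₀ (by norm_num) ?_)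
    simp only [Exp.wt]; nlinarith

theorem Exp.wf_lt (e : Exp) : ∀ {j}, e.wf j → j < 16 := by
  induction e with
  | c z => intro j h; simp [Exp.wf] at h; exact h.1
  | v x => intro j h; simpa [Exp.wf] using h
  | arr k e ih => intro j h; simp [Exp.wf] at h; omega
  | inp e ih => intro j h; exact ih (by simpa [Exp.wf] using h)
  | bin o e f ihe ihf =>
    intro j h
    exact ihe (by cases o <;> simp_all [Exp.wf])

theorem abs_le_tmp {z : ℤ} {m : ℕ} (h : |z| ≤ 2 ^ (C.β * m)) (hm : m ≤ 100) :
    |z| ≤ 2 ^ (100 * C.β) :=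
  h.trans (pow_le_pow_right₀ (by norm_num) (by nlinarith))

theorem abs_addr_le {z : ℤ} {m : ℕ} (h : |z| ≤ 2 ^ (C.β * m)) (k : Arr) (hm : m + 2 ≤ 100) :
    |z * 64| ≤ 2 ^ (100 * C.β) ∧ |z * 64 + k.reg| ≤ 2 ^ (100 * C.β) := by
  have h7 := C.seven_le
  have h1 : (2 : ℤ) ^ (C.β * m) * 2 ^ 7 ≤ 2 ^ (100 * C.β) := by
    rw [← pow_add]; exact pow_le_pow_right₀ (by norm_num) (by nlinarith)
  have h2 : (1 : ℤ) ≤ 2 ^ (C.β * m) := one_le_pow₀ (by norm_num)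
  have h3 : (k.reg : ℤ) < 8 := by exact_mod_cast k.reg_lt
  have h4 : (0 : ℤ) ≤ k.reg := by positivity
  rw [abs_le] at h
  constructor <;> rw [abs_le] <;> constructor <;> linarith [h.1, h.2]

/-- Computing the address `64 * z + k` in temporary `j`. -/
theorem addr_run {j m : ℕ} {k : Arr} {z : ℤ} (hj : j < 15) (hm : m + 2 ≤ 100) (h : Rel C s σ)
    (hs : s.mem (48 + j) = z) (hz : |z| ≤ 2 ^ (C.β * m)) :
    ∃ f1 f2 f3 f4, Runs C (.instr (.const (49 + j) 64)) s f1 1 ∧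
      Runs C (.instr (.op .mul (48 + j) (48 + j) (49 + j))) f1 f2 1 ∧
      Runs C (.instr (.const (49 + j) k.reg)) f2 f3 1 ∧
      Runs C (.instr (.op .add (48 + j) (48 + j) (49 + j))) f3 f4 1 ∧
      Rel C f4 σ ∧ f4.mem (48 + j) = z * 64 + k.reg ∧
      ∀ j' < j, f4.mem (48 + j') = s.mem (48 + j') := by
  obtain ⟨ha, hb⟩ := abs_addr_le hz k hm
  have h64 : |(64 : ℤ)| ≤ 2 ^ (100 * C.β) := by
    have h7 := C.seven_le
    have : (2 : ℤ) ^ 7 ≤ 2 ^ (100 * C.β) := pow_le_pow_right₀ (by norm_num) (by omega)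
    norm_num at *; linarith
  have hk : |(k.reg : ℤ)| ≤ 2 ^ (100 * C.β) := by
    have h3 : (k.reg : ℤ) < 8 := by exact_mod_cast k.reg_lt
    rw [Nat.abs_cast]; norm_num at h64; linarith
  have r1 : Rel C (Instr.exec C.inp s (.const (49 + j) 64)) σ := by
    have := h.set_tmp (j := j + 1) (by omega) h64
    rwa [show 48 + (j + 1) = 49 + j by omega] at this
  have r2 : Rel C (Instr.exec C.inp (Instr.exec C.inp s (.const (49 + j) 64))
      (.op .mul (48 + j) (48 + j) (49 + j))) σ :=
    r1.set_tmp (j := j) (by omega) (by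
      simpa [Instr.exec, Op.eval, Function.update_apply, hs] using ha)
  have r3 : Rel C (Instr.exec C.inp (Instr.exec C.inp (Instr.exec C.inp s (.const (49 + j) 64))
      (.op .mul (48 + j) (48 + j) (49 + j))) (.const (49 + j) k.reg)) σ := by
    have := r2.set_tmp (j := j + 1) (by omega) hk
    rwa [show 48 + (j + 1) = 49 + j by omega] at this
  have r4 : Rel C (Instr.exec C.inp (Instr.exec C.inp (Instr.exec C.inp (Instr.exec C.inp s
      (.const (49 + j) 64)) (.op .mul (48 + j) (48 + j) (49 + j))) (.const (49 + j) k.reg))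
      (.op .add (48 + j) (48 + j) (49 + j))) σ :=
    r3.set_tmp (j := j) (by omega) (by
      simpa [Instr.exec, Op.eval, Function.update_apply, hs] using hb)
  refine ⟨_, _, _, _, .instr _ h r1, .instr _ r1 r2, .instr _ r2 r3, .instr _ r3 r4, r4, ?_, ?_⟩
  · simp [Instr.exec, Op.eval, hs]
  · intro j' hj'
    have h1 : 48 + j' ≠ 48 + j := by omega
    have h2 : 48 + j' ≠ 49 + j := by omega
    simp only [Instr.exec, Finsupp.coe_update, Function.update_of_ne h1, Function.update_of_ne h2]

/-- Evaluation of an expression is correct and preserves the represented state and the temporaries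
before `j`. -/
theorem comp_run (e : Exp) : ∀ j (s : State), e.wf j → e.wt ≤ 100 → e.ok C.inp σ → Rel C s σ →
    ∃ f, Runs C (comp e j) s f (6 * e.wt) ∧ Rel C f σ ∧ f.mem (48 + j) = e.eval C.inp σ ∧
      ∀ j' < j, f.mem (48 + j') = s.mem (48 + j') := by
  induction e with
  | c z =>
    intro j s hj hw _ h
    have hb := Exp.abs_eval_le h.toFits _ _ hj
    have r := h.set_tmp (Exp.wf_lt _ hj) (abs_le_tmp hb hw)
    refine ⟨_, (Runs.instr (.const (48 + j) z) h r).mono (by simp [Exp.wt]), r, ?_, ?_⟩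
    · simp [Instr.exec, Exp.eval]
    · intro j' hj'
      simp [Instr.exec, show j' ≠ j by omega]
  | v x =>
    intro j s hj hw _ h
    have hb := Exp.abs_eval_le h.toFits _ _ hj
    have hx := x.reg_lt
    have r0 : Rel C (Instr.exec C.inp s (.const (48 + j) 0)) σ :=
      h.set_tmp (Exp.wf_lt _ hj) (by simp)
    have r : Rel C (Instr.exec C.inp _ (.op .add (48 + j) x.reg (48 + j))) σ :=
      r0.set_tmp (Exp.wf_lt _ hj) (by
        have : x.reg ≠ 48 + j := by omega
        simpa [Instr.exec, Op.eval, this, h.var, Exp.eval] using abs_le_tmp hb hw)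
    refine ⟨_, (Runs.seq (.instr _ h r0) (.instr _ r0 r)).mono (by simp [Exp.wt]), r, ?_, ?_⟩
    · have : x.reg ≠ 48 + j := by omega
      simp [Instr.exec, Exp.eval, Op.eval, this, h.var]
    · intro j' hj'
      simp [Instr.exec, show j' ≠ j by omega]
  | arr k e ih =>
    intro j s hj hw hok h
    have hb := Exp.abs_eval_le h.toFits _ _ hj
    simp only [Exp.wf, Bool.and_eq_true, decide_eq_true_eq] at hj
    simp only [Exp.wt] at hw
    obtain ⟨f0, h1, h2, h3, h4⟩ := ih j s hj.1 (by omega) hok.1 h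
    obtain ⟨f1, f2, f3, f4, a1, a2, a3, a4, a5, a6, a7⟩ := addr_run (k := k) hj.2 hw h2 h3
      (Exp.abs_eval_le h.toFits _ _ hj.1)
    have hld : f4.mem (f4.mem (48 + j)).toNat = (Exp.arr k e).eval C.inp σ := by
      rw [a6, Exp.eval, ← a5.arr]
      congr 1
      have := hok.2
      omega
    have r : Rel C (Instr.exec C.inp f4 (.load (48 + j) (48 + j))) σ :=
      a5.set_tmp (by omega) (by rw [hld]; exact abs_le_tmp hb hw)
    refine ⟨_, (h1.seq (a1.seq (a2.seq (a3.seq (a4.seq (.instr _ a5 r)))))).mono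
      (by simp only [Exp.wt]; omega), r, ?_, ?_⟩
    · rw [← hld]; simp [Instr.exec]
    · intro j' hj'
      rw [← h4 j' hj', ← a7 j' hj']
      simp [Instr.exec, show j' ≠ j by omega]
  | inp e ih =>
    intro j s hj hw hok h
    have hb := Exp.abs_eval_le h.toFits _ _ hj
    simp only [Exp.wf] at hj
    simp only [Exp.wt] at hw
    obtain ⟨f0, h1, h2, h3, h4⟩ := ih j s hj (by omega) hok h
    have r : Rel C (Instr.exec C.inp f0 (.read (48 + j) (48 + j))) σ :=
      h2.set_tmp (Exp.wf_lt _ hj) (by rw [h3]; exact abs_le_tmp hb hw)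
    refine ⟨_, (h1.seq (.instr _ h2 r)).mono (by simp only [Exp.wt]; omega), r, ?_, ?_⟩
    · simp [Instr.exec, h3, Exp.eval]
    · intro j' hj'
      rw [← h4 j' hj']
      simp [Instr.exec, show j' ≠ j by omega]
  | bin o e f ihe ihf =>
    intro j s hj hw hok h
    have hb := Exp.abs_eval_le h.toFits _ _ hj
    have hj' : e.wf j ∧ f.wf (j + 1) := by
      cases o <;> simp_all [Exp.wf]
    have hw' := hw
    simp only [Exp.wt] at hw'
    obtain ⟨f0, h1, h2, h3, h4⟩ := ihe j s hj'.1 (by omega) hok.1 h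
    obtain ⟨f1, g1, g2, g3, g4⟩ := ihf (j + 1) f0 hj'.2 (by omega) hok.2 h2
    have e0 : f1.mem (48 + j) = e.eval C.inp σ := by rw [g4 j (by omega), h3]
    have e1 : f1.mem (49 + j) = f.eval C.inp σ := by rw [← g3]; congr 1; omega
    have r : Rel C (Instr.exec C.inp f1 (.op o (48 + j) (48 + j) (49 + j))) σ :=
      g2.set_tmp (Exp.wf_lt _ hj'.1) (by rw [e0, e1]; exact abs_le_tmp hb hw)
    refine ⟨_, (h1.seq (g1.seq (.instr _ g2 r))).mono (by simp only [Exp.wt]; omega), r, ?_, ?_⟩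
    · simp [Instr.exec, Exp.eval, e0, e1]
    · intro j' hj'
      rw [← h4 j' hj', ← g4 j' (by omega)]
      simp [Instr.exec, show j' ≠ j by omega]

/-- Total correctness: from any machine state that represents `σ`, the program `p` halts within
`2000 * T` steps and within the space bound, in a state that satisfies `Q`. -/
def Ok (C : Ctx) (p : Prog) (σ : St) (T : ℕ) (Q : St → Prop) : Prop :=
  ∀ s, Rel C s σ → ∃ f τ, Runs C p s f (2000 * T) ∧ Rel C f τ ∧ Q τ

/-- The static conditions on an expression to be evaluated from temporary `j` on. The bound for the
size leaves room for the address computation in `stoP`, so that temporaries have at most `100 * β`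
bits. -/
def Exp.good (e : Exp) (j : ℕ) : Bool := e.wf j && e.wt ≤ 98

theorem Exp.good.wf {e : Exp} {j : ℕ} (h : e.good j) : e.wf j := by
  simp only [Exp.good, Bool.and_eq_true] at h; exact h.1
theorem Exp.good.wt {e : Exp} {j : ℕ} (h : e.good j) : e.wt ≤ 98 := by
  simp only [Exp.good, Bool.and_eq_true, decide_eq_true_eq] at h; exact h.2

variable {p q : Prog} {T T' : ℕ} {Q R : St → Prop} {e f : Exp}

theorem Ok.mono (h : Ok C p σ T Q) (hT : T ≤ T') (hQ : ∀ τ, Fits C τ → Q τ → R τ) :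
    Ok C p σ T' R := by
  intro s hs
  obtain ⟨f, τ, h1, h2, h3⟩ := h s hs
  exact ⟨f, τ, h1.mono (by omega), h2, hQ τ h2.toFits h3⟩

/-- The bounds on the values may be used in proving the correctness of a program. -/
theorem Ok.of_fits (h : Fits C σ → Ok C p σ T Q) : Ok C p σ T Q :=
  fun s hs => h hs.toFits s hs

theorem Ok.seq (h : Ok C p σ T (fun τ => Ok C q τ T' Q)) : Ok C (.seq p q) σ (T + T') Q := by
  intro s hs
  obtain ⟨f, τ, h1, h2, h3⟩ := h s hs
  obtain ⟨g, τ', h1', h2', h3'⟩ := h3 f h2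
  exact ⟨g, τ', (h1.seq h1').mono (by omega), h2', h3'⟩

theorem Ok.skip (h : Q σ) : Ok C skipP σ 1 Q := by
  intro s hs
  have r : Rel C (Instr.exec C.inp s (.const 48 0)) σ :=
    hs.set_tmp (j := 0) (by norm_num) (by simp)
  exact ⟨_, _, (Runs.instr _ hs r).mono (by omega), r, h⟩

theorem Ok.set {x : Var} (he : e.good 0) (hok : e.ok C.inp σ)
    (hb : |e.eval C.inp σ| ≤ 2 ^ C.β) (h : Q (σ.setv x (e.eval C.inp σ))) :
    Ok C (setP x e) σ 1 Q := by
  intro s hs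
  have hw := Exp.good.wt he
  obtain ⟨f, h1, h2, h3, -⟩ := comp_run e 0 s (Exp.good.wf he) (by omega) hok hs
  have hx := x.reg_lt
  have r0 : Rel C (Instr.exec C.inp f (.const x.reg 0)) (σ.setv x 0) := h2.set_var x (by simp)
  have hne : 48 ≠ x.reg := by omega
  have ev : (Instr.exec C.inp f (.const x.reg 0)).mem x.reg +
      (Instr.exec C.inp f (.const x.reg 0)).mem 48 = e.eval C.inp σ := by
    simp [Instr.exec, hne, h3]
  have r : Rel C (Instr.exec C.inp (Instr.exec C.inp f (.const x.reg 0))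
      (.op .add x.reg x.reg 48)) ((σ.setv x 0).setv x (e.eval C.inp σ)) := by
    have r := r0.set_var x (z := e.eval C.inp σ) hb
    rw [← ev] at r
    exact ev ▸ r
  have e2 : (σ.setv x 0).setv x (e.eval C.inp σ) = σ.setv x (e.eval C.inp σ) := by
    simp [St.setv]
  rw [e2] at r
  exact ⟨_, _, (h1.seq ((Runs.instr _ h2 r0).seq (.instr _ r0 r))).mono (by omega), r, h⟩

theorem Ok.sto {k : Arr} (he : e.good 0) (hf : f.good 1) (hok : e.ok C.inp σ) (hok' : f.ok C.inp σ)
    (h0 : 0 ≤ e.eval C.inp σ)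
    (hb : |f.eval C.inp σ| ≤ C.ab k (e.eval C.inp σ).toNat)
    (h : Q (σ.seta k (e.eval C.inp σ).toNat (f.eval C.inp σ))) :
    Ok C (stoP k e f) σ 1 Q := by
  intro s hs
  have hw := Exp.good.wt he
  have hw' := Exp.good.wt hf
  obtain ⟨f0, h1, h2, h3, -⟩ := comp_run e 0 s (Exp.good.wf he) (by omega) hok hs
  obtain ⟨f1, f2, f3, f4, a1, a2, a3, a4, a5, a6, -⟩ := addr_run (k := k) (by norm_num)
    (by omega) h2 h3 (Exp.abs_eval_le hs.toFits _ _ (Exp.good.wf he))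
  obtain ⟨f5, b1, b2, b3, b4⟩ := comp_run f 1 f4 (Exp.good.wf hf) (by omega) hok' a5
  have e1 : (f5.mem 48).toNat = 64 * (e.eval C.inp σ).toNat + k.reg := by
    have := b4 0 (by norm_num)
    simp only [add_zero] at this a6
    rw [this, a6]; omega
  have r : Rel C (Instr.exec C.inp f5 (.store 48 49))
      (σ.seta k (e.eval C.inp σ).toNat (f.eval C.inp σ)) := by
    have := b2.set_arr k (e.eval C.inp σ).toNat hb
    simp only [Instr.exec]
    rw [e1, b3]; exact this
  exact ⟨_, _, (h1.seq (a1.seq (a2.seq (a3.seq (a4.seq (b1.seq (.instr _ b2 r))))))).mono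
    (by omega), r, h⟩

theorem Ok.shl {x : Var} (he : e.good 0) (hf : f.good 1) (hok : e.ok C.inp σ)
    (hok' : f.ok C.inp σ) (hb : |e.eval C.inp σ * 2 ^ (f.eval C.inp σ).toNat| ≤ 2 ^ C.β)
    (h : Q (σ.setv x (e.eval C.inp σ * 2 ^ (f.eval C.inp σ).toNat))) :
    Ok C (shlP x e f) σ 1 Q := by
  intro s hs
  have hw := Exp.good.wt he
  have hw' := Exp.good.wt hf
  obtain ⟨f0, h1, h2, h3, -⟩ := comp_run e 0 s (Exp.good.wf he) (by omega) hok hs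
  obtain ⟨f5, b1, b2, b3, b4⟩ := comp_run f 1 f0 (Exp.good.wf hf) (by omega) hok' h2
  have e1 : f5.mem 48 = e.eval C.inp σ := by rw [← h3]; exact b4 0 (by norm_num)
  have r : Rel C (Instr.exec C.inp f5 (.op .shl x.reg 48 49))
      (σ.setv x (e.eval C.inp σ * 2 ^ (f.eval C.inp σ).toNat)) := by
    have := b2.set_var x hb
    simp only [Instr.exec, Op.eval]
    rw [e1, b3]; exact this
  exact ⟨_, _, (h1.seq (b1.seq (.instr _ b2 r))).mono (by omega), r, h⟩

theorem Ok.write (he : e.good 0) (hok : e.ok C.inp σ) (h : Q (σ.put (e.eval C.inp σ))) :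
    Ok C (writeP e) σ 1 Q := by
  intro s hs
  have hw := Exp.good.wt he
  obtain ⟨f0, h1, h2, h3, -⟩ := comp_run e 0 s (Exp.good.wf he) (by omega) hok hs
  have r : Rel C (Instr.exec C.inp f0 (.write 48)) (σ.put (e.eval C.inp σ)) :=
    { v_le := h2.v_le, a_le := h2.a_le, var := h2.var, arr := h2.arr, tmp := h2.tmp
      zero := h2.zero
      out_eq := by
        simp only [add_zero] at h3
        simp [Instr.exec, h3, h2.out_eq] }
  exact ⟨_, _, (h1.seq (.instr _ h2 r)).mono (by omega), r, h⟩

theorem Ok.ite (he : e.good 0) (hok : e.ok C.inp σ)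
    (h : 0 < e.eval C.inp σ → Ok C p σ T Q) (h' : ¬ 0 < e.eval C.inp σ → Ok C q σ T Q) :
    Ok C (iteP e p q) σ (T + 1) Q := by
  intro s hs
  have hw := Exp.good.wt he
  obtain ⟨f0, h1, h2, h3, -⟩ := comp_run e 0 s (Exp.good.wf he) (by omega) hok hs
  simp only [add_zero] at h3
  by_cases hc : 0 < e.eval C.inp σ
  · obtain ⟨g, τ, ⟨t, b, m, k1, k2, k3⟩, g2, g3⟩ := h hc f0 h2
    exact ⟨g, τ, (h1.seq ⟨_, _, _, .ite_pos (by rw [h3]; exact hc) k1,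
      Nat.succ_le_succ k2, k3⟩).mono (by omega), g2, g3⟩
  · obtain ⟨g, τ, ⟨t, b, m, k1, k2, k3⟩, g2, g3⟩ := h' hc f0 h2
    exact ⟨g, τ, (h1.seq ⟨_, _, _, .ite_neg (by rw [h3]; exact hc) k1,
      Nat.succ_le_succ k2, k3⟩).mono (by omega), g2, g3⟩

theorem Ok.loop_done (he : e.good 0) (hok : e.ok C.inp σ) (hc : ¬ 0 < e.eval C.inp σ) (h : Q σ) :
    Ok C (loopP e p) σ 1 Q := by
  intro s hs
  have hw := Exp.good.wt he
  obtain ⟨f0, h1, h2, h3, -⟩ := comp_run e 0 s (Exp.good.wf he) (by omega) hok hs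
  simp only [add_zero] at h3
  exact ⟨f0, σ, (h1.seq (T' := 1) ⟨_, _, _, .loop_done (by rw [h3]; exact hc), le_rfl,
    h2.space_le⟩).mono (by omega), h2, h⟩

/-- Unrolling a loop. The continuation of the loop is part of the postcondition of its body. -/
theorem Ok.loop_step (he : e.good 0) (hok : e.ok C.inp σ) (hc : 0 < e.eval C.inp σ)
    (h : Ok C p σ T (fun τ => Ok C (loopP e p) τ T' Q)) :
    Ok C (loopP e p) σ (T + 1 + T') Q := by
  intro s hs
  have hw := Exp.good.wt he
  obtain ⟨f0, h1, h2, h3, -⟩ := comp_run e 0 s (Exp.good.wf he) (by omega) hok hs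
  simp only [add_zero] at h3
  obtain ⟨g, τ, ⟨t, b, m, k1, k2, k3⟩, g2, g3⟩ := h f0 h2
  obtain ⟨f', τ', ⟨t', b', m', k1', k2', k3'⟩, g2', g3'⟩ := g3 g g2
  cases k1' with
  | seq r1 r2 =>
    refine ⟨f', τ', (h1.seq (T' := 2000 * T + 2000 * T' + 1)
      ⟨_, _, _, .loop_step (by rw [h3]; exact hc) (.seq k1 r1) r2, ?_, ?_⟩).mono ?_, g2', g3'⟩
    · omega
    · simp only [max_le_iff] at *; tauto
    · omega

/-- A loop with an invariant, indexed by the number of iterations done. -/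
theorem Ok.loop (he : e.good 0) (I : ℕ → St → Prop) (m : ℕ) (h0 : I 0 σ)
    (hok : ∀ i τ, i ≤ m → I i τ → e.ok C.inp τ)
    (hstep : ∀ i τ, i < m → I i τ → Fits C τ → 0 < e.eval C.inp τ ∧ Ok C p τ T (I (i + 1)))
    (hdone : ∀ τ, I m τ → ¬ 0 < e.eval C.inp τ) :
    Ok C (loopP e p) σ (m * (T + 1) + 1) (I m) := by
  have key : ∀ j i τ, i + j = m → I i τ → Ok C (loopP e p) τ (j * (T + 1) + 1) (I m) := by
    intro j
    induction j with
    | zero =>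
      intro i τ hi hI
      obtain rfl : i = m := by omega
      exact (Ok.loop_done he (hok _ _ le_rfl hI) (hdone τ hI) hI).mono (by omega) fun _ _ h => h
    | succ j ih =>
      intro i τ hi hI
      refine Ok.of_fits fun hf => ?_
      obtain ⟨hc, hb⟩ := hstep i τ (by omega) hI hf
      exact (Ok.loop_step he (hok _ _ (by omega) hI) hc
        (hb.mono le_rfl fun τ' _ h => ih (i + 1) τ' (by omega) h)).mono
          (by rw [Nat.succ_mul]; omega) fun _ _ h => h
  exact key m 0 σ (by omega) h0

end RAM

/-! ### Sums over the options of all vertices -/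

namespace Elim

/-- The options of the vertex `v ≥ 1`: an option `o` stands for the colour `o / 2`, which is one of
`1, …, v`, and for the sign `(-1) ^ o`. -/
def opts (v : ℕ) : Finset ℕ := Finset.Icc 2 (2 * v + 1)

/-- The sum over the options of the vertex `v`, weighted by `loc v`. -/
def step {R : Type*} [CommSemiring R] (loc : ℕ → (ℕ → ℕ) → R) (v : ℕ) (τ : (ℕ → ℕ) → R)
    (φ : ℕ → ℕ) : R :=
  ∑ o ∈ opts v, loc v (Function.update φ v o) * τ (Function.update φ v o)

/-- The sum over the options of the vertices `1, …, m`, weighted by `loc`. -/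
def total {R : Type*} [CommSemiring R] (loc : ℕ → (ℕ → ℕ) → R) :
    ℕ → ((ℕ → ℕ) → R) → (ℕ → ℕ) → R
  | 0, τ => τ
  | m + 1, τ => total loc m (step loc (m + 1) τ)

section total

variable {R : Type*} [CommSemiring R] {loc cw g : ℕ → (ℕ → ℕ) → R}

theorem total_congr {m : ℕ} : ∀ {τ τ' : (ℕ → ℕ) → R},
    (∀ φ, (∀ u ∈ Finset.Icc 1 m, φ u ∈ opts u) → τ φ = τ' φ) →
    ∀ φ, total loc m τ φ = total loc m τ' φ := by
  induction m with
  | zero => intro τ τ' h φ; exact h φ (by simp)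
  | succ m ih =>
    intro τ τ' h φ
    refine ih (fun ψ hψ => Finset.sum_congr rfl fun o ho => ?_) φ
    rw [h]
    intro u hu
    by_cases hum : u = m + 1
    · subst hum; simpa using ho
    · rw [Function.update_of_ne hum]
      exact hψ u (by simp only [Finset.mem_Icc] at hu ⊢; omega)

theorem total_sum {ι : Type*} (s : Finset ι) (m : ℕ) : ∀ (τ : ι → (ℕ → ℕ) → R) (φ : ℕ → ℕ),
    total loc m (fun ψ => ∑ i ∈ s, τ i ψ) φ = ∑ i ∈ s, total loc m (τ i) φ := by
  induction m with
  | zero => intro τ φ; rfl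
  | succ m ih =>
    intro τ φ
    simp only [total]
    rw [← ih]
    congr 1
    funext ψ
    simp only [step, Finset.mul_sum]
    exact Finset.sum_comm

theorem total_const_mul (a : R) (m : ℕ) : ∀ (τ : (ℕ → ℕ) → R) (φ : ℕ → ℕ),
    total loc m (fun ψ => a * τ ψ) φ = a * total loc m τ φ := by
  induction m with
  | zero => intro τ φ; rfl
  | succ m ih =>
    intro τ φ
    simp only [total]
    rw [← ih]
    congr 1
    funext ψ
    simp only [step, Finset.mul_sum]
    exact Finset.sum_congr rfl fun o _ => by ring

theorem total_mul (hg : ∀ v φ ψ, (∀ u ≤ v, φ u = ψ u) → g v φ = g v ψ) (m : ℕ) :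
    ∀ (τ : (ℕ → ℕ) → R) (φ : ℕ → ℕ), total (fun v ψ => cw v ψ * g v ψ) m τ φ =
      total cw m (fun ψ => (∏ v ∈ Finset.Icc 1 m, g v ψ) * τ ψ) φ := by
  induction m with
  | zero => intro τ φ; simp [total]
  | succ m ih =>
    intro τ φ
    simp only [total]
    rw [ih]
    congr 1
    funext ψ
    simp only [step, Finset.mul_sum]
    refine Finset.sum_congr rfl fun o _ => ?_
    rw [← Finset.insert_Icc_right_eq_Icc_add_one (by omega), Finset.prod_insert (by simp),
      Finset.prod_congr rfl fun v hv => hg v (Function.update ψ (m + 1) o) ψ fun u hu => by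
        rw [Function.update_of_ne (by simp only [Finset.mem_Icc] at hv; omega)]]
    ring

end total

/-- The data of a perfect elimination: the set `S v` of the relevant predecessors of the vertex
`v`, for the vertices `1, …, n`, is a clique. -/
structure Chordal (n : ℕ) (S : ℕ → Finset ℕ) : Prop where
  lt : ∀ v ≤ n, ∀ u ∈ S v, 1 ≤ u ∧ u < v
  mem : ∀ v ≤ n, ∀ u ∈ S v, ∀ u' ∈ S v, u < u' → u ∈ S u'

/-- The parent of `v` in the elimination forest, with `0` as a virtual root. -/
def par (S : ℕ → Finset ℕ) (v : ℕ) : ℕ := (S v).sup id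

/-- The children of `v` in the elimination forest. -/
def children (n : ℕ) (S : ℕ → Finset ℕ) (v : ℕ) : Finset ℕ :=
  (Finset.Icc (v + 1) n).filter fun x => par S x = v

variable {n : ℕ} {S : ℕ → Finset ℕ}

theorem par_lt (hS : Chordal n S) {v : ℕ} (h1 : 1 ≤ v) (hv : v ≤ n) : par S v < v :=
  (Finset.sup_lt_iff (show 0 < v from h1)).2 fun u hu => (hS.lt v hv u hu).2

theorem par_mem {v : ℕ} (h : 1 ≤ par S v) : par S v ∈ S v := by
  have hne : (S v).Nonempty := by
    rw [Finset.nonempty_iff_ne_empty]; rintro he; simp [par, he] at h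
  obtain ⟨u, hu, he⟩ := Finset.exists_mem_eq_sup (S v) hne id
  unfold par; rw [he]; exact hu

theorem le_par {u v : ℕ} (h : u ∈ S v) : u ≤ par S v := Finset.le_sup (f := id) h

theorem mem_children {v x : ℕ} : x ∈ children n S v ↔ (v < x ∧ x ≤ n) ∧ par S x = v := by
  simp [children]

/-- The value of the subtree of `v` in the elimination forest: the sum over the options of the
vertices of this subtree, factored over the children. -/
def subval {R : Type*} [CommSemiring R] (loc : ℕ → (ℕ → ℕ) → R) (n : ℕ) (S : ℕ → Finset ℕ)
    (v : ℕ) (φ : ℕ → ℕ) : R :=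
  ∑ o ∈ opts v, loc v (Function.update φ v o) *
    ∏ x ∈ (children n S v).attach, subval loc n S x.1 (Function.update φ v o)
termination_by n + 1 - v
decreasing_by
  have := (mem_children.1 x.2).1
  omega

section subval

variable {R : Type*} [CommSemiring R] {loc : ℕ → (ℕ → ℕ) → R}

theorem subval_eq (v : ℕ) (φ : ℕ → ℕ) : subval loc n S v φ =
    ∑ o ∈ opts v, loc v (Function.update φ v o) *
      ∏ x ∈ children n S v, subval loc n S x (Function.update φ v o) := by
  rw [subval]
  refine Finset.sum_congr rfl fun o _ => ?_
  rw [Finset.prod_attach _ fun x => subval loc n S x (Function.update φ v o)]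

/-- The value of the subtree of `v` depends on the options of the vertices in `S v` only. -/
theorem subval_congr (hS : Chordal n S)
    (hloc : ∀ v ≤ n, ∀ φ ψ : ℕ → ℕ, (∀ u ∈ S v, φ u = ψ u) → φ v = ψ v → loc v φ = loc v ψ) (k : ℕ) :
    ∀ v, v ≤ n → n + 1 - v ≤ k → ∀ φ ψ : ℕ → ℕ, (∀ u ∈ S v, φ u = ψ u) →
      subval loc n S v φ = subval loc n S v ψ := by
  induction k with
  | zero => intro v h1 h2; omega
  | succ k ih =>
    intro v hv hk φ ψ h
    rw [subval_eq, subval_eq]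
    refine Finset.sum_congr rfl fun o _ => ?_
    have key : ∀ u ∈ S v, Function.update φ v o u = Function.update ψ v o u := by
      intro u hu
      rw [Function.update_apply, Function.update_apply, h u hu]
    congr 1
    · exact hloc v hv _ _ key (by simp)
    · refine Finset.prod_congr rfl fun x hx => ?_
      obtain ⟨⟨h1, h2⟩, h3⟩ := mem_children.1 hx
      refine ih x h2 (by omega) _ _ fun u hu => ?_
      by_cases huv : u = v
      · subst huv; simp
      · have hle := le_par hu
        have hu1 := hS.lt x h2 u hu
        exact key u (hS.mem x h2 u hu v (h3 ▸ par_mem (by omega)) (by omega))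

/-- The values of the subtrees multiply up to the sum over the options of all vertices. -/
theorem total_eq_prod (hS : Chordal n S)
    (hloc : ∀ v ≤ n, ∀ φ ψ : ℕ → ℕ, (∀ u ∈ S v, φ u = ψ u) → φ v = ψ v → loc v φ = loc v ψ)
    (φ : ℕ → ℕ) : ∀ k ≤ n, total loc k (fun ψ =>
      ∏ x ∈ (Finset.Icc (k + 1) n).filter (fun x => par S x ≤ k), subval loc n S x ψ) φ =
      ∏ x ∈ children n S 0, subval loc n S x φ := by
  intro k
  induction k with
  | zero =>
    intro _
    simp [total, children]
  | succ k ih =>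
    intro hk
    rw [← ih (by omega), total]
    congr 1
    funext ψ
    have e1 : (Finset.Icc (k + 1) n).filter (fun x => par S x ≤ k) =
        insert (k + 1) ((Finset.Icc (k + 2) n).filter (fun x => par S x ≤ k)) := by
      ext x
      have := par_lt hS (v := k + 1) (by omega) hk
      simp only [Finset.mem_filter, Finset.mem_Icc, Finset.mem_insert]
      constructor
      · rintro ⟨⟨h1, h2⟩, h3⟩
        by_cases hx : x = k + 1
        · exact .inl hx
        · exact .inr ⟨⟨by omega, h2⟩, h3⟩
      · rintro (rfl | ⟨⟨h1, h2⟩, h3⟩)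
        · exact ⟨⟨le_rfl, hk⟩, by omega⟩
        · exact ⟨⟨by omega, h2⟩, h3⟩
    have e2 : (Finset.Icc (k + 1 + 1) n).filter (fun x => par S x ≤ k + 1) =
        children n S (k + 1) ∪ (Finset.Icc (k + 2) n).filter (fun x => par S x ≤ k) := by
      ext x
      simp only [children, Finset.mem_filter, Finset.mem_Icc, Finset.mem_union]
      omega
    have hd : Disjoint (children n S (k + 1))
        ((Finset.Icc (k + 2) n).filter (fun x => par S x ≤ k)) := by
      rw [Finset.disjoint_left]
      intro x hx
      simp only [children, Finset.mem_filter, Finset.mem_Icc] at hx ⊢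
      omega
    rw [e1, Finset.prod_insert (by simp), subval_eq, Finset.sum_mul, step, e2]
    refine Finset.sum_congr rfl fun o _ => ?_
    rw [Finset.prod_union hd, mul_assoc]
    congr 2
    refine Finset.prod_congr rfl fun x hx => ?_
    simp only [Finset.mem_filter, Finset.mem_Icc] at hx
    refine subval_congr hS hloc _ x (by omega) le_rfl _ _ fun u hu => ?_
    have := le_par hu
    rw [Function.update_of_ne (by omega)]

end subval

/-! ### The colour sum detects connected even graphs -/

/-- The colours on `S v`. -/
def cols (S : ℕ → Finset ℕ) (φ : ℕ → ℕ) (v : ℕ) : Finset ℕ := (S v).image fun u => φ u / 2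

/-- The weight of the colour of `v`. The colour `v` is new; it stands for all the `q - k` colours
that do not occur on `S v`, where `k` colours do, and the weights are those for `q = 0`, after
division of the weight `q` of the first vertex by `q`. -/
def cw (S : ℕ → Finset ℕ) (v : ℕ) (φ : ℕ → ℕ) : ℤ :=
  if φ v / 2 = v then (if v = 1 then 1 else -((cols S φ v).card : ℤ))
  else if φ v / 2 ∈ cols S φ v then 1 else 0

/-- The sign of an option. -/
def sg (o : ℕ) : ℤ := (-1) ^ o

/-- The graph with the edges `u v` for `R u v` is connected on the vertices `1, …, m`. -/
def Conn (m : ℕ) (R : ℕ → ℕ → Prop) : Prop :=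
  ∀ f : ℕ → Prop, (∀ u v, v ∈ Finset.Icc 1 m → R u v → (f u ↔ f v)) →
    ∀ u ∈ Finset.Icc 1 m, ∀ v ∈ Finset.Icc 1 m, (f u ↔ f v)

theorem sum_opts (A B : ℕ → ℤ) (v : ℕ) : ∑ o ∈ opts v, A (o / 2) * B (o % 2) =
    (∑ c ∈ Finset.Icc 1 v, A c) * (B 0 + B 1) := by
  induction v with
  | zero => simp [opts]
  | succ v ih =>
    have e : opts (v + 1) = insert (2 * v + 3) (insert (2 * v + 2) (opts v)) := by
      ext x; simp only [opts, Finset.mem_insert, Finset.mem_Icc]; omega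
    rw [e, Finset.sum_insert (by simp [opts]), Finset.sum_insert (by simp [opts]), ih,
      ← Finset.insert_Icc_right_eq_Icc_add_one (by omega), Finset.sum_insert (by simp),
      show (2 * v + 3) / 2 = v + 1 by omega, show (2 * v + 2) / 2 = v + 1 by omega,
      show (2 * v + 3) % 2 = 1 by omega, show (2 * v + 2) % 2 = 0 by omega]
    ring

open Classical in
/-- The colours are constant on the edges given by `R`; the signs occur with multiplicity `p`. -/
noncomputable def test (R : ℕ → ℕ → Prop) (p : ℕ → ℕ) (m : ℕ) (φ : ℕ → ℕ) : ℤ :=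
  (if ∀ v ∈ Finset.Icc 1 m, ∀ u, R u v → φ u / 2 = φ v / 2 then 1 else 0) *
    ∏ v ∈ Finset.Icc 1 m, sg (φ v) ^ p v

/-- The relation that arises from `R` by eliminating the vertex `m`. -/
def elimRel (R : ℕ → ℕ → Prop) (m : ℕ) (u v : ℕ) : Prop := R u v ∨ (R u m ∧ R v m ∧ u < v)

/-- A vertex with a neighbour can be eliminated, joining its neighbours, without affecting
connectedness; a last vertex without earlier neighbours is isolated. -/
theorem conn_succ (hS : Chordal n S) {m : ℕ} (hm : m + 1 ≤ n) (h1 : 1 ≤ m) {R : ℕ → ℕ → Prop}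
    (hR : ∀ u v, v ∈ Finset.Icc 1 (m + 1) → R u v → u ∈ S v) :
    Conn (m + 1) R ↔ (∃ u, R u (m + 1)) ∧ Conn m (elimRel R (m + 1)) := by
  have hlt : ∀ u, R u (m + 1) → u ∈ Finset.Icc 1 m := fun u hu => by
    have := hS.lt _ hm u (hR u (m + 1) (by simp) hu)
    simp only [Finset.mem_Icc]; omega
  constructor
  · intro h
    have hex : ∃ u, R u (m + 1) := by
      by_contra hne
      push Not at hne
      have := h (fun x => x = m + 1) (fun u v hv huv => by
        have hu := hS.lt v (by simp only [Finset.mem_Icc] at hv; omega) u (hR u v hv huv)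
        simp only [Finset.mem_Icc] at hv
        have : v ≠ m + 1 := by rintro rfl; exact hne u huv
        change u = m + 1 ↔ v = m + 1
        omega) 1 (by simp) (m + 1) (by simp)
      have : 1 = m + 1 := this.2 rfl
      omega
    obtain ⟨w, hw⟩ := hex
    refine ⟨⟨w, hw⟩, fun f hf u hu v hv => ?_⟩
    have key := h (fun x => if x = m + 1 then f w else f x) (fun a b hb hab => ?_) u
      (by simp only [Finset.mem_Icc] at hu ⊢; omega) v
      (by simp only [Finset.mem_Icc] at hv ⊢; omega)
    · simp only [Finset.mem_Icc] at hu hv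
      rwa [if_neg (by omega), if_neg (by omega)] at key
    · have ha := hS.lt b (by simp only [Finset.mem_Icc] at hb; omega) a (hR a b hb hab)
      simp only [Finset.mem_Icc] at hb
      rw [if_neg (by omega)]
      by_cases hbm : b = m + 1
      · subst hbm
        rw [if_pos rfl]
        rcases lt_trichotomy a w with h2 | h2 | h2
        · exact hf a w (hlt w hw) (.inr ⟨hab, hw, h2⟩)
        · rw [h2]
        · exact (hf w a (hlt a hab) (.inr ⟨hw, hab, h2⟩)).symm
      · rw [if_neg hbm]
        exact hf a b (by simp only [Finset.mem_Icc]; omega) (.inl hab)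
  · rintro ⟨⟨w, hw⟩, h⟩ f hf
    have key := h f (fun u v hv huv => by
      rcases huv with huv | ⟨h2, h3, -⟩
      · exact hf u v (by simp only [Finset.mem_Icc] at hv ⊢; omega) huv
      · exact (hf u (m + 1) (by simp) h2).trans (hf v (m + 1) (by simp) h3).symm)
    have key2 : ∀ u ∈ Finset.Icc 1 (m + 1), (f u ↔ f w) := by
      intro u hu
      by_cases hum : u = m + 1
      · subst hum; exact (hf w (m + 1) (by simp) hw).symm
      · exact key u (by simp only [Finset.mem_Icc] at hu ⊢; omega) w (hlt w hw)
    exact fun u hu v hv => (key2 u hu).trans (key2 v hv).symm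

theorem sg_eq (o : ℕ) : sg o = sg (o % 2) := by
  unfold sg; rw [neg_one_pow_eq_pow_mod_two]

theorem ite_one_mul_ite_one (P Q : Prop) [Decidable P] [Decidable Q] :
    ((if P then 1 else 0) * if Q then 1 else 0 : ℤ) = if P ∧ Q then 1 else 0 := by
  by_cases P <;> by_cases Q <;> simp [*]

theorem ite_one_congr {P Q : Prop} {_ : Decidable P} {_ : Decidable Q} (h : P ↔ Q) :
    (if P then 1 else 0 : ℤ) = if Q then 1 else 0 := by
  by_cases hP : P
  · rw [if_pos hP, if_pos (h.1 hP)]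
  · rw [if_neg hP, if_neg (fun hQ => hP (h.2 hQ))]

theorem ite_two_mul_ite {A B C D : Prop} {_ : Decidable (A ∧ B)} {_ : Decidable (C ∧ D)}
    {_ : Decidable ((A ∧ C) ∧ B ∧ D)} (x : ℤ) :
    (if A ∧ B then 2 else 0) * (if C ∧ D then x else 0) =
      if (A ∧ C) ∧ B ∧ D then x * 2 else 0 := by
  by_cases hA : A <;> by_cases hB : B <;> by_cases hC : C <;> by_cases hD : D <;>
    simp [hA, hB, hC, hD, mul_comm]

open Classical in
/-- The sum over the options of the last vertex, of the weight of the colour and of the condition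
that this colour is that of the neighbours. -/
theorem sum_cw (hS : Chordal n S) {m : ℕ} (hm : m + 1 ≤ n) (h1 : 1 ≤ m) {φ : ℕ → ℕ}
    (hφ : ∀ u ∈ Finset.Icc 1 m, φ u ∈ opts u) (U : ℕ → Prop) (hU : ∀ u, U u → u ∈ S (m + 1)) :
    ∑ c ∈ Finset.Icc 1 (m + 1), (if c = m + 1 then -((cols S φ (m + 1)).card : ℤ)
      else if c ∈ cols S φ (m + 1) then 1 else 0) * (if ∀ u, U u → φ u / 2 = c then 1 else 0) =
    if (∃ u, U u) ∧ ∀ u v, U u → U v → φ u / 2 = φ v / 2 then 1 else 0 := by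
  have hcol : ∀ c ∈ cols S φ (m + 1), c ∈ Finset.Icc 1 m := by
    intro c hc
    obtain ⟨u, hu, rfl⟩ := Finset.mem_image.1 hc
    have h2 := hS.lt _ hm u hu
    have := hφ u (by simp only [Finset.mem_Icc]; omega)
    simp only [opts, Finset.mem_Icc] at this ⊢
    omega
  rw [← Finset.insert_Icc_right_eq_Icc_add_one (by omega), Finset.sum_insert (by simp), if_pos rfl]
  have e1 : ∑ c ∈ Finset.Icc 1 m, (if c = m + 1 then -((cols S φ (m + 1)).card : ℤ)
      else if c ∈ cols S φ (m + 1) then 1 else 0) * (if ∀ u, U u → φ u / 2 = c then 1 else 0) =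
      ∑ c ∈ cols S φ (m + 1), if ∀ u, U u → φ u / 2 = c then 1 else 0 := by
    rw [← Finset.sum_subset (s₁ := cols S φ (m + 1)) (fun c hc => hcol c hc)]
    · refine Finset.sum_congr rfl fun c hc => ?_
      have := hcol c hc
      rw [if_neg (by simp only [Finset.mem_Icc] at this; omega), if_pos hc, one_mul]
    · intro c hc hc'
      rw [if_neg (by simp only [Finset.mem_Icc] at hc; omega), if_neg hc', zero_mul]
  rw [e1]
  by_cases hex : ∃ u, U u
  · obtain ⟨w, hw⟩ := hex
    have hwc : φ w / 2 ∈ cols S φ (m + 1) := Finset.mem_image_of_mem _ (hU w hw)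
    rw [if_neg (c := ∀ u, U u → φ u / 2 = m + 1) (fun h => by
      have := hcol _ hwc
      simp only [Finset.mem_Icc] at this
      have := h w hw
      omega), mul_zero, zero_add,
      Finset.sum_eq_single_of_mem _ hwc (fun c _ hc => if_neg fun h => hc (h w hw).symm)]
    refine if_congr ⟨fun h => ⟨⟨w, hw⟩, fun u v hu hv => (h u hu).trans (h v hv).symm⟩,
      fun h u hu => h.2 u w hu hw⟩ rfl rfl
  · have h2 : ∀ c, ∀ u, U u → φ u / 2 = c := fun c u hu => (hex ⟨u, hu⟩).elim
    rw [if_pos (h2 _), Finset.sum_congr rfl fun c _ => if_pos (h2 c), if_neg fun h => hex h.1]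
    simp

/-- Summing over the options of the last vertex eliminates it. If it has neighbours, only the colours of
its neighbours pass the test, and the sum of their weights is `1` if these agree. If it is isolated,
all `k` colours on `S (m + 1)` and the new colour pass the test, and the weights `1` and `-k` cancel. -/
theorem step_test (hS : Chordal n S) {m : ℕ} (hm : m + 1 ≤ n) (h1 : 1 ≤ m) {R : ℕ → ℕ → Prop}
    (hR : ∀ u v, v ∈ Finset.Icc 1 (m + 1) → R u v → u ∈ S v) (p : ℕ → ℕ) {φ : ℕ → ℕ}
    (hφ : ∀ u ∈ Finset.Icc 1 m, φ u ∈ opts u) :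
    step (cw S) (m + 1) (test R p (m + 1)) φ =
      (open Classical in if (∃ u, R u (m + 1)) ∧ Even (p (m + 1)) then 2 else 0) *
        test (elimRel R (m + 1)) p m φ := by
  classical
  have hSm : m + 1 ∉ S (m + 1) := fun h => by have := hS.lt _ hm _ h; omega
  have hlt : ∀ v ∈ Finset.Icc 1 (m + 1), ∀ u, R u v → u < v ∧ 1 ≤ u := fun v hv u hu => by
    have := hS.lt v (by simp only [Finset.mem_Icc] at hv; omega) u (hR u v hv hu)
    omega
  have hcols : ∀ o, cols S (Function.update φ (m + 1) o) (m + 1) = cols S φ (m + 1) := by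
    intro o
    refine Finset.image_congr fun u hu => ?_
    change Function.update φ (m + 1) o u / 2 = φ u / 2
    rw [Function.update_of_ne]
    rintro rfl; exact hSm hu
  set r : ℤ := if ∀ v ∈ Finset.Icc 1 m, ∀ u, R u v → φ u / 2 = φ v / 2 then 1 else 0 with hr
  set pr : ℤ := ∏ v ∈ Finset.Icc 1 m, sg (φ v) ^ p v with hpr
  have e1 : ∀ o ∈ opts (m + 1), cw S (m + 1) (Function.update φ (m + 1) o) *
      test R p (m + 1) (Function.update φ (m + 1) o) =
      (((if o / 2 = m + 1 then -((cols S φ (m + 1)).card : ℤ)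
      else if o / 2 ∈ cols S φ (m + 1) then 1 else 0) *
        (if ∀ u, R u (m + 1) → φ u / 2 = o / 2 then 1 else 0)) * sg (o % 2) ^ p (m + 1)) *
        (r * pr) := by
    intro o _
    have f1 : cw S (m + 1) (Function.update φ (m + 1) o) =
        if o / 2 = m + 1 then -((cols S φ (m + 1)).card : ℤ)
          else if o / 2 ∈ cols S φ (m + 1) then 1 else 0 := by
      unfold cw
      rw [hcols]
      simp [show m ≠ 0 by omega]
    have f2 : (if ∀ v ∈ Finset.Icc 1 (m + 1), ∀ u, R u v →
        Function.update φ (m + 1) o u / 2 = Function.update φ (m + 1) o v / 2 then (1 : ℤ) else 0) =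
        (if ∀ u, R u (m + 1) → φ u / 2 = o / 2 then 1 else 0) * r := by
      rw [hr, ite_one_mul_ite_one]
      refine ite_one_congr ⟨fun h => ⟨fun u hu => ?_, fun v hv u hu => ?_⟩, ?_⟩
      · have := h (m + 1) (by simp) u hu
        have h2 := hlt (m + 1) (by simp) u hu
        rwa [Function.update_self, Function.update_of_ne (by omega)] at this
      · have hv' : v ∈ Finset.Icc 1 (m + 1) := by simp only [Finset.mem_Icc] at hv ⊢; omega
        have := h v hv' u hu
        have h2 := hlt v hv' u hu
        simp only [Finset.mem_Icc] at hv
        rwa [Function.update_of_ne (by omega), Function.update_of_ne (by omega)] at this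
      · rintro ⟨ha, hb⟩ v hv u hu
        have h2 := hlt v hv u hu
        simp only [Finset.mem_Icc] at hv
        by_cases hvm : v = m + 1
        · subst hvm
          rw [Function.update_self, Function.update_of_ne (by omega)]
          exact ha u hu
        · rw [Function.update_of_ne (by omega), Function.update_of_ne hvm]
          exact hb v (by simp only [Finset.mem_Icc]; omega) u hu
    have f3 : ∏ v ∈ Finset.Icc 1 (m + 1), sg (Function.update φ (m + 1) o v) ^ p v =
        sg (o % 2) ^ p (m + 1) * pr := by
      rw [← Finset.insert_Icc_right_eq_Icc_add_one (by omega), Finset.prod_insert (by simp),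
        Function.update_self, ← sg_eq, hpr]
      congr 1
      refine Finset.prod_congr rfl fun v hv => ?_
      rw [Function.update_of_ne (by simp only [Finset.mem_Icc] at hv; omega)]
    rw [f1, test, f2, f3]
    ring
  rw [step, Finset.sum_congr rfl e1, ← Finset.sum_mul,
    sum_opts (fun c => (if c = m + 1 then -((cols S φ (m + 1)).card : ℤ)
      else if c ∈ cols S φ (m + 1) then 1 else 0) *
        (if ∀ u, R u (m + 1) → φ u / 2 = c then 1 else 0)) (fun s => sg s ^ p (m + 1)),
    sum_cw hS hm h1 hφ (fun u => R u (m + 1)) (fun u hu => hR u _ (by simp) hu)]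
  have e2 : sg 0 ^ p (m + 1) + sg 1 ^ p (m + 1) = if Even (p (m + 1)) then 2 else 0 := by
    split
    · rename_i h; simp [sg, h.neg_one_pow]
    · rename_i h; simp [sg, (Nat.not_even_iff_odd.1 h).neg_one_pow]
  have e3 : test (elimRel R (m + 1)) p m φ =
      ((if ∀ u v, R u (m + 1) → R v (m + 1) → φ u / 2 = φ v / 2 then 1 else 0) * r) * pr := by
    rw [test, hr, ite_one_mul_ite_one, hpr]
    congr 1
    refine ite_one_congr ⟨fun h => ⟨fun u v hu hv => ?_, fun v hv u hu => h v hv u (.inl hu)⟩, ?_⟩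
    · have hu' := hlt (m + 1) (by simp) u hu
      have hv' := hlt (m + 1) (by simp) v hv
      rcases lt_trichotomy u v with h2 | h2 | h2
      · exact h v (by simp only [Finset.mem_Icc]; omega) u (.inr ⟨hu, hv, h2⟩)
      · rw [h2]
      · exact (h u (by simp only [Finset.mem_Icc]; omega) v (.inr ⟨hv, hu, h2⟩)).symm
    · rintro ⟨ha, hb⟩ v hv u (hu | ⟨hu, hv', -⟩)
      · exact hb v hv u hu
      · exact ha u v hu hv'
  rw [e2, e3]
  by_cases hA : ∃ u, R u (m + 1) <;> by_cases hB : Even (p (m + 1)) <;>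
    by_cases hC : ∀ u v, R u (m + 1) → R v (m + 1) → φ u / 2 = φ v / 2 <;>
    simp [hA, hB, hC]

/-- The sum over all colours and signs detects the graphs that are connected and in which all `p v` are
even: with `q` colours, an unweighted sum would be `q` to the number of components, and `cw` picks the
coefficient of `q`, while the signs cancel at odd degrees and give a factor `2` at even ones. -/
theorem total_cw_test (hS : Chordal n S) (φ : ℕ → ℕ) (p : ℕ → ℕ) (m : ℕ) : m + 1 ≤ n →
    ∀ (R : ℕ → ℕ → Prop), (∀ u v, v ∈ Finset.Icc 1 (m + 1) → R u v → u ∈ S v) →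
    total (cw S) (m + 1) (test R p (m + 1)) φ =
      open Classical in if Conn (m + 1) R ∧ ∀ v ∈ Finset.Icc 1 (m + 1), Even (p v)
        then 2 ^ (m + 1) else 0 := by
  classical
  induction m with
  | zero =>
    intro hm R hR
    have hR1 : ∀ u, ¬ R u 1 := fun u hu => by
      have := hS.lt 1 hm u (hR u 1 (by simp) hu); omega
    have hc : Conn (0 + 1) R := by
      intro f _ u hu v hv
      simp only [Finset.mem_Icc] at hu hv
      rw [show u = v by omega]
    simp only [total, step, opts, hc, true_and]
    rw [show Finset.Icc 2 (2 * (0 + 1) + 1) = {2, 3} by rfl]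
    by_cases hp : Even (p 1)
    · simp [test, cw, hR1, hp, sg, hp.neg_one_pow]
    · simp [test, cw, hR1, hp, sg, (Nat.not_even_iff_odd.1 hp).neg_one_pow]
  | succ m ih =>
    intro hm R hR
    rw [total, total_congr (fun ψ hψ => step_test hS hm (by omega) hR p hψ) φ,
      total_const_mul, ih (by omega)]
    · have hev : (∀ v ∈ Finset.Icc 1 (m + 1 + 1), Even (p v)) ↔
          Even (p (m + 1 + 1)) ∧ ∀ v ∈ Finset.Icc 1 (m + 1), Even (p v) := by
        rw [← Finset.insert_Icc_right_eq_Icc_add_one (by omega), Finset.forall_mem_insert]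
      simp only [conn_succ hS hm (by omega) hR, hev, pow_succ (2 : ℤ) (m + 1)]
      exact ite_two_mul_ite _
    · intro u v hv huv
      have hv' : v ∈ Finset.Icc 1 (m + 1 + 1) := by simp only [Finset.mem_Icc] at hv ⊢; omega
      rcases huv with huv | ⟨h1, h2, h3⟩
      · exact hR u v hv' huv
      · exact hS.mem (m + 1 + 1) hm u (hR u _ (by simp) h1) v (hR v _ (by simp) h2) h3

end Elim

/-! ### Extraction of the Hamiltonian cycles -/

namespace Elim

variable {n : ℕ} {S : ℕ → Finset ℕ}

/-- The edges of the graph: the pair `⟨v, u⟩` is an edge if `u ∈ N v`, so `u < v`. -/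
def edges (n : ℕ) (N : ℕ → Finset ℕ) : Finset ((_ : ℕ) × ℕ) := (Finset.Icc 1 n).sigma N

/-- The weight of the option of a vertex `v`: that of its colour, times that of the edges to its
predecessors. An edge is either not used, with weight `a u v`, or used, with weight `z`, which
requires that the colours agree; then it contributes to the signs. -/
def loc (S N : ℕ → Finset ℕ) (a : ℕ → ℕ → ℤ) (z : ℤ) (v : ℕ) (φ : ℕ → ℕ) : ℤ :=
  cw S v φ * ∏ u ∈ N v, ((if φ u / 2 = φ v / 2 then z * (sg (φ u) * sg (φ v)) else 0) + a u v)

/-- The degree of a vertex. -/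
def deg (H : Finset ((_ : ℕ) × ℕ)) (x : ℕ) : ℕ :=
  (H.filter fun e => e.1 = x).card + (H.filter fun e => e.2 = x).card

/-- The graph with edge set `H` is connected, and all degrees are even. -/
def ConnEven (n : ℕ) (H : Finset ((_ : ℕ) × ℕ)) : Prop :=
  Conn n (fun u v => (⟨v, u⟩ : (_ : ℕ) × ℕ) ∈ H) ∧ ∀ x ∈ Finset.Icc 1 n, Even (deg H x)

variable {N : ℕ → Finset ℕ} {a : ℕ → ℕ → ℤ} {z : ℤ}

theorem cw_congr {v : ℕ} {φ ψ : ℕ → ℕ} (h : ∀ u ∈ S v, φ u = ψ u) (hv : φ v = ψ v) :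
    cw S v φ = cw S v ψ := by
  have : cols S φ v = cols S ψ v := Finset.image_congr fun u hu => by
    rw [h u hu]
  unfold cw
  rw [this, hv]

theorem loc_congr (hN : ∀ v ≤ n, N v ⊆ S v) : ∀ v ≤ n, ∀ φ ψ : ℕ → ℕ,
    (∀ u ∈ S v, φ u = ψ u) → φ v = ψ v → loc S N a z v φ = loc S N a z v ψ := by
  intro v hv φ ψ h h'
  unfold loc
  rw [cw_congr h h', Finset.prod_congr rfl fun u hu => by rw [h u (hN v hv hu), h']]

theorem mem_edges {e : (_ : ℕ) × ℕ} : e ∈ edges n N ↔ e.1 ∈ Finset.Icc 1 n ∧ e.2 ∈ N e.1 :=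
  Finset.mem_sigma

theorem snd_mem (hS : Chordal n S) (hN : ∀ v ≤ n, N v ⊆ S v) {e : (_ : ℕ) × ℕ}
    (he : e ∈ edges n N) : e.2 ∈ Finset.Icc 1 n ∧ e.2 < e.1 := by
  obtain ⟨h1, h2⟩ := mem_edges.1 he
  simp only [Finset.mem_Icc] at h1 ⊢
  have := hS.lt e.1 h1.2 e.2 (hN _ h1.2 h2)
  omega

/-- The factors of the edges used form the test for the graph `H`, since the signs of the two ends of all
edges collect to the degrees. -/
theorem prod_edge_eq_test (hS : Chordal n S) (hN : ∀ v ≤ n, N v ⊆ S v)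
    {H : Finset ((_ : ℕ) × ℕ)} (hH : H ⊆ edges n N) (φ : ℕ → ℕ) :
    ∏ e ∈ H, (if φ e.2 / 2 = φ e.1 / 2 then z * (sg (φ e.2) * sg (φ e.1)) else 0) =
      z ^ H.card * test (fun u v => (⟨v, u⟩ : (_ : ℕ) × ℕ) ∈ H) (deg H) n φ := by
  classical
  have e1 : ∏ v ∈ Finset.Icc 1 n, sg (φ v) ^ deg H v =
      (∏ e ∈ H, sg (φ e.1)) * ∏ e ∈ H, sg (φ e.2) := by
    rw [← Finset.prod_fiberwise_of_maps_to (s := H) (t := Finset.Icc 1 n) (g := fun e => e.1)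
      (fun e he => (mem_edges.1 (hH he)).1), ← Finset.prod_fiberwise_of_maps_to (s := H)
      (t := Finset.Icc 1 n) (g := fun e => e.2) (fun e he => (snd_mem hS hN (hH he)).1),
      ← Finset.prod_mul_distrib]
    refine Finset.prod_congr rfl fun v _ => ?_
    rw [deg, pow_add]
    congr 1
    · rw [Finset.prod_congr rfl (g := fun _ => sg (φ v)) fun e he => by
        rw [(Finset.mem_filter.1 he).2], Finset.prod_const]
    · rw [Finset.prod_congr rfl (g := fun _ => sg (φ v)) fun e he => by
        rw [(Finset.mem_filter.1 he).2], Finset.prod_const]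
  rw [test, e1]
  by_cases h : ∀ e ∈ H, φ e.2 / 2 = φ e.1 / 2
  · rw [if_pos (fun v _ u hu => h _ hu), Finset.prod_congr rfl fun e he => if_pos (h e he),
      Finset.prod_mul_distrib, Finset.prod_mul_distrib, Finset.prod_const]
    ring
  · rw [if_neg (fun h' => h fun e he => h' e.1 (mem_edges.1 (hH he)).1 e.2 he)]
    push Not at h
    obtain ⟨e, he, hne⟩ := h
    rw [Finset.prod_eq_zero he (if_neg hne)]
    ring

open Classical in
/-- The value of the virtual root is a generating function of the connected even subgraphs. -/
theorem prod_subval (hS : Chordal n S) (hN : ∀ v ≤ n, N v ⊆ S v) (hn : 1 ≤ n) (φ : ℕ → ℕ) :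
    ∏ x ∈ children n S 0, subval (loc S N a z) n S x φ =
      ∑ H ∈ (edges n N).powerset.filter (ConnEven n),
        2 ^ n * (z ^ H.card * ∏ e ∈ edges n N \ H, a e.2 e.1) := by
  rw [← total_eq_prod hS (loc_congr hN) φ n le_rfl]
  have e0 : ∀ ψ : ℕ → ℕ, ∏ x ∈ (Finset.Icc (n + 1) n).filter (fun x => par S x ≤ n),
      subval (loc S N a z) n S x ψ = 1 := by intro ψ; simp
  simp only [e0]
  -- Predecessors beyond the range `1, …, n` are cut off, so that the weights depend on earlier
  -- vertices only.
  set g : ℕ → (ℕ → ℕ) → ℤ := fun v ψ => if v ≤ n then ∏ u ∈ N v,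
    ((if ψ u / 2 = ψ v / 2 then z * (sg (ψ u) * sg (ψ v)) else 0) + a u v) else 1 with hg
  have e1 : ∀ m ≤ n, ∀ (τ : (ℕ → ℕ) → ℤ) (φ : ℕ → ℕ), total (loc S N a z) m τ φ =
      total (fun v ψ => cw S v ψ * g v ψ) m τ φ := by
    intro m
    induction m with
    | zero => intro _ τ φ; rfl
    | succ m ih =>
      intro hm τ φ
      simp only [total]
      rw [ih (by omega)]
      congr 1
      funext ψ
      simp only [step, loc, hg, if_pos hm]
  rw [e1 n le_rfl, total_mul]
  swap
  · intro v φ ψ h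
    simp only [hg]
    split
    · rename_i hv
      refine Finset.prod_congr rfl fun u hu => ?_
      have := hS.lt v hv u (hN v hv hu)
      rw [h u (by omega), h v le_rfl]
    · rfl
  have e2 : ∀ ψ : ℕ → ℕ, (∏ v ∈ Finset.Icc 1 n, g v ψ) * 1 = ∑ H ∈ (edges n N).powerset,
      (z ^ H.card * ∏ e ∈ edges n N \ H, a e.2 e.1) *
        test (fun u v => (⟨v, u⟩ : (_ : ℕ) × ℕ) ∈ H) (deg H) n ψ := by
    intro ψ
    rw [mul_one, Finset.prod_congr rfl (g := fun v => ∏ u ∈ N v,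
      ((if ψ u / 2 = ψ v / 2 then z * (sg (ψ u) * sg (ψ v)) else 0) + a u v)) fun v hv =>
        if_pos (Finset.mem_Icc.1 hv).2, ← Finset.prod_sigma (Finset.Icc 1 n) N fun e =>
        ((if ψ e.2 / 2 = ψ e.1 / 2 then z * (sg (ψ e.2) * sg (ψ e.1)) else 0) + a e.2 e.1)]
    change ∏ e ∈ edges n N, _ = _
    rw [Finset.prod_add]
    refine Finset.sum_congr rfl fun H hH => ?_
    rw [prod_edge_eq_test hS hN (Finset.mem_powerset.1 hH)]
    ring
  simp only [e2]
  rw [total_sum, Finset.sum_filter]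
  refine Finset.sum_congr rfl fun H hH => ?_
  rw [total_const_mul]
  obtain ⟨m, rfl⟩ : ∃ m, n = m + 1 := ⟨n - 1, by omega⟩
  rw [total_cw_test hS φ (deg H) m le_rfl]
  · by_cases h : ConnEven (m + 1) H
    · rw [if_pos h, if_pos (And.intro h.1 h.2)]; ring
    · rw [if_neg h, if_neg (show ¬ (_ ∧ _) from h), mul_zero]
  · intro u v hv huv
    have h1 := mem_edges.1 (Finset.mem_powerset.1 hH huv)
    exact hN v (Finset.mem_Icc.1 hv).2 h1.2

theorem sum_deg (hS : Chordal n S) (hN : ∀ v ≤ n, N v ⊆ S v) {H : Finset ((_ : ℕ) × ℕ)}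
    (hH : H ⊆ edges n N) : ∑ x ∈ Finset.Icc 1 n, deg H x = 2 * H.card := by
  simp only [deg]
  rw [Finset.sum_add_distrib,
    ← Finset.card_eq_sum_card_fiberwise (fun e he => (mem_edges.1 (hH he)).1),
    ← Finset.card_eq_sum_card_fiberwise (fun e he => (snd_mem hS hN (hH he)).1)]
  omega

theorem two_le_deg (hn : 2 ≤ n) {H : Finset ((_ : ℕ) × ℕ)} (h : ConnEven n H) {x : ℕ}
    (hx : x ∈ Finset.Icc 1 n) : 2 ≤ deg H x := by
  have hpos : deg H x ≠ 0 := by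
    intro h0
    obtain ⟨h1, h2⟩ := Nat.add_eq_zero_iff.1 h0
    rw [Finset.card_eq_zero, Finset.filter_eq_empty_iff] at h1 h2
    have key := h.1 (fun y => y = x) (fun u v _ huv =>
      ⟨fun e => (h2 huv e).elim, fun e => (h1 huv e).elim⟩)
    obtain ⟨y, hy, hne⟩ : ∃ y ∈ Finset.Icc 1 n, y ≠ x := by
      simp only [Finset.mem_Icc] at hx ⊢
      by_cases h : x = 1
      · exact ⟨2, by omega, by omega⟩
      · exact ⟨1, by omega, by omega⟩
    exact hne ((key y hy x hx).2 rfl)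
  obtain ⟨k, hk⟩ := h.2 x hx
  omega

theorem card_le_of_connEven (hS : Chordal n S) (hN : ∀ v ≤ n, N v ⊆ S v) (hn : 2 ≤ n)
    {H : Finset ((_ : ℕ) × ℕ)} (hH : H ⊆ edges n N) (h : ConnEven n H) : n ≤ H.card := by
  have h1 := sum_deg hS hN hH
  have h2 : n * 2 ≤ ∑ x ∈ Finset.Icc 1 n, deg H x := by
    simpa using Finset.card_nsmul_le_sum (Finset.Icc 1 n) (deg H) 2
      fun x hx => two_le_deg hn h hx
  omega

/-- The edge sets of the Hamiltonian cycles: the connected even graphs with `n` edges. -/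
def IsHam (n : ℕ) (H : Finset ((_ : ℕ) × ℕ)) : Prop := ConnEven n H ∧ H.card = n

theorem deg_eq_two (hS : Chordal n S) (hN : ∀ v ≤ n, N v ⊆ S v) (hn : 2 ≤ n)
    {H : Finset ((_ : ℕ) × ℕ)} (hH : H ⊆ edges n N) (h : IsHam n H) :
    ∀ x ∈ Finset.Icc 1 n, deg H x = 2 := by
  have h1 := sum_deg hS hN hH
  have h2 : ∑ x ∈ Finset.Icc 1 n, 2 = ∑ x ∈ Finset.Icc 1 n, deg H x := by
    rw [h1, h.2]; simp; omega
  exact fun x hx => ((Finset.sum_eq_sum_iff_of_le fun x hx => two_le_deg hn h.1 hx).1 h2 x hx).symm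

/-- The alternating binomial sum that extracts the constant term of a polynomial of degree less
than `M` from its values at `1, …, M`. -/
theorem sum_choose_mul_pow {M r : ℕ} (hr : r < M) :
    ∑ j ∈ Finset.Icc 1 M, (-1 : ℤ) ^ (j + 1) * M.choose j * (j : ℤ) ^ r =
      if r = 0 then 1 else 0 := by
  have h : ∑ j ∈ Finset.range (M + 1), (-1 : ℤ) ^ j * M.choose j * (j : ℤ) ^ r = 0 := by
    have h1 := congrFun (fwdDiff_iter_pow_eq_zero_of_lt (R := ℤ) hr) 0
    rw [fwdDiff_iter_eq_sum_shift] at h1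
    simp only [zero_add, nsmul_eq_mul, mul_one, Pi.zero_apply, smul_eq_mul] at h1
    have h2 : ∑ j ∈ Finset.range (M + 1), (-1 : ℤ) ^ j * M.choose j * (j : ℤ) ^ r =
        (-1) ^ M * ∑ j ∈ Finset.range (M + 1), (-1 : ℤ) ^ (M - j) * M.choose j * (j : ℤ) ^ r := by
      rw [Finset.mul_sum]
      refine Finset.sum_congr rfl fun j hj => ?_
      have : (-1 : ℤ) ^ j = (-1) ^ M * (-1) ^ (M - j) := by
        rw [← pow_add]
        have : j ≤ M := by simpa [Nat.lt_succ_iff] using hj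
        rw [show M + (M - j) = j + 2 * (M - j) by omega, pow_add, pow_mul]
        simp
      rw [this]; ring
    rw [h2, h1, mul_zero]
  rw [← Finset.sum_erase_add _ _ (Finset.mem_range.2 (Nat.succ_pos M))] at h
  have e : (Finset.range (M + 1)).erase 0 = Finset.Icc 1 M := by
    ext x; simp only [Finset.mem_erase, Finset.mem_range, Finset.mem_Icc]; omega
  rw [e] at h
  simp only [pow_succ (-1 : ℤ), mul_neg, mul_one, neg_mul, Finset.sum_neg_distrib]
  by_cases h0 : r = 0
  · subst h0; simp at h ⊢; linarith
  · simp [h0] at h ⊢; exact h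

/-- The combination of the values `P z` for `z = 1, …, M` that extracts the Hamiltonian cycles. -/
def combine (n M : ℕ) (P : ℕ → ℤ) : ℤ :=
  ∑ j ∈ Finset.Icc 1 M, (-1 : ℤ) ^ (j + 1) * M.choose j * (P j / (2 * j) ^ n)

open Classical in
/-- Connected even subgraphs have at least `n` edges, and those with exactly `n` are the Hamiltonian
cycles. Hence the quotients by `(2 * j) ^ n` are the values of a polynomial in `j`, whose constant term
belongs to the Hamiltonian cycles. -/
theorem combine_eq (hS : Chordal n S) (hN : ∀ v ≤ n, N v ⊆ S v) (hn : 2 ≤ n) (φ : ℕ → ℕ → ℕ) {M : ℕ}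
    (hM : (edges n N).card < M) :
    combine n M (fun j => ∏ x ∈ children n S 0, subval (loc S N a j) n S x (φ j)) =
      ∑ H ∈ (edges n N).powerset.filter (IsHam n), ∏ e ∈ edges n N \ H, a e.2 e.1 := by
  have e1 : ∀ j ∈ Finset.Icc 1 M, (∏ x ∈ children n S 0, subval (loc S N a j) n S x (φ j)) /
      (2 * j : ℤ) ^ n = ∑ H ∈ (edges n N).powerset.filter (ConnEven n),
        (j : ℤ) ^ (H.card - n) * ∏ e ∈ edges n N \ H, a e.2 e.1 := by
    intro j hj
    have hj0 : (2 * j : ℤ) ^ n ≠ 0 := by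
      simp only [Finset.mem_Icc] at hj
      exact pow_ne_zero _ (by have : j ≠ 0 := by omega
                              positivity)
    refine Int.ediv_eq_of_eq_mul_right hj0 ?_
    rw [prod_subval hS hN (by omega), Finset.mul_sum]
    refine Finset.sum_congr rfl fun H hH => ?_
    have h2 := Finset.mem_filter.1 hH
    have h3 := card_le_of_connEven hS hN hn (Finset.mem_powerset.1 h2.1) h2.2
    rw [mul_pow, mul_assoc, ← mul_assoc ((j : ℤ) ^ n), ← pow_add, show n + (H.card - n) = H.card by omega]
  rw [combine, Finset.sum_congr rfl fun j hj => by rw [e1 j hj]]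
  simp only [Finset.mul_sum]
  rw [Finset.sum_comm, ← Finset.sum_subset (s₁ := (edges n N).powerset.filter (IsHam n))
    (s₂ := (edges n N).powerset.filter (ConnEven n))]
  · refine Finset.sum_congr rfl fun H hH => ?_
    have h2 := (Finset.mem_filter.1 hH).2
    have := sum_choose_mul_pow (M := M) (r := 0) (by omega)
    simp only [h2.2, Nat.sub_self, pow_zero, mul_one, one_mul, if_true] at this ⊢
    rw [← Finset.sum_mul, this, one_mul]
  · intro H hH
    simp only [Finset.mem_filter] at hH ⊢
    exact ⟨hH.1, hH.2.1⟩
  · intro H hH hH'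
    simp only [Finset.mem_filter, not_and] at hH hH'
    have h1 := card_le_of_connEven hS hN hn (Finset.mem_powerset.1 hH.1) hH.2
    have h2 := Finset.card_le_card (Finset.mem_powerset.1 hH.1)
    have h3 : H.card - n ≠ 0 := fun h => hH' hH.1 ⟨hH.2, by omega⟩
    have := sum_choose_mul_pow (M := M) (r := H.card - n) (by omega)
    simp only [← mul_assoc]
    rw [← Finset.sum_mul, this, if_neg h3, zero_mul]

/-- The weight of an edge that is not used: no such weight if the edge is prescribed. -/
def unused (K : ℕ) (c : ℕ → ℕ → ℕ) (forced : ℕ → ℕ → Prop) [∀ u v, Decidable (forced u v)]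
    (u v : ℕ) : ℤ := if forced u v then 0 else 2 ^ (K * c u v)

/-- The cost of a set of edges. -/
def ecost (c : ℕ → ℕ → ℕ) (H : Finset ((_ : ℕ) × ℕ)) : ℕ := ∑ e ∈ H, c e.2 e.1

open Classical in
/-- The edge sets of the Hamiltonian cycles that contain all prescribed edges. -/
noncomputable def hams (n : ℕ) (N : ℕ → Finset ℕ) (forced : ℕ → ℕ → Prop) :
    Finset (Finset ((_ : ℕ) × ℕ)) :=
  (edges n N).powerset.filter fun H => IsHam n H ∧ ∀ e ∈ edges n N, forced e.2 e.1 → e ∈ H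

theorem mem_hams {forced : ℕ → ℕ → Prop} {H : Finset ((_ : ℕ) × ℕ)} : H ∈ hams n N forced ↔
    H ⊆ edges n N ∧ IsHam n H ∧ ∀ e ∈ edges n N, forced e.2 e.1 → e ∈ H := by
  simp [hams]

/-- With the weights `unused`, a cycle that misses a prescribed edge contributes `0`, and any other one a
power of `2 ^ K` whose exponent is the cost of the edges that it does not use. -/
theorem combine_eq_sum_hams (hS : Chordal n S) (hN : ∀ v ≤ n, N v ⊆ S v) (hn : 2 ≤ n)
    (φ : ℕ → ℕ → ℕ) {M : ℕ} (hM : (edges n N).card < M) (K : ℕ) (c : ℕ → ℕ → ℕ)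
    (forced : ℕ → ℕ → Prop) [∀ u v, Decidable (forced u v)] :
    combine n M (fun j => ∏ x ∈ children n S 0,
      subval (loc S N (unused K c forced) j) n S x (φ j)) =
      ((∑ H ∈ hams n N forced, 2 ^ (K * (ecost c (edges n N) - ecost c H)) : ℕ) : ℤ) := by
  classical
  rw [combine_eq hS hN hn φ hM]
  push_cast
  rw [← Finset.sum_subset (s₁ := hams n N forced)]
  · refine Finset.sum_congr rfl fun H hH => ?_
    obtain ⟨h1, -, h3⟩ := mem_hams.1 hH
    rw [Finset.prod_congr rfl (g := fun e => (2 : ℤ) ^ (K * c e.2 e.1)) fun e he => by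
      rw [Finset.mem_sdiff] at he
      exact if_neg fun hf => he.2 (h3 e he.1 hf)]
    rw [Finset.prod_pow_eq_pow_sum, ← Finset.mul_sum]
    congr 2
    have := Finset.sum_sdiff (f := fun e => c e.2 e.1) h1
    unfold ecost
    omega
  · intro H hH
    obtain ⟨h1, h2, -⟩ := mem_hams.1 hH
    exact Finset.mem_filter.2 ⟨Finset.mem_powerset.2 h1, h2⟩
  · intro H hH hH'
    obtain ⟨h1, h2⟩ := Finset.mem_filter.1 hH
    rw [mem_hams] at hH'
    push Not at hH'
    obtain ⟨e, he, hf, heH⟩ := hH' (Finset.mem_powerset.1 h1) h2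
    exact Finset.prod_eq_zero (Finset.mem_sdiff.2 ⟨he, heH⟩) (if_pos hf)

/-- The largest exponent can be read off from the number of binary digits, as there are too few
summands to affect it. -/
theorem size_sum_pow {ι : Type*} (s : Finset ι) (f : ι → ℕ) {K : ℕ} (hK : 1 ≤ K)
    (hs : s.card < 2 ^ K) {i : ι} (hi : i ∈ s) (hmax : ∀ j ∈ s, f j ≤ f i) :
    (((∑ j ∈ s, 2 ^ (K * f j)).size : ℤ) - 1) / K = f i := by
  have h1 : 2 ^ (K * f i) ≤ ∑ j ∈ s, 2 ^ (K * f j) :=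
    Finset.single_le_sum (f := fun j => 2 ^ (K * f j)) (fun _ _ => Nat.zero_le _) hi
  have h2 : ∑ j ∈ s, 2 ^ (K * f j) < 2 ^ (K * f i + K) := by
    calc ∑ j ∈ s, 2 ^ (K * f j) ≤ ∑ j ∈ s, 2 ^ (K * f i) := Finset.sum_le_sum fun j hj =>
          Nat.pow_le_pow_right (by norm_num) (Nat.mul_le_mul_left _ (hmax j hj))
      _ = s.card * 2 ^ (K * f i) := by simp
      _ < 2 ^ K * 2 ^ (K * f i) := by gcongr
      _ = _ := by rw [← pow_add, add_comm]
  have h3 := Nat.lt_size.2 h1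
  have h4 := Nat.size_le.2 h2
  have hK' : (0 : ℤ) < K := by exact_mod_cast hK
  rw [Int.ediv_eq_iff_of_pos hK']
  constructor
  · have : ((K * f i : ℕ) : ℤ) + 1 ≤ (∑ j ∈ s, 2 ^ (K * f j)).size := by exact_mod_cast h3
    push_cast at this; nlinarith
  · have : (((∑ j ∈ s, 2 ^ (K * f j)).size : ℕ) : ℤ) ≤ ((K * f i + K : ℕ) : ℤ) := by
      exact_mod_cast h4
    push_cast at this; nlinarith

theorem card_edges_le (hN : ∀ v ≤ n, N v ⊆ S v) {w : ℕ}
    (hw : ∀ v ≤ n, (S v).card ≤ w) : (edges n N).card ≤ n * w := by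
  rw [edges, Finset.card_sigma]
  refine (Finset.sum_le_card_nsmul _ _ w fun v hv => ?_).trans (by simp)
  have := (Finset.mem_Icc.1 hv).2
  exact (Finset.card_le_card (hN v this)).trans (hw v this)

/-- A Hamiltonian cycle is a choice of `n` among at most `n ^ 2` edges. -/
theorem card_hams_lt (hS : Chordal n S) (hN : ∀ v ≤ n, N v ⊆ S v) (hn : 1 ≤ n)
    (forced : ℕ → ℕ → Prop) : (hams n N forced).card < 2 ^ (2 * n * n.size) := by
  have hw : ∀ v ≤ n, (S v).card ≤ n := fun v hv => by
    have : S v ⊆ Finset.Icc 1 n := fun u hu => by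
      have := hS.lt v hv u hu
      simp only [Finset.mem_Icc]; omega
    simpa using Finset.card_le_card this
  have h1 : hams n N forced ⊆ Finset.powersetCard n (edges n N) := fun H hH => by
    obtain ⟨h1, h2, -⟩ := mem_hams.1 hH
    exact Finset.mem_powersetCard.2 ⟨h1, h2.2⟩
  calc (hams n N forced).card ≤ (edges n N).card.choose n := by
        simpa using Finset.card_le_card h1
    _ ≤ (edges n N).card ^ n := Nat.choose_le_pow _ _
    _ ≤ (n * n) ^ n := Nat.pow_le_pow_left (card_edges_le hN hw) n
    _ < (2 ^ n.size * 2 ^ n.size) ^ n := by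
        have := Nat.lt_size_self n
        exact Nat.pow_lt_pow_left (Nat.mul_lt_mul'' this this) (by omega)
    _ = _ := by rw [← pow_add, ← pow_mul]; congr 1; ring

/-! ### The structure of a Hamiltonian cycle -/

/-- Adjacency in the graph with edge set `H`. -/
def Nb (H : Finset ((_ : ℕ) × ℕ)) (x y : ℕ) : Prop :=
  (⟨x, y⟩ : (_ : ℕ) × ℕ) ∈ H ∨ (⟨y, x⟩ : (_ : ℕ) × ℕ) ∈ H

theorem Nb.symm {H : Finset ((_ : ℕ) × ℕ)} {x y : ℕ} (h : Nb H x y) : Nb H y x := Or.symm h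

open Classical in
theorem card_nb (hS : Chordal n S) (hN : ∀ v ≤ n, N v ⊆ S v)
    {H : Finset ((_ : ℕ) × ℕ)} (hH : H ⊆ edges n N) (x : ℕ) :
    ((Finset.Icc 1 n).filter (Nb H x)).card = deg H x := by
  have e : (Finset.Icc 1 n).filter (Nb H x) = ((H.filter fun e => e.1 = x).image fun e => e.2) ∪
      (H.filter fun e => e.2 = x).image fun e => e.1 := by
    ext y
    simp only [Finset.mem_filter, Finset.mem_union, Finset.mem_image, Nb]
    constructor
    · rintro ⟨-, h | h⟩
      · exact .inl ⟨_, ⟨h, rfl⟩, rfl⟩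
      · exact .inr ⟨_, ⟨h, rfl⟩, rfl⟩
    · rintro (⟨⟨v, u⟩, ⟨h, rfl⟩, rfl⟩ | ⟨⟨v, u⟩, ⟨h, rfl⟩, rfl⟩)
      · exact ⟨(snd_mem hS hN (hH h)).1, .inl h⟩
      · exact ⟨(mem_edges.1 (hH h)).1, .inr h⟩
  rw [e, Finset.card_union_of_disjoint, deg, Finset.card_image_of_injOn, Finset.card_image_of_injOn]
  · rintro ⟨v, u⟩ h ⟨v', u'⟩ h' heq
    simp only [Finset.coe_filter, Set.mem_ofPred_eq] at h h' heq
    obtain ⟨-, rfl⟩ := h; obtain ⟨-, rfl⟩ := h'; subst heq; rfl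
  · rintro ⟨v, u⟩ h ⟨v', u'⟩ h' heq
    simp only [Finset.coe_filter, Set.mem_ofPred_eq] at h h' heq
    obtain ⟨-, rfl⟩ := h; obtain ⟨-, rfl⟩ := h'; subst heq; rfl
  · rw [Finset.disjoint_left]
    intro y hy hy'
    simp only [Finset.mem_image, Finset.mem_filter] at hy hy'
    obtain ⟨⟨v, u⟩, ⟨h, h1⟩, h2⟩ := hy
    obtain ⟨⟨v', u'⟩, ⟨h', h1'⟩, h2'⟩ := hy'
    have := (snd_mem hS hN (hH h)).2
    have := (snd_mem hS hN (hH h')).2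
    simp only at *
    omega

/-- The properties of a Hamiltonian cycle that are used for constructing it step by step. -/
structure TwoRegular (n : ℕ) (H : Finset ((_ : ℕ) × ℕ)) : Prop where
  irrefl : ∀ x, ¬ Nb H x x
  mem : ∀ x y, Nb H x y → x ∈ Finset.Icc 1 n
  card : ∀ x y₁ y₂ y₃, Nb H x y₁ → Nb H x y₂ → Nb H x y₃ → y₁ = y₂ ∨ y₁ = y₃ ∨ y₂ = y₃
  two : ∀ x ∈ Finset.Icc 1 n, ∀ y, ∃ y', y' ≠ y ∧ Nb H x y'
  conn : ∀ f : ℕ → Prop, (∀ u v, Nb H u v → (f u ↔ f v)) →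
    ∀ u ∈ Finset.Icc 1 n, ∀ v ∈ Finset.Icc 1 n, (f u ↔ f v)

theorem IsHam.twoRegular (hS : Chordal n S) (hN : ∀ v ≤ n, N v ⊆ S v) (hn : 2 ≤ n)
    {H : Finset ((_ : ℕ) × ℕ)} (hH : H ⊆ edges n N) (h : IsHam n H) : TwoRegular n H := by
  classical
  have hmem : ∀ x y, Nb H x y → x ∈ Finset.Icc 1 n := by
    rintro x y (h | h)
    · exact (mem_edges.1 (hH h)).1
    · exact (snd_mem hS hN (hH h)).1
  have hcard : ∀ x ∈ Finset.Icc 1 n, ((Finset.Icc 1 n).filter (Nb H x)).card = 2 := fun x hx => by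
    rw [card_nb hS hN hH, deg_eq_two hS hN hn hH h x hx]
  refine ⟨fun x hx => ?_, hmem, fun x y₁ y₂ y₃ h₁ h₂ h₃ => ?_, fun x hx y => ?_,
    fun f hf => h.1.1 f fun u v _ huv => hf u v (.inr huv)⟩
  · rcases hx with hx | hx <;> exact (snd_mem hS hN (hH hx)).2.ne rfl
  · by_contra hne
    push Not at hne
    have hsub : {y₁, y₂, y₃} ⊆ (Finset.Icc 1 n).filter (Nb H x) := by
      intro y hy
      simp only [Finset.mem_insert, Finset.mem_singleton] at hy
      rcases hy with rfl | rfl | rfl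
      · exact Finset.mem_filter.2 ⟨hmem _ _ h₁.symm, h₁⟩
      · exact Finset.mem_filter.2 ⟨hmem _ _ h₂.symm, h₂⟩
      · exact Finset.mem_filter.2 ⟨hmem _ _ h₃.symm, h₃⟩
    have := Finset.card_le_card hsub
    rw [hcard x (hmem _ _ h₁), Finset.card_eq_three.2 ⟨_, _, _, hne.1, hne.2.1, hne.2.2, rfl⟩] at this
    omega
  · obtain ⟨y', hy', hne⟩ := Finset.exists_mem_ne (by rw [hcard x hx]; norm_num) y
    exact ⟨y', hne, (Finset.mem_filter.1 hy').2⟩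

/-- A path in a two-regular graph whose last vertex has no neighbour outside closes up. -/
theorem TwoRegular.closes {H : Finset ((_ : ℕ) × ℕ)} (h : TwoRegular n H) {p : ℕ → ℕ} {k : ℕ}
    (hp : ∀ i ≤ k, p i ∈ Finset.Icc 1 n) (hinj : ∀ i ≤ k, ∀ j ≤ k, p i = p j → i = j)
    (hadj : ∀ i < k, Nb H (p i) (p (i + 1))) (hlast : ∀ y, Nb H (p k) y → ∃ i ≤ k, y = p i) :
    Nb H (p k) (p 0) ∧ 2 ≤ k := by
  obtain ⟨y, hy, hny⟩ := h.two (p k) (hp k le_rfl) (p (k - 1))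
  obtain ⟨i, hi, rfl⟩ := hlast y hny
  have hik : i ≠ k := by rintro rfl; exact h.irrefl _ hny
  have hik' : i ≠ k - 1 := by rintro rfl; exact hy rfl
  by_cases h0 : i = 0
  · subst h0; exact ⟨hny, by omega⟩
  · have h1 := hadj (i - 1) (by omega)
    have h2 := hadj i (by omega)
    rw [show i - 1 + 1 = i by omega] at h1
    rcases h.card (p i) _ _ _ h1.symm h2 hny.symm with h3 | h3 | h3
    · have := hinj _ (by omega) _ (by omega) h3; omega
    · have := hinj _ (by omega) _ (by omega) h3; omega
    · have := hinj _ (by omega) _ (by omega) h3; omega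

/-- A path in a connected two-regular graph can be continued as long as it misses a vertex. -/
theorem TwoRegular.extend {H : Finset ((_ : ℕ) × ℕ)} (h : TwoRegular n H) {p : ℕ → ℕ} {k : ℕ}
    (hk : k + 1 < n) (hp : ∀ i ≤ k, p i ∈ Finset.Icc 1 n)
    (hinj : ∀ i ≤ k, ∀ j ≤ k, p i = p j → i = j) (hadj : ∀ i < k, Nb H (p i) (p (i + 1))) :
    ∃ y, (∀ i ≤ k, y ≠ p i) ∧ Nb H (p k) y := by
  by_contra hne
  have hlast : ∀ y, Nb H (p k) y → ∃ i ≤ k, y = p i := by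
    intro y hy
    by_contra hy'
    push Not at hy'
    exact hne ⟨y, hy', hy⟩
  obtain ⟨h0, h2⟩ := h.closes hp hinj hadj hlast
  have key : ∀ i ≤ k, ∀ y, Nb H (p i) y → ∃ j ≤ k, y = p j := by
    intro i hi y hy
    rcases Nat.eq_or_lt_of_le hi with rfl | hik
    · exact hlast y hy
    by_cases hi0 : i = 0
    · subst hi0
      rcases h.card _ _ _ _ (hadj 0 (by omega)) h0.symm hy with h3 | h3 | h3
      · have := hinj _ (by omega) _ (by omega) h3; omega
      · exact ⟨_, by omega, h3.symm⟩
      · exact ⟨_, le_rfl, h3.symm⟩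
    · have h1 := hadj (i - 1) (by omega)
      have h2 := hadj i (by omega)
      rw [show i - 1 + 1 = i by omega] at h1
      rcases h.card (p i) _ _ _ h1.symm h2 hy with h3 | h3 | h3
      · have := hinj _ (by omega) _ (by omega) h3; omega
      · exact ⟨_, by omega, h3.symm⟩
      · exact ⟨_, by omega, h3.symm⟩
  have hsub : Finset.Icc 1 n ⊆ (Finset.range (k + 1)).image p := by
    intro v hv
    have := (h.conn (fun x => ∃ i ≤ k, x = p i) (fun u v huv =>
      ⟨by rintro ⟨i, hi, rfl⟩; exact key i hi v huv,
        by rintro ⟨i, hi, rfl⟩; exact key i hi u huv.symm⟩) (p 0) (hp 0 (by omega)) v hv).1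
          ⟨0, by omega, rfl⟩
    obtain ⟨i, hi, rfl⟩ := this
    exact Finset.mem_image_of_mem _ (by simpa [Nat.lt_succ_iff] using hi)
  have := (Finset.card_le_card hsub).trans Finset.card_image_le
  simp at this
  omega

/-- A Hamiltonian path in a two-regular graph closes up. -/
theorem TwoRegular.closes_ham {H : Finset ((_ : ℕ) × ℕ)} (h : TwoRegular n H) {p : ℕ → ℕ}
    (hn : 1 ≤ n) (hp : ∀ i < n, p i ∈ Finset.Icc 1 n)
    (hinj : ∀ i < n, ∀ j < n, p i = p j → i = j) (hadj : ∀ i, i + 1 < n → Nb H (p i) (p (i + 1))) :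
    Nb H (p (n - 1)) (p 0) ∧ 3 ≤ n := by
  have := h.closes (k := n - 1) (fun i hi => hp i (by omega))
    (fun i hi j hj => hinj i (by omega) j (by omega)) (fun i hi => hadj i (by omega)) ?_
  · exact ⟨this.1, by omega⟩
  · intro y hy
    have hmem := h.mem _ _ hy.symm
    have e : (Finset.range n).image p = Finset.Icc 1 n := by
      refine Finset.eq_of_subset_of_card_le (fun x hx => ?_) ?_
      · obtain ⟨i, hi, rfl⟩ := Finset.mem_image.1 hx
        exact hp i (by simpa using hi)
      · rw [Finset.card_image_of_injOn]
        · simp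
        · intro i hi j hj hij
          exact hinj i (by simpa using hi) j (by simpa using hj) hij
    rw [← e] at hmem
    obtain ⟨i, hi, rfl⟩ := Finset.mem_image.1 hmem
    exact ⟨i, by have := Finset.mem_range.1 hi; omega, rfl⟩

end Elim

/-! ### Rooted tree decompositions -/

namespace TreeDecomposition

variable {n N : ℕ} {G : SimpleGraph (Fin n)} (D : TreeDecomposition G N)

theorem toRoot_isPath (x : Fin N) : (D.toRoot x).IsPath :=
  (D.isTree.existsUnique_path x D.root).choose_spec.1

theorem eq_toRoot {x : Fin N} {p : D.tree.Walk x D.root} (hp : p.IsPath) : p = D.toRoot x :=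
  (D.isTree.existsUnique_path x D.root).choose_spec.2 p hp

theorem toRoot_root : D.toRoot D.root = .nil := (D.eq_toRoot .nil).symm

theorem parent_root : D.parent D.root = D.root := by
  rw [parent, toRoot_root]; rfl

/-- The distance of a node from the root. -/
noncomputable def dep (x : Fin N) : ℕ := (D.toRoot x).length

theorem dep_root : D.dep D.root = 0 := by rw [dep, toRoot_root]; rfl

theorem toRoot_eq_cons {x : Fin N} (hx : x ≠ D.root) :
    ∃ h : D.tree.Adj x (D.parent x), D.toRoot x = .cons h (D.toRoot (D.parent x)) := by
  have key : ∀ p : D.tree.Walk x D.root, p.IsPath →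
      ∃ (y : Fin N) (h : D.tree.Adj x y), p = .cons h (D.toRoot y) ∧ p.snd = y := by
    intro p hp
    cases p with
    | nil => exact (hx rfl).elim
    | cons h q =>
      rw [D.eq_toRoot hp.of_cons]
      exact ⟨_, h, rfl, SimpleGraph.Walk.snd_cons _ _⟩
  obtain ⟨y, h, h1, h2⟩ := key _ (D.toRoot_isPath x)
  obtain rfl : D.parent x = y := h2
  exact ⟨h, h1⟩

theorem dep_eq_succ {x : Fin N} (hx : x ≠ D.root) : D.dep x = D.dep (D.parent x) + 1 := by
  obtain ⟨h, e⟩ := D.toRoot_eq_cons hx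
  rw [dep, e]; rfl

theorem parent_eq_self {x : Fin N} : D.parent x = x ↔ x = D.root := by
  constructor
  · intro h
    by_contra hx
    have := D.dep_eq_succ hx
    rw [h] at this
    omega
  · rintro rfl; exact D.parent_root

theorem dep_lt (x : Fin N) : D.dep x < N := by
  simpa [dep] using (D.toRoot_isPath x).length_lt

theorem dep_parent (x : Fin N) : D.dep (D.parent x) = D.dep x - 1 := by
  by_cases hx : x = D.root
  · rw [hx, D.parent_root, D.dep_root]
  · rw [D.dep_eq_succ hx]; rfl

theorem dep_eq_zero {x : Fin N} : D.dep x = 0 ↔ x = D.root := by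
  constructor
  · intro h
    by_contra hx
    have := D.dep_eq_succ hx
    omega
  · rintro rfl; exact D.dep_root

theorem dep_iterate (k : ℕ) (x : Fin N) : D.dep (D.parent^[k] x) = D.dep x - k := by
  induction k with
  | zero => rfl
  | succ k ih => rw [Function.iterate_succ_apply', D.dep_parent, ih]; omega

theorem adj_parent {x y : Fin N} (h : D.tree.Adj x y) : D.parent x = y ∨ D.parent y = x := by
  classical
  by_cases hy : y ∈ (D.toRoot x).support
  · left
    have hp := (D.toRoot_isPath x).takeUntil hy
    have e : (D.toRoot x).takeUntil y hy = .cons h .nil :=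
      D.isTree.existsUnique_path x y |>.unique hp (by simp [h.ne])
    have e2 := (D.toRoot x).take_spec hy
    rw [e] at e2
    rw [parent, ← e2]
    simp
  · right
    have hp : (SimpleGraph.Walk.cons h.symm (D.toRoot x)).IsPath :=
      (D.toRoot_isPath x).cons hy
    rw [parent, ← D.eq_toRoot hp]
    simp

/-- A path in the tree of length at least one leaves its first node towards the parent or enters its
last node from the parent. -/
theorem parent_mem_path {x y : Fin N} (p : D.tree.Walk x y) (hp : p.IsPath) (hxy : x ≠ y) :
    p.snd = D.parent x ∨ p.penultimate = D.parent y := by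
  induction p with
  | nil => exact (hxy rfl).elim
  | @cons x z y h q ih =>
    rw [SimpleGraph.Walk.snd_cons]
    have hq : q.IsPath := hp.of_cons
    by_cases hzy : z = y
    · subst hzy
      have := (SimpleGraph.Walk.isPath_iff_nil (p := q)).1 hq
      rcases D.adj_parent h with h1 | h1
      · exact .inl h1.symm
      · right; rw [SimpleGraph.Walk.eq_nil_iff_nil.2 this]; exact h1.symm
    · rcases ih hq hzy with h1 | h1
      · rcases D.adj_parent h with h2 | h2
        · exact .inl h2.symm
        · exfalso
          rw [h2] at h1
          have hx : x ∈ q.support := h1 ▸ q.getVert_mem_support 1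
          exact ((SimpleGraph.Walk.cons_isPath_iff h q).1 hp).2 hx
      · right
        rw [← h1]
        exact SimpleGraph.Walk.penultimate_cons_of_not_nil h q
          (fun hn => hzy (hn.eq))

/-- The node `x` is the highest one whose bag contains the vertex `a`. -/
def IsTop (x : Fin N) (a : Fin n) : Prop :=
  a ∈ D.bag x ∧ (D.parent x = x ∨ a ∉ D.bag (D.parent x))

theorem IsTop.unique {D : TreeDecomposition G N} {x y : Fin N} {a : Fin n} (hx : D.IsTop x a)
    (hy : D.IsTop y a) : x = y := by
  by_contra hxy
  obtain ⟨p, hp, -⟩ := D.isTree.existsUnique_path x y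
  have key : ∀ z ∈ p.support, a ∈ D.bag z := fun z hz =>
    D.inter_subset x y z p hp hz (Finset.mem_inter.2 ⟨hx.1, hy.1⟩)
  have hnil : ¬ p.Nil := fun h => hxy h.eq
  rcases D.parent_mem_path p hp hxy with h | h
  · rcases hx.2 with h1 | h1
    · have := p.adj_snd hnil
      rw [h, h1] at this
      exact this.ne rfl
    · exact h1 (h ▸ key _ (p.getVert_mem_support 1))
  · rcases hy.2 with h1 | h1
    · have := p.adj_penultimate hnil
      rw [h, h1] at this
      exact this.ne rfl
    · exact h1 (h ▸ key _ (p.getVert_mem_support _))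

theorem exists_isTop (a : Fin n) (k : ℕ) : ∀ y, D.dep y = k → a ∈ D.bag y →
    ∃ j ≤ D.dep y, D.IsTop (D.parent^[j] y) a ∧ ∀ i ≤ j, a ∈ D.bag (D.parent^[i] y) := by
  induction k with
  | zero =>
    intro y hy ha
    have := D.dep_eq_zero.1 hy
    exact ⟨0, Nat.zero_le _, ⟨ha, .inl (D.parent_eq_self.2 this)⟩, fun i hi => by
      rw [Nat.le_zero.1 hi]; exact ha⟩
  | succ k ih =>
    intro y hy ha
    by_cases hp : a ∈ D.bag (D.parent y)
    · obtain ⟨j, h1, h2, h3⟩ := ih (D.parent y) (by rw [dep_parent, hy]; rfl) hp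
      refine ⟨j + 1, ?_, h2, fun i hi => ?_⟩
      · rw [dep_parent] at h1; omega
      · cases i with
        | zero => exact ha
        | succ i => exact h3 i (by omega)
    · exact ⟨0, Nat.zero_le _, ⟨ha, .inr hp⟩, fun i hi => by rw [Nat.le_zero.1 hi]; exact ha⟩

theorem exists_top (a : Fin n) : ∃ x, D.IsTop x a := by
  obtain ⟨y, hy⟩ := D.vertex_mem a
  obtain ⟨j, -, h, -⟩ := D.exists_isTop a _ y rfl hy
  exact ⟨_, h⟩

/-- The highest node whose bag contains the vertex `a`. -/
noncomputable def top (a : Fin n) : Fin N := (D.exists_top a).choose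

theorem isTop_top (a : Fin n) : D.IsTop (D.top a) a := (D.exists_top a).choose_spec

theorem isTop_iff {x : Fin N} {a : Fin n} : D.IsTop x a ↔ D.top a = x :=
  ⟨fun h => (D.isTop_top a).unique h, fun h => h ▸ D.isTop_top a⟩

theorem top_eq_iterate {a : Fin n} {y : Fin N} (h : a ∈ D.bag y) :
    ∃ j ≤ D.dep y, D.top a = D.parent^[j] y ∧ ∀ i ≤ j, a ∈ D.bag (D.parent^[i] y) := by
  obtain ⟨j, h1, h2, h3⟩ := D.exists_isTop a _ y rfl h
  exact ⟨j, h1, D.isTop_iff.1 h2, h3⟩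

theorem mem_bag_top {a b : Fin n} {y : Fin N} (ha : a ∈ D.bag y) (hb : b ∈ D.bag y)
    (h : D.dep (D.top a) ≤ D.dep (D.top b)) : a ∈ D.bag (D.top b) := by
  obtain ⟨j, h1, h2, h3⟩ := D.top_eq_iterate ha
  obtain ⟨k, h1', h2', -⟩ := D.top_eq_iterate hb
  rw [h2, h2', D.dep_iterate, D.dep_iterate] at h
  rw [h2']
  exact h3 k (by omega)

/-- The union of the bags on the path from a node to the root. -/
noncomputable def above (x : Fin N) : Finset (Fin n) :=
  (D.toRoot x).support.toFinset.biUnion D.bag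

theorem card_above_le (x : Fin N) : (D.above x).card ≤ D.depth :=
  Finset.le_sup (f := fun x => (D.above x).card) (Finset.mem_univ x)

theorem bag_subset_above (x : Fin N) : D.bag x ⊆ D.above x := fun _ ha =>
  Finset.mem_biUnion.2 ⟨x, by simp, ha⟩

theorem above_parent_subset (x : Fin N) : D.above (D.parent x) ⊆ D.above x := by
  by_cases hx : x = D.root
  · rw [hx, parent_root]
  · obtain ⟨h, e⟩ := D.toRoot_eq_cons hx
    refine Finset.biUnion_subset_biUnion_of_subset_left _ fun z hz => ?_
    rw [e]
    simp only [SimpleGraph.Walk.support_cons, List.mem_toFinset, List.mem_cons] at hz ⊢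
    exact .inr hz

theorem above_iterate_subset (k : ℕ) (x : Fin N) : D.above (D.parent^[k] x) ⊆ D.above x := by
  induction k with
  | zero => exact subset_rfl
  | succ k ih =>
    rw [Function.iterate_succ_apply']
    exact (D.above_parent_subset _).trans ih

theorem above_top_subset {a : Fin n} {y : Fin N} (h : a ∈ D.bag y) :
    D.above (D.top a) ⊆ D.above y := by
  obtain ⟨j, -, h2, -⟩ := D.top_eq_iterate h
  rw [h2]
  exact D.above_iterate_subset j y

theorem card_bag_le (hw : 1 ≤ D.width) (x : Fin N) : (D.bag x).card ≤ D.width + 1 := by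
  have := Finset.le_sup (f := fun x => (D.bag x).card) (Finset.mem_univ x)
  unfold width at hw ⊢
  omega

theorem two_le_card (hw : 1 ≤ D.width) : ∃ x, 2 ≤ (D.bag x).card := by
  by_contra h
  push Not at h
  have : (Finset.univ.sup fun x => (D.bag x).card) ≤ 1 :=
    Finset.sup_le fun x _ => by have := h x; omega
  unfold width at hw
  omega

theorem two_le_n (hw : 1 ≤ D.width) : 2 ≤ n := by
  obtain ⟨x, hx⟩ := D.two_le_card hw
  simpa using hx.trans (Finset.card_le_univ _)

theorem width_lt_depth (hw : 1 ≤ D.width) : D.width < D.depth := by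
  have h : (Finset.univ.sup fun x => (D.bag x).card) ≤ D.depth :=
    Finset.sup_le fun x _ => (Finset.card_le_card (D.bag_subset_above x)).trans (D.card_above_le x)
  unfold width at hw ⊢
  omega

theorem depth_le : D.depth ≤ n :=
  Finset.sup_le fun x _ => (Finset.card_le_univ _).trans (by simp)

/-! ### The elimination order given by a tree decomposition -/

/-- An enumeration of the vertices as `ord 1, …, ord n`, ordered by the depth of their top nodes. -/
structure IsOrder (ord : ℕ → Fin n) : Prop where
  inj : ∀ i ∈ Finset.Icc 1 n, ∀ j ∈ Finset.Icc 1 n, ord i = ord j → i = j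
  mono : ∀ i j, 1 ≤ i → i ≤ j → j ≤ n → D.dep (D.top (ord i)) ≤ D.dep (D.top (ord j))

/-- The relevant predecessors of a vertex: those in the bag of its top node. -/
noncomputable def pred (ord : ℕ → Fin n) (j : ℕ) : Finset ℕ :=
  (Finset.Ico 1 j).filter fun i => ord i ∈ D.bag (D.top (ord j))

variable {D} {ord : ℕ → Fin n}

theorem mem_pred {i j : ℕ} : i ∈ D.pred ord j ↔ (1 ≤ i ∧ i < j) ∧ ord i ∈ D.bag (D.top (ord j)) := by
  simp [pred]

theorem IsOrder.surj (h : D.IsOrder ord) (a : Fin n) : ∃ i ∈ Finset.Icc 1 n, ord i = a := by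
  have e : (Finset.Icc 1 n).image ord = Finset.univ := by
    refine Finset.eq_univ_of_card _ ?_
    rw [Finset.card_image_of_injOn fun i hi j hj => h.inj i hi j hj]
    simp
  have := Finset.mem_univ a
  rw [← e] at this
  exact Finset.mem_image.1 this

theorem IsOrder.chordal (h : D.IsOrder ord) : Elim.Chordal n (D.pred ord) where
  lt v _ u hu := (mem_pred.1 hu).1
  mem v hv u hu u' hu' huu' := by
    obtain ⟨h1, h2⟩ := mem_pred.1 hu
    obtain ⟨h1', h2'⟩ := mem_pred.1 hu'
    exact mem_pred.2 ⟨⟨h1.1, huu'⟩, D.mem_bag_top h2 h2' (h.mono u u' h1.1 huu'.le (by omega))⟩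

theorem IsOrder.adj (h : D.IsOrder ord) {u v : ℕ} (hu : 1 ≤ u) (huv : u < v) (hv : v ≤ n)
    (ha : G.Adj (ord u) (ord v)) : u ∈ D.pred ord v := by
  obtain ⟨y, h1, h2⟩ := D.edge_mem _ _ ha
  exact mem_pred.2 ⟨⟨hu, huv⟩, D.mem_bag_top h1 h2 (h.mono u v hu huv.le hv)⟩

theorem IsOrder.card_pred_le (h : D.IsOrder ord) (hw : 1 ≤ D.width) {v : ℕ} (hv : v ≤ n) :
    (D.pred ord v).card ≤ D.width := by
  rcases Nat.eq_zero_or_pos v with rfl | hv0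
  · simp [pred]
  have h1 : ((D.pred ord v).image ord).card = (D.pred ord v).card := by
    refine Finset.card_image_of_injOn fun i hi j hj hij => ?_
    have hi' := (mem_pred.1 hi).1
    have hj' := (mem_pred.1 hj).1
    exact h.inj i (Finset.mem_Icc.2 (by omega)) j (Finset.mem_Icc.2 (by omega)) hij
  have h2 : (D.pred ord v).image ord ⊆ (D.bag (D.top (ord v))).erase (ord v) := by
    intro a ha
    obtain ⟨i, hi, rfl⟩ := Finset.mem_image.1 ha
    obtain ⟨h3, h4⟩ := mem_pred.1 hi
    refine Finset.mem_erase.2 ⟨fun he => ?_, h4⟩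
    have := h.inj i (Finset.mem_Icc.2 (by omega)) v (Finset.mem_Icc.2 (by omega)) he
    omega
  have h3 := Finset.card_le_card h2
  rw [h1, Finset.card_erase_of_mem (D.isTop_top (ord v)).1] at h3
  have := D.card_bag_le hw (D.top (ord v))
  omega

end TreeDecomposition

namespace Elim

/-- The level of a vertex in the elimination forest; the virtual root has level `0`. -/
def lev (S : ℕ → Finset ℕ) (v : ℕ) : ℕ := if par S v < v then lev S (par S v) + 1 else 0
termination_by v

theorem lev_zero (S : ℕ → Finset ℕ) : lev S 0 = 0 := by rw [lev]; simp

theorem lev_eq {n : ℕ} {S : ℕ → Finset ℕ} (hS : Chordal n S) {v : ℕ} (h1 : 1 ≤ v) (hv : v ≤ n) :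
    lev S v = lev S (par S v) + 1 := by
  rw [lev, if_pos (par_lt hS h1 hv)]

end Elim

namespace TreeDecomposition

variable {n N : ℕ} {G : SimpleGraph (Fin n)} {D : TreeDecomposition G N} {ord : ℕ → Fin n}

/-- The vertices on a branch of the elimination forest lie in the bags on a path to the root. -/
theorem IsOrder.lev_le (h : D.IsOrder ord) (v : ℕ) : v ≤ n → Elim.lev (D.pred ord) v ≤ D.depth := by
  have key : ∀ v, 1 ≤ v → v ≤ n → Elim.lev (D.pred ord) v ≤
      ((Finset.Icc 1 v).filter fun i => ord i ∈ D.above (D.top (ord v))).card := by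
    intro v
    induction v using Nat.strong_induction_on with
    | _ v ih =>
      intro h1 hv
      have hlt := Elim.par_lt h.chordal h1 hv
      have hself : v ∈ (Finset.Icc 1 v).filter fun i => ord i ∈ D.above (D.top (ord v)) :=
        Finset.mem_filter.2 ⟨Finset.mem_Icc.2 ⟨h1, le_rfl⟩,
          D.bag_subset_above _ (D.isTop_top _).1⟩
      rw [Elim.lev_eq h.chordal h1 hv]
      rcases Nat.eq_zero_or_pos (Elim.par (D.pred ord) v) with h0 | h0
      · rw [h0, Elim.lev_zero]
        exact Finset.card_pos.2 ⟨v, hself⟩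
      · refine (Nat.succ_le_succ (ih _ hlt h0 (by omega))).trans ?_
        refine Nat.succ_le_of_lt (Finset.card_lt_card ?_)
        rw [Finset.ssubset_iff_of_subset]
        · refine ⟨v, hself, fun hv' => ?_⟩
          have := (Finset.mem_Icc.1 (Finset.mem_filter.1 hv').1).2
          omega
        · intro i hi
          obtain ⟨h3, h4⟩ := Finset.mem_filter.1 hi
          have h5 := (mem_pred.1 (Elim.par_mem h0)).2
          have h3' := Finset.mem_Icc.1 h3
          exact Finset.mem_filter.2 ⟨Finset.mem_Icc.2 (by omega), D.above_top_subset h5 h4⟩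
  intro hv
  rcases Nat.eq_zero_or_pos v with rfl | h0
  · rw [Elim.lev_zero]; exact Nat.zero_le _
  refine (key v h0 hv).trans ?_
  refine (Finset.card_le_card_of_injOn ord (fun i hi => (Finset.mem_filter.1 hi).2)
    fun i hi j hj hij => ?_).trans (D.card_above_le (D.top (ord v)))
  have hi' := Finset.mem_Icc.1 (Finset.mem_filter.1 hi).1
  have hj' := Finset.mem_Icc.1 (Finset.mem_filter.1 hj).1
  exact h.inj i (Finset.mem_Icc.2 (by omega)) j (Finset.mem_Icc.2 (by omega)) hij

end TreeDecomposition

/-! ### Hamiltonian cycles as edge sets -/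

namespace Elim

variable {n : ℕ} {G : SimpleGraph (Fin n)} {ord : ℕ → Fin n} {S : ℕ → Finset ℕ}

open Classical in
/-- The predecessors of a vertex that are adjacent to it. -/
noncomputable def nbrs (G : SimpleGraph (Fin n)) (ord : ℕ → Fin n) (S : ℕ → Finset ℕ) (v : ℕ) :
    Finset ℕ := (S v).filter fun u => G.Adj (ord v) (ord u)

/-- An elimination order of the graph `G`. -/
structure IsElim (G : SimpleGraph (Fin n)) (ord : ℕ → Fin n) (S : ℕ → Finset ℕ) : Prop extends
    Chordal n S where
  inj : ∀ i ∈ Finset.Icc 1 n, ∀ j ∈ Finset.Icc 1 n, ord i = ord j → i = j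
  surj : ∀ a, ∃ i ∈ Finset.Icc 1 n, ord i = a
  adj : ∀ u v, 1 ≤ u → u < v → v ≤ n → G.Adj (ord v) (ord u) → u ∈ S v

/-- The cost of the edge between two positions. -/
def pcost (c : Sym2 (Fin n) → ℕ) (ord : ℕ → Fin n) (u v : ℕ) : ℕ := c s(ord v, ord u)

theorem nbrs_subset (v : ℕ) : nbrs G ord S v ⊆ S v := by
  classical exact Finset.filter_subset _ _

theorem IsElim.mem_edges (h : IsElim G ord S) {u v : ℕ} :
    (⟨v, u⟩ : (_ : ℕ) × ℕ) ∈ edges n (nbrs G ord S) ↔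
      1 ≤ u ∧ u < v ∧ v ≤ n ∧ G.Adj (ord v) (ord u) := by
  simp only [Elim.mem_edges, Finset.mem_Icc, nbrs, Finset.mem_filter]
  constructor
  · rintro ⟨⟨h1, h2⟩, h3, h4⟩
    have := h.lt v h2 u h3
    exact ⟨this.1, this.2, h2, h4⟩
  · rintro ⟨h1, h2, h3, h4⟩
    exact ⟨⟨by omega, h3⟩, h.adj u v h1 h2 h3 h4, h4⟩

/-- The edge of the graph that corresponds to a pair of positions. -/
def toEdge (ord : ℕ → Fin n) (e : (_ : ℕ) × ℕ) : Sym2 (Fin n) := s(ord e.1, ord e.2)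

theorem IsElim.toEdge_inj (h : IsElim G ord S) {e e' : (_ : ℕ) × ℕ}
    (he : e ∈ edges n (nbrs G ord S)) (he' : e' ∈ edges n (nbrs G ord S))
    (heq : toEdge ord e = toEdge ord e') : e = e' := by
  obtain ⟨v, u⟩ := e
  obtain ⟨v', u'⟩ := e'
  obtain ⟨h1, h2, h3, -⟩ := h.mem_edges.1 he
  obtain ⟨h1', h2', h3', -⟩ := h.mem_edges.1 he'
  have key : ∀ {i j}, 1 ≤ i → i ≤ n → 1 ≤ j → j ≤ n → ord i = ord j → i = j :=
    fun a b c d => h.inj _ (Finset.mem_Icc.2 ⟨a, b⟩) _ (Finset.mem_Icc.2 ⟨c, d⟩)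
  rcases Sym2.eq_iff.1 heq with ⟨ha, hb⟩ | ⟨ha, hb⟩
  · obtain rfl := key (by omega) h3 (by omega) h3' ha
    obtain rfl := key h1 (by omega) h1' (by omega) hb
    rfl
  · have h4 := key (by omega) h3 h1' (by omega) ha
    have h5 := key h1 (by omega) (by omega) h3' hb
    simp only at *
    omega

theorem IsElim.exists_edge (h : IsElim G ord S) {a b : Fin n} (hab : G.Adj a b) :
    ∃ e ∈ edges n (nbrs G ord S), toEdge ord e = s(a, b) := by
  obtain ⟨i, hi, rfl⟩ := h.surj a
  obtain ⟨j, hj, rfl⟩ := h.surj b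
  simp only [Finset.mem_Icc] at hi hj
  rcases lt_trichotomy i j with hij | hij | hij
  · exact ⟨⟨j, i⟩, h.mem_edges.2 ⟨hi.1, hij, hj.2, hab.symm⟩, Sym2.eq_swap⟩
  · subst hij; exact (hab.ne rfl).elim
  · exact ⟨⟨i, j⟩, h.mem_edges.2 ⟨hj.1, hij, hi.2, hab⟩, rfl⟩

theorem IsElim.toEdge_mem (h : IsElim G ord S) {e : (_ : ℕ) × ℕ}
    (he : e ∈ edges n (nbrs G ord S)) : toEdge ord e ∈ G.edgeSet :=
  (h.mem_edges.1 he).2.2.2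

theorem IsElim.ecost_edges (h : IsElim G ord S) (c : Sym2 (Fin n) → ℕ) :
    ecost (pcost c ord) (edges n (nbrs G ord S)) = TSP.totalWeight G c := by
  classical
  unfold ecost TSP.totalWeight
  refine Finset.sum_bij (fun e _ => toEdge ord e) (fun e he => ?_) (fun e he e' he' heq => ?_)
    (fun x hx => ?_) (fun e he => rfl)
  · exact Finset.mem_filter.2 ⟨Finset.mem_univ _, h.toEdge_mem he⟩
  · exact h.toEdge_inj he he' heq
  · have hx := (Finset.mem_filter.1 hx).2
    induction x using Sym2.ind with
    | _ a b =>
      obtain ⟨e, he, heq⟩ := h.exists_edge hx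
      exact ⟨e, he, heq⟩

open Classical in
/-- The pairs of positions that correspond to the edges of a walk. -/
noncomputable def walkEdges (ord : ℕ → Fin n) (S : ℕ → Finset ℕ) {a b : Fin n} (q : G.Walk a b) :
    Finset ((_ : ℕ) × ℕ) := (edges n (nbrs G ord S)).filter fun e => toEdge ord e ∈ q.edges

theorem IsElim.image_walkEdges (h : IsElim G ord S) {a b : Fin n} (q : G.Walk a b) :
    (walkEdges ord S q).image (toEdge ord) = q.edges.toFinset := by
  ext x
  simp only [walkEdges, Finset.mem_image, Finset.mem_filter, List.mem_toFinset]
  constructor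
  · rintro ⟨e, ⟨-, he⟩, rfl⟩; exact he
  · intro hx
    have hxG := q.edges_subset_edgeSet hx
    induction x using Sym2.ind with
    | _ u v =>
      obtain ⟨e, he, heq⟩ := h.exists_edge hxG
      exact ⟨e, ⟨he, heq ▸ hx⟩, heq⟩

theorem IsElim.injOn_walkEdges (h : IsElim G ord S) {a b : Fin n} (q : G.Walk a b) :
    Set.InjOn (toEdge ord) (walkEdges ord S q) := fun _ he _ he' heq =>
  h.toEdge_inj (Finset.mem_filter.1 he).1 (Finset.mem_filter.1 he').1 heq

theorem IsElim.ecost_walkEdges (h : IsElim G ord S) (c : Sym2 (Fin n) → ℕ) {a b : Fin n}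
    {q : G.Walk a b} (hq : q.edges.Nodup) :
    ecost (pcost c ord) (walkEdges ord S q) = TSP.cost c q := by
  rw [TSP.cost, ← List.sum_toFinset c hq, ← h.image_walkEdges, Finset.sum_image (h.injOn_walkEdges q)]
  rfl

theorem walk_const {g : Fin n → Prop} {a b : Fin n} (q : G.Walk a b)
    (hg : ∀ u v, s(u, v) ∈ q.edges → (g u ↔ g v)) : ∀ v ∈ q.support, (g a ↔ g v) := by
  induction q with
  | nil => intro v hv; rw [List.mem_singleton.1 hv]
  | @cons a x b hax q ih =>
    intro v hv
    rw [SimpleGraph.Walk.support_cons, List.mem_cons] at hv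
    rcases hv with rfl | hv
    · rfl
    · exact (hg a x (by simp)).trans
        (ih (fun u w huw => hg u w (by simp [huw])) v hv)

/-- A Hamiltonian cycle gives a connected even graph with `n` edges. -/
theorem IsElim.walkEdges_mem (h : IsElim G ord S) {a : Fin n} {q : G.Walk a a}
    (hq : q.IsHamiltonianCycle) : walkEdges ord S q ∈ hams n (nbrs G ord S) (fun _ _ => False) := by
  classical
  have hnd := hq.isCycle.isTrail.edges_nodup
  have hsub : walkEdges ord S q ⊆ edges n (nbrs G ord S) := Finset.filter_subset _ _
  have hcard : (walkEdges ord S q).card = n := by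
    rw [← Finset.card_image_of_injOn (h.injOn_walkEdges q), h.image_walkEdges,
      List.toFinset_card_of_nodup hnd, SimpleGraph.Walk.length_edges, hq.length_eq, Fintype.card_fin]
  refine mem_hams.2 ⟨hsub, ⟨⟨fun f hf => ?_, fun x hx => ?_⟩, hcard⟩, fun _ _ hF => hF.elim⟩
  · choose pos hpos hord using h.surj
    have hinv : ∀ i ∈ Finset.Icc 1 n, pos (ord i) = i := fun i hi =>
      h.inj _ (hpos _) _ hi (hord _)
    have key := walk_const (g := fun v => f (pos v)) q (fun u v huv => by
      obtain ⟨⟨j, i⟩, he, heq⟩ := h.exists_edge (q.edges_subset_edgeSet huv)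
      have hmem : (⟨j, i⟩ : (_ : ℕ) × ℕ) ∈ walkEdges ord S q :=
        Finset.mem_filter.2 ⟨he, heq ▸ huv⟩
      obtain ⟨h1, h2, h3, -⟩ := h.mem_edges.1 he
      have hj : j ∈ Finset.Icc 1 n := Finset.mem_Icc.2 (by omega)
      have hi : i ∈ Finset.Icc 1 n := Finset.mem_Icc.2 (by omega)
      have hfe := hf i j hj hmem
      rcases Sym2.eq_iff.1 heq with ⟨rfl, rfl⟩ | ⟨rfl, rfl⟩
      · simp only [hinv i hi, hinv j hj]; exact hfe.symm
      · simp only [hinv i hi, hinv j hj]; exact hfe)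
    intro u hu v hv
    have h1 := key (ord u) (hq.mem_support _)
    have h2 := key (ord v) (hq.mem_support _)
    simp only [hinv u hu, hinv v hv] at h1 h2
    exact h1.symm.trans h2
  · have h1 := (hq.isCycle.isTrail.even_countP_edges_iff (ord x)).2 (fun hne => (hne rfl).elim)
    rw [List.countP_eq_length_filter, ← List.toFinset_card_of_nodup (hnd.filter _),
      List.toFinset_filter, ← h.image_walkEdges, Finset.filter_image,
      Finset.card_image_of_injOn ((h.injOn_walkEdges q).mono (by
        intro e he; exact (Finset.mem_filter.1 he).1))] at h1
    convert h1 using 1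
    rw [deg, ← Finset.card_union_of_disjoint, ← Finset.filter_or]
    · refine congrArg Finset.card (Finset.filter_congr fun e he => ?_)
      obtain ⟨v, u⟩ := e
      obtain ⟨h2, h3, h4, -⟩ := h.mem_edges.1 (hsub he)
      have hv : v ∈ Finset.Icc 1 n := Finset.mem_Icc.2 (by omega)
      have hu : u ∈ Finset.Icc 1 n := Finset.mem_Icc.2 (by omega)
      simp only [toEdge, Sym2.mem_iff, decide_eq_true_eq]
      constructor
      · rintro (rfl | rfl)
        · exact .inl rfl
        · exact .inr rfl
      · rintro (h5 | h5)
        · exact .inl (h.inj _ hx _ hv h5).symm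
        · exact .inr (h.inj _ hx _ hu h5).symm
    · rw [Finset.disjoint_left]
      intro e he he'
      have h2 := (Finset.mem_filter.1 he).2
      have h3 := (Finset.mem_filter.1 he').2
      have := (h.mem_edges.1 (hsub (Finset.mem_filter.1 he).1)).2.1
      omega

theorem IsElim.adj_of_nb (h : IsElim G ord S) {H : Finset ((_ : ℕ) × ℕ)}
    (hH : H ⊆ edges n (nbrs G ord S)) {x y : ℕ} (hxy : Nb H x y) : G.Adj (ord x) (ord y) := by
  rcases hxy with h1 | h1
  · exact (h.mem_edges.1 (hH h1)).2.2.2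
  · exact (h.mem_edges.1 (hH h1)).2.2.2.symm

/-- A Hamiltonian path within the edge set of a Hamiltonian cycle closes up to this cycle. -/
theorem IsElim.exists_cycle (h : IsElim G ord S) (hn : 2 ≤ n) (c : Sym2 (Fin n) → ℕ)
    {H : Finset ((_ : ℕ) × ℕ)} (hH : H ∈ hams n (nbrs G ord S) (fun _ _ => False)) {p : ℕ → ℕ}
    (hp : ∀ i < n, p i ∈ Finset.Icc 1 n) (hinj : ∀ i < n, ∀ j < n, p i = p j → i = j)
    (hadj : ∀ i, i + 1 < n → Nb H (p i) (p (i + 1))) :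
    ∃ (a : Fin n) (q : G.Walk a a), q.IsHamiltonianCycle ∧
      q.support.tail = (List.range n).map (fun i => ord (p i)) ∧
      TSP.cost c q = ecost (pcost c ord) H := by
  classical
  obtain ⟨hsub, hham, -⟩ := mem_hams.1 hH
  have hreg := hham.twoRegular h.toChordal (fun v _ => nbrs_subset v) hn hsub
  obtain ⟨hclose, h3⟩ := hreg.closes_ham (by omega) hp hinj hadj
  set l : List (Fin n) := (List.range n).map (fun i => ord (p i)) with hl
  have hlen : l.length = n := by simp [hl]
  have hne : l ≠ [] := fun e => by rw [e] at hlen; simp at hlen; omega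
  have hget : ∀ i (hi : i < l.length), l[i] = ord (p i) := fun i hi => by simp [hl]
  have hchain : l.IsChain G.Adj := by
    rw [List.isChain_iff_getElem]
    intro i hi
    rw [hget, hget]
    exact h.adj_of_nb hsub (hadj i (by omega))
  have hnd : l.Nodup := by
    rw [List.nodup_iff_injective_getElem]
    intro i j hij
    simp only [hget] at hij
    have hi : (i : ℕ) < n := i.2.trans_eq hlen
    have hj : (j : ℕ) < n := j.2.trans_eq hlen
    exact Fin.ext (hinj i hi j hj (h.inj _ (hp _ hi) _ (hp _ hj) hij))
  have hhead : l.head hne = ord (p 0) := by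
    rw [List.head_eq_getElem, hget]
  have hlast : l.getLast hne = ord (p (n - 1)) := by
    rw [List.getLast_eq_getElem, hget, hlen]
  set w := SimpleGraph.Walk.ofSupport l hne hchain with hw
  have hclose' : G.Adj (l.getLast hne) (l.head hne) := by
    rw [hhead, hlast]; exact h.adj_of_nb hsub hclose
  have hpath : w.IsPath := by
    rw [SimpleGraph.Walk.isPath_def, hw, SimpleGraph.Walk.support_ofSupport]; exact hnd
  have hwlen : w.length = n - 1 := by
    rw [hw, SimpleGraph.Walk.length_ofSupport, hlen]
  have hsupp : (SimpleGraph.Walk.cons hclose' w).support.tail = l := by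
    rw [SimpleGraph.Walk.support_cons, List.tail_cons, hw, SimpleGraph.Walk.support_ofSupport]
  have hcyc : (SimpleGraph.Walk.cons hclose' w).IsHamiltonianCycle := by
    rw [SimpleGraph.Walk.isHamiltonianCycle_iff_isCycle_and_length_eq]
    constructor
    · rw [SimpleGraph.Walk.cons_isCycle_iff]
      refine ⟨hpath, fun he => ?_⟩
      rw [Sym2.eq_swap] at he
      have := hpath.length_eq_one_of_mem_edges he
      omega
    · rw [SimpleGraph.Walk.length_cons, hwlen, Fintype.card_fin]; omega
  refine ⟨_, _, hcyc, hsupp, ?_⟩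
  rw [← h.ecost_walkEdges c hcyc.isCycle.isTrail.edges_nodup]
  congr 1
  have hmem := mem_hams.1 (h.walkEdges_mem hcyc)
  refine Finset.eq_of_subset_of_card_le (fun e he => ?_) (by rw [hham.2, hmem.2.1.2])
  -- Every edge of the cycle joins consecutive vertices.
  have hedge : ∀ x ∈ (SimpleGraph.Walk.cons hclose' w).edges,
      ∃ i j, Nb H i j ∧ x = s(ord i, ord j) := by
    intro x hx
    rw [SimpleGraph.Walk.edges_cons, List.mem_cons] at hx
    rcases hx with rfl | hx
    · exact ⟨_, _, hclose, by rw [hhead, hlast]⟩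
    · obtain ⟨i, hi, rfl⟩ := List.getElem_of_mem hx
      rw [SimpleGraph.Walk.length_edges, hwlen] at hi
      refine ⟨_, _, hadj i (by omega), ?_⟩
      have hv : ∀ j (hj : j < n), w.getVert j = ord (p j) := fun j hj => by
        rw [SimpleGraph.Walk.getVert_eq_support_getElem w (by omega)]
        simp only [hw, SimpleGraph.Walk.support_ofSupport]
        exact hget j (by omega)
      rw [SimpleGraph.Walk.getElem_edges, hv i (by omega), hv (i + 1) (by omega)]
  obtain ⟨i, j, hij, hx⟩ := hedge _ (Finset.mem_filter.1 he).2
  have he' := (Finset.mem_filter.1 he).1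
  rcases hij with h1 | h1
  · rwa [h.toEdge_inj he' (hsub h1) hx]
  · rwa [h.toEdge_inj he' (hsub h1) (hx.trans Sym2.eq_swap)]

end Elim

/-! ### Programs for the value of the elimination forest -/

namespace RAM

open Elim

/-- Sequential composition of programs. -/
infixr:60 " ;; " => Prog.seq

/-- The states `σ` and `τ` agree, except for the variables in `L`. -/
structure Fr (L : List Var) (σ τ : St) : Prop where
  a : τ.a = σ.a
  out : τ.out = σ.out
  v : ∀ x, x ∉ L → τ.v x = σ.v x

theorem Fr.refl (L : List Var) (σ : St) : Fr L σ σ := ⟨rfl, rfl, fun _ _ => rfl⟩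

theorem Fr.trans {L : List Var} {σ τ ρ : St} (h : Fr L σ τ) (h' : Fr L τ ρ) : Fr L σ ρ :=
  ⟨h'.a.trans h.a, h'.out.trans h.out, fun x hx => (h'.v x hx).trans (h.v x hx)⟩

theorem Fr.setv {L : List Var} {σ τ : St} (h : Fr L σ τ) (x : Var) (z : ℤ) (hx : x ∈ L) :
    Fr L σ (τ.setv x z) :=
  ⟨h.a, h.out, fun y hy => by
    rw [St.setv_v, if_neg (by rintro rfl; exact hy hx), h.v y hy]⟩

theorem Fr.weaken {L L' : List Var} {σ τ : St} (h : Fr L σ τ) (hL : ∀ x ∈ L, x ∈ L') :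
    Fr L' σ τ := ⟨h.a, h.out, fun x hx => h.v x fun hx' => hx (hL x hx')⟩

/-- `1 - size a` is positive if and only if `a = 0`. -/
theorem one_sub_size_pos {a : ℤ} : 0 < 1 - (a.natAbs.size : ℤ) ↔ a = 0 := by
  constructor
  · intro h
    have : a.natAbs.size = 0 := by omega
    exact Int.natAbs_eq_zero.1 (Nat.size_eq_zero.1 this)
  · rintro rfl; simp

theorem toNat_idx (v n u : ℕ) : ((v : ℤ) * (n + 1) + u).toNat = v * (n + 1) + u := by
  rw [show (v : ℤ) * (n + 1) + u = ((v * (n + 1) + u : ℕ) : ℤ) by push_cast; ring,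
    Int.toNat_natCast]

/-- The setting for the evaluation: an elimination order of `n` vertices with the relevant
predecessors `S v`, adjacent predecessors `N v` and costs `cst`, such that the input contains the
edges, where `o` gives the original number of a vertex. -/
structure Scene (C : Ctx) (n : ℕ) (S N : ℕ → Finset ℕ) (cst : ℕ → ℕ → ℕ) (o : ℕ → ℕ) : Prop where
  chordal : Chordal n S
  sub : ∀ v, N v ⊆ S v
  two_le : 2 ≤ n
  inp : ∀ u v, 1 ≤ u → u < v → v ≤ n →
    C.inp.getD (2 + o v * n + o u) 0 = if u ∈ N v then cst u v + 1 else 0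
  small : 64 * (n + 2) ^ 4 ≤ 2 ^ C.β

/-- The part of the memory that does not change during an evaluation. -/
structure Base (n : ℕ) (S : ℕ → Finset ℕ) (o nx : ℕ → ℕ) (K z : ℕ) (σ : St) : Prop where
  n_eq : σ.v .n = n
  K_eq : σ.v .K = K
  z_eq : σ.v .z = z
  S_eq : ∀ v u, 1 ≤ u → u < v → v ≤ n → σ.a .S (v * (n + 1) + u) = if u ∈ S v then 1 else 0
  ord_eq : ∀ i, 1 ≤ i → i ≤ n → σ.a .ord i = o i
  par_eq : ∀ i, 1 ≤ i → i ≤ n → σ.a .par i = par S i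
  nxt_eq : ∀ i, σ.a .nxt i = nx i

theorem Base.fr {n : ℕ} {S : ℕ → Finset ℕ} {o nx : ℕ → ℕ} {K z : ℕ} {σ τ : St}
    (h : Base n S o nx K z σ) {L : List Var} (hf : Fr L σ τ) (hL : Var.n ∉ L ∧ Var.K ∉ L ∧ Var.z ∉ L) :
    Base n S o nx K z τ where
  n_eq := (hf.v _ hL.1).trans h.n_eq
  K_eq := (hf.v _ hL.2.1).trans h.K_eq
  z_eq := (hf.v _ hL.2.2).trans h.z_eq
  S_eq := hf.a ▸ h.S_eq
  ord_eq := hf.a ▸ h.ord_eq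
  par_eq := hf.a ▸ h.par_eq
  nxt_eq := hf.a ▸ h.nxt_eq

variable {C : Ctx} {n : ℕ} {S N : ℕ → Finset ℕ} {cst : ℕ → ℕ → ℕ} {o nx : ℕ → ℕ} {K z : ℕ} {σ : St}
  {φ : ℕ → ℕ}

theorem Scene.abs_le (h : Scene C n S N cst o) {x : ℤ} (hx : |x| ≤ 64 * (n + 2) ^ 4) :
    |x| ≤ 2 ^ C.β := hx.trans (by exact_mod_cast h.small)

theorem Scene.abs_le_lin (h : Scene C n S N cst o) {x : ℤ} (hx : |x| ≤ 4 * n + 8) :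
    |x| ≤ 2 ^ C.β := h.abs_le (by
  have h1 : (1 : ℤ) ≤ n + 2 := by have := h.two_le; omega
  have h2 : (1 : ℤ) ≤ (n + 2) ^ 3 := one_le_pow₀ h1
  have h3 : (n + 2 : ℤ) ^ 4 = (n + 2) * (n + 2) ^ 3 := by ring
  rw [h3]; nlinarith)

/-- `found := 1` if the colour `cc` occurs on `S v`, and `found := 0` otherwise. -/
def foundP : Prog :=
  setP .found 0 ;; setP .u 1 ;;
  loopP (Exp.v .v - Exp.v .u)
    (iteP (Exp.arr .S (Exp.v .v * (Exp.v .n + 1) + Exp.v .u))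
      (iteP (1 - (Exp.arr .opt (Exp.v .u) / 2 - Exp.v .cc).size) (setP .found 1) skipP) skipP ;;
    setP .u (Exp.v .u + 1))

theorem foundP_ok (hs : Scene C n S N cst o) (hb : Base n S o nx K z σ)
    {v cc : ℕ} (hv1 : 1 ≤ v) (hvn : v ≤ n) (hv : σ.v .v = v) (hcc : σ.v .cc = cc)
    (hφ : ∀ u, σ.a .opt u = φ u) :
    Ok C foundP σ (5 * n + 3) fun τ => Fr [.found, .u] σ τ ∧
      τ.v .found = if cc ∈ cols S φ v then 1 else 0 := by
  have hlt := hs.chordal.lt v hvn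
  refine Ok.mono (T := 1 + (1 + ((v - 1) * (4 + 1) + 1))) ?_ (by omega) fun _ _ h => h
  refine Ok.seq (Ok.set (by decide) (by simp) (by simp) ?_)
  refine Ok.seq (Ok.set (by decide) (by simp) (by simp; exact one_le_pow₀ (by norm_num)) ?_)
  refine (Ok.loop (by decide) (fun i τ => Fr [.found, .u] σ τ ∧ τ.v .u = ((i + 1 : ℕ) : ℤ) ∧
    τ.v .found = if ∃ u ∈ S v, u ≤ i ∧ φ u / 2 = cc then 1 else 0) (v - 1) ?_ ?_ ?_ ?_).mono le_rfl ?_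
  · refine ⟨((Fr.refl _ σ).setv _ _ (by simp)).setv _ _ (by simp), by simp, ?_⟩
    rw [if_neg]
    · simp
    · rintro ⟨u, hu, h0, -⟩
      have := hlt u hu; omega
  · intro i τ _ _; simp
  · rintro i τ hi ⟨hf, hu, hfd⟩ _
    have hu1 : i + 1 < v := by omega
    have ev : τ.v .v = v := (hf.v _ (by decide)).trans hv
    have en : τ.v .n = n := (hf.v _ (by decide)).trans hb.n_eq
    have ec : τ.v .cc = cc := (hf.v _ (by decide)).trans hcc
    have eS := hb.S_eq v (i + 1) (by omega) hu1 hvn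
    refine ⟨by simp [ev, hu]; omega, ?_⟩
    have hlast : ∀ ρ : St, Fr [.found, .u] σ ρ → ρ.v .u = ((i + 1 : ℕ) : ℤ) →
        (ρ.v .found = if ∃ u ∈ S v, u ≤ i + 1 ∧ φ u / 2 = cc then 1 else 0) →
        Ok C (setP .u (Exp.v .u + 1)) ρ 1 fun τ => Fr [.found, .u] σ τ ∧
          τ.v .u = ((i + 1 + 1 : ℕ) : ℤ) ∧
          τ.v .found = if ∃ u ∈ S v, u ≤ i + 1 ∧ φ u / 2 = cc then 1 else 0 := by
      intro ρ h1 h2 h3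
      refine Ok.set (by decide) (by simp) ?_ ⟨h1.setv _ _ (by simp), by simp [h2], by simpa using h3⟩
      refine hs.abs_le_lin ?_
      simp only [eval_add, eval_v, eval_one, h2]
      rw [abs_of_nonneg (by positivity)]; push_cast; omega
    refine Ok.seq (T := 3) (T' := 1) ?_
    refine Ok.ite (T := 2) (by decide) (by simp [ev, en, hu]; positivity) ?_ ?_
    · intro hpos
      have hmem : i + 1 ∈ S v := by
        by_contra hmem
        rw [if_neg hmem] at eS
        simp only [eval_arr, eval_add, eval_mul, eval_v, eval_one, ev, en, hu, hf.a, toNat_idx, eS] at hpos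
        omega
      refine Ok.ite (by decide) (by simp [hu]; positivity) ?_ ?_
      · intro hpos2
        refine Ok.set (by decide) (by simp) (by simp; exact one_le_pow₀ (by norm_num)) ?_
        refine hlast _ (hf.setv _ _ (by simp)) (by simpa using hu) ?_
        simp only [eval_sub, eval_one, eval_size, eval_div, eval_arr, eval_v, eval_two, hu,
          Int.toNat_natCast, hf.a, hφ, hf.v .cc (by decide), hcc, one_sub_size_pos] at hpos2
        rw [if_pos ⟨i + 1, hmem, le_rfl, by omega⟩]
        simp
      · intro hneg
        refine (Ok.skip ?_).mono le_rfl fun _ _ h => h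
        refine hlast _ hf hu ?_
        simp only [eval_sub, eval_one, eval_size, eval_div, eval_arr, eval_v, eval_two, hu,
          Int.toNat_natCast, hf.a, hφ, ec, one_sub_size_pos] at hneg
        rw [hfd]
        refine if_congr ⟨fun ⟨u, h1, h2, h3⟩ => ⟨u, h1, by omega, h3⟩, fun ⟨u, h1, h2, h3⟩ =>
          ⟨u, h1, ?_, h3⟩⟩ rfl rfl
        by_contra h4
        have : u = i + 1 := by omega
        subst this; omega
    · intro hneg
      refine (Ok.skip ?_).mono (by norm_num) fun _ _ h => h
      refine hlast _ hf hu ?_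
      have hmem : i + 1 ∉ S v := by
        intro hmem
        rw [if_pos hmem] at eS
        simp only [eval_arr, eval_add, eval_mul, eval_v, eval_one, ev, en, hu, hf.a, toNat_idx, eS] at hneg
        omega
      rw [hfd]
      refine if_congr ⟨fun ⟨u, h1, h2, h3⟩ => ⟨u, h1, by omega, h3⟩, fun ⟨u, h1, h2, h3⟩ =>
        ⟨u, h1, ?_, h3⟩⟩ rfl rfl
      by_contra h4
      have : u = i + 1 := by omega
      subst this; exact hmem h1
  · rintro τ ⟨hf, hu, -⟩
    simp [hu, hf.v .v (by decide), hv]; omega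
  · rintro τ _ ⟨hf, hu, hfd⟩
    refine ⟨hf, hfd.trans (if_congr ?_ rfl rfl)⟩
    simp only [cols, Finset.mem_image]
    constructor
    · rintro ⟨u, h1, -, h3⟩; exact ⟨u, h1, h3⟩
    · rintro ⟨u, h1, h3⟩; exact ⟨u, h1, by have := hlt u h1; omega, h3⟩

end RAM

/-! ### The weight of an option -/

namespace RAM

open Elim

variable {C : Ctx} {n : ℕ} {S N : ℕ → Finset ℕ} {cst : ℕ → ℕ → ℕ} {o nx : ℕ → ℕ} {K z : ℕ} {σ : St}
  {φ : ℕ → ℕ}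

/-- Repeat `p` for `x` running from `a` to the number before `b`. -/
def forP (x : Var) (a b : Exp) (p : Prog) : Prog :=
  setP x a ;; loopP (b - Exp.v x) (p ;; setP x (Exp.v x + 1))

theorem Ok.for {x : Var} {a b : Exp} {p : Prog} {s m T : ℕ} (hb : (b - Exp.v x).good 0) (ha : a.good 0)
    (hok : a.ok C.inp σ) (hs : a.eval C.inp σ = s) (hβ : ((s + m : ℕ) : ℤ) ≤ 2 ^ C.β)
    (I : ℕ → St → Prop) (h0 : I 0 (σ.setv x s))
    (hI : ∀ i τ, i ≤ m → I i τ → b.ok C.inp τ ∧ b.eval C.inp τ = (s + m : ℕ) ∧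
      τ.v x = ((s + i : ℕ) : ℤ))
    (hstep : ∀ i τ, i < m → I i τ → τ.v x = ((s + i : ℕ) : ℤ) → Fits C τ → Ok C p τ T fun ρ =>
      ρ.v x = ((s + i : ℕ) : ℤ) ∧ I (i + 1) (ρ.setv x ((s + (i + 1) : ℕ) : ℤ))) :
    Ok C (forP x a b p) σ (m * (T + 2) + 2) (I m) := by
  refine Ok.mono (T := 1 + (m * (T + 1 + 1) + 1)) ?_ (by ring_nf; omega) fun _ _ h => h
  refine Ok.seq (Ok.set ha hok ?_ ?_)
  · rw [hs, Nat.abs_cast]; push_cast at hβ; omega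
  rw [hs]
  refine Ok.loop hb I m h0 ?_ ?_ ?_
  · intro i τ hi h
    simpa using (hI i τ hi h).1
  · intro i τ hi h hf
    obtain ⟨h1, h2, h3⟩ := hI i τ hi.le h
    refine ⟨?_, ?_⟩
    · simp only [eval_sub, eval_v, h2, h3]; push_cast; omega
    · refine Ok.seq ((hstep i τ hi h h3 hf).mono le_rfl ?_)
      rintro ρ _ ⟨h4, h5⟩
      have e : (Exp.v x + 1).eval C.inp ρ = ((s + (i + 1) : ℕ) : ℤ) := by
        simp only [eval_add, eval_v, h4, eval_one]; push_cast; ring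
      refine Ok.set (by rfl) (by simp) ?_ ?_
      · rw [e, Nat.abs_cast]; push_cast at hβ ⊢; omega
      · rw [e]; exact h5
  · intro τ h
    obtain ⟨h1, h2, h3⟩ := hI m τ le_rfl h
    simp [h2, h3]

/-- Doing nothing is within any time bound. -/
theorem Ok.skip' {Q : St → Prop} {T : ℕ} (hT : 1 ≤ T) (h : Q σ) : Ok C skipP σ T Q :=
  (Ok.skip h).mono hT fun _ _ h => h

/-- The number `k` of colours on `S v`, and whether the colour `c` is one of them. -/
def colsP : Prog :=
  setP .k 0 ;; setP .hit 0 ;;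
  forP .cc 1 (Exp.v .v)
    (foundP ;; setP .k (Exp.v .k + Exp.v .found) ;;
      iteP (1 - (Exp.v .cc - Exp.v .c).size) (setP .hit (Exp.v .found)) skipP)

theorem cols_subset (hS : Chordal n S) {v : ℕ} (hv : v ≤ n) (hφ : ∀ u ∈ S v, φ u ∈ opts u) :
    cols S φ v ⊆ Finset.Icc 1 (v - 1) := by
  intro c hc
  obtain ⟨u, hu, rfl⟩ := Finset.mem_image.1 hc
  have h1 := hS.lt v hv u hu
  have h2 := hφ u hu
  simp only [opts, Finset.mem_Icc] at h2 ⊢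
  omega

theorem card_cols_le (hS : Chordal n S) {v : ℕ} (hv : v ≤ n) (hφ : ∀ u ∈ S v, φ u ∈ opts u) :
    (cols S φ v).card ≤ v - 1 := by
  simpa using Finset.card_le_card (cols_subset hS hv hφ)

theorem card_filter_le_succ (s : Finset ℕ) (i : ℕ) : (s.filter (· ≤ i + 1)).card =
    (s.filter (· ≤ i)).card + if i + 1 ∈ s then 1 else 0 := by
  have e : s.filter (· ≤ i + 1) = s.filter (· ≤ i) ∪ s.filter (· = i + 1) := by
    ext x; simp only [Finset.mem_filter, Finset.mem_union]
    constructor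
    · rintro ⟨h1, h2⟩
      by_cases h : x = i + 1
      · exact .inr ⟨h1, h⟩
      · exact .inl ⟨h1, by omega⟩
    · rintro (⟨h1, h2⟩ | ⟨h1, h2⟩)
      · exact ⟨h1, by omega⟩
      · exact ⟨h1, by omega⟩
  rw [e, Finset.card_union_of_disjoint, Finset.filter_eq']
  · split <;> simp
  · rw [Finset.disjoint_filter]; intro x _ h; omega

theorem colsP_ok (hs : Scene C n S N cst o) (hb : Base n S o nx K z σ)
    {v c : ℕ} (hv1 : 1 ≤ v) (hvn : v ≤ n) (hv : σ.v .v = v) (hc : σ.v .c = c)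
    (hφ : ∀ u, σ.a .opt u = φ u) (hopt : ∀ u ∈ S v, φ u ∈ opts u) :
    Ok C colsP σ (n * (5 * n + 8) + 4) fun τ => Fr [.found, .u, .k, .hit, .cc] σ τ ∧
      τ.v .k = (cols S φ v).card ∧ τ.v .hit = if c ∈ cols S φ v then 1 else 0 := by
  have hcols := cols_subset hs.chordal hvn hopt
  have hcard := card_cols_le hs.chordal hvn hopt
  refine Ok.mono (T := 1 + (1 + ((v - 1) * ((5 * n + 3 + (1 + 2)) + 2) + 2))) ?_ ?_ fun _ _ h => h
  swap
  · have : (v - 1) * (5 * n + 8) ≤ n * (5 * n + 8) := Nat.mul_le_mul_right _ (by omega)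
    rw [show 5 * n + 3 + (1 + 2) + 2 = 5 * n + 8 by ring]; omega
  refine Ok.seq (Ok.set (by decide) (by simp) (by simp) ?_)
  refine Ok.seq (Ok.set (by decide) (by simp) (by simp) ?_)
  refine (Ok.for (s := 1) (m := v - 1) (T := 5 * n + 3 + (1 + 2)) (by decide) (by decide) (by simp) (by simp) ?_
    (fun i τ => Fr [.found, .u, .k, .hit, .cc] σ τ ∧ τ.v .cc = ((1 + i : ℕ) : ℤ) ∧
      τ.v .k = ((cols S φ v).filter (· ≤ i)).card ∧
      τ.v .hit = if c ≤ i ∧ c ∈ cols S φ v then 1 else 0) ?_ ?_ ?_).mono le_rfl ?_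
  · have := hs.abs_le_lin (x := n) (by rw [Nat.abs_cast]; omega)
    rw [Nat.abs_cast] at this
    refine le_trans ?_ this
    norm_cast; omega
  · refine ⟨(((Fr.refl _ σ).setv _ _ (by simp)).setv _ _ (by simp)).setv _ _ (by simp), by simp, ?_,
      ?_⟩
    · have : (cols S φ v).filter (· ≤ 0) = ∅ := by
        rw [Finset.filter_eq_empty_iff]
        intro x hx
        have := Finset.mem_Icc.1 (hcols hx)
        omega
      simp only [this, St.setv_v, reduceCtorEq, if_false, if_true, Finset.card_empty]; rfl
    · rw [if_neg]
      · simp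
      · rintro ⟨h1, h2⟩
        have := Finset.mem_Icc.1 (hcols h2)
        omega
  · rintro i τ - ⟨hf, h1, -⟩
    refine ⟨by simp, ?_, h1⟩
    simp [hf.v .v (by decide), hv]; omega
  · rintro i τ hi ⟨hf, h1, h2, h3⟩ - -
    have eφ : ∀ u, τ.a .opt u = φ u := hf.a ▸ hφ
    refine Ok.seq ((foundP_ok hs (hb.fr hf (by decide)) hv1 hvn ((hf.v _ (by decide)).trans hv) h1
      eφ).mono le_rfl ?_)
    rintro ρ - ⟨hf', hfound⟩
    have hk : ρ.v .k = ((cols S φ v).filter (· ≤ i)).card := (hf'.v _ (by decide)).trans h2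
    have hhit := (hf'.v .hit (by decide)).trans h3
    have hcc := (hf'.v .cc (by decide)).trans h1
    have hff : Fr [.found, .u, .k, .hit, .cc] σ ρ := hf.trans (hf'.weaken (by decide))
    have hkk : (Exp.v .k + Exp.v .found).eval C.inp ρ =
        ((cols S φ v).filter (· ≤ i + 1)).card := by
      rw [card_filter_le_succ, add_comm i 1]
      simp only [eval_add, eval_v, hk, hfound]; push_cast; rfl
    refine Ok.seq (Ok.set (by decide) (by simp) ?_ ?_)
    · rw [hkk]
      refine hs.abs_le_lin ?_
      rw [Nat.abs_cast]
      have := Finset.card_filter_le (cols S φ v) (· ≤ i + 1)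
      omega
    rw [hkk]
    refine Ok.ite (T := 1) (by decide) (by simp) ?_ ?_
    · intro hpos
      simp only [eval_sub, eval_one, eval_size, eval_v, one_sub_size_pos, St.setv_v] at hpos
      have hci : c = 1 + i := by
        have := hff.v .c (by decide)
        simp [hcc, this, hc] at hpos
        omega
      refine Ok.set (by decide) (by simp) ?_ ?_
      · simp only [eval_v, St.setv_v, reduceCtorEq, if_false, hfound]
        split
        · simp; exact one_le_pow₀ (by norm_num)
        · simp
      · refine ⟨by simpa using hcc, ((hff.setv _ _ (by simp)).setv _ _ (by simp)).setv _ _ (by simp),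
          by simp, by simp, ?_⟩
        simp only [eval_v, St.setv_v, reduceCtorEq, if_false, hfound, if_true]
        refine if_congr ?_ rfl rfl
        rw [hci]; exact ⟨fun h => ⟨by omega, h⟩, fun h => h.2⟩
    · intro hneg
      simp only [eval_sub, eval_one, eval_size, eval_v, one_sub_size_pos, St.setv_v] at hneg
      have hci : c ≠ 1 + i := by
        have := hff.v .c (by decide)
        simp [hcc, this, hc] at hneg
        omega
      refine Ok.skip ⟨by simpa using hcc, (hff.setv _ _ (by simp)).setv _ _ (by simp), by simp,
        by simp, ?_⟩
      simp only [St.setv_v, reduceCtorEq, if_false, hhit]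
      refine if_congr ?_ rfl rfl
      exact and_congr_left fun _ => by omega
  · rintro τ - ⟨hf, h1, h2, h3⟩
    refine ⟨hf, ?_, ?_⟩
    · rw [h2, Finset.filter_true_of_mem]
      intro x hx
      exact (Finset.mem_Icc.1 (hcols hx)).2
    · rw [h3]
      refine if_congr ⟨fun h => h.2, fun h => ⟨?_, h⟩⟩ rfl rfl
      exact (Finset.mem_Icc.1 (hcols h)).2

theorem prod_filter_le_succ {M : Type*} [CommMonoid M] (s : Finset ℕ) (f : ℕ → M) (i : ℕ) :
    ∏ x ∈ s.filter (· ≤ i + 1), f x =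
      (∏ x ∈ s.filter (· ≤ i), f x) * if i + 1 ∈ s then f (i + 1) else 1 := by
  have e : s.filter (· ≤ i + 1) = s.filter (· ≤ i) ∪ s.filter (· = i + 1) := by
    ext x; simp only [Finset.mem_filter, Finset.mem_union]
    constructor
    · rintro ⟨h1, h2⟩
      by_cases h : x = i + 1
      · exact .inr ⟨h1, h⟩
      · exact .inl ⟨h1, by omega⟩
    · rintro (⟨h1, h2⟩ | ⟨h1, h2⟩)
      · exact ⟨h1, by omega⟩
      · exact ⟨h1, by omega⟩
  rw [e, Finset.prod_union, Finset.filter_eq']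
  · split <;> simp
  · rw [Finset.disjoint_filter]; intro x _ h; omega

/-- The edges prescribed by the pointers `nx`. -/
abbrev linked (nx : ℕ → ℕ) (u v : ℕ) : Prop := nx u = v ∨ nx v = u

/-- The factor of an edge in the weight of an option. -/
def factor (K : ℕ) (cst : ℕ → ℕ → ℕ) (nx : ℕ → ℕ) (z : ℕ) (φ : ℕ → ℕ) (v u : ℕ) : ℤ :=
  (if φ u / 2 = φ v / 2 then (z : ℤ) * (sg (φ u) * sg (φ v)) else 0) + unused K cst (linked nx) u v

/-- A bound for the weight of the options of `v`. -/
def lam (n : ℕ) (N : ℕ → Finset ℕ) (K : ℕ) (cst : ℕ → ℕ → ℕ) (z v : ℕ) : ℕ :=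
  n * ∏ u ∈ N v, (z + 2 ^ (K * cst u v))

theorem abs_sg (a : ℕ) : |sg a| = 1 := by
  unfold sg; rw [abs_pow, abs_neg, abs_one, one_pow]

theorem abs_factor_le (v u : ℕ) :
    |factor K cst nx z φ v u| ≤ ((z + 2 ^ (K * cst u v) : ℕ) : ℤ) := by
  unfold factor unused
  refine (abs_add_le _ _).trans ?_
  push_cast
  refine add_le_add ?_ ?_
  · split
    · simp [abs_mul, abs_sg]
    · simp
  · split
    · simp
    · rw [abs_of_nonneg (by positivity)]

theorem abs_cw_le (hS : Chordal n S) {v : ℕ} (hv1 : 1 ≤ v) (hv : v ≤ n)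
    (hφ : ∀ u ∈ S v, φ u ∈ opts u) : |cw S v φ| ≤ n := by
  have := card_cols_le hS hv hφ
  unfold cw
  split
  · split
    · simp; omega
    · rw [abs_neg, Nat.abs_cast]; omega
  · split
    · simp; omega
    · simp

theorem abs_weight_le (hS : Chordal n S) {v : ℕ} (hv1 : 1 ≤ v) (hv : v ≤ n)
    (hφ : ∀ u ∈ S v, φ u ∈ opts u) {A : Finset ℕ} (hA : A ⊆ N v) :
    |cw S v φ * ∏ u ∈ A, factor K cst nx z φ v u| ≤ (lam n N K cst z v : ℕ) := by
  rw [abs_mul, Finset.abs_prod]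
  unfold lam
  rw [Nat.cast_mul]
  refine mul_le_mul (abs_cw_le hS hv1 hv hφ) ?_ (Finset.prod_nonneg fun _ _ => abs_nonneg _)
    (by positivity)
  refine (Finset.prod_le_prod (fun _ _ => abs_nonneg _) fun u _ => abs_factor_le v u).trans ?_
  rw [← Nat.cast_prod]
  have : ∏ u ∈ A, (z + 2 ^ (K * cst u v)) ≤ ∏ u ∈ N v, (z + 2 ^ (K * cst u v)) :=
    Finset.prod_le_prod_of_subset_of_one_le' hA fun u _ _ => by
      have := Nat.one_le_two_pow (n := K * cst u v); omega
  exact_mod_cast this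

theorem single_le_lam {v u : ℕ} (hn : 1 ≤ n) (hu : u ∈ N v) :
    z + 2 ^ (K * cst u v) ≤ lam n N K cst z v := by
  refine le_trans ?_ (Nat.le_mul_of_pos_left _ hn)
  exact Finset.single_le_prod' (f := fun u => z + 2 ^ (K * cst u v)) (fun u _ => by
      have := Nat.one_le_two_pow (n := K * cst u v); omega) hu

/-- The sign of an option is computed from its parity. -/
theorem one_sub_two_mul (a : ℕ) : (1 - 2 * ((a : ℤ) % 2)) = sg a := by
  rw [sg_eq]
  have := Nat.mod_two_eq_zero_or_one a
  rcases this with h | h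
  · have : (a : ℤ) % 2 = 0 := by omega
    rw [h, this]; simp [sg]
  · have : (a : ℤ) % 2 = 1 := by omega
    rw [h, this]; simp [sg]

/-- Multiply the weight by the factor of the edge between `u` and `v`. -/
def factorP : Prog :=
  setP .g 0 ;;
  iteP (1 - (Exp.arr .opt (Exp.v .u) / 2 - Exp.v .c).size)
    (setP .g (Exp.v .z * ((1 - 2 * (Exp.arr .opt (Exp.v .u) % 2)) *
      (1 - 2 * (Exp.arr .opt (Exp.v .v) % 2))))) skipP ;;
  iteP (1 - ((Exp.arr .nxt (Exp.v .u) - Exp.v .v) * (Exp.arr .nxt (Exp.v .v) - Exp.v .u)).size)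
    skipP (shlP .e 1 (Exp.v .K * (Exp.v .e - 1)) ;; setP .g (Exp.v .g + Exp.v .e)) ;;
  setP .wt (Exp.v .wt * Exp.v .g)

theorem factorP_ok (hb : Base n S o nx K z σ) {v u : ℕ} {c : ℤ} (hv : σ.v .v = v) (hu : σ.v .u = u)
    (hφ : ∀ u, σ.a .opt u = φ u) (hc : σ.v .c = (φ v / 2 : ℕ)) (he : σ.v .e = cst u v + 1)
    (hw : σ.v .wt = c) (hz : z + 2 ^ (K * cst u v) ≤ 2 ^ C.β)
    (hbd : |c * factor K cst nx z φ v u| ≤ 2 ^ C.β) :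
    Ok C factorP σ 7 fun τ => Fr [.g, .e, .wt] σ τ ∧ τ.v .wt = c * factor K cst nx z φ v u := by
  have hz' : ((z + 2 ^ (K * cst u v) : ℕ) : ℤ) ≤ 2 ^ C.β := by exact_mod_cast hz
  refine Ok.seq (T := 1) (T' := 6) (Ok.set (by decide) (by simp) (by simp) ?_)
  refine Ok.seq (T := 2) (T' := 4) ?_
  refine Ok.mono (T := 2) (Q := fun τ => Fr [.g, .e, .wt] σ τ ∧ τ.v .wt = c ∧ τ.v .e = cst u v + 1 ∧
    τ.v .g = if φ u / 2 = φ v / 2 then (z : ℤ) * (sg (φ u) * sg (φ v)) else 0) ?_ le_rfl ?_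
  · have e1 : (σ.a .opt u) / 2 - σ.v .c = 0 ↔ φ u / 2 = φ v / 2 := by rw [hφ, hc]; omega
    refine Ok.ite (T := 1) (by decide) (by simp [hu]) ?_ ?_ <;> intro hpos <;>
      simp only [eval_sub, eval_one, eval_size, eval_div, eval_arr, eval_v, eval_two, St.setv_v,
          reduceCtorEq, if_false, hu, Int.toNat_natCast, St.setv_a, one_sub_size_pos, e1] at hpos
    · have e2 : (Exp.v .z * ((1 - 2 * (Exp.arr .opt (Exp.v .u) % 2)) *
        (1 - 2 * (Exp.arr .opt (Exp.v .v) % 2)))).eval C.inp (σ.setv .g 0) =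
          (z : ℤ) * (sg (φ u) * sg (φ v)) := by
        simp [hu, hv, hφ, hb.z_eq, one_sub_two_mul]
      refine Ok.set (by decide) (by simp [hu, hv]) ?_ ?_
      · rw [eval_zero, e2]; simp only [abs_mul, abs_sg, Nat.abs_cast, mul_one]
        refine le_trans ?_ hz'
        push_cast; simp
      · rw [eval_zero, e2, if_pos hpos]
        exact ⟨((Fr.refl _ σ).setv _ _ (by simp)).setv _ _ (by simp), by simp [hw], by simp [he],
          by simp⟩
    · rw [if_neg hpos]
      exact Ok.skip ⟨(Fr.refl _ σ).setv _ _ (by simp), by simp [hw], by simp [he], by simp⟩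
  rintro τ - ⟨hf, h1, h2, h3⟩
  refine Ok.seq (T := 3) (T' := 1) ?_
  refine Ok.mono (T := 3) (Q := fun τ => Fr [.g, .e, .wt] σ τ ∧ τ.v .wt = c ∧
    τ.v .g = factor K cst nx z φ v u) ?_ le_rfl ?_
  · have e1 : (τ.a .nxt u - (v : ℤ)) * (τ.a .nxt v - u) = 0 ↔ linked nx u v := by
      rw [hf.a, hb.nxt_eq, hb.nxt_eq, mul_eq_zero]; unfold linked; omega
    have ev := (hf.v .v (by decide)).trans hv
    have eu := (hf.v .u (by decide)).trans hu
    have eK := (hf.v .K (by decide)).trans hb.K_eq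
    refine Ok.ite (T := 2) (by decide) (by simp [eu, ev]) ?_ ?_ <;> intro hpos <;>
      simp only [eval_sub, eval_one, eval_size, eval_arr, eval_v, eval_mul, eu, ev,
          Int.toNat_natCast, one_sub_size_pos, e1] at hpos
    · refine Ok.skip' (by norm_num) ⟨hf, h1, ?_⟩
      rw [h3, factor, unused, if_pos hpos, add_zero]
    · have e2 : (1 : Exp).eval C.inp τ * 2 ^ ((Exp.v .K * (Exp.v .e - 1)).eval C.inp τ).toNat =
          unused K cst (linked nx) u v := by
        rw [unused, if_neg hpos]
        simp only [eval_one, eval_mul, eval_v, eK, h2, eval_sub, add_sub_cancel_right, one_mul]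
        norm_cast
      refine Ok.seq (T := 1) (T' := 1) (Ok.shl (by decide) (by decide) (by simp) (by simp) ?_ ?_)
      · rw [e2, unused, if_neg hpos, abs_of_nonneg (by positivity)]
        refine le_trans ?_ hz'
        push_cast; simp
      rw [e2]
      have e3 : (Exp.v .g + Exp.v .e).eval C.inp (τ.setv .e (unused K cst (linked nx) u v)) =
          factor K cst nx z φ v u := by
        simp [h3, factor]
      refine Ok.set (by decide) (by simp) ?_ ?_
      · rw [e3]; exact (abs_factor_le v u).trans hz'
      · rw [e3]
        exact ⟨(hf.setv _ _ (by simp)).setv _ _ (by simp), by simp [h1], by simp⟩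
  rintro ρ - ⟨hf', h4, h5⟩
  have e4 : (Exp.v .wt * Exp.v .g).eval C.inp ρ = c * factor K cst nx z φ v u := by simp [h4, h5]
  refine Ok.set (by decide) (by simp) (by rw [e4]; exact hbd) ?_
  rw [e4]
  exact ⟨hf'.setv _ _ (by simp), by simp⟩

/-- The weight `wt` of the option `opt v` of the vertex `v`. -/
def wtP : Prog :=
  setP .c (Exp.arr .opt (Exp.v .v) / 2) ;; colsP ;;
  iteP (Exp.v .v - Exp.v .c) (setP .wt (Exp.v .hit))
    (iteP (Exp.v .v - 1) (setP .wt (0 - Exp.v .k)) (setP .wt 1)) ;;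
  forP .u 1 (Exp.v .v)
    (setP .e (Exp.inp (2 + Exp.arr .ord (Exp.v .v) * Exp.v .n + Exp.arr .ord (Exp.v .u))) ;;
      iteP (Exp.v .e) factorP skipP)

theorem wtP_ok (hs : Scene C n S N cst o) (hb : Base n S o nx K z σ)
    {v : ℕ} (hv1 : 1 ≤ v) (hvn : v ≤ n) (hv : σ.v .v = v)
    (hφ : ∀ u, σ.a .opt u = φ u) (hopt : ∀ u ∈ S v, φ u ∈ opts u) (hoptv : φ v ∈ opts v)
    (hlam : lam n N K cst z v ≤ 2 ^ C.β) :
    Ok C wtP σ (100 * n ^ 2) fun τ => Fr [.c, .found, .u, .k, .hit, .cc, .g, .e, .wt] σ τ ∧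
      τ.v .wt = loc S N (unused K cst (linked nx)) z v φ := by
  have hn := hs.two_le
  have hlam' : ((lam n N K cst z v : ℕ) : ℤ) ≤ 2 ^ C.β := by exact_mod_cast hlam
  have hn1 : ((n : ℕ) : ℤ) ≤ 2 ^ C.β := by
    have := hs.abs_le_lin (x := n) (by rw [Nat.abs_cast]; omega)
    rwa [Nat.abs_cast] at this
  have hcv : φ v / 2 ≤ v := by simp only [opts, Finset.mem_Icc] at hoptv; omega
  refine Ok.mono (T := 1 + ((n * (5 * n + 8) + 4) + (3 + ((v - 1) * (1 + (7 + 1) + 2) + 2)))) ?_ ?_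
    fun _ _ h => h
  swap
  · have : n * n ≥ 2 * n := Nat.mul_le_mul_right _ hn
    have h1 : n * (5 * n + 8) = 5 * (n * n) + 8 * n := by ring
    have h2 : n ^ 2 = n * n := by ring
    rw [h1, h2]; omega
  have ec : (Exp.arr .opt (Exp.v .v) / 2).eval C.inp σ = (φ v / 2 : ℕ) := by simp [hv, hφ]
  refine Ok.seq (Ok.set (by decide) (by simp [hv]) ?_ ?_)
  · rw [ec, Nat.abs_cast]; refine le_trans ?_ hn1; norm_cast; omega
  rw [ec]
  have f1 : Fr [.c, .found, .u, .k, .hit, .cc, .g, .e, .wt] σ (σ.setv .c (φ v / 2 : ℕ)) :=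
    (Fr.refl _ σ).setv _ _ (by simp)
  refine Ok.seq ((colsP_ok hs (hb.fr f1 (by decide)) hv1 hvn (by simpa using hv) (c := φ v / 2)
    (by simp) (by simpa using hφ) hopt).mono le_rfl ?_)
  rintro τ - ⟨f2, hk, hhit⟩
  have f3 := f1.trans (f2.weaken (L' := [.c, .found, .u, .k, .hit, .cc, .g, .e, .wt]) (by decide))
  have ev := (f3.v .v (by decide)).trans hv
  have ec' : τ.v .c = (φ v / 2 : ℕ) := (f2.v .c (by decide)).trans (by simp)
  refine Ok.seq (Ok.mono (T := 3) (Q := fun τ =>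
    Fr [.c, .found, .u, .k, .hit, .cc, .g, .e, .wt] σ τ ∧ τ.v .c = (φ v / 2 : ℕ) ∧
    τ.v .wt = cw S v φ) ?_ le_rfl ?_)
  · refine Ok.ite (T := 2) (by decide) (by simp) ?_ ?_ <;> intro hpos <;>
      simp only [eval_sub, eval_v, ev, ec'] at hpos
    · have e1 : cw S v φ = if φ v / 2 ∈ cols S φ v then 1 else 0 := by
        rw [cw, if_neg (by omega)]
      refine Ok.mono (T := 1) (Ok.set (by decide) (by simp) ?_ ⟨f3.setv _ _ (by simp), by simp [ec'],
        by simp [hhit, e1]⟩) (by norm_num) fun _ _ h => h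
      rw [eval_v, hhit]; split
      · simp; exact one_le_pow₀ (by norm_num)
      · simp
    · have e0 : φ v / 2 = v := by omega
      refine Ok.ite (T := 1) (by decide) (by simp) ?_ ?_ <;> intro hpos' <;>
        simp only [eval_sub, eval_v, eval_one, ev] at hpos'
      · have e1 : cw S v φ = -((cols S φ v).card : ℤ) := by
          rw [cw, if_pos e0, if_neg (by omega)]
        have e2 : (0 - Exp.v .k).eval C.inp τ = cw S v φ := by simp [hk, e1]
        refine Ok.set (by decide) (by simp) ?_ ?_
        · rw [e2]; exact (abs_cw_le hs.chordal hv1 hvn hopt).trans hn1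
        · rw [e2]; exact ⟨f3.setv _ _ (by simp), by simp [ec'], by simp⟩
      · have e1 : cw S v φ = 1 := by
          rw [cw, if_pos e0, if_pos (by omega)]
        refine Ok.set (by decide) (by simp) (by simp; exact one_le_pow₀ (by norm_num))
          ⟨f3.setv _ _ (by simp), by simp [ec'], by simp [e1]⟩
  rintro τ - ⟨hf, hc, hw⟩
  have hNlt : ∀ u ∈ N v, 1 ≤ u ∧ u < v := fun u hu => hs.chordal.lt v hvn u (hs.sub v hu)
  refine (Ok.for (s := 1) (m := v - 1) (by decide) (by decide) (by simp) (by simp) ?_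
    (fun i τ => Fr [.c, .found, .u, .k, .hit, .cc, .g, .e, .wt] σ τ ∧ τ.v .u = ((1 + i : ℕ) : ℤ) ∧
      τ.v .c = (φ v / 2 : ℕ) ∧
      τ.v .wt = cw S v φ * ∏ u ∈ (N v).filter (· ≤ i), factor K cst nx z φ v u) ?_ ?_ ?_).mono
    le_rfl ?_
  · refine le_trans ?_ hn1; norm_cast; omega
  · have : (N v).filter (· ≤ 0) = ∅ := by
      rw [Finset.filter_eq_empty_iff]
      intro x hx
      have := hNlt x hx
      omega
    refine ⟨hf.setv _ _ (by simp), by simp, by simp [hc], ?_⟩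
    rw [this]; simp [hw]
  · rintro i τ - ⟨hf, h1, -⟩
    refine ⟨by simp, ?_, h1⟩
    simp [hf.v .v (by decide), hv]; omega
  · rintro i τ hi ⟨hf, hu, hc, hw⟩ - -
    have ev := (hf.v .v (by decide)).trans hv
    have en := (hf.v .n (by decide)).trans hb.n_eq
    have eo1 : τ.a .ord v = o v := by rw [hf.a, hb.ord_eq v hv1 hvn]
    have eo2 : τ.a .ord (1 + i) = o (1 + i) := by rw [hf.a, hb.ord_eq _ (by omega) (by omega)]
    have e1 : (Exp.inp (2 + Exp.arr .ord (Exp.v .v) * Exp.v .n + Exp.arr .ord (Exp.v .u))).eval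
        C.inp τ = if 1 + i ∈ N v then (cst (1 + i) v + 1 : ℤ) else 0 := by
      simp only [eval_inp, eval_add, eval_two, eval_mul, eval_arr, eval_v, ev, hu, Int.toNat_natCast,
        eo1, eo2, en]
      rw [show (2 + (o v : ℤ) * n + o (1 + i)).toNat = 2 + o v * n + o (1 + i) by
        rw [← Int.toNat_natCast (2 + o v * n + o (1 + i))]; push_cast; rfl,
        hs.inp (1 + i) v (by omega) (by omega) hvn]
      split <;> simp
    refine Ok.seq (Ok.set (by decide) (by simp [ev, hu]; positivity) ?_ ?_)
    · rw [eval_inp, Nat.abs_cast]; exact_mod_cast C.inp_le _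
    rw [e1]
    have f1 := hf.setv .e (if 1 + i ∈ N v then (cst (1 + i) v + 1 : ℤ) else 0) (by simp)
    refine Ok.ite (T := 7) (by decide) (by simp) ?_ ?_ <;> intro hpos <;>
      simp only [eval_v, St.setv_v, if_true] at hpos
    · have hmem : 1 + i ∈ N v := by
        by_contra hmem; simp [hmem] at hpos
      have e2 : cw S v φ * ∏ u ∈ (N v).filter (· ≤ i + 1), factor K cst nx z φ v u =
          (cw S v φ * ∏ u ∈ (N v).filter (· ≤ i), factor K cst nx z φ v u) *
            factor K cst nx z φ v (1 + i) := by
        rw [prod_filter_le_succ, add_comm i 1, if_pos hmem]; ring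
      refine (factorP_ok (hb.fr f1 (by decide)) (v := v) (u := 1 + i) (by simpa using ev)
        (by simpa using hu) (φ := φ) (by simpa [hf.a] using hφ) (by simpa using hc)
        (by simp [hmem]) (by simpa using hw) ((single_le_lam (by omega) hmem).trans hlam) ?_).mono
        le_rfl ?_
      · rw [← e2]
        exact (abs_weight_le hs.chordal hv1 hvn hopt (Finset.filter_subset _ _)).trans hlam'
      · rintro ρ - ⟨f2, hw2⟩
        refine ⟨(f2.v .u (by decide)).trans (by simpa using hu),
          (f1.trans (f2.weaken (by decide))).setv _ _ (by simp), by simp, ?_, ?_⟩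
        · simpa [f2.v .c (by decide)] using hc
        · rw [e2]; simpa using hw2
    · have hmem : 1 + i ∉ N v := by
        intro hmem; simp [hmem] at hpos
      refine Ok.skip' (by norm_num) ⟨by simpa using hu, f1.setv _ _ (by simp), by simp,
        by simpa using hc, ?_⟩
      rw [prod_filter_le_succ, add_comm i 1]
      simpa [hmem] using hw
  · rintro τ - ⟨hf, -, -, hw⟩
    refine ⟨hf, ?_⟩
    rw [hw, Finset.filter_true_of_mem]
    · rfl
    · intro x hx
      have := hNlt x hx; omega

end RAM

/-! ### Bounds for the values of subtrees -/

namespace Elim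

variable {n : ℕ} {S : ℕ → Finset ℕ}

theorem card_opts (v : ℕ) : (opts v).card = 2 * v := by simp [opts]

theorem total_const (g : ℕ → ℕ) (a : ℕ) (φ : ℕ → ℕ) (m : ℕ) :
    total (fun v _ => g v) m (fun _ => a) φ = (∏ u ∈ Finset.Icc 1 m, 2 * u * g u) * a := by
  induction m generalizing a with
  | zero => simp [total]
  | succ m ih =>
    have : step (fun v _ => g v) (m + 1) (fun _ => a) = fun _ : ℕ → ℕ => 2 * (m + 1) * g (m + 1) * a := by
      funext ψ; simp [step, card_opts]; ring
    rw [total, this, ih, Finset.prod_Icc_succ_top (by omega)]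
    ring

/-- A bound for the absolute values of subtrees with weights bounded by `g`. -/
def bound (g : ℕ → ℕ) (n : ℕ) (S : ℕ → Finset ℕ) (v : ℕ) : ℕ :=
  subval (fun v _ => g v) n S v (fun _ => 0)

theorem subval_const (g : ℕ → ℕ) {v : ℕ} (hv : v ≤ n) (φ : ℕ → ℕ) :
    subval (fun v _ => g v) n S v φ = bound g n S v := by
  have key : ∀ k v, v ≤ n → n + 1 - v ≤ k → ∀ φ ψ : ℕ → ℕ,
      subval (fun v _ => g v) n S v φ = subval (fun v _ => g v) n S v ψ := by
    intro k
    induction k with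
    | zero => intro v hv hk; omega
    | succ k ih =>
      intro v hv hk φ ψ
      rw [subval_eq, subval_eq]
      refine Finset.sum_congr rfl fun o _ => ?_
      congr 1
      refine Finset.prod_congr rfl fun x hx => ?_
      have := mem_children.1 hx
      exact ih x (by omega) (by omega) _ _
  exact key _ v hv le_rfl _ _

theorem bound_eq (g : ℕ → ℕ) (v : ℕ) :
    bound g n S v = 2 * v * (g v * ∏ x ∈ children n S v, bound g n S x) := by
  rw [bound, subval_eq]
  rw [Finset.sum_congr rfl fun o _ => by
    rw [Finset.prod_congr rfl fun x hx => subval_const g (mem_children.1 hx).1.2 _]]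
  rw [Finset.sum_const, card_opts, smul_eq_mul]

theorem one_le_bound {g : ℕ → ℕ} (hg : ∀ v, 1 ≤ g v) {v : ℕ} (hv1 : 1 ≤ v) :
    1 ≤ bound g n S v := by
  have key : ∀ k v, 1 ≤ v → n + 1 - v ≤ k → 1 ≤ bound g n S v := by
    intro k
    induction k with
    | zero =>
      intro v hv hk
      rw [bound_eq]
      have : children n S v = ∅ := by
        rw [Finset.eq_empty_iff_forall_notMem]; intro x hx
        have := mem_children.1 hx; omega
      rw [this, Finset.prod_empty]
      have := hg v
      exact Nat.mul_pos (by omega) (by omega)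
    | succ k ih =>
      intro v hv hk
      rw [bound_eq]
      have := hg v
      refine Nat.mul_pos (by omega) (Nat.mul_pos (by omega) (Finset.prod_pos fun x hx => ?_))
      have := mem_children.1 hx
      exact ih x (by omega) (by omega)
  exact key _ v hv1 le_rfl

/-- All subtrees together are bounded by the product over all vertices. -/
theorem prod_bound_le (hS : Chordal n S) {g : ℕ → ℕ} {k : ℕ} (hk : k ≤ n) :
    (∏ u ∈ Finset.Icc 1 k, 2 * u * g u) *
      ∏ x ∈ (Finset.Icc (k + 1) n).filter (fun x => par S x ≤ k), bound g n S x =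
    ∏ u ∈ Finset.Icc 1 n, 2 * u * g u := by
  have key : ∀ k ≤ n, (∏ u ∈ Finset.Icc 1 k, 2 * u * g u) *
      ∏ x ∈ (Finset.Icc (k + 1) n).filter (fun x => par S x ≤ k), bound g n S x =
      ∏ x ∈ children n S 0, bound g n S x := by
    intro k hk
    have h := total_eq_prod (loc := fun v _ => g v) hS (fun _ _ _ _ _ _ => rfl) (fun _ => 0) k hk
    rw [Finset.prod_congr rfl fun x hx => subval_const g (mem_children.1 hx).1.2 _] at h
    rw [← h, ← total_const]
    congr 1
    funext ψ
    refine Finset.prod_congr rfl fun x hx => (subval_const g ?_ _).symm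
    have := Finset.mem_Icc.1 (Finset.mem_filter.1 hx).1
    omega
  rw [key k hk, ← key n le_rfl]
  simp

theorem bound_le (hS : Chordal n S) {g : ℕ → ℕ} (hg : ∀ v, 1 ≤ g v) {v : ℕ} (hv1 : 1 ≤ v)
    (hv : v ≤ n) : bound g n S v ≤ ∏ u ∈ Finset.Icc 1 n, 2 * u * g u := by
  obtain ⟨k, rfl⟩ : ∃ k, v = k + 1 := ⟨v - 1, by omega⟩
  rw [← prod_bound_le hS (k := k) (by omega)]
  have h1 : 1 ≤ ∏ u ∈ Finset.Icc 1 k, 2 * u * g u := Nat.succ_le_of_lt <| Finset.prod_pos fun u hu => by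
    have := Finset.mem_Icc.1 hu
    have := hg u
    exact Nat.mul_pos (by omega) (by omega)
  refine le_trans ?_ (Nat.le_mul_of_pos_left _ h1)
  refine Finset.single_le_prod' (f := fun x => bound g n S x) (fun x hx => ?_) ?_
  · have := Finset.mem_Icc.1 (Finset.mem_filter.1 hx).1
    exact one_le_bound hg (by omega)
  · have := par_lt hS hv1 hv
    exact Finset.mem_filter.2 ⟨Finset.mem_Icc.2 ⟨le_rfl, hv⟩, by omega⟩

theorem prod_children_zero (hS : Chordal n S) (g : ℕ → ℕ) :
    ∏ x ∈ children n S 0, bound g n S x = ∏ u ∈ Finset.Icc 1 n, 2 * u * g u := by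
  rw [← prod_bound_le hS (k := 0) (Nat.zero_le _)]
  simp [children]

theorem abs_subval_le {loc : ℕ → (ℕ → ℕ) → ℤ} {g : ℕ → ℕ}
    (h : ∀ v φ, 1 ≤ v → v ≤ n → |loc v φ| ≤ g v) : ∀ v φ, 1 ≤ v → v ≤ n →
    |subval loc n S v φ| ≤ bound g n S v := by
  have key : ∀ k v φ, 1 ≤ v → v ≤ n → n + 1 - v ≤ k → |subval loc n S v φ| ≤ bound g n S v := by
    intro k
    induction k with
    | zero => intro v φ _ _ _; omega
    | succ k ih =>
      intro v φ hv1 hv hk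
      rw [subval_eq, bound_eq, ← card_opts]
      refine (Finset.abs_sum_le_sum_abs _ _).trans ((Finset.sum_le_card_nsmul _ _ _ fun o _ => ?_).trans
        (by rw [nsmul_eq_mul]; push_cast; rfl))
      rw [abs_mul, Finset.abs_prod]
      refine mul_le_mul (h v _ hv1 hv) ?_ (Finset.prod_nonneg fun _ _ => abs_nonneg _) (by positivity)
      exact Finset.prod_le_prod (fun _ _ => abs_nonneg _) fun x hx => by
        have := mem_children.1 hx
        exact ih x _ (by omega) (by omega) (by omega)
  exact fun v φ hv1 hv => key _ v φ hv1 hv le_rfl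

/-- The time for a subtree, when a vertex takes time `A` and has `B` options. -/
def subtime (A B n : ℕ) (S : ℕ → Finset ℕ) (v : ℕ) : ℕ :=
  A + B * ∑ x ∈ (children n S v).attach, subtime A B n S x.1
termination_by n + 1 - v
decreasing_by
  have := (mem_children.1 x.2).1
  omega

theorem subtime_eq (A B v : ℕ) :
    subtime A B n S v = A + B * ∑ x ∈ children n S v, subtime A B n S x := by
  rw [subtime, Finset.sum_attach (children n S v) (fun x => subtime A B n S x)]

theorem sum_subtime (hS : Chordal n S) (A B : ℕ) {k : ℕ} (hk : k ≤ n) :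
    ∑ u ∈ Finset.Icc 1 k, B ^ lev S u * A +
      ∑ x ∈ (Finset.Icc (k + 1) n).filter (fun x => par S x ≤ k), B ^ lev S x * subtime A B n S x =
    B * ∑ x ∈ children n S 0, subtime A B n S x := by
  induction k with
  | zero =>
    rw [Finset.mul_sum]
    simp only [Finset.Icc_eq_empty_of_lt Nat.zero_lt_one, Finset.sum_empty, zero_add]
    have e : (Finset.Icc 1 n).filter (fun x => par S x ≤ 0) = children n S 0 := by
      ext x; simp [mem_children]; omega
    rw [e]
    refine Finset.sum_congr rfl fun x hx => ?_
    obtain ⟨h1, h2⟩ := mem_children.1 hx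
    rw [lev_eq hS (by omega) h1.2, h2, lev_zero, zero_add, pow_one]
  | succ k ih =>
    rw [← ih (by omega), Finset.sum_Icc_succ_top (by omega), add_assoc]
    congr 1
    have hp := par_lt hS (v := k + 1) (by omega) hk
    have e1 : (Finset.Icc (k + 1) n).filter (fun x => par S x ≤ k) =
        insert (k + 1) ((Finset.Icc (k + 2) n).filter (fun x => par S x ≤ k)) := by
      ext x
      simp only [Finset.mem_filter, Finset.mem_Icc, Finset.mem_insert]
      constructor
      · rintro ⟨h1, h2⟩
        by_cases h : x = k + 1
        · exact .inl h
        · exact .inr ⟨by omega, h2⟩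
      · rintro (rfl | ⟨h1, h2⟩)
        · omega
        · exact ⟨by omega, h2⟩
    have e2 : (Finset.Icc (k + 1 + 1) n).filter (fun x => par S x ≤ k + 1) =
        children n S (k + 1) ∪ (Finset.Icc (k + 2) n).filter (fun x => par S x ≤ k) := by
      ext x
      simp only [Finset.mem_filter, Finset.mem_Icc, Finset.mem_union, mem_children]
      omega
    rw [e1, e2, Finset.sum_insert (by simp), Finset.sum_union, ← add_assoc, subtime_eq A B (k + 1),
      mul_add]
    · congr 2
      rw [← mul_assoc, ← pow_succ, Finset.mul_sum]
      refine Finset.sum_congr rfl fun x hx => ?_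
      obtain ⟨h1, h2⟩ := mem_children.1 hx
      rw [lev_eq hS (by omega) h1.2, h2]
    · rw [Finset.disjoint_left]; intro x hx hx'
      have := (mem_children.1 hx).2
      have := (Finset.mem_filter.1 hx').2
      omega

theorem sum_subtime_le (hS : Chordal n S) {A B d : ℕ} (hB : 1 ≤ B) (hd : ∀ v ≤ n, lev S v ≤ d) :
    ∑ x ∈ children n S 0, subtime A B n S x ≤ n * (B ^ d * A) := by
  have h := sum_subtime hS A B (k := n) le_rfl
  have e : (Finset.Icc (n + 1) n) = ∅ := Finset.Icc_eq_empty_of_lt (Nat.lt_succ_self n)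
  rw [e, Finset.filter_empty, Finset.sum_empty, add_zero] at h
  refine (Nat.le_mul_of_pos_left _ hB).trans (h.symm.le.trans ?_)
  refine (Finset.sum_le_card_nsmul _ _ (B ^ d * A) fun u hu => ?_).trans (by simp)
  exact Nat.mul_le_mul_right _ (Nat.pow_le_pow_right hB (hd u (Finset.mem_Icc.1 hu).2))

end Elim

/-! ### The traversal of the elimination forest -/

namespace RAM

open Elim

/-- The product of the bounds for the sums over the options of the single vertices. -/
def fullBound (n : ℕ) (N : ℕ → Finset ℕ) (K : ℕ) (cst : ℕ → ℕ → ℕ) (z : ℕ) : ℕ :=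
  ∏ u ∈ Finset.Icc 1 n, 2 * u * lam n N K cst z u

/-- The weights of the options that are computed by `wtP`. -/
abbrev wgt (S N : ℕ → Finset ℕ) (cst : ℕ → ℕ → ℕ) (nx : ℕ → ℕ) (K z : ℕ) (v : ℕ) (φ : ℕ → ℕ) : ℤ :=
  loc S N (unused K cst (linked nx)) z v φ

/-- The value of the subtree of `v`. -/
abbrev val (n : ℕ) (S N : ℕ → Finset ℕ) (cst : ℕ → ℕ → ℕ) (nx : ℕ → ℕ) (K z : ℕ) (v : ℕ)
    (φ : ℕ → ℕ) : ℤ :=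
  subval (wgt S N cst nx K z) n S v φ

/-- The setting, together with the bounds for the arrays that are used in the traversal. -/
structure Stage (C : Ctx) (n : ℕ) (S N : ℕ → Finset ℕ) (cst : ℕ → ℕ → ℕ) (o : ℕ → ℕ) (K z w : ℕ) :
    Prop extends Scene C n S N cst o where
  card_le : ∀ v ≤ n, (S v).card ≤ w
  one_le_w : 1 ≤ w
  opt_le : ∀ v, 1 ≤ v → v ≤ n → 2 * n + 2 ≤ C.ab .opt v
  acc_le : ∀ v ≤ n, fullBound n N K cst z ≤ C.ab .acc (lev S v)
  prod_le : ∀ v ≤ n, fullBound n N K cst z ≤ C.ab .prod (lev S v)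

/-- The variables that change during the traversal. -/
def evalVars : List Var := [.lev, .v, .x, .mode, .c, .found, .u, .k, .hit, .cc, .g, .e, .wt]

/-- The changes between two states of the traversal: the options of vertices below `v`, the
partial sums of levels below `a` and the partial products of levels below `p` are unchanged. -/
structure EF (v a p : ℕ) (σ τ : St) : Prop where
  out : τ.out = σ.out
  var : ∀ x, x ∉ evalVars → τ.v x = σ.v x
  arr : ∀ k, k ≠ .opt → k ≠ .acc → k ≠ .prod → τ.a k = σ.a k
  opt : ∀ u < v, τ.a .opt u = σ.a .opt u
  acc : ∀ i < a, τ.a .acc i = σ.a .acc i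
  prod : ∀ i < p, τ.a .prod i = σ.a .prod i

theorem EF.trans {v a p v' a' p' v'' a'' p'' : ℕ} {σ τ ρ : St} (h : EF v a p σ τ)
    (h' : EF v' a' p' τ ρ) (h1 : v'' ≤ v ∧ v'' ≤ v') (h2 : a'' ≤ a ∧ a'' ≤ a')
    (h3 : p'' ≤ p ∧ p'' ≤ p') : EF v'' a'' p'' σ ρ where
  out := h'.out.trans h.out
  var x hx := (h'.var x hx).trans (h.var x hx)
  arr k h4 h5 h6 := (h'.arr k h4 h5 h6).trans (h.arr k h4 h5 h6)
  opt u hu := (h'.opt u (by omega)).trans (h.opt u (by omega))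
  acc u hu := (h'.acc u (by omega)).trans (h.acc u (by omega))
  prod u hu := (h'.prod u (by omega)).trans (h.prod u (by omega))

theorem Fr.ef {L : List Var} {σ τ : St} (h : Fr L σ τ) (hL : ∀ x ∈ L, x ∈ evalVars) (v a p : ℕ) :
    EF v a p σ τ :=
  ⟨h.out, fun x hx => h.v x fun h' => hx (hL x h'), fun _ _ _ _ => by rw [h.a],
    fun _ _ => by rw [h.a], fun _ _ => by rw [h.a], fun _ _ => by rw [h.a]⟩

variable {C : Ctx} {n : ℕ} {S N : ℕ → Finset ℕ} {cst : ℕ → ℕ → ℕ} {o nx : ℕ → ℕ} {K z w : ℕ}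
  {σ τ : St} {φ : ℕ → ℕ}

theorem Base.ef (hb : Base n S o nx K z σ) {v a p : ℕ} (h : EF v a p σ τ) :
    Base n S o nx K z τ where
  n_eq := (h.var _ (by decide)).trans hb.n_eq
  K_eq := (h.var _ (by decide)).trans hb.K_eq
  z_eq := (h.var _ (by decide)).trans hb.z_eq
  S_eq := (h.arr .S (by decide) (by decide) (by decide)) ▸ hb.S_eq
  ord_eq := (h.arr .ord (by decide) (by decide) (by decide)) ▸ hb.ord_eq
  par_eq := (h.arr .par (by decide) (by decide) (by decide)) ▸ hb.par_eq
  nxt_eq := (h.arr .nxt (by decide) (by decide) (by decide)) ▸ hb.nxt_eq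

/-- The current options of the vertices. -/
def optf (σ : St) (u : ℕ) : ℕ := (σ.a .opt u).toNat

theorem EF.optf {v a p : ℕ} (h : EF v a p σ τ) {u : ℕ} (hu : u < v) : optf τ u = optf σ u := by
  unfold RAM.optf; rw [h.opt u hu]

/-- The traversal is at the vertex `v`. -/
structure At (n : ℕ) (S : ℕ → Finset ℕ) (o nx : ℕ → ℕ) (K z v : ℕ) (σ : St) : Prop where
  base : Base n S o nx K z σ
  le : v ≤ n
  v_eq : σ.v .v = v
  lev_eq : σ.v .lev = lev S v
  nonneg : ∀ u, 0 ≤ σ.a .opt u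
  opts : ∀ u ∈ S v, optf σ u ∈ opts u

theorem At.eq_optf {v : ℕ} (h : At n S o nx K z v σ) (u : ℕ) : σ.a .opt u = optf σ u := by
  have := h.nonneg u
  unfold optf; omega

/-- Look for the next child of `v`; without one, add the product to the sum of the options. -/
def scanP : Prog :=
  iteP (Exp.v .n + 1 - Exp.v .x)
    (iteP (1 - (Exp.arr .par (Exp.v .x) - Exp.v .v).size)
      (setP .lev (Exp.v .lev + 1) ;; setP .v (Exp.v .x) ;; stoP .acc (Exp.v .lev) 0 ;;
        stoP .opt (Exp.v .v) 2 ;; setP .mode 2)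
      (setP .x (Exp.v .x + 1)))
    (iteP (Exp.v .lev)
      (stoP .acc (Exp.v .lev) (Exp.arr .acc (Exp.v .lev) + Exp.arr .prod (Exp.v .lev)) ;;
        stoP .opt (Exp.v .v) (Exp.arr .opt (Exp.v .v) + 1) ;; setP .mode 2)
      (setP .mode 0))

/-- Try the next option of `v`; without one, return to the parent. -/
def tryP : Prog :=
  iteP (2 * Exp.v .v + 2 - Exp.arr .opt (Exp.v .v))
    (wtP ;; iteP (Exp.v .wt).size
      (stoP .prod (Exp.v .lev) (Exp.v .wt) ;; setP .x (Exp.v .v + 1) ;; setP .mode 1)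
      (stoP .opt (Exp.v .v) (Exp.arr .opt (Exp.v .v) + 1)))
    (stoP .prod (Exp.v .lev - 1) (Exp.arr .prod (Exp.v .lev - 1) * Exp.arr .acc (Exp.v .lev)) ;;
      setP .x (Exp.v .v + 1) ;; setP .v (Exp.arr .par (Exp.v .v)) ;;
      setP .lev (Exp.v .lev - 1) ;; setP .mode 1)

/-- The traversal, in which `mode` is `1` for `scanP` and `2` for `tryP`. -/
def walkP : Prog := loopP (Exp.v .mode) (iteP (Exp.v .mode - 1) tryP scanP)

/-- The value of the elimination forest, in `prod 0`. -/
def evalP : Prog :=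
  setP .lev 0 ;; setP .v 0 ;; setP .x 1 ;; stoP .prod 0 1 ;; setP .mode 1 ;; walkP

theorem abs_cw_le' (hS : Chordal n S) {v : ℕ} (hv1 : 1 ≤ v) (hv : v ≤ n) : |cw S v φ| ≤ n := by
  have h1 : S v ⊆ Finset.Icc 1 (v - 1) := fun u hu => by
    have := hS.lt v hv u hu
    simp only [Finset.mem_Icc]; omega
  have h2 := Finset.card_le_card h1
  have h3 : (cols S φ v).card ≤ (S v).card := Finset.card_image_le
  simp only [Nat.card_Icc] at h2
  unfold cw
  split
  · split
    · simp; omega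
    · rw [abs_neg, Nat.abs_cast]; omega
  · split
    · simp; omega
    · simp

theorem abs_wgt_le (hS : Chordal n S) (v : ℕ) (φ : ℕ → ℕ) (hv1 : 1 ≤ v) (hv : v ≤ n) :
    |wgt S N cst nx K z v φ| ≤ (lam n N K cst z v : ℕ) := by
  unfold wgt loc lam
  rw [abs_mul, Finset.abs_prod]
  push_cast
  refine mul_le_mul (abs_cw_le' hS hv1 hv) ?_ (Finset.prod_nonneg fun _ _ => abs_nonneg _)
    (by positivity)
  exact Finset.prod_le_prod (fun _ _ => abs_nonneg _) fun u _ => by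
    exact_mod_cast abs_factor_le (K := K) (cst := cst) (nx := nx) (z := z) (φ := φ) v u

theorem one_le_lam (hn : 1 ≤ n) (v : ℕ) : 1 ≤ lam n N K cst z v :=
  Nat.mul_pos hn (Finset.prod_pos fun u _ => by
    have := Nat.one_le_two_pow (n := K * cst u v); omega)

/-- Only the new colour and the colours on `S v` have nonzero weight. With two signs for each, there are
at most `2 * (w + 1) ≤ 4 * w` branches per level, whence the base `4 * w` of the running time. -/
theorem card_wgt_ne_zero (hS : Chordal n S) {v : ℕ} (hv : v ≤ n) (hw : (S v).card ≤ w) (φ : ℕ → ℕ) :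
    ((opts v).filter fun p => wgt S N cst nx K z v (Function.update φ v p) ≠ 0).card ≤
      2 * (w + 1) := by
  have hvS : v ∉ S v := fun h => by have := hS.lt v hv v h; omega
  have h1 : (opts v).filter (fun p => wgt S N cst nx K z v (Function.update φ v p) ≠ 0) ⊆
      (insert v (cols S φ v)).biUnion fun c => {2 * c, 2 * c + 1} := by
    intro p hp
    have hne := (Finset.mem_filter.1 hp).2
    have hcw : cw S v (Function.update φ v p) ≠ 0 := by
      intro h; exact hne (by rw [wgt, loc, h, zero_mul])
    have hc : cols S (Function.update φ v p) v = cols S φ v := Finset.image_congr fun u hu => by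
      have : u ≠ v := by rintro rfl; exact hvS hu
      simp [this]
    rw [cw, hc, Function.update_self] at hcw
    refine Finset.mem_biUnion.2 ⟨p / 2, ?_, by simp; omega⟩
    by_cases h : p / 2 = v
    · exact Finset.mem_insert.2 (.inl h)
    · refine Finset.mem_insert.2 (.inr ?_)
      by_contra h'
      rw [if_neg h, if_neg h'] at hcw
      exact hcw rfl
  refine (Finset.card_le_card h1).trans ((Finset.card_biUnion_le_card_mul _ _ 2 fun c _ =>
    Finset.card_le_two).trans ?_)
  have h2 := Finset.card_insert_le v (cols S φ v)
  have h3 : (cols S φ v).card ≤ (S v).card := Finset.card_image_le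
  omega

theorem val_congr (hs : Scene C n S N cst o) {v : ℕ} (hv : v ≤ n) {φ ψ : ℕ → ℕ}
    (h : ∀ u ∈ S v, φ u = ψ u) : val n S N cst nx K z v φ = val n S N cst nx K z v ψ :=
  subval_congr hs.chordal (loc_congr fun v _ => hs.sub v) _ v hv le_rfl _ _ h

theorem abs_val_le (hs : Scene C n S N cst o) {v : ℕ} (hv1 : 1 ≤ v) (hv : v ≤ n) (φ : ℕ → ℕ) :
    |val n S N cst nx K z v φ| ≤ bound (lam n N K cst z) n S v :=
  abs_subval_le (abs_wgt_le hs.chordal) v φ hv1 hv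

/-- The time for one option, apart from the children. -/
def optTime (n : ℕ) : ℕ := 100 * n ^ 2 + 30

/-- The time for the subtree of `v`. -/
def valTime (n w : ℕ) (S : ℕ → Finset ℕ) (v : ℕ) : ℕ :=
  subtime (2 * n * optTime n + 4 * w * (20 * n + 20) + 20) (4 * w) n S v

/-- The time for the children of `v` from `x` on. -/
def scanTime (n w : ℕ) (S : ℕ → Finset ℕ) (v x : ℕ) : ℕ :=
  ∑ y ∈ Finset.Ico x (n + 1), (20 + if par S y = v then valTime n w S y else 0)

theorem scanTime_le (v : ℕ) : scanTime n w S v (v + 1) ≤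
    20 * n + ∑ x ∈ children n S v, valTime n w S x := by
  have e : children n S v = (Finset.Ico (v + 1) (n + 1)).filter fun x => par S x = v := by
    ext x; simp [mem_children]
  rw [scanTime, Finset.sum_add_distrib, e, Finset.sum_filter]
  gcongr
  simp; omega

/-- The children of `v` from `x` on. -/
def rest (n : ℕ) (S : ℕ → Finset ℕ) (v x : ℕ) : Finset ℕ := (children n S v).filter (x ≤ ·)

theorem rest_start (v : ℕ) : rest n S v (v + 1) = children n S v :=
  Finset.filter_true_of_mem fun _ hx => (mem_children.1 hx).1.1

theorem rest_end (v : ℕ) : rest n S v (n + 1) = ∅ :=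
  Finset.filter_eq_empty_iff.2 fun x hx => by have := mem_children.1 hx; omega

theorem rest_insert {v x : ℕ} (h : x ∈ children n S v) :
    rest n S v x = insert x (rest n S v (x + 1)) := by
  ext y
  simp only [rest, Finset.mem_filter, Finset.mem_insert]
  constructor
  · rintro ⟨h1, h2⟩
    by_cases hy : y = x
    · exact .inl hy
    · exact .inr ⟨h1, by omega⟩
  · rintro (rfl | ⟨h1, h2⟩)
    · exact ⟨h, le_rfl⟩
    · exact ⟨h1, by omega⟩

theorem rest_succ {v x : ℕ} (h : x ∉ children n S v) : rest n S v x = rest n S v (x + 1) := by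
  ext y
  simp only [rest, Finset.mem_filter]
  refine and_congr_right fun h1 => ?_
  have : y ≠ x := by rintro rfl; exact h h1
  omega

theorem notMem_rest (v x : ℕ) : x ∉ rest n S v (x + 1) := by
  simp [rest]

theorem mem_of_mem_child (hS : Chordal n S) {v x u : ℕ} (hx : x ≤ n) (hp : par S x = v)
    (hu : u ∈ S x) : u = v ∨ (u ∈ S v ∧ u < v) := by
  have h1 := le_par hu
  have h2 := hS.lt x hx u hu
  by_cases h : u = v
  · exact .inl h
  · exact .inr ⟨hS.mem x hx u hu v (hp ▸ par_mem (by omega)) (by omega), by omega⟩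

theorem Stage.fullBound_le (hs : Stage C n S N cst o K z w) : fullBound n N K cst z ≤ 2 ^ C.β :=
  (hs.acc_le 0 (Nat.zero_le _)).trans (C.ab_le _ _)

theorem Stage.lam_le (hs : Stage C n S N cst o K z w) {v : ℕ} (hv1 : 1 ≤ v) (hv : v ≤ n) :
    lam n N K cst z v ≤ fullBound n N K cst z := by
  have hn := hs.two_le
  refine le_trans ?_ (bound_le hs.chordal (g := lam n N K cst z) (one_le_lam (by omega)) hv1 hv)
  rw [bound_eq]
  have h1 : 1 ≤ ∏ x ∈ children n S v, bound (lam n N K cst z) n S x :=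
    Finset.one_le_prod' fun _ hx =>
      one_le_bound (one_le_lam (by omega)) (by have := mem_children.1 hx; omega)
  calc lam n N K cst z v = 1 * (lam n N K cst z v * 1) := by ring
    _ ≤ _ := Nat.mul_le_mul (by omega) (Nat.mul_le_mul_left _ h1)

theorem lev_le_self (hS : Chordal n S) (v : ℕ) : v ≤ n → lev S v ≤ v := by
  induction v using Nat.strong_induction_on with
  | _ v ih =>
    intro hv
    rcases Nat.eq_zero_or_pos v with rfl | hv1
    · rw [lev_zero]
    · have h1 := par_lt hS hv1 hv
      have h2 := ih _ h1 (by omega)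
      rw [lev_eq hS hv1 hv]; omega

theorem Scene.nat_le (hs : Scene C n S N cst o) {m : ℕ} (hm : m ≤ 4 * n + 8) : (m : ℤ) ≤ 2 ^ C.β := by
  have := hs.abs_le_lin (x := m) (by rw [Nat.abs_cast]; omega)
  rwa [Nat.abs_cast] at this

theorem Scene.abs_nat_le (hs : Scene C n S N cst o) {m : ℕ} (hm : m ≤ 4 * n + 8) :
    |(m : ℤ)| ≤ 2 ^ C.β := by
  rw [Nat.abs_cast]; exact hs.nat_le hm

theorem two_le_pow_seven (C : Ctx) : (2 : ℤ) ≤ 2 ^ C.β := by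
  have := C.seven_le
  calc (2 : ℤ) = 2 ^ 1 := by norm_num
    _ ≤ 2 ^ C.β := pow_le_pow_right₀ (by norm_num) (by omega)

/-- Descending to a child. -/
theorem scan_down (hs : Stage C n S N cst o K z w) {v x : ℕ} (h : At n S o nx K z v σ)
    (hm : σ.v .mode = 1) (hx : σ.v .x = x) (hvx : v < x) (hxn : x ≤ n) (hp : par S x = v)
    (hv : 1 ≤ v → optf σ v ∈ opts v) :
    Ok C (iteP (Exp.v .mode - 1) tryP scanP) σ 8 fun τ => At n S o nx K z x τ ∧ τ.v .mode = 2 ∧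
      τ.a .opt x = 2 ∧ τ.a .acc (lev S x) = 0 ∧ EF x (lev S x) n σ τ := by
  have hl : lev S x = lev S v + 1 := by rw [lev_eq hs.chordal (by omega) hxn, hp]
  have hlx := lev_le_self hs.chordal x hxn
  refine Ok.ite (by decide) (by simp) (fun hc => by simp [hm] at hc) fun _ => ?_
  refine Ok.ite (T := 6) (by decide) (by simp) (fun _ => ?_) fun hc => by
    simp [h.base.n_eq, hx] at hc; omega
  refine Ok.ite (T := 5) (by decide) (by simp [hx]) (fun _ => ?_) fun hc => by
    simp only [eval_sub, eval_one, eval_size, eval_arr, eval_v, hx, Int.toNat_natCast,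
      one_sub_size_pos, h.base.par_eq x (by omega) hxn, hp, h.v_eq] at hc
    omega
  have e1 : (Exp.v .lev + 1).eval C.inp σ = (lev S x : ℕ) := by simp [h.lev_eq, hl]
  refine Ok.seq (T := 1) (T' := 4) (Ok.set (by decide) (by simp) ?_ ?_) <;> rw [e1]
  · exact hs.abs_nat_le (by omega)
  have e2 : (Exp.v .x).eval C.inp (σ.setv .lev (lev S x : ℕ)) = x := by simp [hx]
  refine Ok.seq (T := 1) (T' := 3) (Ok.set (by decide) (by simp) ?_ ?_) <;> rw [e2]
  · exact hs.abs_nat_le (by omega)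
  refine Ok.seq (T := 1) (T' := 2) (Ok.sto (by decide) (by decide) (by simp) (by simp) (by simp)
    (by simp) ?_)
  refine Ok.seq (T := 1) (T' := 1) (Ok.sto (by decide) (by decide) (by simp) (by simp) (by simp)
    ?_ ?_)
  · have := hs.opt_le x (by omega) hxn
    simp; omega
  refine Ok.set (by decide) (by simp) (by simpa using two_le_pow_seven C) ?_
  have hef : EF x (lev S x) n σ (((((σ.setv .lev (lev S x : ℕ)).setv .v x).seta .acc (lev S x) 0).seta
      .opt x 2).setv .mode 2) := by
    refine ⟨by simp, fun y hy => ?_, fun k h1 h2 h3 => ?_, fun u hu => ?_, fun i hi => ?_,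
      fun i hi => ?_⟩
    · simp only [evalVars, List.mem_cons, not_or] at hy
      simp [hy]
    · funext i; simp [h1, h2]
    · simp [hu.ne]
    · simp [hi.ne]
    · simp
  simp only [eval_v, St.setv_v, eval_zero, eval_two, St.seta_v, if_true, Int.toNat_natCast,
    reduceCtorEq, if_false]
  refine ⟨⟨h.base.ef hef, hxn, by simp, by simp, fun u => ?_, fun u hu => ?_⟩, by simp, by simp, by simp,
    hef⟩
  · have := h.nonneg u
    simp only [St.setv_a, St.seta_a, reduceCtorEq, false_and, if_false, true_and]
    split
    · norm_num
    · exact this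
  · have hux := hs.chordal.lt x hxn u hu
    rw [hef.optf (by omega)]
    rcases mem_of_mem_child hs.chordal hxn hp hu with rfl | ⟨h1, -⟩
    · exact hv (by omega)
    · exact h.opts u h1

/-- Passing a vertex that is not a child. -/
theorem scan_skip (hs : Stage C n S N cst o K z w) {v x : ℕ} (h : At n S o nx K z v σ)
    (hm : σ.v .mode = 1) (hx : σ.v .x = x) (hvx : v < x) (hxn : x ≤ n) (hp : par S x ≠ v) :
    Ok C (iteP (Exp.v .mode - 1) tryP scanP) σ 8 fun τ => τ = σ.setv .x (x + 1 : ℕ) := by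
  refine Ok.ite (by decide) (by simp) (fun hc => by simp [hm] at hc) fun _ => ?_
  refine Ok.ite (T := 6) (by decide) (by simp) (fun _ => ?_) fun hc => by
    simp [h.base.n_eq, hx] at hc; omega
  refine Ok.ite (T := 5) (by decide) (by simp [hx]) (fun hc => ?_) fun _ => ?_
  · simp only [eval_sub, eval_one, eval_size, eval_arr, eval_v, hx, Int.toNat_natCast,
      one_sub_size_pos, h.base.par_eq x (by omega) hxn, h.v_eq] at hc
    omega
  have e1 : (Exp.v .x + 1).eval C.inp σ = (x + 1 : ℕ) := by simp [hx]
  refine (Ok.set (by decide) (by simp) ?_ ?_).mono (T := 1) (by norm_num) fun _ _ h => h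
  · rw [e1]; exact hs.abs_nat_le (by omega)
  · rw [e1]

/-- At the end of the children of a vertex, its next option is up. -/
theorem scan_up (hs : Stage C n S N cst o K z w) {v : ℕ} (h : At n S o nx K z v σ)
    (hm : σ.v .mode = 1) (hx : σ.v .x = (n + 1 : ℕ)) (hv1 : 1 ≤ v) (hv : optf σ v ∈ opts v)
    (hb : |σ.a .acc (lev S v) + σ.a .prod (lev S v)| ≤ fullBound n N K cst z) :
    Ok C (iteP (Exp.v .mode - 1) tryP scanP) σ 6 fun τ => At n S o nx K z v τ ∧ τ.v .mode = 2 ∧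
      τ.a .opt v = optf σ v + 1 ∧ τ.a .acc (lev S v) = σ.a .acc (lev S v) + σ.a .prod (lev S v) ∧
      EF v (lev S v) (lev S v) σ τ := by
  have hl : lev S v = lev S (par S v) + 1 := lev_eq hs.chordal hv1 h.le
  have hv' := hv
  simp only [opts, Finset.mem_Icc] at hv'
  have hvn := h.le
  refine Ok.ite (by decide) (by simp) (fun hc => by simp [hm] at hc) fun _ => ?_
  refine Ok.ite (T := 4) (by decide) (by simp) (fun hc => by simp [h.base.n_eq, hx] at hc)
    fun _ => ?_
  refine Ok.ite (T := 3) (by decide) (by simp) (fun _ => ?_) fun hc => by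
    simp [h.lev_eq, hl] at hc
  refine Ok.seq (T := 1) (T' := 2) (Ok.sto (by decide) (by decide) (by simp)
    (by simp [h.lev_eq]) (by simp [h.lev_eq]) ?_ ?_)
  · simp only [eval_v, eval_add, eval_arr, h.lev_eq, Int.toNat_natCast]
    exact hb.trans (by exact_mod_cast hs.acc_le v h.le)
  refine Ok.seq (T := 1) (T' := 1) (Ok.sto (by decide) (by decide) (by simp)
    (by simp [h.v_eq]) (by simp [h.v_eq]) ?_ ?_)
  · have := hs.opt_le v hv1 h.le
    simp only [eval_v, eval_add, eval_arr, St.seta_v, h.v_eq, Int.toNat_natCast, St.seta_a,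
      reduceCtorEq, false_and, if_false, eval_one, h.eq_optf]
    rw [abs_of_nonneg (by positivity)]; omega
  refine Ok.set (by decide) (by simp) (by simpa using two_le_pow_seven C) ?_
  simp only [eval_v, eval_add, eval_arr, eval_two, St.seta_v, Int.toNat_natCast,
    reduceCtorEq, if_false, h.lev_eq, h.v_eq, St.seta_a, false_and, eval_one]
  have hef : EF v (lev S v) (lev S v) σ (((σ.seta .acc (lev S v) (σ.a .acc (lev S v) +
      σ.a .prod (lev S v))).seta .opt v (σ.a .opt v + 1)).setv .mode 2) := by
    refine ⟨by simp, fun y hy => ?_, fun k h1 h2 h3 => ?_, fun u hu => ?_, fun i hi => ?_,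
      fun i hi => ?_⟩
    · simp only [evalVars, List.mem_cons, not_or] at hy
      simp [hy]
    · funext i; simp [h1, h2]
    · simp [hu.ne]
    · simp [hi.ne]
    · simp
  refine ⟨⟨h.base.ef hef, h.le, by simp [h.v_eq], by simp [h.lev_eq], fun u => ?_, fun u hu => ?_⟩,
    by simp, by simp [h.eq_optf], by simp, hef⟩
  · have := h.nonneg u
    have := h.nonneg v
    simp only [St.setv_a, St.seta_a, reduceCtorEq, false_and, if_false, true_and]
    split <;> omega
  · have hux := hs.chordal.lt v h.le u hu
    rw [hef.optf (by omega)]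
    exact h.opts u hu

/-- The last option of a vertex has been tried. -/
theorem try_back (hs : Stage C n S N cst o K z w) {v : ℕ} (h : At n S o nx K z v σ)
    (hm : σ.v .mode = 2) (hv1 : 1 ≤ v) (hv : σ.a .opt v = 2 * v + 2)
    (hb : |σ.a .prod (lev S v - 1) * σ.a .acc (lev S v)| ≤ fullBound n N K cst z) :
    Ok C (iteP (Exp.v .mode - 1) tryP scanP) σ 7 fun τ => (τ.v .v = par S v ∧
      τ.v .lev = lev S (par S v) ∧ ∀ u, 0 ≤ τ.a .opt u) ∧ τ.v .mode = 1 ∧ τ.v .x = (v + 1 : ℕ) ∧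
      τ.a .prod (lev S v - 1) = σ.a .prod (lev S v - 1) * σ.a .acc (lev S v) ∧
      EF v (lev S v) (lev S v - 1) σ τ := by
  have hl : lev S v = lev S (par S v) + 1 := lev_eq hs.chordal hv1 h.le
  have hpl := par_lt hs.chordal hv1 h.le
  have hlev := lev_le_self hs.chordal v h.le
  have hvn := h.le
  refine Ok.ite (by decide) (by simp) (fun _ => ?_) (fun hc => by simp [hm] at hc)
  refine Ok.ite (T := 5) (by decide) (by simp [h.v_eq]) (fun hc => by simp [h.v_eq, hv] at hc)
    fun _ => ?_
  have e0 : (Exp.v .lev - 1).eval C.inp σ = (lev S v - 1 : ℕ) := by simp [h.lev_eq, hl]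
  have e1 : (Exp.arr .prod (Exp.v .lev - 1) * Exp.arr .acc (Exp.v .lev)).eval C.inp σ =
      σ.a .prod (lev S v - 1) * σ.a .acc (lev S v) := by
    rw [eval_mul, eval_arr, eval_arr, e0, eval_v, h.lev_eq, Int.toNat_natCast, Int.toNat_natCast]
  refine Ok.seq (T := 1) (T' := 4) (Ok.sto (by decide) (by decide) (by simp) ?_ ?_ ?_ ?_)
  · simp [h.lev_eq, hl]; positivity
  · rw [e0]; positivity
  · rw [e1, e0, Int.toNat_natCast]
    refine hb.trans ?_
    have := hs.prod_le (par S v) (by omega)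
    rw [hl, Nat.add_sub_cancel]; exact_mod_cast this
  rw [e0, e1, Int.toNat_natCast]
  set p := σ.a .prod (lev S v - 1) * σ.a .acc (lev S v) with hpdef
  refine Ok.seq (T := 1) (T' := 3) (Ok.set (by decide) (by simp) ?_ ?_)
  · simp only [eval_add, eval_v, St.seta_v, h.v_eq, eval_one]
    exact_mod_cast hs.abs_nat_le (m := v + 1) (by omega)
  refine Ok.seq (T := 1) (T' := 2) (Ok.set (by decide) (by simp [h.v_eq]) ?_ ?_)
  · simp only [eval_arr, eval_v, St.seta_v, h.v_eq, St.setv_v, reduceCtorEq, if_false, St.setv_a,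
      St.seta_a, false_and, Int.toNat_natCast, h.base.par_eq v hv1 h.le]
    exact hs.abs_nat_le (by omega)
  refine Ok.seq (T := 1) (T' := 1) (Ok.set (by decide) (by simp) ?_ ?_)
  · simp only [eval_sub, eval_v, St.seta_v, St.setv_v, reduceCtorEq, if_false, h.lev_eq, eval_one]
    rw [hl]; push_cast; rw [add_sub_cancel_right]; exact hs.abs_nat_le (by omega)
  refine Ok.set (by decide) (by simp) (by simp; exact one_le_pow₀ (by norm_num)) ?_
  simp only [eval_v, eval_add, eval_sub, eval_arr, St.setv_v, St.seta_v, if_true, Int.toNat_natCast,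
    reduceCtorEq, if_false, h.lev_eq, h.v_eq, St.seta_a, St.setv_a, false_and, eval_one,
    h.base.par_eq v hv1 h.le]
  have e3 : ((lev S v : ℕ) : ℤ) - 1 = (lev S (par S v) : ℕ) := by rw [hl]; push_cast; ring
  rw [e3]
  have hef : EF v (lev S v) (lev S v - 1) σ (((((σ.seta .prod (lev S v - 1) p).setv .x (v + 1)).setv .v
      (par S v)).setv .lev (lev S (par S v))).setv .mode 1) := by
    refine ⟨by simp, fun y hy => ?_, fun k h1 h2 h3 => ?_, fun u hu => ?_, fun i hi => ?_,
      fun i hi => ?_⟩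
    · simp only [evalVars, List.mem_cons, not_or] at hy
      simp [hy]
    · funext i; simp [h3]
    · simp
    · simp
    · simp [hi.ne]
  exact ⟨⟨by simp, by simp, fun u => by simpa using h.nonneg u⟩, by simp, by simp, by simp, hef⟩

/-- The traversal returns from a subtree. -/
theorem At.ret (hS : Chordal n S) {v x a p : ℕ} (h : At n S o nx K z v σ) (hef : EF x a p σ τ)
    (hvx : v < x) (h1 : τ.v .v = v) (h2 : τ.v .lev = lev S v) (h3 : ∀ u, 0 ≤ τ.a .opt u) :
    At n S o nx K z v τ :=
  ⟨h.base.ef hef, h.le, h1, h2, h3, fun u hu => by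
    have := hS.lt v h.le u hu
    rw [hef.optf (by omega)]; exact h.opts u hu⟩

/-- Trying an option. -/
theorem try_option (hs : Stage C n S N cst o K z w) {v : ℕ} (h : At n S o nx K z v σ)
    (hm : σ.v .mode = 2) (hv1 : 1 ≤ v) (hv : optf σ v ∈ opts v) :
    Ok C (iteP (Exp.v .mode - 1) tryP scanP) σ (100 * n ^ 2 + 6) fun τ => At n S o nx K z v τ ∧
      ((wgt S N cst nx K z v (optf σ) ≠ 0 ∧ τ.v .mode = 1 ∧ τ.v .x = (v + 1 : ℕ) ∧
        optf τ v = optf σ v ∧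
        τ.a .acc (lev S v) = σ.a .acc (lev S v) ∧
        τ.a .prod (lev S v) = wgt S N cst nx K z v (optf σ)) ∨
      (wgt S N cst nx K z v (optf σ) = 0 ∧ τ.v .mode = 2 ∧ τ.a .opt v = optf σ v + 1 ∧
        τ.a .acc (lev S v) = σ.a .acc (lev S v))) ∧
      EF v (lev S v) (lev S v) σ τ := by
  have hl : lev S v = lev S (par S v) + 1 := lev_eq hs.chordal hv1 h.le
  have hv' := hv
  simp only [opts, Finset.mem_Icc] at hv'
  have hvn := h.le
  have hlam := (hs.lam_le hv1 h.le)
  refine Ok.ite (by decide) (by simp) (fun _ => ?_) (fun hc => by simp [hm] at hc)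
  refine Ok.ite (T := 100 * n ^ 2 + 4) (by decide) (by simp [h.v_eq]) (fun _ => ?_) (fun hc => by
    simp [h.v_eq, h.eq_optf] at hc; omega)
  refine Ok.seq (T := 100 * n ^ 2) (T' := 4) ((wtP_ok hs.toScene h.base hv1 h.le h.v_eq h.eq_optf
    h.opts hv (hlam.trans hs.fullBound_le)).mono le_rfl ?_)
  rintro τ - ⟨hf, hw⟩
  have hef := hf.ef (by decide) v n n
  have ev : τ.v .v = v := (hf.v _ (by decide)).trans h.v_eq
  have el : τ.v .lev = lev S v := (hf.v _ (by decide)).trans h.lev_eq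
  have em : τ.v .mode = 2 := (hf.v _ (by decide)).trans hm
  have hlev := lev_le_self hs.chordal v h.le
  have hsz : (0 : ℤ) < (τ.v .wt).natAbs.size ↔ τ.v .wt ≠ 0 := by
    have := Nat.size_eq_zero (n := (τ.v .wt).natAbs)
    have := Int.natAbs_eq_zero (a := τ.v .wt)
    rw [Nat.cast_pos, Nat.pos_iff_ne_zero]
    tauto
  refine Ok.ite (T := 3) (by decide) (by simp) (fun hc => ?_) (fun hc => ?_) <;>
    simp only [eval_size, eval_v, hsz] at hc
  · refine Ok.seq (T := 1) (T' := 2) (Ok.sto (by decide) (by decide) (by simp) (by simp)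
      (by simp [el]) ?_ ?_)
    · simp only [eval_v, el, Int.toNat_natCast, hw]
      exact (abs_wgt_le hs.chordal v _ hv1 h.le).trans (by
        exact_mod_cast hlam.trans (hs.prod_le v h.le))
    refine Ok.seq (T := 1) (T' := 1) (Ok.set (by decide) (by simp) ?_ ?_)
    · simp only [eval_add, eval_v, St.seta_v, ev, eval_one]
      exact_mod_cast hs.abs_nat_le (m := v + 1) (by omega)
    refine Ok.set (by decide) (by simp) (by simp; exact one_le_pow₀ (by norm_num)) ?_
    simp only [eval_v, eval_add, St.seta_v, Int.toNat_natCast, el, ev, eval_one]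
    have hef' : EF v (lev S v) (lev S v) τ (((τ.seta .prod (lev S v) (τ.v .wt)).setv .x (v + 1)).setv
        .mode 1) := by
      refine ⟨by simp, fun y hy => ?_, fun k h1 h2 h3 => ?_, fun u hu => ?_, fun i hi => ?_,
        fun i hi => ?_⟩
      · simp only [evalVars, List.mem_cons, not_or] at hy
        simp [hy]
      · funext i; simp [h3]
      · simp
      · simp
      · simp [hi.ne]
    have hef2 := hef.trans hef' (v'' := v) (a'' := lev S v) (p'' := lev S v) (by omega) (by omega)
      (by omega)
    refine ⟨⟨h.base.ef hef2, h.le, by simp [ev], by simp [el], fun u => ?_, fun u hu => ?_⟩,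
      .inl ⟨fun h => hc (hw.trans h), by simp, by simp, ?_, ?_, by simp [hw]⟩, hef2⟩
    · have := h.nonneg u
      simpa [hf.a] using this
    · have := hs.chordal.lt v h.le u hu
      rw [hef2.optf (by omega)]
      exact h.opts u hu
    · simp [optf, hf.a]
    · simp [hf.a]
  · rw [not_not] at hc
    have eo : τ.a .opt v = optf σ v := by rw [hf.a, h.eq_optf]
    refine Ok.mono (T := 1) (Ok.sto (by decide) (by decide) (by simp) (by simp [ev]) (by simp [ev])
      ?_ ?_) (by norm_num) fun _ _ h => h
    · have := hs.opt_le v hv1 h.le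
      simp only [eval_v, eval_add, eval_arr, ev, Int.toNat_natCast, eval_one, eo]
      rw [abs_of_nonneg (by positivity)]; omega
    simp only [eval_v, eval_add, eval_arr, Int.toNat_natCast, ev, eval_one, eo]
    have hef' : EF v (lev S v) (lev S v) τ (τ.seta .opt v (optf σ v + 1)) := by
      refine ⟨by simp, fun y hy => by simp, fun k h1 h2 h3 => ?_, fun u hu => ?_, fun i hi => ?_,
        fun i hi => ?_⟩
      · funext i; simp [h1]
      · simp [hu.ne]
      · simp
      · simp
    have hef2 := hef.trans hef' (v'' := v) (a'' := lev S v) (p'' := lev S v) (by omega) (by omega)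
      (by omega)
    refine ⟨⟨h.base.ef hef2, h.le, by simp [ev], by simp [el], fun u => ?_, fun u hu => ?_⟩,
      .inr ⟨hw.symm.trans hc, by simp [em], by simp, by simp [hf.a]⟩, hef2⟩
    · have := h.nonneg u
      simp only [St.seta_a, true_and]
      split
      · positivity
      · rw [hf.a]; exact this
    · have := hs.chordal.lt v h.le u hu
      rw [hef2.optf (by omega)]
      exact h.opts u hu

end RAM

/-! ### Correctness of the traversal -/

namespace RAM

open Elim

variable {C : Ctx} {n : ℕ} {S N : ℕ → Finset ℕ} {cst : ℕ → ℕ → ℕ} {o nx : ℕ → ℕ} {K z w : ℕ}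
  {σ τ : St} {φ : ℕ → ℕ}

/-- What the traversal does from the moment when it enters the vertex `v`, stated in terms of the
continuation: the value of the subtree is multiplied to the product at the level above. -/
def Enters (C : Ctx) (n : ℕ) (S N : ℕ → Finset ℕ) (cst : ℕ → ℕ → ℕ) (o nx : ℕ → ℕ) (K z w : ℕ)
    (v : ℕ) : Prop :=
  ∀ (σ : St) (T : ℕ) (Q : St → Prop), At n S o nx K z v σ → σ.v .mode = 2 → σ.a .opt v = 2 →
    σ.a .acc (lev S v) = 0 →
    |σ.a .prod (lev S v - 1)| * bound (lam n N K cst z) n S v ≤ fullBound n N K cst z →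
    (∀ τ, EF v (lev S v) (lev S v - 1) σ τ → τ.v .v = par S v → τ.v .lev = lev S (par S v) →
      (∀ u, 0 ≤ τ.a .opt u) → τ.v .mode = 1 → τ.v .x = (v + 1 : ℕ) →
      τ.a .prod (lev S v - 1) = σ.a .prod (lev S v - 1) * val n S N cst nx K z v (optf σ) →
      Ok C walkP τ T Q) →
    Ok C walkP σ (valTime n w S v + T) Q

/-- The traversal of the children of `v`. -/
theorem scan_ok (hs : Stage C n S N cst o K z w) {v : ℕ}
    (hE : ∀ x, v < x → x ≤ n → Enters C n S N cst o nx K z w x) (j : ℕ) :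
    ∀ (x : ℕ) (σ : St) (T : ℕ) (Q : St → Prop), n + 1 - x = j → v < x → x ≤ n + 1 →
    At n S o nx K z v σ → σ.v .mode = 1 → σ.v .x = x → (1 ≤ v → optf σ v ∈ opts v) →
    |σ.a .prod (lev S v)| * (∏ y ∈ rest n S v x, bound (lam n N K cst z) n S y : ℕ) ≤
      fullBound n N K cst z →
    (∀ τ, EF (v + 1) (lev S v + 1) (lev S v) σ τ → At n S o nx K z v τ → τ.v .mode = 1 →
      τ.v .x = (n + 1 : ℕ) →
      τ.a .prod (lev S v) =
        σ.a .prod (lev S v) * ∏ y ∈ rest n S v x, val n S N cst nx K z y (optf σ) →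
      Ok C walkP τ T Q) →
    Ok C walkP σ (scanTime n w S v x + T) Q := by
  have hn := hs.two_le
  induction j with
  | zero =>
    intro x σ T Q hj hvx hxn hat hm hx hv hb hk
    obtain rfl : x = n + 1 := by omega
    refine (hk σ ⟨rfl, fun _ _ => rfl, fun _ _ _ _ => rfl, fun _ _ => rfl, fun _ _ => rfl,
      fun _ _ => rfl⟩ hat hm hx (by rw [rest_end]; simp)).mono (by omega) fun _ _ h => h
  | succ j ih =>
    intro x σ T Q hj hvx hxn hat hm hx hv hb hk
    have hxn' : x ≤ n := by omega
    have hst : scanTime n w S v x = (20 + if par S x = v then valTime n w S x else 0) +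
        scanTime n w S v (x + 1) := by
      unfold scanTime; rw [Finset.sum_eq_sum_Ico_succ_bot (by omega)]
    by_cases hp : par S x = v
    · have hl : lev S x = lev S v + 1 := by rw [lev_eq hs.chordal (by omega) hxn', hp]
      have hlev := lev_le_self hs.chordal x hxn'
      have hmem : x ∈ children n S v := mem_children.2 ⟨⟨hvx, hxn'⟩, hp⟩
      have hB1 : 1 ≤ ∏ y ∈ rest n S v (x + 1), bound (lam n N K cst z) n S y :=
        Finset.one_le_prod' fun y hy => one_le_bound (one_le_lam (by omega)) (by
          have := (mem_children.1 (Finset.mem_filter.1 hy).1); omega)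
      rw [rest_insert hmem, Finset.prod_insert (notMem_rest v x)] at hb
      rw [hst, if_pos hp]
      refine Ok.mono (T := 8 + 1 + (valTime n w S x + (scanTime n w S v (x + 1) + T))) ?_ (by omega)
        fun _ _ h => h
      refine Ok.loop_step (by decide) (by simp) (by simp [hm]) ((scan_down hs hat hm hx hvx hxn' hp
        hv).mono le_rfl ?_)
      rintro τ - ⟨hat', hm', ho', ha', hef⟩
      have hpr : τ.a .prod (lev S v) = σ.a .prod (lev S v) := hef.prod _ (by omega)
      refine hE x hvx hxn' τ _ Q hat' hm' ho' ha' ?_ ?_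
      · rw [hl, Nat.add_sub_cancel, hpr]
        refine le_trans ?_ hb
        push_cast
        refine mul_le_mul_of_nonneg_left ?_ (abs_nonneg _)
        refine le_mul_of_one_le_right (by positivity) ?_
        exact_mod_cast hB1
      · intro ρ hef' hv' hlev' hnn hm'' hx'' hprod
        rw [hl, Nat.add_sub_cancel] at hprod hef'
        rw [hp] at hv' hlev'
        have hef2 := hef.trans hef' (v'' := x) (a'' := lev S v + 1) (p'' := lev S v) (by omega)
          (by omega) (by omega)
        have hat2 : At n S o nx K z v ρ := hat.ret hs.chordal hef2 hvx hv' hlev' hnn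
        have hφ : ∀ u < x, optf τ u = optf σ u := fun u hu => hef.optf hu
        have hval : val n S N cst nx K z x (optf τ) = val n S N cst nx K z x (optf σ) :=
          val_congr hs.toScene hxn' fun u hu => hφ u (hs.chordal.lt x hxn' u hu).2
        rw [hval, hpr] at hprod
        refine ih (x + 1) ρ T Q (by omega) (by omega) (by omega) hat2 hm'' hx'' (fun h1 => ?_) ?_ ?_
        · rw [hef2.optf hvx]; exact hv h1
        · rw [hprod, abs_mul, mul_assoc]
          refine le_trans (mul_le_mul_of_nonneg_left ?_ (abs_nonneg _)) hb
          push_cast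
          refine mul_le_mul_of_nonneg_right ?_ (by positivity)
          exact abs_val_le hs.toScene (by omega) hxn' _
        · intro ρ' hef3 hat3 hm3 hx3 hprod3
          refine hk ρ' (hef2.trans hef3 (by omega) (by omega) (by omega)) hat3 hm3 hx3 ?_
          rw [hprod3, hprod, rest_insert hmem, Finset.prod_insert (notMem_rest v x), mul_assoc]
          congr 2
          refine Finset.prod_congr rfl fun y hy => ?_
          obtain ⟨⟨h1, h2⟩, h3⟩ := mem_children.1 (Finset.mem_filter.1 hy).1
          refine val_congr hs.toScene h2 fun u hu => hef2.optf ?_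
          have := le_par hu
          omega
    · have hmem : x ∉ children n S v := fun h => hp (mem_children.1 h).2
      rw [rest_succ hmem] at hb hk
      rw [hst, if_neg hp]
      refine Ok.mono (T := 8 + 1 + (scanTime n w S v (x + 1) + T)) ?_ (by omega) fun _ _ h => h
      refine Ok.loop_step (by decide) (by simp) (by simp [hm]) ((scan_skip hs hat hm hx hvx hxn'
        hp).mono le_rfl ?_)
      rintro τ - rfl
      have hef : EF (v + 1) (lev S v + 1) (lev S v) σ (σ.setv .x (x + 1 : ℕ)) :=
        ((Fr.refl [.x] σ).setv _ _ (by simp)).ef (by decide) _ _ _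
      have hat2 : At n S o nx K z v (σ.setv .x (x + 1 : ℕ)) :=
        hat.ret hs.chordal hef (by omega) (by simp [hat.v_eq]) (by simp [hat.lev_eq]) hat.nonneg
      refine ih (x + 1) _ T Q (by omega) (by omega) (by omega) hat2 (by simp [hm]) (by simp) hv hb ?_
      intro ρ hef3 hat3 hm3 hx3 hprod3
      exact hk ρ (hef.trans hef3 (by omega) (by omega) (by omega)) hat3 hm3 hx3 hprod3

/-- The contribution of an option to the value of the subtree of `v`. -/
def term (n : ℕ) (S N : ℕ → Finset ℕ) (cst : ℕ → ℕ → ℕ) (nx : ℕ → ℕ) (K z v : ℕ) (φ : ℕ → ℕ)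
    (p : ℕ) : ℤ :=
  wgt S N cst nx K z v (Function.update φ v p) *
    ∏ x ∈ children n S v, val n S N cst nx K z x (Function.update φ v p)

theorem abs_term_le (hs : Scene C n S N cst o) {v : ℕ} (hv1 : 1 ≤ v) (hv : v ≤ n) (p : ℕ) :
    |term n S N cst nx K z v φ p| ≤ (lam n N K cst z v *
      ∏ x ∈ children n S v, bound (lam n N K cst z) n S x : ℕ) := by
  rw [term, abs_mul, Finset.abs_prod]
  push_cast
  refine mul_le_mul (abs_wgt_le hs.chordal v _ hv1 hv) ?_
    (Finset.prod_nonneg fun _ _ => abs_nonneg _) (by positivity)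
  exact Finset.prod_le_prod (fun _ _ => abs_nonneg _) fun x hx => by
    have := mem_children.1 hx
    exact abs_val_le hs (by omega) (by omega) _

/-- The time for the options of `v` from `p` on. -/
def restTime (n w : ℕ) (S N : ℕ → Finset ℕ) (cst : ℕ → ℕ → ℕ) (nx : ℕ → ℕ) (K z v : ℕ)
    (φ : ℕ → ℕ) (p : ℕ) : ℕ :=
  ∑ q ∈ Finset.Ico p (2 * v + 2), (optTime n +
    if wgt S N cst nx K z v (Function.update φ v q) ≠ 0 then scanTime n w S v (v + 1) else 0)

theorem restTime_le (hs : Stage C n S N cst o K z w) {v : ℕ} (hv : v ≤ n) (φ : ℕ → ℕ) :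
    restTime n w S N cst nx K z v φ 2 + 20 ≤ valTime n w S v := by
  have h1 : Finset.Ico 2 (2 * v + 2) = opts v := by ext; simp [opts]; omega
  have h2 := card_wgt_ne_zero (cst := cst) (nx := nx) (K := K) (z := z) (N := N) hs.chordal hv
    (hs.card_le v hv) φ
  have h3 := scanTime_le (n := n) (w := w) (S := S) v
  have hw := hs.one_le_w
  rw [restTime, h1, Finset.sum_add_distrib, ← Finset.sum_filter, Finset.sum_const, Finset.sum_const,
    card_opts, smul_eq_mul, smul_eq_mul, valTime, subtime_eq]
  have h4 : 2 * v * optTime n ≤ 2 * n * optTime n := Nat.mul_le_mul_right _ (by omega)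
  have h5 : ((opts v).filter fun p => wgt S N cst nx K z v (Function.update φ v p) ≠ 0).card *
      scanTime n w S v (v + 1) ≤ 4 * w * (20 * n + ∑ x ∈ children n S v, valTime n w S x) :=
    Nat.mul_le_mul (h2.trans (by omega)) h3
  have h6 : 4 * w * (20 * n + ∑ x ∈ children n S v, valTime n w S x) ≤
      4 * w * (20 * n + 20) + 4 * w * ∑ x ∈ children n S v, valTime n w S x := by
    rw [← Nat.mul_add]; exact Nat.mul_le_mul_left _ (by omega)
  unfold valTime at *
  omega

/-- The traversal of the subtree of `v`, from the option `p` of `v` on. -/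
theorem options_ok (hs : Stage C n S N cst o K z w) {v : ℕ} (hv1 : 1 ≤ v) (hvn : v ≤ n)
    (hE : ∀ x, v < x → x ≤ n → Enters C n S N cst o nx K z w x) (σ₀ : St) (T : ℕ) (Q : St → Prop)
    (hb : |σ₀.a .prod (lev S v - 1)| * bound (lam n N K cst z) n S v ≤ fullBound n N K cst z)
    (hk : ∀ τ, EF v (lev S v) (lev S v - 1) σ₀ τ → τ.v .v = par S v → τ.v .lev = lev S (par S v) →
      (∀ u, 0 ≤ τ.a .opt u) → τ.v .mode = 1 → τ.v .x = (v + 1 : ℕ) →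
      τ.a .prod (lev S v - 1) = σ₀.a .prod (lev S v - 1) * val n S N cst nx K z v (optf σ₀) →
      Ok C walkP τ T Q) (j : ℕ) : ∀ (p : ℕ) (σ : St), 2 * v + 2 - p = j → 2 ≤ p → p ≤ 2 * v + 2 →
    EF v (lev S v) (lev S v) σ₀ σ → At n S o nx K z v σ → σ.v .mode = 2 → σ.a .opt v = p →
    σ.a .acc (lev S v) = ∑ q ∈ Finset.Ico 2 p, term n S N cst nx K z v (optf σ₀) q →
    Ok C walkP σ (restTime n w S N cst nx K z v (optf σ₀) p + 20 + T) Q := by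
  have hn := hs.two_le
  have hl : lev S v = lev S (par S v) + 1 := lev_eq hs.chordal hv1 hvn
  have hB1 : 1 ≤ ∏ y ∈ children n S v, bound (lam n N K cst z) n S y :=
    Finset.one_le_prod' fun y hy => one_le_bound (one_le_lam (by omega)) (by
      have := (mem_children.1 hy); omega)
  have hbv := bound_le hs.chordal (g := lam n N K cst z) (one_le_lam (by omega)) hv1 hvn
  have hbe := bound_eq (lam n N K cst z) (n := n) (S := S) v
  set B := lam n N K cst z v * ∏ x ∈ children n S v, bound (lam n N K cst z) n S x with hBdef
  have hsum : ∀ p, p ≤ 2 * v + 2 →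
      |∑ q ∈ Finset.Ico 2 p, term n S N cst nx K z v (optf σ₀) q| ≤ (fullBound n N K cst z : ℕ) := by
    intro p hp
    refine (Finset.abs_sum_le_sum_abs _ _).trans ((Finset.sum_le_card_nsmul _ _ _ fun q _ =>
      abs_term_le hs.toScene hv1 hvn q).trans ?_)
    rw [nsmul_eq_mul, ← Nat.cast_mul, Nat.card_Ico]
    norm_cast
    refine le_trans ?_ hbv
    rw [hbe]
    exact Nat.mul_le_mul_right _ (by omega)
  induction j with
  | zero =>
    intro p σ hj h2 hp hef hat hm ho ha
    obtain rfl : p = 2 * v + 2 := by omega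
    have hval : ∑ q ∈ Finset.Ico 2 (2 * v + 2), term n S N cst nx K z v (optf σ₀) q =
        val n S N cst nx K z v (optf σ₀) := by
      have h1 : Finset.Ico 2 (2 * v + 2) = opts v := by ext; simp [opts]; omega
      rw [h1, val, subval_eq]; rfl
    have hpr : σ.a .prod (lev S v - 1) = σ₀.a .prod (lev S v - 1) := hef.prod _ (by omega)
    rw [hval] at ha
    refine Ok.mono (T := 7 + 1 + T) ?_ (by omega) fun _ _ h => h
    refine Ok.loop_step (by decide) (by simp) (by simp [hm]) ((try_back hs hat hm hv1 (by
      rw [ho]; push_cast; ring) ?_).mono le_rfl ?_)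
    · rw [hpr, ha, abs_mul]
      exact (mul_le_mul_of_nonneg_left (abs_val_le hs.toScene hv1 hvn _) (abs_nonneg _)).trans hb
    · rintro τ - ⟨⟨h1, h2, h3⟩, h4, h5, h6, h7⟩
      refine hk τ (hef.trans h7 (by omega) (by omega) (by omega)) h1 h2 h3 h4 h5 ?_
      rw [h6, hpr, ha]
  | succ j ih =>
    intro p σ hj h2 hp hef hat hm ho ha
    have hop : optf σ v = p := by simp [optf, ho]
    have hpm : p ∈ opts v := by simp only [opts, Finset.mem_Icc]; omega
    have hφ : ∀ u ≤ v, optf σ u = Function.update (optf σ₀) v p u := by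
      intro u hu
      by_cases h : u = v
      · subst h; simp [hop]
      · rw [Function.update_of_ne h, hef.optf (by omega)]
    have hlt := hs.chordal.lt v hvn
    have hw : wgt S N cst nx K z v (optf σ) =
        wgt S N cst nx K z v (Function.update (optf σ₀) v p) :=
      loc_congr (n := n) (fun v _ => hs.sub v) v hvn _ _
        (fun u hu => hφ u (hlt u hu).2.le) (hφ v le_rfl)
    have hrt : restTime n w S N cst nx K z v (optf σ₀) p = (optTime n +
        if wgt S N cst nx K z v (Function.update (optf σ₀) v p) ≠ 0 then scanTime n w S v (v + 1)
        else 0) + restTime n w S N cst nx K z v (optf σ₀) (p + 1) := by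
      unfold restTime; rw [Finset.sum_eq_sum_Ico_succ_bot (by omega)]
    have hss : ∑ q ∈ Finset.Ico 2 (p + 1), term n S N cst nx K z v (optf σ₀) q =
        (∑ q ∈ Finset.Ico 2 p, term n S N cst nx K z v (optf σ₀) q) +
          term n S N cst nx K z v (optf σ₀) p := Finset.sum_Ico_succ_top h2 _
    have hbp := hsum (p + 1) (by omega)
    rw [hss] at hbp
    rw [hrt]
    refine Ok.mono (T := 100 * n ^ 2 + 6 + 1 + ((if wgt S N cst nx K z v
      (Function.update (optf σ₀) v p) ≠ 0 then scanTime n w S v (v + 1) + 7 else 0) +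
      (restTime n w S N cst nx K z v (optf σ₀) (p + 1) + 20 + T))) ?_
      (by unfold optTime; split <;> omega) fun _ _ h => h
    refine Ok.loop_step (by decide) (by simp) (by simp [hm]) ((try_option hs hat hm hv1 (by
      rw [hop]; exact hpm)).mono le_rfl ?_)
    rintro τ - ⟨hat', (⟨hw0, hm', hx', ho', ha', hp'⟩ | ⟨hw0, hm', ho', ha'⟩), hef'⟩
    · rw [hw] at hw0 hp'
      rw [if_pos hw0]
      have hopt' : optf τ v = p := by rw [ho', hop]
      have hφ' : ∀ u ≤ v, optf τ u = Function.update (optf σ₀) v p u := by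
        intro u hu
        by_cases h : u = v
        · subst h; simp [hopt']
        · rw [hef'.optf (by omega), hφ u hu]
      refine Ok.mono (T := scanTime n w S v (v + 1) + (6 + 1 + (restTime n w S N cst nx K z v (optf σ₀)
        (p + 1) + 20 + T))) ?_ (by omega) fun _ _ h => h
      refine scan_ok hs hE _ (v + 1) τ _ Q rfl (by omega) (by omega) hat' hm' hx' (fun _ => by
        rw [hopt']; exact hpm) ?_ ?_
      · rw [hp', rest_start]
        refine (mul_le_mul_of_nonneg_right (abs_wgt_le hs.chordal v _ hv1 hvn) (by positivity)).trans ?_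
        norm_cast
        refine le_trans ?_ hbv
        rw [hbe]
        exact Nat.le_mul_of_pos_left _ (by omega)
      · intro ρ hefρ hatρ hmρ hxρ hpρ
        have hterm : ρ.a .prod (lev S v) = term n S N cst nx K z v (optf σ₀) p := by
          rw [hpρ, hp', rest_start, term]
          congr 1
          refine Finset.prod_congr rfl fun y hy => ?_
          obtain ⟨⟨h1, h2⟩, h3⟩ := mem_children.1 hy
          refine val_congr hs.toScene h2 fun u hu => hφ' u ?_
          have := le_par hu
          omega
        have haρ : ρ.a .acc (lev S v) =
            ∑ q ∈ Finset.Ico 2 p, term n S N cst nx K z v (optf σ₀) q := by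
          rw [hefρ.acc _ (by omega), ha', ha]
        have hoρ : optf ρ v = p := by rw [hefρ.optf (by omega), hopt']
        refine Ok.loop_step (by decide) (by simp) (by simp [hmρ]) ((scan_up hs hatρ hmρ hxρ hv1 (by
          rw [hoρ]; exact hpm) ?_).mono le_rfl ?_)
        · rw [hterm, haρ]; exact hbp
        · rintro ρ' - ⟨hat2, hm2, ho2, ha2, hef2⟩
          refine ih (p + 1) ρ' (by omega) (by omega) (by omega) ?_ hat2 hm2 (by
            rw [ho2, hoρ]; push_cast; ring) (by rw [ha2, haρ, hterm, hss])
          exact ((hef.trans hef' (v'' := v) (a'' := lev S v) (p'' := lev S v) (by omega) (by omega)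
            (by omega)).trans hefρ (v'' := v) (a'' := lev S v) (p'' := lev S v) (by omega) (by omega)
            (by omega)).trans hef2 (by omega) (by omega) (by omega)
    · rw [hw] at hw0
      have hterm : term n S N cst nx K z v (optf σ₀) p = 0 := by rw [term, hw0, zero_mul]
      rw [if_neg (by simpa using hw0), zero_add]
      refine ih (p + 1) τ (by omega) (by omega) (by omega)
        (hef.trans hef' (by omega) (by omega) (by omega)) hat' hm' (by
        rw [ho', hop]; push_cast; ring) (by rw [ha', ha, hss, hterm, add_zero])

/-- Induction from the leaves of the elimination forest towards its roots. -/
theorem enters_ok (hs : Stage C n S N cst o K z w) {v : ℕ} (hv1 : 1 ≤ v) (hvn : v ≤ n) :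
    Enters C n S N cst o nx K z w v := by
  have key : ∀ k v, 1 ≤ v → v ≤ n → n + 1 - v ≤ k → Enters C n S N cst o nx K z w v := by
    intro k
    induction k with
    | zero => intro v _ _ _; omega
    | succ k ih =>
      intro v hv1 hvn hk σ T Q hat hm ho ha hb hcont
      refine (options_ok hs hv1 hvn (fun x h1 h2 => ih x (by omega) h2 (by omega)) σ T Q hb hcont _ 2 σ
        rfl le_rfl (by omega) ⟨rfl, fun _ _ => rfl, fun _ _ _ _ => rfl, fun _ _ => rfl,
        fun _ _ => rfl, fun _ _ => rfl⟩ hat hm (by exact_mod_cast ho) (by simpa using ha)).mono ?_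
        fun _ _ h => h
      have := restTime_le (nx := nx) hs hvn (optf σ)
      omega
  exact key _ v hv1 hvn le_rfl

/-- The time for the whole traversal. -/
def evalTime (n w d : ℕ) : ℕ :=
  n * ((4 * w) ^ d * (2 * n * optTime n + 4 * w * (20 * n + 20) + 20)) + 20 * n + 20

/-- The traversal is started at the virtual root `0`, which has no options of its own. -/
theorem evalP_ok (hs : Stage C n S N cst o K z w) (hb : Base n S o nx K z σ) {d : ℕ}
    (hd : ∀ v ≤ n, lev S v ≤ d) (hopt : ∀ u, 0 ≤ σ.a .opt u) :
    Ok C evalP σ (evalTime n w d) fun τ => EF 0 0 0 σ τ ∧ (∀ u, 0 ≤ τ.a .opt u) ∧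
      τ.a .prod 0 = ∏ x ∈ children n S 0, val n S N cst nx K z x (fun _ => 0) := by
  have hn := hs.two_le
  have hS0 : S 0 = ∅ := by
    rw [Finset.eq_empty_iff_forall_notMem]; intro u hu
    have := hs.chordal.lt 0 (by omega) u hu; omega
  have hl0 := lev_zero S
  have h1β : |(1 : ℤ)| ≤ 2 ^ C.β := by rw [abs_one]; exact one_le_pow₀ (by norm_num)
  have hfull : 1 ≤ fullBound n N K cst z := (one_le_lam (by omega) 1).trans (hs.lam_le le_rfl (by omega))
  have hp0 := hs.prod_le 0 (by omega)
  rw [hl0] at hp0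
  refine Ok.mono (T := 1 + (1 + (1 + (1 + (1 + (scanTime n w S 0 1 + (4 + 1 + 1))))))) ?_ ?_
    fun _ _ h => h
  swap
  · have h1 := scanTime_le (n := n) (w := w) (S := S) 0
    have h2 := sum_subtime_le (n := n) (S := S) hs.chordal (A := 2 * n * optTime n + 4 * w * (20 * n + 20) + 20)
      (B := 4 * w) (by have := hs.one_le_w; omega) hd
    unfold evalTime
    unfold valTime at h1
    rw [zero_add] at h1
    omega
  refine Ok.seq (Ok.set (by decide) (by simp) (by simp) ?_)
  refine Ok.seq (Ok.set (by decide) (by simp) (by simp) ?_)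
  refine Ok.seq (Ok.set (by decide) (by simp) (by simpa using h1β) ?_)
  refine Ok.seq (Ok.sto (by decide) (by decide) (by simp) (by simp) (by simp) ?_ ?_)
  · simp; omega
  refine Ok.seq (Ok.set (by decide) (by simp) (by simpa using h1β) ?_)
  simp only [eval_zero, eval_one, Int.toNat_zero]
  set σ₁ : St := ((((σ.setv .lev 0).setv .v 0).setv .x 1).seta .prod 0 1).setv .mode 1 with hσ₁
  have hef : EF n n 0 σ σ₁ := by
    refine ⟨by simp [hσ₁], fun y hy => ?_, fun k h1 h2 h3 => ?_, fun u hu => by simp [hσ₁],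
      fun i hi => by simp [hσ₁], fun i hi => by omega⟩
    · simp only [evalVars, List.mem_cons, not_or] at hy
      simp [hσ₁, hy]
    · funext i; simp [hσ₁, h3]
  have hat : At n S o nx K z 0 σ₁ := ⟨hb.ef hef, by omega, by simp [hσ₁], by simp [hσ₁, hl0],
    fun u => by simpa [hσ₁] using hopt u, fun u hu => by simp [hS0] at hu⟩
  refine scan_ok hs (fun x h1 h2 => enters_ok hs h1 h2) _ 1 σ₁ _ _ rfl (by omega) (by omega) hat
    (by simp [hσ₁]) (by simp [hσ₁]) (by omega) ?_ ?_
  · rw [hl0]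
    have : rest n S 0 1 = children n S 0 := rest_start 0
    rw [this, prod_children_zero hs.chordal]
    simp [hσ₁, fullBound]
  · intro τ hefτ hatτ hmτ hxτ hpτ
    refine Ok.loop_step (by decide) (by simp) (by simp [hmτ]) (Ok.ite (T := 3) (by decide) (by simp)
      (fun hc => by simp [hmτ] at hc) fun _ => ?_)
    refine Ok.ite (T := 2) (by decide) (by simp) (fun hc => by simp [hatτ.base.n_eq, hxτ] at hc)
      fun _ => ?_
    refine Ok.ite (T := 1) (by decide) (by simp) (fun hc => by simp [hatτ.lev_eq, hl0] at hc)
      fun _ => ?_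
    refine Ok.set (by decide) (by simp) (by simp) ?_
    refine Ok.loop_done (by decide) (by simp) (by simp) ⟨?_, fun u => by simpa using hatτ.nonneg u, ?_⟩
    · exact (hef.trans hefτ (v'' := 0) (a'' := 0) (p'' := 0) (by omega) (by omega) (by omega)).trans
        (((Fr.refl [.mode] τ).setv .mode (Exp.eval C.inp τ 0) (by simp)).ef (by decide) 0 0 0)
        (by omega) (by omega) (by omega)
    · rw [hl0] at hpτ
      have h1 : rest n S 0 1 = children n S 0 := rest_start 0
      rw [h1] at hpτ
      simp only [St.setv_a, hpτ]
      rw [show σ₁.a .prod 0 = 1 by simp [hσ₁], one_mul]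
      refine Finset.prod_congr rfl fun x hx => ?_
      obtain ⟨⟨h1, h2⟩, h3⟩ := mem_children.1 hx
      refine val_congr hs.toScene h2 fun u hu => ?_
      have := le_par hu
      have := hs.chordal.lt x h2 u hu
      omega

end RAM

/-! ### The weighted count of Hamiltonian cycles -/

namespace RAM

open Elim

/-- The setting for the sum over the values of the forest for `z = 1, …, M`, with a bound `F` for
these values. -/
structure Arena (C : Ctx) (n : ℕ) (S N : ℕ → Finset ℕ) (cst : ℕ → ℕ → ℕ) (o : ℕ → ℕ) (K w M F : ℕ) :
    Prop where
  stage : ∀ z, 1 ≤ z → z ≤ M → Stage C n S N cst o K z w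
  full_le : ∀ z, 1 ≤ z → z ≤ M → fullBound n N K cst z ≤ F
  sum_le : M * (2 ^ M * F) ≤ 2 ^ C.β
  pow_le : (2 * M) ^ n ≤ 2 ^ C.β
  one_le : 1 ≤ M

/-- The data for the evaluation are in the memory. -/
def Stored (n : ℕ) (S : ℕ → Finset ℕ) (o nx : ℕ → ℕ) (K : ℕ) (σ : St) : Prop :=
  ∀ z : ℕ, Base n S o nx K z (σ.setv .z z)

/-- The variables that change when the sum is computed. -/
def solveVars : List Var := [.z, .T, .b, .q, .i] ++ evalVars

/-- The changes between two states in the computation of the sum. -/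
structure SF (σ τ : St) : Prop where
  out : τ.out = σ.out
  var : ∀ x, x ∉ solveVars → τ.v x = σ.v x
  arr : ∀ k, k ≠ .opt → k ≠ .acc → k ≠ .prod → τ.a k = σ.a k

theorem SF.trans {σ τ ρ : St} (h : SF σ τ) (h' : SF τ ρ) : SF σ ρ where
  out := h'.out.trans h.out
  var x hx := (h'.var x hx).trans (h.var x hx)
  arr k h4 h5 h6 := (h'.arr k h4 h5 h6).trans (h.arr k h4 h5 h6)

theorem SF.refl (σ : St) : SF σ σ := ⟨rfl, fun _ _ => rfl, fun _ _ _ _ => rfl⟩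

theorem SF.setv {σ τ : St} (h : SF σ τ) (x : Var) (y : ℤ) (hx : x ∈ solveVars) :
    SF σ (τ.setv x y) where
  out := h.out
  var u hu := by
    rw [St.setv_v, if_neg (by rintro rfl; exact hu hx), h.var u hu]
  arr := h.arr

theorem EF.sf {v a p : ℕ} {σ τ : St} (h : EF v a p σ τ) : SF σ τ :=
  ⟨h.out, fun x hx => h.var x fun h' => hx (List.mem_append_right _ h'), h.arr⟩

variable {C : Ctx} {n : ℕ} {S N : ℕ → Finset ℕ} {cst : ℕ → ℕ → ℕ} {o nx : ℕ → ℕ} {K z w M F : ℕ}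
  {σ τ : St} {φ : ℕ → ℕ}

theorem Stored.sf (h : Stored n S o nx K σ) (hf : SF σ τ) : Stored n S o nx K τ := fun z => by
  have hb := h z
  have e1 := hf.arr .S (by decide) (by decide) (by decide)
  have e2 := hf.arr .ord (by decide) (by decide) (by decide)
  have e3 := hf.arr .par (by decide) (by decide) (by decide)
  have e4 := hf.arr .nxt (by decide) (by decide) (by decide)
  refine ⟨?_, ?_, by simp, ?_, ?_, ?_, ?_⟩
  · have := hb.n_eq
    simpa [hf.var .n (by decide)] using this
  · have := hb.K_eq
    simpa [hf.var .K (by decide)] using this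
  · simpa [e1] using hb.S_eq
  · simpa [e2] using hb.ord_eq
  · simpa [e3] using hb.par_eq
  · simpa [e4] using hb.nxt_eq

theorem Stored.base (h : Stored n S o nx K σ) (hz : σ.v .z = z) : Base n S o nx K z σ := by
  have hb := h z
  have e : σ.setv .z z = σ := by
    rw [← hz]; simp [St.setv]
  rwa [e] at hb

/-- The value of the whole forest. -/
abbrev forest (n : ℕ) (S N : ℕ → Finset ℕ) (cst : ℕ → ℕ → ℕ) (nx : ℕ → ℕ) (K z : ℕ) : ℤ :=
  ∏ x ∈ children n S 0, val n S N cst nx K z x (fun _ => 0)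

theorem Arena.abs_forest_le (h : Arena C n S N cst o K w M F) (hz1 : 1 ≤ z) (hz : z ≤ M) :
    |forest n S N cst nx K z| ≤ F := by
  have hs := h.stage z hz1 hz
  unfold forest
  rw [Finset.abs_prod]
  refine (Finset.prod_le_prod (fun _ _ => abs_nonneg _) fun x hx => abs_val_le hs.toScene
    (by have := mem_children.1 hx; omega) (by have := mem_children.1 hx; omega) _).trans ?_
  rw [← Nat.cast_prod, prod_children_zero hs.chordal]
  exact_mod_cast h.full_le z hz1 hz

/-- The sum, in `T`: the number of Hamiltonian cycles, weighted by powers of `2 ^ K`. -/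
def solveP : Prog :=
  setP .T 0 ;; setP .b (0 - 1) ;;
  forP .z 1 (Exp.v .M + 1)
    (setP .b (0 - Exp.v .b * (Exp.v .M - Exp.v .z + 1) / Exp.v .z) ;; evalP ;; setP .q 1 ;;
      forP .i 0 (Exp.v .n) (setP .q (Exp.v .q * (2 * Exp.v .z))) ;;
      setP .T (Exp.v .T + Exp.v .b * (Exp.arr .prod 0 / Exp.v .q)))

/-- The time for the sum. -/
def solveTime (n w d M : ℕ) : ℕ := M * (evalTime n w d + 3 * n + 10) + 5

/-- The signed binomial coefficients satisfy a recursion. -/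
theorem choose_step (M j : ℕ) (hj : j < M) :
    0 - ((-1) ^ (j + 1) * (M.choose j : ℤ)) * ((M : ℤ) - (1 + j : ℕ) + 1) / (1 + j : ℕ) =
      (-1) ^ (j + 1 + 1) * (M.choose (j + 1) : ℤ) := by
  have h1 := Nat.choose_succ_right_eq M j
  have h2 : (M.choose (j + 1) : ℤ) * (j + 1) = M.choose j * (M - j) := by
    have : ((M - j : ℕ) : ℤ) = (M : ℤ) - j := by omega
    rw [← this]; exact_mod_cast h1
  have h3 : ((-1) ^ (j + 1) * (M.choose j : ℤ)) * ((M : ℤ) - (1 + j : ℕ) + 1) =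
      ((-1) ^ (j + 1) * (M.choose (j + 1) : ℤ)) * (1 + j : ℕ) := by
    push_cast
    linear_combination (-(-1 : ℤ) ^ (j + 1)) * h2
  rw [h3, Int.mul_ediv_cancel _ (by push_cast; positivity)]
  ring

/-- The signed binomial coefficients, in `b`, and the powers, in `q`, are updated on the way, so that only
one value of the forest is in memory at a time. -/
theorem solveP_ok (hA : Arena C n S N cst o K w M F) (hb : Stored n S o nx K σ) {d : ℕ}
    (hd : ∀ v ≤ n, lev S v ≤ d) (hopt : ∀ u, 0 ≤ σ.a .opt u) (hM : σ.v .M = M) :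
    Ok C solveP σ (solveTime n w d M) fun τ => SF σ τ ∧ (∀ u, 0 ≤ τ.a .opt u) ∧
      τ.v .T = combine n M fun j => forest n S N cst nx K j := by
  have hM1 := hA.one_le
  have hs1 := hA.stage 1 le_rfl hM1
  have hn := hs1.two_le
  have hF1 : 1 ≤ F := ((one_le_lam (n := n) (N := N) (K := K) (cst := cst) (z := 1) (by omega) 1).trans
    (hs1.lam_le le_rfl (by omega))).trans (hA.full_le 1 le_rfl hM1)
  have hMp : 2 ^ M ≤ 2 ^ C.β := by
    refine le_trans ?_ hA.sum_le
    calc 2 ^ M = 1 * (2 ^ M * 1) := by ring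
      _ ≤ _ := Nat.mul_le_mul hM1 (Nat.mul_le_mul_left _ hF1)
  have hMp' : ((2 ^ M : ℕ) : ℤ) ≤ 2 ^ C.β := by exact_mod_cast hMp
  have hMlt : M < 2 ^ M := Nat.lt_two_pow_self
  have h1β : |(1 : ℤ)| ≤ 2 ^ C.β := by rw [abs_one]; exact one_le_pow₀ (by norm_num)
  have hchoose : ∀ j, |(-1) ^ (j + 1) * (M.choose j : ℤ)| ≤ ((2 ^ M : ℕ) : ℤ) := by
    intro j
    rw [abs_mul, abs_pow, abs_neg, abs_one, one_pow, one_mul, Nat.abs_cast]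
    exact_mod_cast Nat.choose_le_two_pow M j
  have hT : ∀ i ≤ M, |∑ j ∈ Finset.Icc 1 i, (-1 : ℤ) ^ (j + 1) * M.choose j *
      (forest n S N cst nx K j / (2 * j) ^ n)| ≤ 2 ^ C.β := by
    intro i hi
    refine (Finset.abs_sum_le_sum_abs _ _).trans ((Finset.sum_le_card_nsmul _ _
      ((2 ^ M * F : ℕ) : ℤ) fun j hj => ?_).trans ?_)
    · have hj' := Finset.mem_Icc.1 hj
      rw [abs_mul, Nat.cast_mul]
      refine mul_le_mul (hchoose j) ?_ (abs_nonneg _) (by positivity)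
      exact (Int.abs_ediv_le_abs _ _).trans (hA.abs_forest_le hj'.1 (by omega))
    · rw [nsmul_eq_mul, ← Nat.cast_mul]
      have : (Finset.Icc 1 i).card * (2 ^ M * F) ≤ 2 ^ C.β :=
        (Nat.mul_le_mul_right _ (by simpa using hi)).trans hA.sum_le
      exact_mod_cast this
  refine Ok.mono (T := 1 + (1 + (M * ((1 + (evalTime n w d + (1 + ((n * (1 + 2) + 2) + 1)))) + 2) + 2)))
    ?_ ?_ fun _ _ h => h
  swap
  · unfold solveTime
    have : 1 + (evalTime n w d + (1 + (n * (1 + 2) + 2 + 1))) + 2 ≤ evalTime n w d + 3 * n + 10 := by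
      omega
    have := Nat.mul_le_mul_left M this
    omega
  refine Ok.seq (Ok.set (by decide) (by simp) (by simp) ?_)
  refine Ok.seq (Ok.set (by decide) (by simp) (by simpa using h1β) ?_)
  refine (Ok.for (s := 1) (m := M) (by decide) (by decide) (by simp) (by simp) ?_
    (fun i τ => SF σ τ ∧ (∀ u, 0 ≤ τ.a .opt u) ∧ τ.v .z = ((1 + i : ℕ) : ℤ) ∧
      τ.v .b = (-1) ^ (i + 1) * (M.choose i : ℤ) ∧
      τ.v .T = ∑ j ∈ Finset.Icc 1 i, (-1 : ℤ) ^ (j + 1) * M.choose j *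
        (forest n S N cst nx K j / (2 * j) ^ n)) ?_ ?_ ?_).mono le_rfl ?_
  · refine le_trans ?_ hMp'; exact_mod_cast (by omega)
  · exact ⟨(((SF.refl σ).setv _ _ (by decide)).setv _ _ (by decide)).setv _ _ (by decide),
      by simpa using hopt, by simp, by simp, by simp⟩
  · rintro i τ - ⟨hf, -, hz, -⟩
    refine ⟨by simp, ?_, hz⟩
    simp [hf.var .M (by decide), hM]; ring
  · rintro i τ hi ⟨hf, hopt, hz, hbb, hTT⟩ - -
    have eM : τ.v .M = M := (hf.var _ (by decide)).trans hM
    have e1 : (0 - Exp.v .b * (Exp.v .M - Exp.v .z + 1) / Exp.v .z).eval C.inp τ =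
        (-1) ^ (i + 1 + 1) * (M.choose (i + 1) : ℤ) := by
      rw [← choose_step M i hi]
      simp only [eval_sub, eval_zero, eval_div, eval_mul, eval_v, eval_add, eval_one, hbb, eM, hz]
    refine Ok.seq (Ok.set (by decide) (by simp) ?_ ?_) <;> rw [e1]
    · exact (hchoose (i + 1)).trans hMp'
    set τ₁ := τ.setv .b ((-1) ^ (i + 1 + 1) * (M.choose (i + 1) : ℤ)) with hτ₁
    have hf1 : SF σ τ₁ := hf.setv _ _ (by decide)
    have hz1 : τ₁.v .z = ((1 + i : ℕ) : ℤ) := by simpa [hτ₁] using hz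
    have hs := hA.stage (1 + i) (by omega) (by omega)
    refine Ok.seq ((evalP_ok hs ((hb.sf hf1).base hz1) hd (by simpa [hτ₁] using hopt)).mono le_rfl ?_)
    rintro ρ - ⟨hef, hopt2, hP⟩
    have hf2 := hf1.trans hef.sf
    have hz2 : ρ.v .z = ((1 + i : ℕ) : ℤ) := (hef.var _ (by decide)).trans hz1
    have hb2 : ρ.v .b = (-1) ^ (i + 1 + 1) * (M.choose (i + 1) : ℤ) :=
      (hef.var _ (by decide)).trans (by simp [hτ₁])
    have hT2 := (hef.var .T (by decide)).trans (show τ₁.v .T = _ by simpa [hτ₁] using hTT)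
    have hn2 : ρ.v .n = n := ((hb.sf hf2).base hz2).n_eq
    refine Ok.seq (Ok.set (by decide) (by simp) (by simpa using h1β) ?_)
    refine Ok.seq (Ok.mono (T := n * (1 + 2) + 2) (Ok.for (x := .i) (s := 0) (m := n) (by decide)
      (by decide) (by simp) (by simp) ?_
      (fun l τ' => SF σ τ' ∧ τ'.a = ρ.a ∧ τ'.v .i = ((0 + l : ℕ) : ℤ) ∧ τ'.v .z = ρ.v .z ∧
        τ'.v .b = ρ.v .b ∧ τ'.v .T = ρ.v .T ∧ τ'.v .q = (2 * (1 + i : ℕ) : ℤ) ^ l) ?_ ?_ ?_) le_rfl ?_)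
    · exact hs1.nat_le (by omega)
    · exact ⟨(hf2.setv _ _ (by decide)).setv _ _ (by decide), rfl, by simp, by simp, by simp, by simp,
        by simp⟩
    · rintro l τ' - ⟨hf', -, hi', -⟩
      refine ⟨by simp, ?_, hi'⟩
      simp [hf'.var .n (by decide)]
      rw [← hf2.var .n (by decide), hn2]
    · rintro l τ' hl ⟨hf', ha', hi', hz', hb', hT', hq'⟩ - -
      have e2 : (Exp.v .q * (2 * Exp.v .z)).eval C.inp τ' = (2 * (1 + i : ℕ) : ℤ) ^ (l + 1) := by
        simp [hq', hz', hz2, pow_succ]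
      refine Ok.set (by decide) (by simp) ?_ ?_ <;> rw [e2]
      · have h1 : (2 * (1 + i)) ^ (l + 1) ≤ (2 * M) ^ n :=
          (Nat.pow_le_pow_left (by omega) _).trans (Nat.pow_le_pow_right (by omega) (by omega))
        rw [abs_of_nonneg (by positivity)]
        exact_mod_cast h1.trans hA.pow_le
      · exact ⟨by simpa using hi', (hf'.setv _ _ (by decide)).setv _ _ (by decide), by simpa using ha',
          by simp, by simpa using hz', by simpa using hb', by simpa using hT', by simp⟩
    · rintro τ' - ⟨hf', ha', -, hz', hb', hT', hq'⟩
      have e3 : (Exp.v .T + Exp.v .b * (Exp.arr .prod 0 / Exp.v .q)).eval C.inp τ' =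
          ∑ j ∈ Finset.Icc 1 (i + 1), (-1 : ℤ) ^ (j + 1) * M.choose j *
            (forest n S N cst nx K j / (2 * j) ^ n) := by
        rw [Finset.sum_Icc_succ_top (by omega)]
        simp only [eval_add, eval_v, eval_mul, eval_div, eval_arr, eval_zero, Int.toNat_zero, hT', hT2,
          hb', hb2, ha', hP, hq']
        rw [add_comm 1 i]
      refine Ok.set (by decide) (by simp) ?_ ?_ <;> rw [e3]
      · exact hT (i + 1) (by omega)
      · exact ⟨by simp [hz', hz2], (hf'.setv _ _ (by decide)).setv _ _ (by decide),
          by simpa [ha'] using hopt2, by simp, by simp [hb', hb2], by simp⟩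
  · rintro τ - ⟨h1, h2, -, -, h3⟩
    exact ⟨h1, h2, h3⟩

end RAM

/-! ### Computing the elimination order -/

namespace TreeDecomposition

variable {n N : ℕ} {G : SimpleGraph (Fin n)} (D : TreeDecomposition G N)

/-- The vertices are sorted by the depth of their top nodes, the top nodes, and their numbers. -/
noncomputable def key (a : Fin n) : ℕ := (D.dep (D.top a) * N + D.top a) * n + a

theorem key_div (a : Fin n) : D.key a / n = D.dep (D.top a) * N + D.top a := by
  have hn : 0 < n := a.pos
  rw [key, Nat.add_div_of_dvd_right (Dvd.intro_left _ rfl), Nat.mul_div_cancel _ hn,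
    Nat.div_eq_of_lt a.2, add_zero]

theorem key_div_div (a : Fin n) : D.key a / n / N = D.dep (D.top a) := by
  have hN : 0 < N := (D.top a).pos
  rw [key_div, Nat.add_div_of_dvd_right (Dvd.intro_left _ rfl), Nat.mul_div_cancel _ hN,
    Nat.div_eq_of_lt (D.top a).2, add_zero]

theorem key_mod (a : Fin n) : D.key a % n = a := by
  rw [key, add_comm, Nat.add_mul_mod_self_right, Nat.mod_eq_of_lt a.2]

theorem key_inj : Function.Injective D.key := fun a b h => by
  have := D.key_mod a
  rw [h, D.key_mod] at this
  exact Fin.ext this.symm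

theorem key_lt (a : Fin n) : D.key a < N * N * n := by
  have h1 := D.dep_lt (D.top a)
  have h2 := (D.top a).2
  have h3 := a.2
  have h4 : D.dep (D.top a) * N + D.top a + 1 ≤ N * N :=
    calc D.dep (D.top a) * N + D.top a + 1 ≤ D.dep (D.top a) * N + N := by omega
      _ = (D.dep (D.top a) + 1) * N := by ring
      _ ≤ N * N := Nat.mul_le_mul_right _ h1
  calc D.key a < (D.dep (D.top a) * N + D.top a) * n + n := by unfold key; omega
    _ = (D.dep (D.top a) * N + D.top a + 1) * n := by ring
    _ ≤ N * N * n := Nat.mul_le_mul_right _ h4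

open Classical in
/-- The number of vertices with key less than `q`. -/
noncomputable def rank (q : ℕ) : ℕ := (Finset.univ.filter fun a => D.key a < q).card

theorem rank_mono {q r : ℕ} (h : q ≤ r) : D.rank q ≤ D.rank r := by
  classical
  exact Finset.card_le_card fun a ha => by
    simp only [Finset.mem_filter, Finset.mem_univ, true_and] at ha ⊢; omega

theorem rank_le (q : ℕ) : D.rank q ≤ n := by
  classical
  exact (Finset.card_filter_le _ _).trans (by simp)

theorem rank_zero : D.rank 0 = 0 := by
  classical
  simp [rank]

theorem rank_end : D.rank (N * N * n) = n := by
  classical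
  rw [rank, Finset.filter_true_of_mem fun a _ => D.key_lt a]; simp

theorem rank_succ (a : Fin n) : D.rank (D.key a + 1) = D.rank (D.key a) + 1 := by
  classical
  have : (Finset.univ.filter fun b => D.key b < D.key a + 1) =
      insert a (Finset.univ.filter fun b => D.key b < D.key a) := by
    ext b
    simp only [Finset.mem_filter, Finset.mem_univ, true_and, Finset.mem_insert]
    constructor
    · intro h
      by_cases hb : D.key b = D.key a
      · exact .inl (D.key_inj hb)
      · exact .inr (by omega)
    · rintro (rfl | h) <;> omega
  rw [rank, this, Finset.card_insert_of_notMem (by simp)]; rfl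

theorem rank_eq {q r : ℕ} (hqr : q ≤ r) (h : ∀ a, D.key a < q ∨ r ≤ D.key a) :
    D.rank r = D.rank q := by
  classical
  unfold rank
  congr 1
  ext a
  simp only [Finset.mem_filter, Finset.mem_univ, true_and]
  have := h a
  omega

theorem rank_key_lt (a : Fin n) : D.rank (D.key a) < n := by
  have h1 := D.rank_succ a
  have h2 := D.rank_le (D.key a + 1)
  omega

/-- The order by keys is an elimination order. -/
theorem exists_order (hn : 0 < n) : ∃ ord : ℕ → Fin n, D.IsOrder ord ∧
    ∀ a, ord (D.rank (D.key a) + 1) = a := by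
  classical
  have hlt : ∀ a b, D.key a < D.key b → D.rank (D.key a) < D.rank (D.key b) := fun a b h => by
    have := D.rank_mono (q := D.key a + 1) (r := D.key b) h
    rw [D.rank_succ] at this; omega
  set pos : Fin n → ℕ := fun a => D.rank (D.key a) + 1 with hpos
  have hinj : Function.Injective pos := fun a b h => by
    simp only [hpos] at h
    rcases lt_trichotomy (D.key a) (D.key b) with h1 | h1 | h1
    · have := hlt _ _ h1; omega
    · exact D.key_inj h1
    · have := hlt _ _ h1; omega
  have himg : Finset.univ.image pos = Finset.Icc 1 n := by
    refine Finset.eq_of_subset_of_card_le (fun i hi => ?_) ?_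
    · obtain ⟨a, -, rfl⟩ := Finset.mem_image.1 hi
      have := D.rank_key_lt a
      simp only [hpos, Finset.mem_Icc]; omega
    · rw [Finset.card_image_of_injective _ hinj]; simp
  have hsurj : ∀ i ∈ Finset.Icc 1 n, ∃ a, pos a = i := fun i hi => by
    rw [← himg] at hi
    obtain ⟨a, -, h⟩ := Finset.mem_image.1 hi
    exact ⟨a, h⟩
  set ord : ℕ → Fin n := fun i => if h : ∃ a, pos a = i then h.choose else ⟨0, hn⟩ with hord
  have hpo : ∀ i ∈ Finset.Icc 1 n, pos (ord i) = i := fun i hi => by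
    have h := hsurj i hi
    simp only [hord, dif_pos h]
    exact h.choose_spec
  refine ⟨ord, ⟨fun i hi j hj h => ?_, fun i j hi hij hj => ?_⟩, fun a => ?_⟩
  · rw [← hpo i hi, h, hpo j hj]
  · have h1 := hpo i (Finset.mem_Icc.2 ⟨hi, by omega⟩)
    have h2 := hpo j (Finset.mem_Icc.2 ⟨by omega, hj⟩)
    have h3 : D.key (ord i) ≤ D.key (ord j) := by
      by_contra h
      have := hlt _ _ (not_le.1 h)
      simp only [hpos] at h1 h2; omega
    rw [← D.key_div_div, ← D.key_div_div]
    exact Nat.div_le_div_right (Nat.div_le_div_right h3)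
  · exact hinj (hpo (pos a) (by rw [← himg]; exact Finset.mem_image_of_mem _ (Finset.mem_univ a)))

end TreeDecomposition

namespace RAM

open Elim

variable {n N : ℕ} {G : SimpleGraph (Fin n)} {c : Sym2 (Fin n) → ℕ} {D : TreeDecomposition G N}
  {ord : ℕ → Fin n} {C : Ctx} {σ τ : St}

open Classical in
/-- The input consists of the numbers `n` and `N`, the weighted adjacency matrix of the graph, the
parents of the nodes of the tree, and the incidence matrix of the bags. -/
structure Coded (inp : List ℕ) (G : SimpleGraph (Fin n)) (c : Sym2 (Fin n) → ℕ)
    (D : TreeDecomposition G N) : Prop where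
  n_eq : inp.getD 0 0 = n
  N_eq : inp.getD 1 0 = N
  adj : ∀ a b : Fin n, inp.getD (2 + a * n + b) 0 = if G.Adj a b then c s(a, b) + 1 else 0
  par : ∀ x : Fin N, inp.getD (2 + n * n + x) 0 = D.parent x
  bag : ∀ (x : Fin N) (a : Fin n),
    inp.getD (2 + n * n + N + x * n + a) 0 = if a ∈ D.bag x then 1 else 0

/-- The parent of a node. -/
def parE (x : Exp) : Exp := Exp.inp (2 + Exp.v .n * Exp.v .n + x)

/-- Whether a vertex is in a bag. -/
def bagE (x a : Exp) : Exp := Exp.inp (2 + Exp.v .n * Exp.v .n + Exp.v .N + x * Exp.v .n + a)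

/-- The depth `dp` of the node `x`. -/
def depP : Prog :=
  setP .y (Exp.v .x) ;; setP .dp 0 ;;
  loopP (parE (Exp.v .y) - Exp.v .y).size (setP .y (parE (Exp.v .y)) ;; setP .dp (Exp.v .dp + 1))

/-- Append the vertex `a`, with top node `x`, to the order. -/
def addP : Prog :=
  setP .cnt (Exp.v .cnt + 1) ;; stoP .ord (Exp.v .cnt) (Exp.v .a) ;; setP .pr 0 ;;
  forP .j 1 (Exp.v .cnt)
    (iteP (bagE (Exp.v .x) (Exp.arr .ord (Exp.v .j)))
      (stoP .S (Exp.v .cnt * (Exp.v .n + 1) + Exp.v .j) 1 ;; setP .pr (Exp.v .j) ;;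
        setP .e (Exp.inp (2 + Exp.v .a * Exp.v .n + Exp.arr .ord (Exp.v .j))) ;;
        iteP (Exp.v .e) (setP .W (Exp.v .W + (Exp.v .e - 1)) ;; setP .M (Exp.v .M + 1)) skipP)
      skipP) ;;
  stoP .par (Exp.v .cnt) (Exp.v .pr)

/-- Compute the order, the parents and predecessors in the elimination forest, the total weight,
and the number of edges, increased by one. -/
def preP : Prog :=
  setP .n (Exp.inp 0) ;; setP .N (Exp.inp 1) ;; setP .M 1 ;;
  forP .lv 0 (Exp.v .N) (forP .x 0 (Exp.v .N)
    (depP ;; iteP (1 - (Exp.v .dp - Exp.v .lv).size)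
      (setP .y (parE (Exp.v .x)) ;; forP .a 0 (Exp.v .n)
        (iteP (bagE (Exp.v .x) (Exp.v .a) *
            (1 - bagE (Exp.v .y) (Exp.v .a) * (Exp.v .y - Exp.v .x).size)) addP skipP))
      skipP)) ;;
  setP .K (2 * Exp.v .n * (Exp.v .n).size)

/-- The bounds needed for the computation of the order. -/
structure PreCtx (C : Ctx) (G : SimpleGraph (Fin n)) (c : Sym2 (Fin n) → ℕ)
    (D : TreeDecomposition G N) (ord : ℕ → Fin n) : Prop where
  coded : Coded C.inp G c D
  two_le : 2 ≤ n
  order : D.IsOrder ord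
  rank : ∀ a, ord (D.rank (D.key a) + 1) = a
  small : 64 * (n + 2) ^ 4 ≤ 2 ^ C.β
  weight_le : TSP.totalWeight G c ≤ 2 ^ C.β
  ord_le : ∀ i, 1 ≤ i → i ≤ n → n ≤ C.ab .ord i
  par_le : ∀ i, 1 ≤ i → i ≤ n → n ≤ C.ab .par i
  S_le : ∀ v u, v ≤ n → u ∈ D.pred ord v → 1 ≤ C.ab .S (v * (n + 1) + u)

theorem isElim_pred (h : D.IsOrder ord) : IsElim G ord (D.pred ord) where
  toChordal := h.chordal
  inj := h.inj
  surj := h.surj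
  adj _ _ h1 h2 h3 h4 := h.adj h1 h2 h3 h4.symm

/-- The first `m` vertices of the order have been stored. -/
structure Placed (G : SimpleGraph (Fin n)) (c : Sym2 (Fin n) → ℕ) (D : TreeDecomposition G N)
    (ord : ℕ → Fin n) (m : ℕ) (σ : St) : Prop where
  n_eq : σ.v .n = n
  N_eq : σ.v .N = N
  cnt_eq : σ.v .cnt = m
  ord_eq : ∀ i, 1 ≤ i → i ≤ m → σ.a .ord i = (ord i : ℕ)
  par_eq : ∀ i, 1 ≤ i → i ≤ m → σ.a .par i = Elim.par (D.pred ord) i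
  S_eq : ∀ v u, 1 ≤ u → u < v → v ≤ n →
    σ.a .S (v * (n + 1) + u) = if v ≤ m ∧ u ∈ D.pred ord v then 1 else 0
  M_eq : σ.v .M = ((edges m (nbrs G ord (D.pred ord))).card + 1 : ℕ)
  W_eq : σ.v .W = ecost (pcost c ord) (edges m (nbrs G ord (D.pred ord)))
  nxt_eq : ∀ i, σ.a .nxt i = 0
  opt_eq : ∀ i, σ.a .opt i = 0
  out_eq : σ.out = []

theorem Placed.setv {m : ℕ} (h : Placed G c D ord m σ) (x : Var) (y : ℤ)
    (hx : x ∉ [Var.n, .N, .cnt, .M, .W]) : Placed G c D ord m (σ.setv x y) := by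
  simp only [List.mem_cons, not_or] at hx
  exact { n_eq := by simp [Ne.symm hx.1, h.n_eq], N_eq := by simp [Ne.symm hx.2.1, h.N_eq]
          cnt_eq := by simp [Ne.symm hx.2.2.1, h.cnt_eq], ord_eq := h.ord_eq, par_eq := h.par_eq
          S_eq := h.S_eq, M_eq := by simp [Ne.symm hx.2.2.2.1, h.M_eq]
          W_eq := by simp [Ne.symm hx.2.2.2.2.1, h.W_eq], nxt_eq := h.nxt_eq, opt_eq := h.opt_eq
          out_eq := h.out_eq }

theorem PreCtx.abs_le (h : PreCtx C G c D ord) {m : ℕ} (hm : m ≤ 4 * n ^ 2 + 8) :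
    |(m : ℤ)| ≤ 2 ^ C.β := by
  rw [Nat.abs_cast]
  have h1 : m ≤ 64 * (n + 2) ^ 4 := by
    have e : (n + 2) ^ 4 = (n + 2) ^ 2 * (n + 2) ^ 2 := by ring
    have h2 : (n + 2) ^ 2 = n ^ 2 + 4 * n + 4 := by ring
    rw [e, h2]; nlinarith
  exact_mod_cast h1.trans h.small

theorem PreCtx.N_le (h : PreCtx C G c D ord) : (N : ℤ) ≤ 2 ^ C.β := by
  have := C.inp_le 1
  rw [h.coded.N_eq] at this
  exact_mod_cast this

theorem depP_ok (h : PreCtx C G c D ord) {x : Fin N} (hx : σ.v .x = (x : ℕ)) (hn : σ.v .n = n) :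
    Ok C depP σ (3 * N + 3) fun τ => ∃ y : ℤ, τ = (σ.setv .y y).setv .dp (D.dep x) := by
  have hN := h.N_le
  have hlt := D.dep_lt x
  have hpar : ∀ (ρ : St) (y : Fin N), ρ.v .y = (y : ℕ) → ρ.v .n = n →
      (parE (Exp.v .y)).eval C.inp ρ = (D.parent y : ℕ) := by
    intro ρ y hy hn
    simp only [parE, eval_inp, eval_add, eval_two, eval_mul, eval_v, hy, hn]
    rw [show (2 + (n : ℤ) * n + (y : ℕ)).toNat = 2 + n * n + y by
      rw [← Int.toNat_natCast (2 + n * n + y)]; push_cast; rfl, h.coded.par]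
  have hb : ∀ y : Fin N, |((y : ℕ) : ℤ)| ≤ 2 ^ C.β := fun y => by
    rw [Nat.abs_cast]; have := y.2; omega
  refine Ok.mono (T := 1 + (1 + (D.dep x * ((1 + 1) + 1) + 1))) ?_ (by omega) fun _ _ h => h
  refine Ok.seq (Ok.set (by decide) (by simp) (by simpa [hx] using hb x) ?_)
  refine Ok.seq (Ok.set (by decide) (by simp) (by simp) ?_)
  refine (Ok.loop (by decide) (fun k τ => τ = (σ.setv .y (D.parent^[k] x : Fin N)).setv .dp (k : ℕ))
    (D.dep x) ?_ ?_ ?_ ?_).mono le_rfl ?_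
  · simp [hx]
  · rintro i τ - -; simp [parE]
  · rintro k τ hk rfl -
    have hd := D.dep_iterate k x
    have e1 := hpar ((σ.setv .y (D.parent^[k] x : Fin N)).setv .dp (k : ℕ)) (D.parent^[k] x)
      (by simp) (by simp [hn])
    refine ⟨?_, ?_⟩
    · simp only [eval_size, eval_sub, e1]
      have : D.parent (D.parent^[k] x) ≠ D.parent^[k] x := fun he => by
        rw [D.parent_eq_self] at he
        rw [he, D.dep_root] at hd; omega
      have hne : ((D.parent (D.parent^[k] x) : ℕ) : ℤ) - (D.parent^[k] x : Fin N) ≠ 0 := fun he =>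
        this (Fin.ext (by omega))
      simpa [Nat.pos_iff_ne_zero, Nat.size_eq_zero] using hne
    · refine Ok.seq (T := 1) (T' := 1) (Ok.set (by decide) (by simp [parE]) ?_ ?_)
      · rw [e1]; exact hb _
      rw [e1]
      have e2 : (Exp.v .dp + 1).eval C.inp (((σ.setv .y (D.parent^[k] x : Fin N)).setv .dp
          (k : ℕ)).setv .y (D.parent (D.parent^[k] x) : Fin N)) = (k + 1 : ℕ) := by simp
      refine Ok.set (by decide) (by simp) ?_ ?_ <;> rw [e2]
      · rw [Nat.abs_cast]; omega
      · rw [Function.iterate_succ_apply']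
        simp only [St.setv]
        congr 1
        funext u
        simp only [Function.update_apply]
        split_ifs <;> rfl
  · rintro τ rfl
    have hd := D.dep_iterate (D.dep x) x
    rw [Nat.sub_self, D.dep_eq_zero] at hd
    have e1 := hpar ((σ.setv .y (D.parent^[D.dep x] x : Fin N)).setv .dp (D.dep x : ℕ))
      (D.parent^[D.dep x] x) (by simp) (by simp [hn])
    rw [hd, D.parent_root] at e1
    rw [hd]
    simp [e1]
  · rintro τ - rfl
    exact ⟨_, rfl⟩

theorem idx_inj {n v u v' u' : ℕ} (hu : u ≤ n) (hu' : u' ≤ n) :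
    v * (n + 1) + u = v' * (n + 1) + u' ↔ v = v' ∧ u = u' := by
  constructor
  · intro h
    have h1 : (v * (n + 1) + u) / (n + 1) = v := by
      rw [Nat.add_div_of_dvd_right (Dvd.intro_left _ rfl), Nat.mul_div_cancel _ (Nat.succ_pos n),
        Nat.div_eq_of_lt (by omega), add_zero]
    have h2 : (v' * (n + 1) + u') / (n + 1) = v' := by
      rw [Nat.add_div_of_dvd_right (Dvd.intro_left _ rfl), Nat.mul_div_cancel _ (Nat.succ_pos n),
        Nat.div_eq_of_lt (by omega), add_zero]
    have h3 : v = v' := by rw [← h1, h, h2]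
    subst h3; omega
  · rintro ⟨rfl, rfl⟩; rfl

theorem sup_filter_le_succ (s : Finset ℕ) (i : ℕ) : (s.filter (· ≤ i + 1)).sup id =
    if i + 1 ∈ s then i + 1 else (s.filter (· ≤ i)).sup id := by
  split
  · rename_i h
    refine le_antisymm (Finset.sup_le fun x hx => (Finset.mem_filter.1 hx).2) ?_
    exact Finset.le_sup (f := id) (Finset.mem_filter.2 ⟨h, le_rfl⟩)
  · rename_i h
    congr 1
    ext x
    simp only [Finset.mem_filter]
    refine and_congr_right fun hx => ?_
    have : x ≠ i + 1 := by rintro rfl; exact h hx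
    omega

theorem sum_filter_le_succ (s : Finset ℕ) (f : ℕ → ℕ) (i : ℕ) :
    ∑ x ∈ s.filter (· ≤ i + 1), f x =
      ∑ x ∈ s.filter (· ≤ i), f x + if i + 1 ∈ s then f (i + 1) else 0 := by
  have h := prod_filter_le_succ s (fun x => Multiplicative.ofAdd (f x)) i
  apply_fun Multiplicative.toAdd at h
  simp only [toAdd_prod, toAdd_mul, toAdd_ofAdd] at h
  rw [h]
  split <;> rfl

theorem edges_succ (m : ℕ) (N : ℕ → Finset ℕ) :
    (edges (m + 1) N).card = (edges m N).card + (N (m + 1)).card := by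
  simp only [edges, Finset.card_sigma]
  rw [Finset.sum_Icc_succ_top (by omega)]

theorem ecost_succ (m : ℕ) (N : ℕ → Finset ℕ) (f : ℕ → ℕ → ℕ) :
    ecost f (edges (m + 1) N) = ecost f (edges m N) + ∑ u ∈ N (m + 1), f u (m + 1) := by
  simp only [ecost, edges, Finset.sum_sigma]
  rw [Finset.sum_Icc_succ_top (by omega)]

theorem edges_mono {m k : ℕ} (h : m ≤ k) (N : ℕ → Finset ℕ) : edges m N ⊆ edges k N :=
  Finset.sigma_mono (Finset.Icc_subset_Icc_right h) fun _ => subset_rfl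

/-- The state after the inner loop of `addP` has treated the first `i` positions. -/
structure Adding (G : SimpleGraph (Fin n)) (c : Sym2 (Fin n) → ℕ) (D : TreeDecomposition G N)
    (ord : ℕ → Fin n) (m : ℕ) (σ : St) (i : ℕ) (τ : St) : Prop where
  var : ∀ y, y ∉ [Var.cnt, .j, .pr, .e, .W, .M] → τ.v y = σ.v y
  arr : ∀ k, k ≠ .S → k ≠ .ord → τ.a k = σ.a k
  ord_eq : ∀ i, 1 ≤ i → i ≤ m + 1 → τ.a .ord i = (ord i : ℕ)
  out : τ.out = σ.out
  cnt_eq : τ.v .cnt = (m + 1 : ℕ)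
  S_eq : ∀ v u, 1 ≤ u → u < v → v ≤ n → τ.a .S (v * (n + 1) + u) =
    if (v ≤ m ∨ v = m + 1 ∧ u ≤ i) ∧ u ∈ D.pred ord v then 1 else 0
  j_eq : τ.v .j = (1 + i : ℕ)
  pr_eq : τ.v .pr = (((D.pred ord (m + 1)).filter (· ≤ i)).sup id : ℕ)
  M_eq : τ.v .M = ((edges m (nbrs G ord (D.pred ord))).card + 1 +
    ((nbrs G ord (D.pred ord) (m + 1)).filter (· ≤ i)).card : ℕ)
  W_eq : τ.v .W = (ecost (pcost c ord) (edges m (nbrs G ord (D.pred ord))) +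
    ∑ u ∈ (nbrs G ord (D.pred ord) (m + 1)).filter (· ≤ i), pcost c ord u (m + 1) : ℕ)

/-- One step of the inner loop of `addP`. -/
theorem addP_step (h : PreCtx C G c D ord) {m i : ℕ} {x : Fin N} (hm : m < n)
    (hx : σ.v .x = (x : ℕ)) (ha : σ.v .a = (ord (m + 1) : ℕ)) (hn : σ.v .n = n) (hN : σ.v .N = N)
    (htop : D.top (ord (m + 1)) = x) (hi : i < m) (hA : Adding G c D ord m σ i τ) :
    Ok C (iteP (bagE (Exp.v .x) (Exp.arr .ord (Exp.v .j)))
      (stoP .S (Exp.v .cnt * (Exp.v .n + 1) + Exp.v .j) 1 ;; setP .pr (Exp.v .j) ;;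
        setP .e (Exp.inp (2 + Exp.v .a * Exp.v .n + Exp.arr .ord (Exp.v .j))) ;;
        iteP (Exp.v .e) (setP .W (Exp.v .W + (Exp.v .e - 1)) ;; setP .M (Exp.v .M + 1)) skipP)
      skipP) τ 7 fun ρ => ρ.v .j = (1 + i : ℕ) ∧
        Adding G c D ord m σ (i + 1) (ρ.setv .j (1 + (i + 1) : ℕ)) := by
  have hE := isElim_pred h.order
  have ex : τ.v .x = (x : ℕ) := (hA.var _ (by decide)).trans hx
  have ea : τ.v .a = (ord (m + 1) : ℕ) := (hA.var _ (by decide)).trans ha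
  have en : τ.v .n = n := (hA.var _ (by decide)).trans hn
  have eN : τ.v .N = N := (hA.var _ (by decide)).trans hN
  have ej := hA.j_eq
  have eo : τ.a .ord (1 + i) = (ord (1 + i) : ℕ) := hA.ord_eq _ (by omega) (by omega)
  have hmem : ord (1 + i) ∈ D.bag x ↔ i + 1 ∈ D.pred ord (m + 1) := by
    rw [TreeDecomposition.mem_pred, htop, add_comm 1 i]
    exact ⟨fun h => ⟨⟨by omega, by omega⟩, h⟩, fun h => h.2⟩
  have ebag : (bagE (Exp.v .x) (Exp.arr .ord (Exp.v .j))).eval C.inp τ =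
      if i + 1 ∈ D.pred ord (m + 1) then 1 else 0 := by
    simp only [bagE, eval_inp, eval_add, eval_two, eval_mul, eval_v, eval_arr, ex, en, eN, ej,
      Int.toNat_natCast, eo]
    rw [show (2 + (n : ℤ) * n + N + (x : ℕ) * n + (ord (1 + i) : ℕ)).toNat =
      2 + n * n + N + x * n + ord (1 + i) by
        rw [← Int.toNat_natCast (2 + n * n + N + x * n + ord (1 + i))]; push_cast; rfl,
      h.coded.bag]
    simp only [hmem]
    split <;> rfl
  refine Ok.ite (T := 6) (by decide) (by simp [bagE, ej]; positivity) (fun hc => ?_) fun hc => ?_ <;>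
    rw [ebag] at hc
  · have hS : i + 1 ∈ D.pred ord (m + 1) := by
      by_contra hS; rw [if_neg hS] at hc; exact lt_irrefl _ hc
    have eidx : (Exp.v .cnt * (Exp.v .n + 1) + Exp.v .j).eval C.inp τ =
        ((m + 1) * (n + 1) + (i + 1) : ℕ) := by
      simp only [eval_add, eval_mul, eval_v, eval_one, hA.cnt_eq, en, ej]; push_cast; ring
    refine Ok.seq (T := 1) (T' := 5) (Ok.sto (by decide) (by decide) (by simp) (by simp) ?_ ?_ ?_) <;>
      rw [eidx]
    · positivity
    · rw [Int.toNat_natCast, eval_one, abs_one]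
      exact_mod_cast h.S_le (m + 1) (i + 1) hm hS
    rw [Int.toNat_natCast, eval_one]
    set τ₁ := τ.seta .S ((m + 1) * (n + 1) + (i + 1)) 1 with hτ₁
    have hin : i + 1 ≤ 4 * n ^ 2 + 8 := by nlinarith
    refine Ok.seq (T := 1) (T' := 4) (Ok.set (by decide) (by simp) ?_ ?_)
    · simp only [hτ₁, eval_v, St.seta_v, ej]; exact h.abs_le (by omega)
    have ee : (Exp.inp (2 + Exp.v .a * Exp.v .n + Exp.arr .ord (Exp.v .j))).eval C.inp
        (τ₁.setv .pr ((Exp.v .j).eval C.inp τ₁)) =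
          if i + 1 ∈ nbrs G ord (D.pred ord) (m + 1) then (pcost c ord (i + 1) (m + 1) + 1 : ℤ)
          else 0 := by
      have hn' : i + 1 ∈ nbrs G ord (D.pred ord) (m + 1) ↔ G.Adj (ord (m + 1)) (ord (i + 1)) := by
        simp only [nbrs, Finset.mem_filter, hS, true_and]
      simp only [eval_inp, eval_add, eval_two, eval_mul, eval_v, eval_arr, St.setv_v, reduceCtorEq,
        if_false, hτ₁, St.seta_v, ea, en, ej, Int.toNat_natCast, St.setv_a, St.seta_a, false_and, eo]
      rw [show (2 + (ord (m + 1) : ℕ) * (n : ℤ) + (ord (1 + i) : ℕ)).toNat =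
        2 + ord (m + 1) * n + ord (1 + i) by
          rw [← Int.toNat_natCast (2 + ord (m + 1) * n + ord (1 + i))]; push_cast; rfl,
        h.coded.adj, add_comm 1 i]
      by_cases hnb : i + 1 ∈ nbrs G ord (D.pred ord) (m + 1)
      · rw [if_pos (hn'.1 hnb), if_pos hnb]; simp [pcost]
      · rw [if_neg (fun hh => hnb (hn'.2 hh)), if_neg hnb]; simp
    refine Ok.seq (T := 1) (T' := 3) (Ok.set (by decide) (by simp [hτ₁, ej]; positivity) ?_ ?_)
    · rw [eval_inp, Nat.abs_cast]; exact_mod_cast C.inp_le _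
    rw [ee]
    simp only [eval_v, hτ₁, St.seta_v, ej]
    have key : ∀ ρ : St, (∀ y, y ∉ [Var.cnt, .j, .pr, .e, .W, .M] → ρ.v y = τ.v y) →
        ρ.a = τ₁.a → ρ.out = τ.out → ρ.v .cnt = τ.v .cnt → ρ.v .j = (1 + i : ℕ) →
        ρ.v .pr = (1 + i : ℕ) →
        ρ.v .M = τ.v .M + (if i + 1 ∈ nbrs G ord (D.pred ord) (m + 1) then 1 else 0) →
        ρ.v .W = τ.v .W + (if i + 1 ∈ nbrs G ord (D.pred ord) (m + 1) then
          (pcost c ord (i + 1) (m + 1) : ℤ) else 0) →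
        ρ.v .j = (1 + i : ℕ) ∧ Adding G c D ord m σ (i + 1) (ρ.setv .j (1 + (i + 1) : ℕ)) := by
      intro ρ h1 h2 h3 h4 h5 h6 h7 h8
      refine ⟨h5, ⟨fun y hy => ?_, fun k h9 h10 => ?_, fun l h9 h10 => ?_, ?_, ?_, fun v u h9 h10 h11 => ?_,
        by simp, ?_, ?_, ?_⟩⟩
      · have hy' := hy
        simp only [List.mem_cons, not_or] at hy
        rw [St.setv_v, if_neg hy.2.1, h1 y hy', hA.var y hy']
      · rw [St.setv_a, h2, ← hA.arr k h9 h10]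
        funext l; simp [hτ₁, h9]
      · rw [St.setv_a, h2, ← hA.ord_eq l h9 h10]; simp [hτ₁]
      · rw [St.setv_out, h3, hA.out]
      · simp [h4, hA.cnt_eq]
      · rw [St.setv_a, h2, hτ₁, St.seta_a]
        by_cases hvu : v = m + 1 ∧ u = i + 1
        · obtain ⟨rfl, rfl⟩ := hvu
          rw [if_pos ⟨rfl, rfl⟩, if_pos ⟨.inr ⟨rfl, le_rfl⟩, hS⟩]
        · rw [if_neg (fun hh => hvu ((idx_inj (by omega) (by omega)).1 hh.2)), hA.S_eq v u h9 h10 h11]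
          refine if_congr (and_congr_left fun _ => ?_) rfl rfl
          omega
      · rw [sup_filter_le_succ, if_pos hS, add_comm i 1]; simp [h6]
      · rw [card_filter_le_succ]; simp only [St.setv_v, reduceCtorEq, if_false, h7, hA.M_eq]
        push_cast; ring
      · rw [sum_filter_le_succ]; simp only [St.setv_v, reduceCtorEq, if_false, h8, hA.W_eq]
        push_cast; ring
    have hcard : (edges m (nbrs G ord (D.pred ord))).card + 1 +
        ((nbrs G ord (D.pred ord) (m + 1)).filter (· ≤ i)).card ≤ n * n + 1 := by
      have h1 := Finset.card_filter_le (nbrs G ord (D.pred ord) (m + 1)) (· ≤ i)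
      have h2 := edges_succ m (nbrs G ord (D.pred ord))
      have h3 := Finset.card_le_card (edges_mono hm (nbrs G ord (D.pred ord)))
      have h4 := card_edges_le (n := n) (S := D.pred ord) (N := nbrs G ord (D.pred ord))
        (fun v _ => nbrs_subset v) (w := n) fun v hv => by
          have : D.pred ord v ⊆ Finset.Icc 1 n := fun u hu => by
            have := h.order.chordal.lt v hv u hu
            simp only [Finset.mem_Icc]; omega
          simpa using Finset.card_le_card this
      simp only [Nat.succ_eq_add_one] at h3
      omega
    have hcost : ∀ l, ecost (pcost c ord) (edges m (nbrs G ord (D.pred ord))) +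
        ∑ u ∈ (nbrs G ord (D.pred ord) (m + 1)).filter (· ≤ l), pcost c ord u (m + 1) ≤
          TSP.totalWeight G c := by
      intro l
      rw [← hE.ecost_edges c]
      have h1 : ∑ u ∈ (nbrs G ord (D.pred ord) (m + 1)).filter (· ≤ l), pcost c ord u (m + 1) ≤
          ∑ u ∈ (nbrs G ord (D.pred ord) (m + 1)), pcost c ord u (m + 1) :=
        Finset.sum_le_sum_of_subset (Finset.filter_subset _ _)
      have h2 := ecost_succ m (nbrs G ord (D.pred ord)) (pcost c ord)
      have h3 : ecost (pcost c ord) (edges (m + 1) (nbrs G ord (D.pred ord))) ≤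
          ecost (pcost c ord) (edges n (nbrs G ord (D.pred ord))) :=
        Finset.sum_le_sum_of_subset (edges_mono hm _)
      omega
    refine Ok.ite (T := 2) (by decide) (by simp) (fun hc => ?_) fun hc => ?_ <;>
      simp only [eval_v, St.setv_v, if_true] at hc
    · have hnb : i + 1 ∈ nbrs G ord (D.pred ord) (m + 1) := by
        by_contra hnb; rw [if_neg hnb] at hc; exact lt_irrefl _ hc
      rw [if_pos hnb]
      refine Ok.seq (T := 1) (T' := 1) (Ok.set (by decide) (by simp) ?_ ?_)
      · have := hcost (i + 1)
        rw [sum_filter_le_succ, if_pos hnb] at this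
        have e : (Exp.v .W + (Exp.v .e - 1)).eval C.inp
            (((τ.seta .S ((m + 1) * (n + 1) + (i + 1)) 1).setv .pr (1 + i : ℕ)).setv .e
              (pcost c ord (i + 1) (m + 1) + 1)) = (ecost (pcost c ord) (edges m (nbrs G ord
              (D.pred ord))) + (∑ u ∈ (nbrs G ord (D.pred ord) (m + 1)).filter (· ≤ i),
              pcost c ord u (m + 1) + pcost c ord (i + 1) (m + 1)) : ℕ) := by
          simp [hA.W_eq]; ring
        rw [e, Nat.abs_cast]
        exact_mod_cast this.trans h.weight_le
      refine Ok.set (by decide) (by simp) ?_ (key _ (fun y hy => ?_) ?_ ?_ ?_ ?_ ?_ ?_ ?_)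
      · simp only [eval_add, eval_v, eval_one, St.setv_v, St.seta_v, reduceCtorEq, if_false, hA.M_eq]
        have := h.abs_le (m := (edges m (nbrs G ord (D.pred ord))).card + 1 +
          ((nbrs G ord (D.pred ord) (m + 1)).filter (· ≤ i)).card + 1) (by nlinarith)
        exact_mod_cast this
      · simp only [List.mem_cons, not_or] at hy
        simp [hy]
      · simp [hτ₁]
      · simp
      · simp
      · simp [ej]
      · simp
      · simp [hnb]
      · simp [hnb]
    · have hnb : i + 1 ∉ nbrs G ord (D.pred ord) (m + 1) := by
        intro hnb; rw [if_pos hnb] at hc; exact hc (by positivity)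
      refine Ok.skip' (by norm_num) (key _ (fun y hy => ?_) ?_ ?_ ?_ ?_ ?_ ?_ ?_)
      · simp only [List.mem_cons, not_or] at hy
        simp [hy]
      · simp [hτ₁]
      · simp
      · simp
      · simp [ej]
      · simp
      · simp [hnb]
      · simp [hnb]
  · have hS : i + 1 ∉ D.pred ord (m + 1) := by
      intro hS; rw [if_pos hS] at hc; exact hc one_pos
    have hnb : i + 1 ∉ nbrs G ord (D.pred ord) (m + 1) := fun hh => hS (nbrs_subset _ hh)
    refine Ok.skip' (by norm_num) ⟨ej, ⟨fun y hy => ?_, hA.arr, hA.ord_eq, hA.out, by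
      simpa using hA.cnt_eq, fun v u h9 h10 h11 => ?_, by simp, ?_, ?_, ?_⟩⟩
    · have := hA.var y hy
      simp only [List.mem_cons, not_or] at hy
      simpa [hy] using this
    · rw [St.setv_a, hA.S_eq v u h9 h10 h11]
      by_cases hvu : v = m + 1 ∧ u = i + 1
      · obtain ⟨rfl, rfl⟩ := hvu
        rw [if_neg (fun hh => hS hh.2), if_neg (fun hh => hS hh.2)]
      · refine if_congr (and_congr_left fun _ => ?_) rfl rfl
        omega
    · rw [sup_filter_le_succ, if_neg hS]; simpa using hA.pr_eq
    · rw [card_filter_le_succ, if_neg hnb]; simpa using hA.M_eq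
    · rw [sum_filter_le_succ, if_neg hnb]; simpa using hA.W_eq

end RAM

/-! ### Correctness of the elimination order -/

namespace RAM

open Elim

variable {n N : ℕ} {G : SimpleGraph (Fin n)} {c : Sym2 (Fin n) → ℕ} {D : TreeDecomposition G N}
  {ord : ℕ → Fin n} {C : Ctx} {σ τ : St}

/-- Placing the next vertex of the order records its predecessors, its parent and its edges. -/
theorem addP_ok (h : PreCtx C G c D ord) {m : ℕ} {x : Fin N} (hP : Placed G c D ord m σ) (hm : m < n)
    (hx : σ.v .x = (x : ℕ)) (ha : σ.v .a = (ord (m + 1) : ℕ)) (htop : D.top (ord (m + 1)) = x) :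
    Ok C addP σ (9 * n + 6) fun τ => Placed G c D ord (m + 1) τ ∧
      ∀ y, y ∉ [Var.cnt, .j, .pr, .e, .W, .M] → τ.v y = σ.v y := by
  refine Ok.mono (T := 1 + (1 + (1 + ((m * (7 + 2) + 2) + 1)))) ?_ (by omega) fun _ _ h => h
  have e1 : (Exp.v .cnt + 1).eval C.inp σ = (m + 1 : ℕ) := by simp [hP.cnt_eq]
  refine Ok.seq (Ok.set (by decide) (by simp) ?_ ?_) <;> rw [e1]
  · exact h.abs_le (by nlinarith)
  refine Ok.seq (Ok.sto (by decide) (by decide) (by simp) (by simp) (by simp; positivity) ?_ ?_)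
  · simp only [eval_v, St.setv_v, reduceCtorEq, if_false, if_true, Int.toNat_natCast, ha, Nat.abs_cast]
    have := h.ord_le (m + 1) (by omega) hm
    have := (ord (m + 1)).2
    omega
  simp only [eval_v, St.setv_v, reduceCtorEq, if_false, if_true, Int.toNat_natCast, ha]
  refine Ok.seq (Ok.set (by decide) (by simp) (by simp) ?_)
  have hbase : Adding G c D ord m σ 0 ((((σ.setv .cnt (m + 1 : ℕ)).seta .ord (m + 1)
      (ord (m + 1) : ℕ)).setv .pr 0).setv .j (1 : ℕ)) := by
    have hflt : ∀ s : Finset ℕ, (∀ u ∈ s, 1 ≤ u) → s.filter (· ≤ 0) = ∅ := fun s hs =>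
      Finset.filter_eq_empty_iff.2 fun u hu => by have := hs u hu; omega
    have h1 : ∀ u ∈ D.pred ord (m + 1), 1 ≤ u := fun u hu => (TreeDecomposition.mem_pred.1 hu).1.1
    have h2 : ∀ u ∈ nbrs G ord (D.pred ord) (m + 1), 1 ≤ u := fun u hu => h1 u (nbrs_subset _ hu)
    refine ⟨fun y hy => ?_, fun k h9 h10 => ?_, fun l h9 h10 => ?_, by simp, by simp,
      fun v u h9 h10 h11 => ?_, by simp, ?_, ?_, ?_⟩
    · simp only [List.mem_cons, not_or] at hy
      simp [hy]
    · funext l; simp [h10]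
    · simp only [St.setv_a, St.seta_a, true_and]
      split
      · rename_i hl; rw [hl]
      · exact hP.ord_eq l h9 (by omega)
    · simp only [St.setv_a, St.seta_a, reduceCtorEq, false_and, if_false]
      rw [hP.S_eq v u h9 h10 h11]
      refine if_congr (and_congr_left fun _ => ?_) rfl rfl
      omega
    · rw [hflt _ h1]; simp
    · rw [hflt _ h2]; simp [hP.M_eq]
    · rw [hflt _ h2]; simp [hP.W_eq]
  refine Ok.seq (Ok.mono (T := m * (7 + 2) + 2) (Ok.for (s := 1) (m := m) (by decide) (by decide)
    (by simp) (by simp) ?_ (fun i τ => Adding G c D ord m σ i τ) ?_ ?_ ?_) le_rfl ?_)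
  · have := h.abs_le (m := 1 + m) (by nlinarith)
    rwa [Nat.abs_cast] at this
  · simpa using hbase
  · rintro i τ - hA
    refine ⟨by simp, ?_, hA.j_eq⟩
    rw [eval_v, hA.cnt_eq]; congr 1; omega
  · rintro i τ hi hA - -
    exact addP_step h hm hx ha hP.n_eq hP.N_eq htop hi hA
  · rintro τ - hA
    have hfil : ∀ s : Finset ℕ, (∀ u ∈ s, u ≤ m) → s.filter (· ≤ m) = s := fun s hs =>
      Finset.filter_true_of_mem hs
    have h1 : ∀ u ∈ D.pred ord (m + 1), u ≤ m := fun u hu => by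
      have := (TreeDecomposition.mem_pred.1 hu).1.2; omega
    have h2 : ∀ u ∈ nbrs G ord (D.pred ord) (m + 1), u ≤ m := fun u hu => h1 u (nbrs_subset _ hu)
    have hpr : τ.v .pr = (Elim.par (D.pred ord) (m + 1) : ℕ) := by
      rw [hA.pr_eq, hfil _ h1]; rfl
    have hpl := par_lt h.order.chordal (v := m + 1) (by omega) hm
    refine Ok.sto (by decide) (by decide) (by simp) (by simp) (by simp [hA.cnt_eq]; positivity) ?_ ?_
    · simp only [eval_v, hpr, hA.cnt_eq, Int.toNat_natCast, Nat.abs_cast]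
      have := h.par_le (m + 1) (by omega) hm
      omega
    simp only [eval_v, hpr, hA.cnt_eq, Int.toNat_natCast]
    refine ⟨⟨?_, ?_, ?_, fun l h9 h10 => ?_, fun l h9 h10 => ?_, fun v u h9 h10 h11 => ?_, ?_, ?_,
      fun l => ?_, fun l => ?_, ?_⟩, fun y hy => by simpa using hA.var y hy⟩
    · simpa [hA.var .n (by decide)] using hP.n_eq
    · simpa [hA.var .N (by decide)] using hP.N_eq
    · simpa using hA.cnt_eq
    · simpa using hA.ord_eq l h9 h10
    · simp only [St.seta_a, true_and]
      split
      · rename_i hl; rw [hl]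
      · rw [hA.arr .par (by decide) (by decide)]; exact hP.par_eq l h9 (by omega)
    · simp only [St.seta_a, reduceCtorEq, false_and, if_false]
      rw [hA.S_eq v u h9 h10 h11]
      refine if_congr (and_congr_left fun hu => ?_) rfl rfl
      constructor
      · rintro (h12 | ⟨rfl, -⟩) <;> omega
      · intro h12
        by_cases hv : v = m + 1
        · subst hv; exact .inr ⟨rfl, h1 u hu⟩
        · left; omega
    · rw [St.seta_v, hA.M_eq, hfil _ h2, edges_succ]; push_cast; ring
    · rw [St.seta_v, hA.W_eq, hfil _ h2, ecost_succ]
    · simpa [hA.arr .nxt (by decide) (by decide)] using hP.nxt_eq l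
    · simpa [hA.arr .opt (by decide) (by decide)] using hP.opt_eq l
    · rw [St.seta_out, hA.out, hP.out_eq]

/-- The loop over the vertices for a node `x` with depth `lv`. -/
theorem place_node (h : PreCtx C G c D ord) {lv : ℕ} {x : Fin N} (hlv : D.dep x = lv)
    (hP : Placed G c D ord (D.rank ((lv * N + x) * n)) σ) (hx : σ.v .x = (x : ℕ))
    (hl : σ.v .lv = lv) :
    Ok C (setP .y (parE (Exp.v .x)) ;; forP .a 0 (Exp.v .n)
        (iteP (bagE (Exp.v .x) (Exp.v .a) *
            (1 - bagE (Exp.v .y) (Exp.v .a) * (Exp.v .y - Exp.v .x).size)) addP skipP)) σ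
      (n * (9 * n + 9) + 3) fun τ => Placed G c D ord (D.rank ((lv * N + (x + 1)) * n)) τ ∧
        τ.v .x = (x : ℕ) ∧ τ.v .lv = lv := by
  have hN := h.N_le
  have e1 : (parE (Exp.v .x)).eval C.inp σ = (D.parent x : ℕ) := by
    simp only [parE, eval_inp, eval_add, eval_two, eval_mul, eval_v, hx, hP.n_eq]
    rw [show (2 + (n : ℤ) * n + (x : ℕ)).toNat = 2 + n * n + x by
      rw [← Int.toNat_natCast (2 + n * n + x)]; push_cast; rfl, h.coded.par]
  have hbag : ∀ (ρ : St) (y : Fin N) (a : Fin n) (e : Exp), e.eval C.inp ρ = (y : ℕ) →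
      ρ.v .a = (a : ℕ) → ρ.v .n = n → ρ.v .N = N →
      (bagE e (Exp.v .a)).eval C.inp ρ = if a ∈ D.bag y then 1 else 0 := by
    intro ρ y a e he ha hn hN
    simp only [bagE, eval_inp, eval_add, eval_two, eval_mul, eval_v, he, ha, hn, hN]
    rw [show (2 + (n : ℤ) * n + N + (y : ℕ) * n + (a : ℕ)).toNat = 2 + n * n + N + y * n + a by
        rw [← Int.toNat_natCast (2 + n * n + N + y * n + a)]; push_cast; rfl, h.coded.bag]
    split <;> rfl
  refine Ok.mono (T := 1 + (n * ((9 * n + 6 + 1) + 2) + 2)) ?_ (by ring_nf; omega) fun _ _ h => h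
  refine Ok.seq (Ok.set (by decide) (by simp [parE]) ?_ ?_) <;> rw [e1]
  · rw [Nat.abs_cast]; have := (D.parent x).2; omega
  refine (Ok.for (s := 0) (m := n) (by decide) (by decide) (by simp) (by simp) ?_
    (fun i τ => Placed G c D ord (D.rank ((lv * N + x) * n + i)) τ ∧ τ.v .a = (0 + i : ℕ) ∧
      τ.v .x = (x : ℕ) ∧ τ.v .lv = lv ∧ τ.v .y = (D.parent x : ℕ)) ?_ ?_ ?_).mono le_rfl ?_
  · have := h.abs_le (m := 0 + n) (by nlinarith)
    rwa [Nat.abs_cast] at this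
  · exact ⟨(hP.setv _ _ (by decide)).setv _ _ (by decide), by simp, by simp [hx], by simp [hl],
      by simp⟩
  · rintro i τ - ⟨hP', ha, -⟩
    exact ⟨by simp, by simp [hP'.n_eq], ha⟩
  · rintro i τ hi ⟨hP', ha, hx', hl', hy'⟩ - -
    rw [zero_add] at ha
    set a : Fin n := ⟨i, hi⟩ with hadef
    have hai : (a : ℕ) = i := rfl
    have e2 := hbag τ x a (Exp.v .x) hx' ha hP'.n_eq hP'.N_eq
    have e3 := hbag τ (D.parent x) a (Exp.v .y) hy' ha hP'.n_eq hP'.N_eq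
    have hcond : 0 < (bagE (Exp.v .x) (Exp.v .a) *
        (1 - bagE (Exp.v .y) (Exp.v .a) * (Exp.v .y - Exp.v .x).size)).eval C.inp τ ↔
        D.top a = x := by
      rw [← D.isTop_iff, TreeDecomposition.IsTop]
      simp only [eval_mul, eval_sub, eval_one, eval_size, e2, e3, eval_v, hx', hy']
      have hsz : ((((D.parent x : ℕ) : ℤ) - (x : ℕ)).natAbs.size = 0) ↔ D.parent x = x := by
        rw [Nat.size_eq_zero, Int.natAbs_eq_zero, Fin.ext_iff]; omega
      by_cases h1 : a ∈ D.bag x <;> by_cases h2 : a ∈ D.bag (D.parent x) <;> simp [h1, h2]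
      rw [← hsz]
    have hq : D.top a = x → D.key a = (lv * N + x) * n + i := fun ht => by
      rw [TreeDecomposition.key, ht, hlv]
    refine Ok.ite (by decide) (by simp [bagE]) (fun hc => ?_) fun hc => ?_ <;> rw [hcond] at hc
    · have hk := hq hc
      rw [← hk] at hP'
      have ho := h.rank a
      refine (addP_ok h hP' (D.rank_key_lt a) hx' (by rw [ho]; exact ha) (by rw [ho]; exact hc)).mono
        le_rfl ?_
      rintro ρ - ⟨hP2, hv⟩
      refine ⟨(hv _ (by decide)).trans (by simpa using ha), ?_, by simp, ?_, ?_, ?_⟩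
      · rw [← Nat.add_assoc, ← hk, D.rank_succ]; exact hP2.setv _ _ (by decide)
      · simp [hv .x (by decide), hx']
      · simp [hv .lv (by decide), hl']
      · simp [hv .y (by decide), hy']
    · have hr : D.rank ((lv * N + x) * n + (i + 1)) = D.rank ((lv * N + x) * n + i) := by
        refine D.rank_eq (by omega) fun b => ?_
        by_contra hb
        have hb' : D.key b = (lv * N + x) * n + i := by omega
        have h1 := D.key_mod b
        have h2 := D.key_div b
        rw [hb', add_comm, Nat.add_mul_mod_self_right, Nat.mod_eq_of_lt hi] at h1
        have hba : b = a := Fin.ext h1.symm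
        rw [hb', Nat.add_div_of_dvd_right (Dvd.intro_left _ rfl),
          Nat.mul_div_cancel _ (by omega : 0 < n), Nat.div_eq_of_lt hi, add_zero] at h2
        have h3 := congrArg (· % N) h2
        simp only [add_comm _ ((_ : Fin N) : ℕ), Nat.add_mul_mod_self_right, Nat.mod_eq_of_lt x.2,
          Nat.mod_eq_of_lt (D.top b).2] at h3
        exact hc (hba ▸ Fin.ext h3.symm)
      refine Ok.skip' (by omega) ⟨by simpa using ha, ?_, by simp, by simp [hx'], by simp [hl'],
        by simp [hy']⟩
      rw [hr]; exact hP'.setv _ _ (by decide)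
  · rintro τ - ⟨hP', -, hx', hl', -⟩
    refine ⟨?_, hx', hl'⟩
    rwa [show (lv * N + (x + 1)) * n = (lv * N + x) * n + n by ring]

/-- The time for `preP`. -/
def preTime (n N : ℕ) : ℕ := N * (N * (n * (9 * n + 9) + 3 * N + 10) + 10) + 10

/-- The vertices are found in the order of their keys by searching through all depths, all nodes of that
depth, and all vertices with that top node, so that no sorting is needed. -/
theorem preP_ok (h : PreCtx C G c D ord) :
    Ok C preP ⟨fun _ => 0, fun _ _ => 0, []⟩ (preTime n N) fun τ => Placed G c D ord n τ ∧
      τ.v .K = (2 * n * n.size : ℕ) := by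
  have hN := h.N_le
  have h1β : |(1 : ℤ)| ≤ 2 ^ C.β := by rw [abs_one]; exact one_le_pow₀ (by norm_num)
  refine Ok.mono (T := 1 + (1 + (1 + ((N * ((N * ((3 * N + 3 + (n * (9 * n + 9) + 3 + 1)) + 2) + 2) + 2)
    + 2) + 1)))) ?_ ?_ fun _ _ h => h
  swap
  · unfold preTime
    have : N * (3 * N + 3 + (n * (9 * n + 9) + 3 + 1) + 2) ≤ N * (n * (9 * n + 9) + 3 * N + 10) :=
      Nat.mul_le_mul_left _ (by omega)
    have := Nat.mul_le_mul_left N (show N * (3 * N + 3 + (n * (9 * n + 9) + 3 + 1) + 2) + 2 + 2 ≤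
      N * (n * (9 * n + 9) + 3 * N + 10) + 10 by omega)
    omega
  have e1 : ∀ ρ, (Exp.inp 0).eval C.inp ρ = n := fun ρ => by
    rw [eval_inp, eval_zero, Int.toNat_zero, h.coded.n_eq]
  have e2 : ∀ ρ, (Exp.inp 1).eval C.inp ρ = N := fun ρ => by
    rw [eval_inp, eval_one, Int.toNat_one, h.coded.N_eq]
  refine Ok.seq (Ok.set (by decide) (by simp) ?_ ?_) <;> rw [e1]
  · exact h.abs_le (by nlinarith)
  refine Ok.seq (Ok.set (by decide) (by simp) ?_ ?_) <;> rw [e2]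
  · rwa [Nat.abs_cast]
  refine Ok.seq (Ok.set (by decide) (by simp) (by simpa using h1β) ?_)
  refine Ok.seq (Ok.mono (T := N * ((N * ((3 * N + 3 + (n * (9 * n + 9) + 3 + 1)) + 2) + 2) + 2)
    + 2) (Ok.for (s := 0) (m := N) (by decide) (by decide) (by simp) (by simp) (by simpa using hN)
    (fun i τ => Placed G c D ord (D.rank (i * N * n)) τ ∧ τ.v .lv = (0 + i : ℕ)) ?_ ?_ ?_) le_rfl ?_)
  · refine ⟨?_, by simp⟩
    rw [Nat.zero_mul, Nat.zero_mul, D.rank_zero]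
    refine ⟨by simp, by simp, by simp, by omega, by omega, fun v u h1 h2 h3 => ?_, by simp [edges],
      by simp [edges, ecost, Finset.sum_sigma], by simp, by simp, by simp⟩
    rw [if_neg (by omega)]; simp
  · rintro i τ - ⟨hP, hl⟩
    exact ⟨by simp, by simp [hP.N_eq], hl⟩
  · rintro lv τ hlv ⟨hP, hl⟩ - -
    rw [zero_add] at hl
    refine (Ok.for (s := 0) (m := N) (by decide) (by decide) (by simp) (by simp) (by simpa using hN)
      (fun i τ => Placed G c D ord (D.rank ((lv * N + i) * n)) τ ∧ τ.v .x = (0 + i : ℕ) ∧ τ.v .lv = lv)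
      ?_ ?_ ?_).mono le_rfl ?_
    · exact ⟨hP.setv _ _ (by decide), by simp, by simp [hl]⟩
    · rintro i τ - ⟨hP, hx, -⟩
      exact ⟨by simp, by simp [hP.N_eq], hx⟩
    · rintro i τ hi ⟨hP, hx, hl⟩ - -
      rw [zero_add] at hx
      set x : Fin N := ⟨i, hi⟩ with hxdef
      refine Ok.seq ((depP_ok h (x := x) hx hP.n_eq).mono le_rfl ?_)
      rintro ρ - ⟨y, rfl⟩
      refine Ok.ite (by decide) (by simp) (fun hc => ?_) fun hc => ?_ <;>
        simp only [eval_sub, eval_one, eval_size, eval_v, one_sub_size_pos, St.setv_v, if_true,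
          reduceCtorEq, if_false, hl] at hc
      · have hd : D.dep x = lv := by omega
        refine (place_node h hd (x := x) ((hP.setv _ _ (by decide)).setv _ _ (by decide))
          (by simpa using hx) (by simpa using hl)).mono le_rfl ?_
        rintro ρ - ⟨hP2, hx2, hl2⟩
        exact ⟨by simpa using hx2, hP2.setv _ _ (by decide), by simp, by simp [hl2]⟩
      · have hd : D.dep x ≠ lv := by omega
        have hr : D.rank ((lv * N + (i + 1)) * n) = D.rank ((lv * N + i) * n) := by
          refine D.rank_eq (Nat.mul_le_mul_right _ (by omega)) fun b => ?_
          by_contra hb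
          have hn : 0 < n := b.pos
          have h1 : D.key b / n = lv * N + i := by
            refine Nat.div_eq_of_lt_le (by omega) (by
              rw [show lv * N + i + 1 = lv * N + (i + 1) by ring]; omega)
          have h2 := D.key_div_div b
          have h3 := D.key_div b
          rw [h1] at h2 h3
          have h4 : (lv * N + i) / N = lv := by
            rw [Nat.add_div_of_dvd_right (Dvd.intro_left _ rfl), Nat.mul_div_cancel _ (by omega),
              Nat.div_eq_of_lt hi, add_zero]
          rw [h4] at h2
          rw [← h2] at h3
          have h5 : i = D.top b := by omega
          exact hd (by rw [show x = D.top b from Fin.ext h5, h2])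
        refine Ok.skip' (by omega) ⟨by simpa using hx, ?_, by simp, by simp [hl]⟩
        rw [hr]
        exact ((hP.setv _ _ (by decide)).setv _ _ (by decide)).setv _ _ (by decide)
    · rintro ρ - ⟨hP2, -, hl2⟩
      refine ⟨by simpa using hl2, ?_, by simp⟩
      rw [show (lv + 1) * N * n = (lv * N + N) * n by ring]
      exact hP2.setv _ _ (by decide)
  · rintro τ - ⟨hP, -⟩
    rw [D.rank_end] at hP
    have e3 : (2 * Exp.v .n * (Exp.v .n).size).eval C.inp τ = (2 * n * n.size : ℕ) := by
      simp [hP.n_eq]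
    have hsz : n.size ≤ n := Nat.size_le.2 Nat.lt_two_pow_self
    refine Ok.set (by decide) (by simp) ?_ ?_ <;> rw [e3]
    · exact h.abs_le (by nlinarith)
    · exact ⟨hP.setv _ _ (by decide), by simp⟩

end RAM

/-! ### Growing an optimal cycle -/

namespace Elim

variable {n : ℕ} {S N : ℕ → Finset ℕ} {p nx : ℕ → ℕ} {k K y : ℕ} {cst : ℕ → ℕ → ℕ}
  {H : Finset ((_ : ℕ) × ℕ)}

/-- The weight saved by the cycle `H`: that of the edges that it does not use. -/
def saving (n : ℕ) (N : ℕ → Finset ℕ) (cst : ℕ → ℕ → ℕ) (H : Finset ((_ : ℕ) × ℕ)) : ℕ :=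
  ecost cst (edges n N) - ecost cst H

/-- The Hamiltonian cycles through the edges prescribed by `nx`, as counted by the algorithm. -/
noncomputable def tally (n : ℕ) (N : ℕ → Finset ℕ) (cst : ℕ → ℕ → ℕ) (K : ℕ) (nx : ℕ → ℕ) : ℕ :=
  ∑ H ∈ hams n N (RAM.linked nx), 2 ^ (K * saving n N cst H)

/-- The largest saving of a cycle can be read off from the length of the tally. -/
theorem exists_saving (hS : Chordal n S) (hN : ∀ v ≤ n, N v ⊆ S v) (hn : 2 ≤ n)
    (hK : K = 2 * n * n.size) (hne : (hams n N (RAM.linked nx)).Nonempty) :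
    ∃ H ∈ hams n N (RAM.linked nx),
      (((tally n N cst K nx).size : ℤ) - 1) / K = saving n N cst H ∧
      ∀ H' ∈ hams n N (RAM.linked nx), saving n N cst H' ≤ saving n N cst H := by
  obtain ⟨H, hH, hmax⟩ := Finset.exists_max_image _ (saving n N cst) hne
  have hs : 0 < n.size := Nat.size_pos.2 (by omega)
  exact ⟨H, hH, size_sum_pow _ _ (by rw [hK]; exact Nat.mul_pos (by omega) hs)
    (hK ▸ card_hams_lt hS hN (by omega) _) hH hmax, hmax⟩

theorem tally_pos : 0 < tally n N cst K nx ↔ (hams n N (RAM.linked nx)).Nonempty := by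
  constructor
  · intro h
    by_contra hne
    rw [tally, Finset.not_nonempty_iff_eq_empty.1 hne] at h
    simp at h
  · intro h
    exact Finset.sum_pos (fun _ _ => by positivity) h

/-- The empty tally has length `0`, which is not mistaken for a saving. -/
theorem tally_eq_neg (hn : 2 ≤ n) (hK : K = 2 * n * n.size)
    (hne : ¬ (hams n N (RAM.linked nx)).Nonempty) :
    (((tally n N cst K nx).size : ℤ) - 1) / K = -1 := by
  have h0 : tally n N cst K nx = 0 := by
    have := (tally_pos (cst := cst) (K := K)).not.2 hne
    omega
  have hs : 0 < n.size := Nat.size_pos.2 (by omega)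
  have hK1 : 1 ≤ K := by rw [hK]; exact Nat.mul_pos (by omega) hs
  rw [h0, Nat.size_zero]
  rw [Int.ediv_eq_iff_of_pos (by exact_mod_cast hK1)]
  constructor <;> push_cast <;> omega

theorem hams_subset (forced : ℕ → ℕ → Prop) : hams n N forced ⊆ hams n N (fun _ _ => False) :=
  fun _ h => by
    obtain ⟨h1, h2, -⟩ := mem_hams.1 h
    exact mem_hams.2 ⟨h1, h2, fun _ _ h => h.elim⟩

theorem hams_linked_zero (hS : Chordal n S) (hN : ∀ v ≤ n, N v ⊆ S v) :
    hams n N (RAM.linked fun _ => 0) = hams n N (fun _ _ => False) := by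
  refine (hams_subset _).antisymm fun H h => ?_
  obtain ⟨h1, h2, -⟩ := mem_hams.1 h
  refine mem_hams.2 ⟨h1, h2, fun e he hl => ?_⟩
  have h3 := snd_mem hS hN he
  have h4 := Finset.mem_Icc.1 h3.1
  rcases hl with h5 | h5 <;> simp only at h5 h3 <;> omega

/-- The path `p 0, …, p k` in the graph is stored as a linked list in `nx`. -/
structure IsList (n : ℕ) (N : ℕ → Finset ℕ) (p : ℕ → ℕ) (k : ℕ) (nx : ℕ → ℕ) : Prop where
  mem : ∀ i ≤ k, p i ∈ Finset.Icc 1 n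
  inj : ∀ i ≤ k, ∀ j ≤ k, p i = p j → i = j
  next : ∀ i < k, nx (p i) = p (i + 1)
  zero : ∀ y, (∀ i < k, y ≠ p i) → nx y = 0
  adj : ∀ i < k, Nb (edges n N) (p i) (p (i + 1))

theorem IsList.nb (h : IsList n N p k nx) (hH : H ∈ hams n N (RAM.linked nx)) :
    ∀ i < k, Nb H (p i) (p (i + 1)) := by
  intro i hi
  obtain ⟨-, -, h3⟩ := mem_hams.1 hH
  rcases h.adj i hi with h4 | h4
  · exact .inl (h3 _ h4 (.inr (h.next i hi)))
  · exact .inr (h3 _ h4 (.inl (h.next i hi)))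

/-- A cycle through the path contains an edge that prolongs the path. -/
theorem IsList.exists_next (h : IsList n N p k nx) (hS : Chordal n S) (hN : ∀ v ≤ n, N v ⊆ S v)
    (hn : 2 ≤ n) (hH : H ∈ hams n N (RAM.linked nx)) (hk : k + 1 < n) :
    ∃ y ∈ Finset.Icc 1 n, nx y = 0 ∧ Nb (edges n N) (p k) y ∧
      H ∈ hams n N (RAM.linked (Function.update nx (p k) y)) := by
  obtain ⟨h1, h2, h3⟩ := mem_hams.1 hH
  have hreg := h2.twoRegular hS hN hn h1
  obtain ⟨y, hy, hnb⟩ := hreg.extend hk h.mem h.inj (h.nb hH)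
  refine ⟨y, hreg.mem _ _ hnb.symm, h.zero y fun i hi => hy i hi.le, hnb.imp (@h1 _) (@h1 _),
    mem_hams.2 ⟨h1, h2, fun e he hl => ?_⟩⟩
  have h0 : nx (p k) = 0 := h.zero _ fun i hi he => by have := h.inj k le_rfl i hi.le he; omega
  have key : ∀ a b, (⟨a, b⟩ : (_ : ℕ) × ℕ) = e ∨ (⟨b, a⟩ : (_ : ℕ) × ℕ) = e →
      Function.update nx (p k) y a = b → e ∈ H := by
    intro a b hab hl'
    rw [Function.update_apply] at hl'
    split at hl'
    · rename_i ha
      subst ha hl'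
      rcases hab with rfl | rfl
      · rcases hnb with h4 | h4
        · exact h4
        · exact ((snd_mem hS hN (h1 h4)).2.asymm (snd_mem hS hN he).2).elim
      · rcases hnb with h4 | h4
        · exact ((snd_mem hS hN (h1 h4)).2.asymm (snd_mem hS hN he).2).elim
        · exact h4
    · rcases hab with rfl | rfl
      · exact h3 _ he (.inr hl')
      · exact h3 _ he (.inl hl')
  rcases hl with hl | hl
  · exact key e.2 e.1 (.inr rfl) hl
  · exact key e.1 e.2 (.inl rfl) hl

theorem IsList.snoc (h : IsList n N p k nx) (hS : Chordal n S) (hN : ∀ v ≤ n, N v ⊆ S v)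
    (hy : y ∈ Finset.Icc 1 n) (h0 : nx y = 0) (hnb : Nb (edges n N) (p k) y) :
    IsList n N (Function.update p (k + 1) y) (k + 1) (Function.update nx (p k) y) := by
  have hne : ∀ i ≤ k, y ≠ p i := by
    rintro i hi rfl
    rcases Nat.lt_or_eq_of_le hi with hi' | rfl
    · have h1 := h.next i hi'
      have h2 := Finset.mem_Icc.1 (h.mem (i + 1) hi')
      omega
    · rcases hnb with h1 | h1 <;> exact (snd_mem hS hN h1).2.ne rfl
  have hold : ∀ i ≤ k, Function.update p (k + 1) y i = p i := fun i hi =>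
    Function.update_of_ne (by omega) _ _
  have hnew : Function.update p (k + 1) y (k + 1) = y := Function.update_self _ _ _
  refine ⟨fun i hi => ?_, fun i hi j hj hij => ?_, fun i hi => ?_, fun x hx => ?_, fun i hi => ?_⟩
  · rcases Nat.lt_or_eq_of_le hi with hi | rfl
    · rw [hold i (by omega)]; exact h.mem i (by omega)
    · rwa [hnew]
  · rcases Nat.lt_or_eq_of_le hi with hi | rfl <;> rcases Nat.lt_or_eq_of_le hj with hj | rfl
    · rw [hold i (by omega), hold j (by omega)] at hij
      exact h.inj i (by omega) j (by omega) hij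
    · rw [hold i (by omega), hnew] at hij
      exact (hne i (by omega) hij.symm).elim
    · rw [hold j (by omega), hnew] at hij
      exact (hne j (by omega) hij).elim
    · rfl
  · rcases Nat.lt_or_eq_of_le (Nat.le_of_lt_succ hi) with hi | rfl
    · rw [hold i (by omega), hold (i + 1) (by omega), Function.update_of_ne]
      · exact h.next i hi
      · intro he
        have := h.inj i hi.le k le_rfl he
        omega
    · rw [hold i le_rfl, hnew, Function.update_self]
  · have h1 := hx k (by omega)
    rw [hold k le_rfl] at h1
    rw [Function.update_of_ne h1]
    exact h.zero x fun i hi => by rw [← hold i hi.le]; exact hx i (by omega)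
  · rcases Nat.lt_or_eq_of_le (Nat.le_of_lt_succ hi) with hi | rfl
    · rw [hold i (by omega), hold (i + 1) (by omega)]; exact h.adj i hi
    · rwa [hold i le_rfl, hnew]

end Elim

namespace RAM

open Elim

/-- Try the vertices in turn as successors of the last vertex `cur` of the path. A candidate must be
adjacent to `cur` and without a successor of its own, and the search ends, with `go` equal to `0`, as
soon as some cycle of optimal cost extends the path. A rejected candidate is overwritten by the next
one. The vertex `cur` itself, whose entry may be zero, is excluded by adjacency. -/
def nextP : Prog :=
  setP .go 1 ;;
  forP .a 1 (Exp.v .n + 1)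
    (iteP (Exp.v .go * (1 - (Exp.arr .nxt (Exp.v .a)).size) *
        Exp.inp (2 + Exp.arr .ord (Exp.v .cur) * Exp.v .n + Exp.arr .ord (Exp.v .a)))
      (stoP .nxt (Exp.v .cur) (Exp.v .a) ;; solveP ;;
        iteP (1 -
            (((Exp.v .T).size - 1) / Exp.v .K - Exp.v .best).size)
          (setP .go 0 ;; setP .w (Exp.v .a)) skipP)
      skipP)

/-- The whole algorithm. -/
def tspP : Prog :=
  preP ;; solveP ;;
  iteP (Exp.v .T)
    (setP .best (((Exp.v .T).size - 1) / Exp.v .K) ;; writeP (Exp.v .W - Exp.v .best) ;;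
      setP .cur 1 ;; writeP (Exp.arr .ord (Exp.v .cur)) ;;
      forP .lv 1 (Exp.v .n)
        (nextP ;; setP .cur (Exp.v .w) ;; writeP (Exp.arr .ord (Exp.v .cur))))
    skipP

end RAM

/-! ### Correctness of the search for an optimal cycle -/

namespace RAM

open Elim

variable {n N : ℕ} {G : SimpleGraph (Fin n)} {c : Sym2 (Fin n) → ℕ} {D : TreeDecomposition G N}
  {ord : ℕ → Fin n} {C : Ctx} {σ τ : St} {F K w : ℕ} {nx p : ℕ → ℕ} {best cur k : ℕ}

theorem stored_iff {S : ℕ → Finset ℕ} {o : ℕ → ℕ} : Stored n S o nx K σ ↔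
    σ.v .n = n ∧ σ.v .K = K ∧
    (∀ v u, 1 ≤ u → u < v → v ≤ n → σ.a .S (v * (n + 1) + u) = if u ∈ S v then 1 else 0) ∧
    (∀ i, 1 ≤ i → i ≤ n → σ.a .ord i = o i) ∧ (∀ i, 1 ≤ i → i ≤ n → σ.a .par i = Elim.par S i) ∧
    ∀ i, σ.a .nxt i = nx i := by
  constructor
  · intro h
    have h := h 0
    exact ⟨by simpa using h.n_eq, by simpa using h.K_eq, h.S_eq, h.ord_eq, h.par_eq, h.nxt_eq⟩
  · rintro ⟨h1, h2, h3, h4, h5, h6⟩ z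
    exact ⟨by simpa using h1, by simpa using h2, by simp, h3, h4, h5, h6⟩

/-- The setting for the whole algorithm; `F` bounds the values of the elimination forest. -/
structure Setup (C : Ctx) (G : SimpleGraph (Fin n)) (c : Sym2 (Fin n) → ℕ)
    (D : TreeDecomposition G N) (ord : ℕ → Fin n) (F : ℕ) : Prop extends PreCtx C G c D ord where
  arena : Arena C n (D.pred ord) (nbrs G ord (D.pred ord)) (pcost c ord) (fun i => (ord i : ℕ))
    (2 * n * n.size) D.width ((edges n (nbrs G ord (D.pred ord))).card + 1) F
  nxt_le : ∀ i, 1 ≤ i → i ≤ n → n ≤ C.ab .nxt i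

/-- The state between two evaluations, when the successors in the list are given by `nx` and `best`
is the saving of an optimal cycle. -/
structure Ready (G : SimpleGraph (Fin n)) (D : TreeDecomposition G N) (ord : ℕ → Fin n)
    (nx : ℕ → ℕ) (best cur : ℕ) (σ : St) : Prop where
  stored : Stored n (D.pred ord) (fun i => (ord i : ℕ)) nx (2 * n * n.size) σ
  M_eq : σ.v .M = ((edges n (nbrs G ord (D.pred ord))).card + 1 : ℕ)
  opt_nonneg : ∀ u, 0 ≤ σ.a .opt u
  best_eq : σ.v .best = best
  cur_eq : σ.v .cur = cur

theorem Ready.setv (h : Ready G D ord nx best cur σ) (x : Var) (y : ℤ)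
    (hx : x ∉ [Var.n, .K, .M, .best, .cur]) : Ready G D ord nx best cur (σ.setv x y) := by
  obtain ⟨h1, h2, h3, h4, h5⟩ := h
  rw [stored_iff] at h1
  simp only [List.mem_cons, not_or, List.not_mem_nil, not_false_eq_true, and_true] at hx
  obtain ⟨a1, a2, a3, a4, a5⟩ := hx
  refine ⟨stored_iff.2 ⟨?_, ?_, h1.2.2⟩, ?_, h3, ?_, ?_⟩
  · rw [St.setv_v, if_neg (Ne.symm a1), h1.1]
  · rw [St.setv_v, if_neg (Ne.symm a2), h1.2.1]
  · rw [St.setv_v, if_neg (Ne.symm a3), h2]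
  · rw [St.setv_v, if_neg (Ne.symm a4), h4]
  · rw [St.setv_v, if_neg (Ne.symm a5), h5]

theorem Ready.set_cur (h : Ready G D ord nx best cur σ) (y : ℕ) :
    Ready G D ord nx best y (σ.setv .cur y) := by
  obtain ⟨h1, h2, h3, h4, h5⟩ := h
  rw [stored_iff] at h1
  exact ⟨stored_iff.2 ⟨by simpa using h1.1, by simpa using h1.2.1, h1.2.2⟩, by simpa using h2, h3,
    by simpa using h4, by simp⟩

theorem Ready.put (h : Ready G D ord nx best cur σ) (z : ℤ) :
    Ready G D ord nx best cur (σ.put z) :=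
  ⟨fun z => ⟨(h.stored z).n_eq, (h.stored z).K_eq, (h.stored z).z_eq, (h.stored z).S_eq,
    (h.stored z).ord_eq, (h.stored z).par_eq, (h.stored z).nxt_eq⟩, h.M_eq, h.opt_nonneg, h.best_eq,
    h.cur_eq⟩

theorem Ready.set_nxt (h : Ready G D ord nx best cur σ) (i y : ℕ) :
    Ready G D ord (Function.update nx i y) best cur (σ.seta .nxt i y) := by
  obtain ⟨h1, h2, h3, h4, h5⟩ := h
  obtain ⟨a1, a2, a3, a4, a5, a6⟩ := stored_iff.1 h1
  refine ⟨stored_iff.2 ⟨a1, a2, by simpa using a3, by simpa using a4, by simpa using a5,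
    fun j => ?_⟩, h2, by simpa using h3, h4, h5⟩
  rw [St.seta_a, Function.update_apply]
  by_cases hj : j = i <;> simp [hj, a6]

theorem Setup.solve_ok (h : Setup C G c D ord F) (hr : Ready G D ord nx best cur σ) :
    Ok C solveP σ (solveTime n D.width D.depth ((edges n (nbrs G ord (D.pred ord))).card + 1))
      fun τ => SF σ τ ∧ Ready G D ord nx best cur τ ∧
        τ.v .T = tally n (nbrs G ord (D.pred ord)) (pcost c ord) (2 * n * n.size) nx := by
  refine (solveP_ok h.arena hr.stored (fun v => h.order.lev_le v) hr.opt_nonneg hr.M_eq).mono le_rfl ?_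
  rintro τ - ⟨h1, h2, h3⟩
  refine ⟨h1, ⟨hr.stored.sf h1, ?_, h2, ?_, ?_⟩, ?_⟩
  · rw [h1.var _ (by decide), hr.M_eq]
  · rw [h1.var _ (by decide), hr.best_eq]
  · rw [h1.var _ (by decide), hr.cur_eq]
  · rw [h3]
    exact combine_eq_sum_hams h.order.chordal (fun v _ => nbrs_subset v) h.two_le _ (Nat.lt_succ_self _)
      _ _ _

/-- The vertex `y` prolongs a path that ends in `cur` within an optimal cycle. -/
def Good (G : SimpleGraph (Fin n)) (c : Sym2 (Fin n) → ℕ) (D : TreeDecomposition G N)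
    (ord : ℕ → Fin n) (nx : ℕ → ℕ) (best cur y : ℕ) : Prop :=
  nx y = 0 ∧ Nb (edges n (nbrs G ord (D.pred ord))) cur y ∧
    ∃ H ∈ hams n (nbrs G ord (D.pred ord)) (linked (Function.update nx cur y)),
      saving n (nbrs G ord (D.pred ord)) (pcost c ord) H = best

/-- The time for `nextP`, if an evaluation takes time `T`. -/
def nextTime (n T : ℕ) : ℕ := n * (T + 7) + 3

theorem nb_edges_iff (h : IsElim G ord (D.pred ord)) {x y : ℕ} (hx : x ∈ Finset.Icc 1 n)
    (hy : y ∈ Finset.Icc 1 n) :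
    Nb (edges n (nbrs G ord (D.pred ord))) x y ↔ G.Adj (ord x) (ord y) := by
  refine ⟨h.adj_of_nb subset_rfl, fun ha => ?_⟩
  obtain ⟨hx1, hxn⟩ := Finset.mem_Icc.1 hx
  obtain ⟨hy1, hyn⟩ := Finset.mem_Icc.1 hy
  rcases lt_trichotomy x y with hxy | rfl | hxy
  · exact .inr (h.mem_edges.2 ⟨hx1, hxy, hyn, ha.symm⟩)
  · exact (ha.ne rfl).elim
  · exact .inl (h.mem_edges.2 ⟨hy1, hxy, hxn, ha⟩)

/-- If some vertex prolongs the path within an optimal cycle, then `nextP` finds one. The entry of `nxt`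
at `cur` is an arbitrary number `t` before a vertex is accepted. -/
theorem Setup.nextP_ok (h : Setup C G c D ord F) (hr : Ready G D ord nx best cur σ)
    (hcur : cur ∈ Finset.Icc 1 n) (h0 : nx cur = 0)
    (hmax : ∀ H ∈ hams n (nbrs G ord (D.pred ord)) (fun _ _ => False),
      saving n (nbrs G ord (D.pred ord)) (pcost c ord) H ≤ best)
    (hex : ∃ y ∈ Finset.Icc 1 n, Good G c D ord nx best cur y) :
    Ok C nextP σ (nextTime n
        (solveTime n D.width D.depth ((edges n (nbrs G ord (D.pred ord))).card + 1)))
      fun τ => (∃ y ∈ Finset.Icc 1 n, Good G c D ord nx best cur y ∧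
        Ready G D ord (Function.update nx cur y) best cur τ ∧ τ.v .w = y) ∧
        τ.out = σ.out ∧ τ.v .lv = σ.v .lv := by
  classical
  have hc := Finset.mem_Icc.1 hcur
  have hS := h.order.chordal
  have hN : ∀ v ≤ n, nbrs G ord (D.pred ord) v ⊆ D.pred ord v := fun v _ => nbrs_subset v
  have h1β : |(1 : ℤ)| ≤ 2 ^ C.β := by rw [abs_one]; exact one_le_pow₀ (by norm_num)
  set T := solveTime n D.width D.depth ((edges n (nbrs G ord (D.pred ord))).card + 1) with hT
  refine Ok.mono (T := 1 + (n * ((1 + (T + (1 + 1 + 1)) + 1) + 2) + 2)) ?_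
    (by unfold nextTime; ring_nf; omega) fun _ _ h => h
  refine Ok.seq (Ok.set (by decide) (by simp) (by simpa using h1β) ?_)
  refine (Ok.for (s := 1) (m := n) (by decide) (by decide) (by simp) (by simp) ?_
    (fun i τ => τ.v .a = (1 + i : ℕ) ∧ (τ.out = σ.out ∧ τ.v .lv = σ.v .lv) ∧
      ∃ t ≤ n, Ready G D ord (Function.update nx cur t) best cur τ ∧
        ((τ.v .go = 1 ∧ ∀ y, 1 ≤ y → y ≤ i → ¬ Good G c D ord nx best cur y) ∨
          (τ.v .go = 0 ∧ 1 ≤ t ∧ Good G c D ord nx best cur t ∧ τ.v .w = t))) ?_ ?_ ?_).mono le_rfl ?_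
  · have := h.abs_le (m := 1 + n) (by nlinarith)
    rwa [Nat.abs_cast] at this
  · refine ⟨by simp, by simp, 0, Nat.zero_le _, ?_, .inl ⟨by simp, fun y h1 h2 => by omega⟩⟩
    rw [← h0, Function.update_eq_self]
    exact (hr.setv _ _ (by decide)).setv _ _ (by decide)
  · rintro i τ - ⟨ha, -, t, -, hr', -⟩
    have hn := (stored_iff.1 hr'.stored).1
    exact ⟨by simp, by simp [hn]; ring, ha⟩
  · rintro i τ hi ⟨ha, hfix, t, ht, hr', hgo⟩ - -
    set y := 1 + i with hy
    have hyI : y ∈ Finset.Icc 1 n := Finset.mem_Icc.2 (by omega)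
    obtain ⟨hn, hK, -, hord, -, hnx⟩ := stored_iff.1 hr'.stored
    have einp : (Exp.inp (2 + Exp.arr .ord (Exp.v .cur) * Exp.v .n + Exp.arr .ord (Exp.v .a))).eval
        C.inp τ = ((if G.Adj (ord cur) (ord y) then c s(ord cur, ord y) + 1 else 0 : ℕ) : ℤ) := by
      simp only [eval_inp, eval_add, eval_two, eval_mul, eval_arr, eval_v, hr'.cur_eq, ha, hn,
        Int.toNat_natCast, hord cur hc.1 hc.2, hord y (by omega) (by omega)]
      rw [show (2 + ((ord cur : ℕ) : ℤ) * n + (ord y : ℕ)).toNat = 2 + (ord cur : ℕ) * n + (ord y : ℕ) by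
        rw [← Int.toNat_natCast (2 + (ord cur : ℕ) * n + (ord y : ℕ))]; push_cast; rfl, h.coded.adj]
    have econd : 0 < (Exp.v .go * (1 - (Exp.arr .nxt (Exp.v .a)).size) *
        Exp.inp (2 + Exp.arr .ord (Exp.v .cur) * Exp.v .n + Exp.arr .ord (Exp.v .a))).eval C.inp τ ↔
        τ.v .go = 1 ∧ nx y = 0 ∧ Nb (edges n (nbrs G ord (D.pred ord))) cur y := by
      rw [nb_edges_iff (isElim_pred h.order) hcur hyI, eval_mul, einp]
      by_cases hadj : G.Adj (ord cur) (ord y)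
      · have hyc : y ≠ cur := by rintro rfl; exact hadj.ne rfl
        simp only [hadj, if_true, and_true, eval_mul, eval_sub, eval_one, eval_size, eval_arr, eval_v,
          ha, Int.toNat_natCast, hnx y, Function.update_of_ne hyc]
        rw [mul_pos_iff_of_pos_right (by positivity)]
        have h3 : 0 < 1 - ((((nx y : ℕ) : ℤ).natAbs.size : ℕ) : ℤ) ↔ nx y = 0 :=
          one_sub_size_pos.trans (by norm_cast)
        rcases hgo with ⟨hg, -⟩ | ⟨hg, -⟩
        · rw [hg, one_mul, h3]; simp
        · rw [hg]; simp
      · simp [hadj]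
    refine Ok.ite (by decide) (by simp [hr'.cur_eq, ha]) (fun hcond => ?_) fun hcond => ?_ <;>
      rw [econd] at hcond
    · obtain ⟨hg, hny, hnb⟩ := hcond
      rcases hgo with ⟨-, hbad⟩ | ⟨hg0, -⟩
      swap
      · rw [hg0] at hg; exact absurd hg (by norm_num)
      refine Ok.seq (Ok.sto (by decide) (by decide) (by simp) (by simp) (by simp [hr'.cur_eq]) ?_ ?_)
      · simp only [eval_v, hr'.cur_eq, ha, Int.toNat_natCast, Nat.abs_cast]
        exact_mod_cast (show y ≤ n by omega).trans (h.nxt_le cur hc.1 hc.2)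
      simp only [eval_v, hr'.cur_eq, ha, Int.toNat_natCast]
      have hr2 := hr'.set_nxt cur y
      rw [Function.update_idem] at hr2
      refine Ok.seq ((h.solve_ok hr2).mono le_rfl ?_)
      rintro ρ - ⟨hsf, hr3, hT3⟩
      obtain ⟨-, hK3, -⟩ := stored_iff.1 hr3.stored
      have hvar : ∀ x, x ∉ solveVars → ρ.v x = τ.v x := fun x hx => by simpa using hsf.var x hx
      have hout : ρ.out = τ.out := by simpa using hsf.out
      have etest : 0 < (1 - (((Exp.v .T).size - 1) / Exp.v .K - Exp.v .best).size).eval C.inp ρ ↔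
          ∃ H ∈ hams n (nbrs G ord (D.pred ord)) (linked (Function.update nx cur y)),
            saving n (nbrs G ord (D.pred ord)) (pcost c ord) H = best := by
        simp only [eval_sub, eval_one, eval_size, eval_div, eval_v, hT3, hK3, hr3.best_eq,
          one_sub_size_pos, Int.natAbs_natCast, sub_eq_zero]
        by_cases hne : (hams n (nbrs G ord (D.pred ord)) (linked (Function.update nx cur y))).Nonempty
        · obtain ⟨H, hH, h5, h6⟩ := exists_saving (cst := pcost c ord) hS hN h.two_le rfl hne
          rw [h5]
          constructor
          · intro h7; exact ⟨H, hH, by exact_mod_cast h7⟩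
          · rintro ⟨H', hH', rfl⟩
            exact_mod_cast le_antisymm (hmax H (hams_subset _ hH)) (h6 H' hH')
        · rw [tally_eq_neg h.two_le rfl hne]
          constructor
          · intro h7; omega
          · rintro ⟨H', hH', -⟩; exact (hne ⟨H', hH'⟩).elim
      refine Ok.ite (by decide) (by simp) (fun ht2 => ?_) fun ht2 => ?_ <;> rw [etest] at ht2
      · refine Ok.seq (Ok.set (by decide) (by simp) (by simp) ?_)
        have ea : ρ.v .a = y := (hvar _ (by decide)).trans ha
        refine Ok.set (by decide) (by simp) ?_ ?_
        · have := h.abs_le (m := y) (by nlinarith)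
          simpa [ea] using this
        · refine ⟨by simp [ea, hy], by simp, ?_, y, by omega, ?_, .inr ⟨by simp, by omega,
            ⟨hny, hnb, ht2⟩, by simp [ea]⟩⟩
          · simp [hout, hfix, hvar .lv (by decide)]
          · exact ((hr3.setv _ _ (by decide)).setv _ _ (by decide)).setv _ _ (by decide)
      · refine Ok.skip' (by omega) ⟨?_, by simp, ?_, y, by omega, hr3.setv _ _ (by decide), .inl
          ⟨?_, fun x h1 h2 => ?_⟩⟩
        · rw [hvar _ (by decide), ha]
        · simp [hout, hfix, hvar .lv (by decide)]
        · simp [hvar .go (by decide), hg]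
        · rcases Nat.lt_or_eq_of_le h2 with h3 | rfl
          · exact hbad x h1 (by omega)
          · rintro ⟨-, -, h4⟩
            exact ht2 (by rwa [hy, add_comm])
    · refine Ok.skip' (by omega) ⟨ha, by simp, by simpa using hfix, t, ht,
        hr'.setv _ _ (by decide), ?_⟩
      rcases hgo with ⟨hg, hbad⟩ | ⟨hg, h4⟩
      · refine .inl ⟨by simpa using hg, fun x h1 h2 => ?_⟩
        rcases Nat.lt_or_eq_of_le h2 with h3 | rfl
        · exact hbad x h1 (by omega)
        · rintro ⟨h4, h5, -⟩
          exact hcond ⟨hg, by rwa [hy, add_comm], by rwa [hy, add_comm]⟩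
      · exact .inr ⟨by simpa using hg, by simpa using h4⟩
  · rintro τ - ⟨-, hfix, t, ht, hr', hgo⟩
    refine ⟨?_, hfix⟩
    rcases hgo with ⟨-, hbad⟩ | ⟨-, h1, h2, h3⟩
    · obtain ⟨y, hy, hgood⟩ := hex
      have := Finset.mem_Icc.1 hy
      exact (hbad y this.1 this.2 hgood).elim
    · exact ⟨t, Finset.mem_Icc.2 ⟨h1, ht⟩, h2, hr', h3⟩

/-- The time for the whole algorithm, if an evaluation takes time `T`. -/
def tspTime (n N T : ℕ) : ℕ := preTime n N + (T + (n * (nextTime n T + 6) + 10))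

/-- The first evaluation finds the optimal cost or the absence of Hamiltonian cycles; then the cycle is
grown, keeping the path within an optimal cycle. -/
theorem Setup.tspP_ok (h : Setup C G c D ord F) :
    Ok C tspP ⟨fun _ => 0, fun _ _ => 0, []⟩ (tspTime n N
      (solveTime n D.width D.depth ((edges n (nbrs G ord (D.pred ord))).card + 1)))
      fun τ => TSP.IsAnswer G c τ.out := by
  have hS := h.order.chordal
  have hn := h.two_le
  have hE := isElim_pred h.order
  set T := solveTime n D.width D.depth ((edges n (nbrs G ord (D.pred ord))).card + 1) with hT
  set Nb' := nbrs G ord (D.pred ord) with hNb'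
  have hN : ∀ v ≤ n, Nb' v ⊆ D.pred ord v := fun v _ => nbrs_subset v
  have h1β : |(1 : ℤ)| ≤ 2 ^ C.β := by rw [abs_one]; exact one_le_pow₀ (by norm_num)
  refine Ok.mono (T := preTime n N + (T + ((1 + (1 + (1 + (1 + ((n - 1) * ((nextTime n T + (1 + 1)) + 2)
    + 2)))) + 1)))) ?_ ?_ fun _ _ h => h
  swap
  · have := Nat.mul_le_mul (show n - 1 ≤ n by omega) (show nextTime n T + (1 + 1) + 2 ≤
      nextTime n T + 6 by omega)
    unfold tspTime; omega
  refine Ok.seq ((preP_ok h.toPreCtx).mono le_rfl ?_)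
  rintro σ - ⟨hP, hK⟩
  have hst : Stored n (D.pred ord) (fun i => (ord i : ℕ)) (fun _ => 0) (2 * n * n.size) σ := by
    refine stored_iff.2 ⟨hP.n_eq, hK, fun v u h1 h2 h3 => ?_, hP.ord_eq, hP.par_eq, by simp [hP.nxt_eq]⟩
    rw [hP.S_eq v u h1 h2 h3]; simp [h3]
  refine Ok.seq ((solveP_ok h.arena hst (fun v => h.order.lev_le v) (by simp [hP.opt_eq])
    hP.M_eq).mono le_rfl ?_)
  rintro τ - ⟨hsf, hopt, hTv⟩
  have hst' := hst.sf hsf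
  have hTv : τ.v .T = tally n Nb' (pcost c ord) (2 * n * n.size) fun _ => 0 := by
    rw [hTv]; exact combine_eq_sum_hams hS hN hn _ (Nat.lt_succ_self _) _ _ _
  have hMv : τ.v .M = ((edges n Nb').card + 1 : ℕ) := by rw [hsf.var _ (by decide), hP.M_eq]
  have hWv : τ.v .W = ecost (pcost c ord) (edges n Nb') := by rw [hsf.var _ (by decide), hP.W_eq]
  have hout : τ.out = [] := by rw [hsf.out, hP.out_eq]
  have hle : ∀ H ∈ hams n Nb' (fun _ _ => False),
      ecost (pcost c ord) H ≤ ecost (pcost c ord) (edges n Nb') := fun H hH =>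
    Finset.sum_le_sum_of_subset (mem_hams.1 hH).1
  refine Ok.ite (by decide) (by simp) (fun hc => ?_) fun hc => ?_ <;>
    rw [eval_v, hTv, Nat.cast_pos, tally_pos] at hc
  swap
  · refine Ok.skip' (by omega) (.inr ⟨fun a q hq => hc ?_, hout⟩)
    rw [hams_linked_zero hS hN]
    exact ⟨_, hE.walkEdges_mem hq⟩
  obtain ⟨H0, hH0, hsize, hmax⟩ := exists_saving (cst := pcost c ord) hS hN hn rfl hc
  rw [hams_linked_zero hS hN] at hmax
  set best := saving n Nb' (pcost c ord) H0 with hbest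
  obtain ⟨hn1, hK1, -, hord1, -, -⟩ := stored_iff.1 hst'
  have ebest : (((Exp.v .T).size - 1) / Exp.v .K).eval C.inp τ = best := by
    simpa [hTv, hK1] using hsize
  have hbW : best ≤ ecost (pcost c ord) (edges n Nb') := Nat.sub_le _ _
  refine Ok.seq (Ok.set (by decide) (by simp) ?_ ?_) <;> rw [ebest]
  · rw [Nat.abs_cast]
    have := h.weight_le
    rw [← hE.ecost_edges c] at this
    exact_mod_cast hbW.trans this
  refine Ok.seq (Ok.write (by decide) (by simp) ?_)
  refine Ok.seq (Ok.set (by decide) (by simp) (by simpa using h1β) ?_)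
  refine Ok.seq (Ok.write (by decide) (by simp) ?_)
  simp only [eval_one, eval_arr, eval_sub, eval_v, St.setv_v, St.put_v, St.put_a, St.setv_a, if_true,
    reduceCtorEq, if_false, hWv, Int.toNat_one, hord1 1 le_rfl (by omega)]
  refine (Ok.for (s := 1) (m := n - 1) (by decide) (by decide) (by simp) (by simp) ?_
    (fun k ρ => (∃ p nx, IsList n Nb' p k nx ∧
      (∃ H ∈ hams n Nb' (linked nx), saving n Nb' (pcost c ord) H = best) ∧
      Ready G D ord nx best (p k) ρ ∧
      ρ.out = ((ecost (pcost c ord) (edges n Nb') : ℤ) - best) ::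
        (List.range (k + 1)).map fun i => ((ord (p i) : ℕ) : ℤ)) ∧ ρ.v .lv = (1 + k : ℕ)) ?_ ?_ ?_).mono
    le_rfl ?_
  · have := h.abs_le (m := 1 + (n - 1)) (by nlinarith [Nat.sub_le n 1])
    rwa [Nat.abs_cast] at this
  · refine ⟨⟨fun _ => 1, fun _ => 0, ⟨fun i hi => Finset.mem_Icc.2 ⟨le_rfl, by omega⟩,
      fun i hi j hj _ => by omega, by omega, by simp, by omega⟩, ⟨H0, hH0, rfl⟩, ?_,
      by simp [hout]⟩, by simp⟩
    have h1 := stored_iff.1 hst'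
    refine ⟨stored_iff.2 ?_, by simpa using hMv, by simpa using hopt, by simp, by simp⟩
    simpa using h1
  · rintro k ρ - ⟨⟨p, nx, -, -, hr, -⟩, hl⟩
    have := (stored_iff.1 hr.stored).1
    refine ⟨by simp, ?_, hl⟩
    rw [eval_v, this]; congr 1; omega
  · rintro k ρ hk ⟨⟨p, nx, hp, ⟨H, hH, hHb⟩, hr, ho⟩, hl⟩ - -
    have h0 : nx (p k) = 0 := hp.zero _ fun i hi he => by
      have := hp.inj k le_rfl i hi.le he; omega
    have hex : ∃ y ∈ Finset.Icc 1 n, Good G c D ord nx best (p k) y := by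
      obtain ⟨y, h1, h2, h3, h4⟩ := hp.exists_next hS hN hn hH (by omega)
      exact ⟨y, h1, h2, h3, H, h4, hHb⟩
    refine Ok.seq ((h.nextP_ok hr (hp.mem k le_rfl) h0 hmax hex).mono le_rfl ?_)
    rintro μ - ⟨⟨y, hy, ⟨hy0, hnb, hHy⟩, hr2, hw⟩, ho2, hl2⟩
    have hyI := Finset.mem_Icc.1 hy
    refine Ok.seq (Ok.set (by decide) (by simp) ?_ (Ok.write (by decide) ?_ ?_))
    · rw [eval_v, hw]
      exact h.abs_le (by nlinarith)
    · simp [hw]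
    have hord2 := (stored_iff.1 hr2.stored).2.2.2.1
    simp only [eval_v, eval_arr, hw, St.setv_v, St.setv_a, if_true, Int.toNat_natCast,
      hord2 y hyI.1 hyI.2]
    have hnew : Function.update p (k + 1) y (k + 1) = y := Function.update_self _ _ _
    refine ⟨by simp [hl2, hl], ⟨_, _, hp.snoc hS hN hy hy0 hnb, hHy, ?_, ?_⟩, by simp⟩
    · rw [hnew]
      exact ((hr2.set_cur y).put _).setv _ _ (by decide)
    · rw [St.setv_out, St.put_out, St.setv_out, ho2, ho, List.range_succ (n := k + 1), List.map_append,
        List.map_singleton, hnew, List.cons_append]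
      congr 2
      refine List.map_congr_left fun i hi => ?_
      have := List.mem_range.1 hi
      rw [Function.update_of_ne (by omega)]
  · rintro ρ - ⟨⟨p, nx, hp, ⟨H, hH, hHb⟩, -, ho⟩, -⟩
    have hH' := hams_subset _ hH
    obtain ⟨a, q, hq, hsupp, hcost⟩ := hE.exists_cycle hn c hH' (p := p)
      (fun i hi => hp.mem i (by omega)) (fun i hi j hj => hp.inj i (by omega) j (by omega))
      (fun i hi => hp.nb hH i (by omega))
    have h1 := hle H hH'
    refine .inl ⟨a, q, hq, fun b q' hq' => ?_, ?_⟩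
    · have h2 := hE.walkEdges_mem hq'
      have h3 := hmax _ h2
      have h4 := hle _ h2
      rw [hcost, ← hE.ecost_walkEdges c hq'.isCycle.isTrail.edges_nodup]
      unfold saving at h3 hHb
      rw [hbest] at h3
      unfold saving at hbest
      omega
    · rw [ho, hsupp, hcost, show n - 1 + 1 = n by omega]
      congr 1
      · unfold saving at hHb
        omega
      · -- The list of vertices in the answer elaborates as a bind, not as a map.
        simp only [List.pure_def, List.bind_eq_flatMap]
        generalize List.range n = l
        induction l with
        | nil => rfl
        | cons i l ih => simpa using ih

end RAM

/-! ### The number of bit operations -/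

namespace RAM

/-- The total length of the register numbers and constants in an instruction. -/
def Instr.litLen : Instr → ℕ
  | .const r z => len r + len z
  | .op _ r a b => len r + len a + len b
  | .load r a => len r + len a
  | .store a b => len a + len b
  | .read r a => len r + len a
  | .write a => len a

/-- The total length of the register numbers and constants in a program. -/
def Prog.litLen : Prog → ℕ
  | .instr i => i.litLen
  | .seq p q => p.litLen + q.litLen
  | .ite a p q => len a + p.litLen + q.litLen
  | .loop a p => len a + p.litLen

theorem State.len_mem_le (s : State) (r : ℕ) : len (s.mem r) ≤ s.space + 1 := by
  by_cases h : s.mem r = 0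
  · rw [h]; simp [len]
  · have h1 : len ((r : ℕ) : ℤ) + len (s.mem r) ≤ s.space :=
      Finset.single_le_sum (f := fun r => len ((r : ℕ) : ℤ) + len (s.mem r))
        (fun _ _ => Nat.zero_le _) (Finsupp.mem_support_iff.2 h)
    omega

theorem Instr.bitCost_le {inp : List ℕ} {s : State} {i : Instr} {Y : ℕ}
    (hinp : ∀ j, len (inp.getD j 0 : ℕ) ≤ Y) (hs : s.space + 1 ≤ Y)
    (hf : (i.exec inp s).space + 1 ≤ Y) : i.bitCost inp s ≤ (3 * i.litLen + 3) * Y ^ 2 := by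
  have hY : Y ≤ Y ^ 2 := Nat.le_self_pow two_ne_zero Y
  have h1 : 1 ≤ Y ^ 2 := by nlinarith
  have hm : ∀ r, len (s.mem r) ≤ Y := fun r => (s.len_mem_le r).trans hs
  have hl : i.litLen ≤ i.litLen * Y ^ 2 := Nat.le_mul_of_pos_right _ (by omega)
  have key : ∀ m, m ≤ i.litLen + 3 * Y ^ 2 → m ≤ (3 * i.litLen + 3) * Y ^ 2 := fun m hm => by
    have : (3 * i.litLen + 3) * Y ^ 2 = 3 * (i.litLen * Y ^ 2) + 3 * Y ^ 2 := by ring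
    omega
  refine key _ ?_
  cases i with
  | const r z => exact Nat.le_add_right _ _
  | op o r a b =>
    have ha := hm a
    have hb := hm b
    have hmul : len (s.mem a) * len (s.mem b) ≤ Y ^ 2 := by rw [sq]; exact Nat.mul_le_mul ha hb
    have he : len (o.eval (s.mem a) (s.mem b)) ≤ Y := by
      have := (State.len_mem_le _ r).trans hf
      simpa [Instr.exec] using this
    simp only [Instr.bitCost, Instr.litLen]
    cases o <;> simp only [Op.bitCost] <;> omega
  | load r a =>
    have := hm a; have := hm (s.mem a).toNat
    simp only [Instr.bitCost, Instr.litLen]; omega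
  | store a b =>
    have := hm a; have := hm b
    simp only [Instr.bitCost, Instr.litLen]; omega
  | read r a =>
    have := hm a; have := hinp (s.mem a).toNat
    simp only [Instr.bitCost, Instr.litLen]; omega
  | write a =>
    have := hm a
    simp only [Instr.bitCost, Instr.litLen]; omega

theorem testCost_le {s : State} {a Y R : ℕ} (hs : s.space + 1 ≤ Y) (hR : len a ≤ R) :
    testCost s a ≤ (3 * R + 3) * Y ^ 2 := by
  have hY : Y ≤ Y ^ 2 := Nat.le_self_pow two_ne_zero Y
  have h1 : 1 ≤ Y ^ 2 := by nlinarith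
  have := s.len_mem_le a
  have hl : R ≤ R * Y ^ 2 := Nat.le_mul_of_pos_right _ (by omega)
  have : (3 * R + 3) * Y ^ 2 = 3 * (R * Y ^ 2) + 3 * Y ^ 2 := by ring
  unfold testCost
  omega

theorem Run.space_le {inp : List ℕ} {p : Prog} {s f : State} {t b m : ℕ} (h : Run inp p s f t b m) :
    s.space ≤ m := by
  induction h with
  | instr i s => exact le_max_left _ _
  | seq _ _ ih _ => exact ih.trans (le_max_left _ _)
  | ite_pos _ _ ih => exact ih
  | ite_neg _ _ ih => exact ih
  | loop_done _ => exact le_rfl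
  | loop_step _ _ _ ih _ => exact ih.trans (le_max_left _ _)

/-- A step costs a number of bit operations that is quadratic in the space. -/
theorem Run.bits_le {inp : List ℕ} {p : Prog} {s f : State} {t b m : ℕ} (h : Run inp p s f t b m)
    {Y R : ℕ} (hinp : ∀ j, len (inp.getD j 0 : ℕ) ≤ Y) (hm : m + 1 ≤ Y) (hR : p.litLen ≤ R) :
    b ≤ t * ((3 * R + 3) * Y ^ 2) := by
  induction h with
  | instr i s =>
    rw [one_mul]
    refine (Instr.bitCost_le hinp (by omega) (by omega)).trans (Nat.mul_le_mul_right _ ?_)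
    simp only [Prog.litLen] at hR
    omega
  | seq h1 h2 ih1 ih2 =>
    simp only [Prog.litLen] at hR
    have := ih1 (by omega) (by omega)
    have := ih2 (by omega) (by omega)
    rw [add_mul]; omega
  | ite_pos _ h1 ih =>
    simp only [Prog.litLen] at hR
    have := ih hm (by omega)
    have := h1.space_le
    rw [add_mul, one_mul]
    exact add_le_add (ih hm (by omega)) (testCost_le (by omega) (by omega))
  | ite_neg _ h1 ih =>
    simp only [Prog.litLen] at hR
    have := h1.space_le
    rw [add_mul, one_mul]
    exact add_le_add (ih hm (by omega)) (testCost_le (by omega) (by omega))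
  | loop_done _ =>
    simp only [Prog.litLen] at hR
    rw [one_mul]
    exact testCost_le hm (by omega)
  | loop_step _ h1 h2 ih1 ih2 =>
    have hR' := hR
    simp only [Prog.litLen] at hR'
    have := h1.space_le
    rw [add_mul, add_mul, one_mul]
    exact add_le_add (add_le_add (ih1 (by omega) (by omega)) (ih2 (by omega) hR))
      (testCost_le (by omega) (by omega))

/-! ### The input -/

variable {n N : ℕ} {G : SimpleGraph (Fin n)} {c : Sym2 (Fin n) → ℕ} {D : TreeDecomposition G N}

theorem coded_encode : Coded (TSP.encode G c D) G c D := by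
  classical
  have hidx : ∀ {m : ℕ} (x : Fin m) (b : Fin n), (x : ℕ) * n + b < m * n := fun {m} x b => by
    have h1 := x.2
    have h2 := b.2
    calc (x : ℕ) * n + b < x * n + n := by omega
      _ = (x + 1) * n := by ring
      _ ≤ m * n := Nat.mul_le_mul_right _ h1
  have hdiv : ∀ {m : ℕ} (x : Fin m) (b : Fin n) (h : (x : ℕ) * n + b < m * n),
      (⟨x * n + b, h⟩ : Fin (m * n)).divNat = x ∧ (⟨x * n + b, h⟩ : Fin (m * n)).modNat = b := by
    intro m x b h
    have hn : 0 < n := b.pos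
    constructor <;> apply Fin.ext <;> simp only [Fin.divNat, Fin.modNat]
    · rw [add_comm, Nat.add_mul_div_right _ _ hn, Nat.div_eq_of_lt b.2, zero_add]
    · rw [add_comm, Nat.add_mul_mod_self_right, Nat.mod_eq_of_lt b.2]
  refine ⟨by simp [TSP.encode], by simp [TSP.encode], fun a b => ?_, fun x => ?_, fun x a => ?_⟩
  · have h := hidx a b
    rw [TSP.encode, List.getD_append _ _ _ _ (by simp; omega), List.getD_append _ _ _ _ (by simp; omega),
      List.getD_append_right _ _ _ _ (by simp; omega)]
    have e : 2 + (a : ℕ) * n + b - [n, N].length = a * n + b := by simp; omega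
    rw [e, List.getD_eq_getElem _ _ (by simpa using h), List.getElem_ofFn, (hdiv a b h).1, (hdiv a b h).2]
  · have h := x.2
    rw [TSP.encode, List.getD_append _ _ _ _ (by simp; omega),
      List.getD_append_right _ _ _ _ (by simp; omega)]
    simp only [List.length_append, List.length_cons, List.length_nil, List.length_ofFn]
    rw [show 2 + n * n + (x : ℕ) - (0 + 1 + 1 + n * n) = x by omega,
      List.getD_eq_getElem _ _ (by simp), List.getElem_ofFn]
  · have h := hidx x a
    rw [TSP.encode, List.getD_append_right _ _ _ _ (by simp; omega)]
    simp only [List.length_append, List.length_cons, List.length_nil, List.length_ofFn]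
    rw [show 2 + n * n + N + (x : ℕ) * n + a - (0 + 1 + 1 + n * n + N) = x * n + a by omega,
      List.getD_eq_getElem _ _ (by simpa using h), List.getElem_ofFn, (hdiv x a h).1, (hdiv x a h).2]

theorem weight_le {a b : Fin n} (h : G.Adj a b) : c s(a, b) ≤ TSP.totalWeight G c := by
  classical
  unfold TSP.totalWeight
  exact Finset.single_le_sum (f := c) (fun _ _ => Nat.zero_le _)
    (Finset.mem_filter.2 ⟨Finset.mem_univ _, h⟩)

theorem getD_encode_le {B : ℕ} (hn : n ≤ B) (hN : N ≤ B) (h1 : 1 ≤ B)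
    (hW : TSP.totalWeight G c + 1 ≤ B) (i : ℕ) : (TSP.encode G c D).getD i 0 ≤ B := by
  classical
  have key : ∀ x ∈ TSP.encode G c D, x ≤ B := by
    intro x hx
    simp only [TSP.encode, List.mem_append, List.mem_cons, List.not_mem_nil, or_false,
      List.mem_ofFn] at hx
    rcases hx with (((rfl | rfl) | ⟨k, rfl⟩) | ⟨k, rfl⟩) | ⟨k, rfl⟩
    · exact hn
    · exact hN
    · split
      · rename_i h; have := weight_le (c := c) h; omega
      · omega
    · exact (D.parent k).2.le.trans hN
    · split <;> omega
  rcases Nat.lt_or_ge i (TSP.encode G c D).length with h | h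
  · rw [List.getD_eq_getElem _ _ h]; exact key _ (List.getElem_mem h)
  · rw [List.getD_eq_default _ _ h]; omega

end RAM

/-! ### Bounds for time and space -/

namespace RAM

open Elim

variable {n N : ℕ} {G : SimpleGraph (Fin n)} {c : Sym2 (Fin n) → ℕ} {D : TreeDecomposition G N}

theorem fullBound_le {N : ℕ → Finset ℕ} {K z : ℕ} {cst : ℕ → ℕ → ℕ} (hz1 : 1 ≤ z)
    (hz : z ≤ 2 ^ (2 * n.size)) : fullBound n N K cst z ≤
      2 ^ ((2 * n.size + 1) * n + ((2 * n.size + 1) * (edges n N).card + K * ecost cst (edges n N))) := by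
  have hL := (Nat.lt_size_self n).le
  have h1 : ∀ u ∈ Finset.Icc 1 n, 2 * u * lam n N K cst z u ≤
      2 ^ ((2 * n.size + 1) + ∑ v ∈ N u, ((2 * n.size + 1) + K * cst v u)) := by
    intro u hu
    have hu := Finset.mem_Icc.1 hu
    rw [lam, pow_add, ← Finset.prod_pow_eq_pow_sum, ← mul_assoc]
    refine Nat.mul_le_mul ?_ (Finset.prod_le_prod' fun v _ => ?_)
    · calc 2 * u * n ≤ 2 * 2 ^ n.size * 2 ^ n.size :=
            Nat.mul_le_mul (Nat.mul_le_mul_left _ (hu.2.trans hL)) hL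
        _ = _ := by ring
    · have h2 : 1 ≤ 2 ^ (K * cst v u) := Nat.one_le_two_pow
      calc z + 2 ^ (K * cst v u) ≤ 2 * (z * 2 ^ (K * cst v u)) := by nlinarith
        _ ≤ 2 * (2 ^ (2 * n.size) * 2 ^ (K * cst v u)) :=
            Nat.mul_le_mul_left _ (Nat.mul_le_mul_right _ hz)
        _ = _ := by ring
  refine (Finset.prod_le_prod' h1).trans ?_
  rw [Finset.prod_pow_eq_pow_sum]
  refine le_of_eq (congrArg _ ?_)
  rw [edges, Finset.card_sigma, ecost, Finset.sum_sigma, Finset.mul_sum, Finset.mul_sum]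
  simp only [Finset.sum_add_distrib, Finset.sum_const, Nat.card_Icc, smul_eq_mul, Finset.mul_sum,
    Nat.add_sub_cancel, mul_comm n]
  congr 2
  · ring
  · rw [← Finset.sum_add_distrib]
    exact Finset.sum_congr rfl fun _ _ => by ring

/-- The unit in which the length of the numbers is measured. -/
noncomputable def unit (G : SimpleGraph (Fin n)) (c : Sym2 (Fin n) → ℕ) (D : TreeDecomposition G N) :
    ℕ := max (TSP.totalWeight G c) 1 * D.width * n * n.size

/-- Inequalities between the unit and the parameters of the problem. -/
structure UnitFacts (n w L W Z : ℕ) : Prop where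
  two_le_n : 2 ≤ n
  two_le_L : 2 ≤ L
  nL : n * L ≤ Z
  nwL : n * w * L ≤ Z
  nW : n * L * W ≤ Z
  W : W + 1 ≤ Z
  nw : n * w + 1 ≤ Z
  L : 2 * L ≤ Z
  four : 4 ≤ Z

theorem unitFacts (hw : 1 ≤ D.width) :
    UnitFacts n D.width n.size (TSP.totalWeight G c) (unit G c D) := by
  have hn := D.two_le_n hw
  have hL : 2 ≤ n.size := by
    have := Nat.lt_size_self n
    by_contra h
    have : 2 ^ n.size ≤ 2 ^ 1 := Nat.pow_le_pow_right (by norm_num) (by omega)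
    omega
  unfold unit
  set w := D.width
  set L := n.size
  set W := TSP.totalWeight G c
  have hm1 : 1 ≤ max W 1 := le_max_right _ _
  have hm2 : W ≤ max W 1 := le_max_left _ _
  have e1 : n * w * L ≤ max W 1 * w * n * L := by
    calc n * w * L = 1 * w * n * L := by ring
      _ ≤ _ := by gcongr
  have e0 : n * L ≤ n * w * L := by
    calc n * L = n * 1 * L := by ring
      _ ≤ _ := by gcongr
  have e2 : n * L * W ≤ max W 1 * w * n * L := by
    calc n * L * W = W * 1 * n * L := by ring
      _ ≤ _ := by gcongr
  have e3 : 2 * L ≤ n * L := Nat.mul_le_mul_right _ hn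
  have e4 : n * w + 1 ≤ n * w * L := by
    have : 2 ≤ n * w := by nlinarith
    nlinarith
  have e5 : 4 * max W 1 ≤ max W 1 * w * n * L := by
    calc 4 * max W 1 = max W 1 * 1 * 2 * 2 := by ring
      _ ≤ _ := by gcongr
  exact ⟨hn, hL, e0.trans e1, e1, e2, by omega, e4.trans e1, (e3.trans e0).trans e1, by omega⟩

theorem UnitFacts.two_mul_pow_le {n w L W Z M : ℕ} (h : UnitFacts n w L W Z) (hM : M ≤ 2 ^ (2 * L)) :
    (2 * M) ^ n ≤ 2 ^ (3 * Z) := by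
  calc (2 * M) ^ n ≤ (2 ^ (2 * L + 1)) ^ n :=
        Nat.pow_le_pow_left (by rw [pow_succ]; omega) n
    _ = 2 ^ (2 * (n * L) + n) := by rw [← pow_mul]; congr 1; ring
    _ ≤ _ := Nat.pow_le_pow_right (by norm_num) (by
        have := h.nL
        have : n * 1 ≤ n * L := Nat.mul_le_mul_left _ (by have := h.two_le_L; omega)
        omega)

theorem UnitFacts.small {w W Z : ℕ} (h : UnitFacts n w n.size W Z) :
    64 * (n + 2) ^ 4 ≤ 2 ^ (5 * Z) := by
  have h1 : n + 2 ≤ 2 ^ (n.size + 1) := by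
    have := Nat.lt_size_self n
    have := h.two_le_n
    rw [pow_succ]; omega
  calc 64 * (n + 2) ^ 4 ≤ 2 ^ 6 * (2 ^ (n.size + 1)) ^ 4 :=
        Nat.mul_le_mul_left _ (Nat.pow_le_pow_left h1 4)
    _ = 2 ^ (4 * n.size + 10) := by rw [← pow_mul, ← pow_add]; congr 1; ring
    _ ≤ _ := Nat.pow_le_pow_right (by norm_num) (by have := h.L; have := h.four; omega)

open Classical in
/-- The entries of the arrays are bounded by this function. -/
noncomputable def arrBound (n : ℕ) (S : ℕ → Finset ℕ) (d Z : ℕ) : Arr → ℕ → ℕ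
  | .ord, i | .par, i | .nxt, i => if i ∈ Finset.range (n + 1) then n else 0
  | .opt, i => if i ∈ Finset.range (n + 1) then 2 * n + 2 else 0
  | .S, i => if i ∈ (Finset.range (n + 1)).biUnion fun v => (S v).image fun u => v * (n + 1) + u
      then 1 else 0
  | .acc, i | .prod, i => if i ∈ Finset.range (d + 1) then 2 ^ (8 * Z) else 0

open Classical in
/-- The entries of the arrays that are used. -/
noncomputable def arrSup (n : ℕ) (S : ℕ → Finset ℕ) (d : ℕ) : Arr → Finset ℕ
  | .ord | .par | .nxt | .opt => Finset.range (n + 1)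
  | .S => (Finset.range (n + 1)).biUnion fun v => (S v).image fun u => v * (n + 1) + u
  | .acc | .prod => Finset.range (d + 1)

theorem len_reg_le {i m : ℕ} (k : Arr) (hi : i < 2 ^ m) : len ((64 * i + k.reg : ℕ) : ℤ) ≤ m + 7 := by
  have := k.reg_lt
  refine len_le_of_lt (m := m + 6) ?_
  rw [pow_add]; omega

/-- The space for an array whose entries and their indices are short. -/
theorem sum_len_le (k : Arr) (s : Finset ℕ) (f : ℕ → ℕ) {a m B : ℕ} (hs : s.card ≤ a)
    (hi : ∀ i ∈ s, i < 2 ^ m) (hf : ∀ i, (f i).size ≤ B) :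
    ∑ i ∈ s, (len ((64 * i + k.reg : ℕ) : ℤ) + ((f i).size + 1)) ≤ a * (m + B + 8) := by
  refine (Finset.sum_le_card_nsmul s _ (m + B + 8) fun i his => ?_).trans ?_
  · have := len_reg_le k (hi i his); have := hf i; omega
  · rw [smul_eq_mul]; exact Nat.mul_le_mul_right _ hs

theorem size_ite_le {p : Prop} [Decidable p] {a B : ℕ} (h : a.size ≤ B) :
    (if p then a else 0).size ≤ B := by
  split
  · exact h
  · simp

/-- There is enough space for the algorithm within the bound of the theorem. -/
theorem exists_setup (G : SimpleGraph (Fin n)) (c : Sym2 (Fin n) → ℕ) (D : TreeDecomposition G N)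
    (hw : 1 ≤ D.width) : ∃ (C : Ctx) (ord : ℕ → Fin n) (F : ℕ), C.inp = TSP.encode G c D ∧
      Setup C G c D ord F ∧ C.M ≤ 40000 * (D.depth * unit G c D) + 6400 * N.size := by
  classical
  have hU := unitFacts (G := G) (c := c) hw
  have hn := hU.two_le_n
  have hdn := D.depth_le
  have hwd := D.width_lt_depth hw
  obtain ⟨ord, ho, hrank⟩ := D.exists_order (by omega)
  have hE := isElim_pred ho
  have hecost := hE.ecost_edges c
  have hS := ho.chordal
  have hN : ∀ v ≤ n, nbrs G ord (D.pred ord) v ⊆ D.pred ord v := fun v _ => nbrs_subset v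
  have hcard : ∀ v ≤ n, (D.pred ord v).card ≤ D.width := fun v hv => ho.card_pred_le hw hv
  have hM1 := card_edges_le hN hcard
  set Z := unit G c D with hZ
  set L := n.size with hL
  set W := TSP.totalWeight G c with hW
  set w := D.width with hwdef
  set Ec := (edges n (nbrs G ord (D.pred ord))).card with hEc
  have hnL : n < 2 ^ L := Nat.lt_size_self n
  have hMZ : Ec + 1 ≤ Z := le_trans (by omega) hU.nw
  have hML : Ec + 1 ≤ 2 ^ (2 * L) := by
    have h1 : n * w + 1 ≤ n * n := by nlinarith
    calc Ec + 1 ≤ n * n := by omega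
      _ ≤ 2 ^ L * 2 ^ L := Nat.mul_le_mul hnL.le hnL.le
      _ = _ := by rw [← pow_add]; congr 1; ring
  have hpow : ∀ {a b : ℕ}, a ≤ b → 2 ^ a ≤ 2 ^ b := fun h => Nat.pow_le_pow_right (by norm_num) h
  have hfull : ∀ z, 1 ≤ z → z ≤ Ec + 1 →
      fullBound n (nbrs G ord (D.pred ord)) (2 * n * L) (pcost c ord) z ≤ 2 ^ (8 * Z) := by
    intro z h1 h2
    refine (fullBound_le h1 (h2.trans hML)).trans (hpow ?_)
    rw [hecost, ← hL, ← hEc]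
    have h3 : (2 * L + 1) * Ec ≤ (2 * L + 1) * (n * w) := Nat.mul_le_mul_left _ hM1
    have h4 : (2 * L + 1) * (n * w) = 2 * (n * w * L) + n * w := by ring
    have h5 : (2 * L + 1) * n = 2 * (n * L) + n := by ring
    have h6 : 2 * n * L * W = 2 * (n * L * W) := by ring
    have h7 := hU.nL; have h8 := hU.nwL; have h9 := hU.nW; have h10 := hU.nw
    have h11 : n ≤ n * w := Nat.le_mul_of_pos_right _ hw
    omega
  have hβ : ∀ {a : ℕ}, a ≤ 10 * Z → 2 ^ a ≤ 2 ^ (10 * Z + N.size) := fun h => hpow (by omega)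
  have hZ4 := hU.four
  have hn2 : 2 * n + 2 ≤ 2 ^ (L + 2) := by rw [pow_add]; omega
  have hLZ := hU.L
  let C : Ctx :=
    { inp := TSP.encode G c D
      β := 10 * Z + N.size
      seven_le := by omega
      inp_le := getD_encode_le (hnL.le.trans (hβ (by omega)))
        ((Nat.lt_size_self N).le.trans (hpow (by omega))) Nat.one_le_two_pow
        ((Nat.lt_two_pow_self.trans_le (hβ (a := W + 1) (by have := hU.W; omega))).le)
      ab := arrBound n (D.pred ord) D.depth Z
      sup := arrSup n (D.pred ord) D.depth
      ab_le := fun k i => by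
        have h1 : ∀ (p : Prop) [Decidable p] (a : ℕ), a ≤ 2 ^ (10 * Z + N.size) →
            (if p then a else 0) ≤ 2 ^ (10 * Z + N.size) := fun p _ a h => by split <;> omega
        cases k <;> apply h1
        · exact hnL.le.trans (hβ (by omega))
        · exact hnL.le.trans (hβ (by omega))
        · exact Nat.one_le_two_pow
        · exact hn2.trans (hβ (by omega))
        · exact hnL.le.trans (hβ (by omega))
        · exact hβ (by omega)
        · exact hβ (by omega)
      ab_zero := fun k i hi => by cases k <;> exact if_neg hi }
  have hCβ : C.β = 10 * Z + N.size := rfl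
  have hmem : ∀ {i}, i ≤ n → i ∈ Finset.range (n + 1) := fun h => Finset.mem_range.2 (by omega)
  have hlev : ∀ v ≤ n, lev (D.pred ord) v ∈ Finset.range (D.depth + 1) := fun v hv =>
    Finset.mem_range.2 (by have := ho.lev_le v hv; omega)
  have hpre : PreCtx C G c D ord :=
    { coded := coded_encode
      two_le := hn
      order := ho
      rank := hrank
      small := hU.small.trans (hβ (by omega))
      weight_le := (Nat.lt_two_pow_self (n := W)).le.trans (hβ (by have := hU.W; omega))
      ord_le := fun i _ hi => (if_pos (hmem hi)).ge
      par_le := fun i _ hi => (if_pos (hmem hi)).ge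
      S_le := fun v u hv hu => (if_pos (Finset.mem_biUnion.2 ⟨v, hmem hv,
        Finset.mem_image_of_mem _ hu⟩)).ge }
  refine ⟨C, ord, 2 ^ (8 * Z), rfl, ⟨hpre, ⟨fun z h1 h2 => ⟨⟨hS, fun v => nbrs_subset v, hn,
    fun u v h3 h4 h5 => ?_, hpre.small⟩, hcard, hw, fun v _ hv => (if_pos (hmem hv)).ge,
    fun v hv => (hfull z h1 h2).trans (if_pos (hlev v hv)).ge,
    fun v hv => (hfull z h1 h2).trans (if_pos (hlev v hv)).ge⟩, hfull, ?_, ?_, by omega⟩,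
    fun i _ hi => (if_pos (hmem hi)).ge⟩, ?_⟩
  · rw [hpre.coded.adj]
    have h6 := hE.mem_edges (u := u) (v := v)
    rw [Elim.mem_edges] at h6
    simp only [Finset.mem_Icc] at h6
    have h7 : u ∈ nbrs G ord (D.pred ord) v ↔ G.Adj (ord v) (ord u) :=
      ⟨fun h => (h6.1 ⟨⟨by omega, h5⟩, h⟩).2.2.2, fun h => (h6.2 ⟨h3, h4, h5, h⟩).2⟩
    exact if_congr h7.symm rfl rfl
  · calc (Ec + 1) * (2 ^ (Ec + 1) * 2 ^ (8 * Z)) ≤ 2 ^ Z * (2 ^ Z * 2 ^ (8 * Z)) :=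
          Nat.mul_le_mul ((Nat.lt_two_pow_self.le).trans (hpow hMZ))
            (Nat.mul_le_mul_right _ (hpow hMZ))
      _ = 2 ^ (10 * Z) := by rw [← pow_add, ← pow_add]; congr 1; ring
      _ ≤ _ := hβ le_rfl
  · exact (hU.two_mul_pow_le hML).trans (hβ (by omega))
  · have hall : Arr.all = {.ord, .par, .S, .opt, .nxt, .acc, .prod} := by decide
    have hr : ∀ i ∈ Finset.range (n + 1), i < 2 ^ L := fun i hi => by
      have := Finset.mem_range.1 hi; omega
    have hsn : n.size ≤ L + 2 := by omega
    have hcn : (Finset.range (n + 1)).card ≤ 2 * n := by rw [Finset.card_range]; omega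
    have hcd : (Finset.range (D.depth + 1)).card ≤ 2 * D.depth := by rw [Finset.card_range]; omega
    have hrd : ∀ i ∈ Finset.range (D.depth + 1), i < 2 ^ L := fun i hi => by
      have := Finset.mem_range.1 hi; omega
    have hcS : (arrSup n (D.pred ord) D.depth .S).card ≤ 2 * (n * w) := by
      refine Finset.card_biUnion_le.trans ?_
      refine (Finset.sum_le_card_nsmul _ _ w fun v hv => Finset.card_image_le.trans
        (hcard v (by have := Finset.mem_range.1 hv; omega))).trans ?_
      rw [Finset.card_range, smul_eq_mul]
      nlinarith
    have hrS : ∀ i ∈ arrSup n (D.pred ord) D.depth .S, i < 2 ^ (2 * L) := fun i hi => by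
      obtain ⟨v, hv, hi⟩ := Finset.mem_biUnion.1 hi
      obtain ⟨u, hu, rfl⟩ := Finset.mem_image.1 hi
      have hv' : v ≤ n := by have := Finset.mem_range.1 hv; omega
      have h3 := (hS.lt v hv' u hu).2
      calc v * (n + 1) + u < (n + 1) * (n + 1) := by nlinarith
        _ ≤ 2 ^ L * 2 ^ L := Nat.mul_le_mul hnL hnL
        _ = _ := by rw [← pow_add]; congr 1; ring
    have b1 := sum_len_le .ord _ (arrBound n (D.pred ord) D.depth Z .ord) hcn hr
      fun i => size_ite_le hsn
    have b2 := sum_len_le .par _ (arrBound n (D.pred ord) D.depth Z .par) hcn hr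
      fun i => size_ite_le hsn
    have b3 := sum_len_le .nxt _ (arrBound n (D.pred ord) D.depth Z .nxt) hcn hr
      fun i => size_ite_le hsn
    have b4 := sum_len_le .opt _ (arrBound n (D.pred ord) D.depth Z .opt) hcn hr
      (B := L + 3) fun i => size_ite_le (Nat.size_le.2 (hn2.trans_lt (by
        exact Nat.pow_lt_pow_right (by norm_num) (by omega))))
    have b5 := sum_len_le .S _ (arrBound n (D.pred ord) D.depth Z .S) hcS hrS
      (B := 1) fun i => size_ite_le (by simp)
    have b6 := sum_len_le .acc _ (arrBound n (D.pred ord) D.depth Z .acc) hcd hrd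
      (B := 8 * Z + 1) fun i => size_ite_le (Nat.size_le.2 (Nat.pow_lt_pow_right (by norm_num) (by omega)))
    have b7 := sum_len_le .prod _ (arrBound n (D.pred ord) D.depth Z .prod) hcd hrd
      (B := 8 * Z + 1) fun i => size_ite_le (Nat.size_le.2 (Nat.pow_lt_pow_right (by norm_num) (by omega)))
    have hCM : C.M = 64 * (9 + 100 * C.β) + ∑ k ∈ Arr.all, ∑ i ∈ arrSup n (D.pred ord) D.depth k,
      (len ((64 * i + k.reg : ℕ) : ℤ) + ((arrBound n (D.pred ord) D.depth Z k i).size + 1)) := rfl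
    rw [hCM, hCβ, hall]
    simp only [Finset.sum_insert, Finset.mem_insert, Finset.mem_singleton, reduceCtorEq, or_self,
      not_false_eq_true, Finset.sum_singleton]
    have hd : 2 ≤ D.depth := by omega
    have c1 : 2 * n * (L + (L + 2) + 8) ≤ 14 * Z := by
      have := hU.nL; have := hU.two_le_L
      have : 2 * n * (L + (L + 2) + 8) = 4 * (n * L) + 20 * n := by ring
      have : n * 2 ≤ n * L := Nat.mul_le_mul_left _ hU.two_le_L
      omega
    have c4 : 2 * n * (L + (L + 3) + 8) ≤ 15 * Z := by
      have := hU.nL; have := hU.two_le_L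
      have : 2 * n * (L + (L + 3) + 8) = 4 * (n * L) + 22 * n := by ring
      have : n * 2 ≤ n * L := Nat.mul_le_mul_left _ hU.two_le_L
      omega
    have c5 : 2 * (n * w) * (2 * L + 1 + 8) ≤ 13 * Z := by
      have := hU.nwL
      have : 2 * (n * w) * (2 * L + 1 + 8) = 4 * (n * w * L) + 18 * (n * w) := by ring
      have : n * w * 2 ≤ n * w * L := Nat.mul_le_mul_left _ hU.two_le_L
      omega
    have c6 : 2 * D.depth * (L + (8 * Z + 1) + 8) ≤ 24 * (D.depth * Z) := by
      calc 2 * D.depth * (L + (8 * Z + 1) + 8) ≤ 2 * D.depth * (12 * Z) :=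
            Nat.mul_le_mul_left _ (by omega)
        _ = _ := by ring
    have c7 : 2 * Z ≤ D.depth * Z := Nat.mul_le_mul_right _ hd
    simp only [arrSup] at b1 b2 b3 b4 b5 b6 b7 ⊢
    omega

end RAM

/-! ### Total time and space -/

namespace RAM

open Elim

theorem optTime_le {n s : ℕ} (hn : n ≤ s) (hs : 1 ≤ s) : optTime n ≤ 130 * s ^ 2 := by
  have h1 : n ^ 2 ≤ s ^ 2 := Nat.pow_le_pow_left hn 2
  have h2 : 1 ≤ s ^ 2 := Nat.one_le_pow _ _ hs
  unfold optTime; omega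

/-- The factor `(4 * w) ^ d` bounds the number of visits of a vertex, one for each choice of options of
nonzero weight on the path above it. -/
theorem evalTime_le {n w d s : ℕ} (hn : n ≤ s) (hw1 : 1 ≤ w) (hw : w ≤ s) (hs : 1 ≤ s) :
    evalTime n w d ≤ 480 * ((4 * w) ^ d * s ^ 4) := by
  have hA : 1 ≤ (4 * w) ^ d := Nat.one_le_pow _ _ (by omega)
  have hp : ∀ k, 1 ≤ s ^ k := fun k => Nat.one_le_pow _ _ hs
  have h1 : 2 * n * optTime n ≤ 260 * s ^ 3 := by
    calc 2 * n * optTime n ≤ 2 * s * (130 * s ^ 2) := Nat.mul_le_mul (by omega) (optTime_le hn hs)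
      _ = _ := by ring
  have h2 : 4 * w * (20 * n + 20) ≤ 160 * s ^ 3 := by
    calc 4 * w * (20 * n + 20) ≤ 4 * s * (40 * s) := Nat.mul_le_mul (by omega) (by omega)
      _ = 160 * (s ^ 2 * 1) := by ring
      _ ≤ 160 * (s ^ 2 * s) := by gcongr
      _ = _ := by ring
  have h3 : n * ((4 * w) ^ d * (2 * n * optTime n + 4 * w * (20 * n + 20) + 20)) ≤
      440 * ((4 * w) ^ d * s ^ 4) := by
    calc n * ((4 * w) ^ d * (2 * n * optTime n + 4 * w * (20 * n + 20) + 20))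
        ≤ s * ((4 * w) ^ d * (440 * s ^ 3)) := by
          refine Nat.mul_le_mul hn (Nat.mul_le_mul_left _ ?_)
          have := hp 3; omega
      _ = _ := by ring
  have h4 : s ≤ (4 * w) ^ d * s ^ 4 := by
    calc s = 1 * s ^ 1 := by ring
      _ ≤ _ := Nat.mul_le_mul hA (Nat.pow_le_pow_right hs (by norm_num))
  unfold evalTime; omega

theorem solveTime_le {n w d M s : ℕ} (hn : n ≤ s) (hw1 : 1 ≤ w) (hw : w ≤ s) (hs : 1 ≤ s)
    (hM : M ≤ s ^ 2) : solveTime n w d M ≤ 498 * ((4 * w) ^ d * s ^ 6) := by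
  have hA : 1 ≤ (4 * w) ^ d := Nat.one_le_pow _ _ (by omega)
  have h1 := evalTime_le (d := d) hn hw1 hw hs
  have h4 : s ≤ (4 * w) ^ d * s ^ 4 := by
    calc s = 1 * s ^ 1 := by ring
      _ ≤ _ := Nat.mul_le_mul hA (Nat.pow_le_pow_right hs (by norm_num))
  have h6 : 1 ≤ (4 * w) ^ d * s ^ 6 := Nat.mul_le_mul hA (Nat.one_le_pow _ _ hs)
  have h5 : M * (evalTime n w d + 3 * n + 10) ≤ 493 * ((4 * w) ^ d * s ^ 6) := by
    calc M * (evalTime n w d + 3 * n + 10) ≤ s ^ 2 * (493 * ((4 * w) ^ d * s ^ 4)) :=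
          Nat.mul_le_mul hM (by omega)
      _ = _ := by ring
  unfold solveTime; omega

theorem tspTime_le {n N T A s : ℕ} (hn : n ≤ s) (hN : N ≤ s) (hs : 1 ≤ s) (hA : 1 ≤ A)
    (hT : T ≤ 498 * (A * s ^ 6)) : tspTime n N T ≤ 1100 * (A * s ^ 8) := by
  have hp : ∀ k, 1 ≤ s ^ k := fun k => Nat.one_le_pow _ _ hs
  have hpp : ∀ {j k}, j ≤ k → s ^ j ≤ s ^ k := fun h => Nat.pow_le_pow_right hs h
  have h7 : 1 ≤ A * s ^ 7 := Nat.mul_le_mul hA (hp 7)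
  have h8 : 1 ≤ A * s ^ 8 := Nat.mul_le_mul hA (hp 8)
  have h6 : 1 ≤ A * s ^ 6 := Nat.mul_le_mul hA (hp 6)
  have h68 : A * s ^ 6 ≤ A * s ^ 8 := Nat.mul_le_mul_left _ (hpp (by norm_num))
  have h48 : s ^ 4 ≤ A * s ^ 8 := by
    calc s ^ 4 = 1 * s ^ 4 := by ring
      _ ≤ _ := Nat.mul_le_mul hA (hpp (by norm_num))
  have h1 : nextTime n T ≤ 508 * (A * s ^ 7) := by
    have : n * (T + 7) ≤ 505 * (A * s ^ 7) := by
      calc n * (T + 7) ≤ s * (505 * (A * s ^ 6)) := Nat.mul_le_mul hn (by omega)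
        _ = _ := by ring
    unfold nextTime; omega
  have h2 : n * (nextTime n T + 6) ≤ 514 * (A * s ^ 8) := by
    calc n * (nextTime n T + 6) ≤ s * (514 * (A * s ^ 7)) := Nat.mul_le_mul hn (by omega)
      _ = _ := by ring
  have h3 : preTime n N ≤ 60 * s ^ 4 := by
    have e1 : n * (9 * n + 9) ≤ 18 * s ^ 2 := by
      calc n * (9 * n + 9) ≤ s * (18 * s) := Nat.mul_le_mul hn (by omega)
        _ = _ := by ring
    have e2 : s ≤ s ^ 2 := Nat.le_self_pow two_ne_zero s
    have e3 : N * (n * (9 * n + 9) + 3 * N + 10) ≤ 31 * s ^ 3 := by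
      calc N * (n * (9 * n + 9) + 3 * N + 10) ≤ s * (31 * s ^ 2) :=
            Nat.mul_le_mul hN (by have := hp 2; omega)
        _ = _ := by ring
    have e4 : N * (N * (n * (9 * n + 9) + 3 * N + 10) + 10) ≤ 41 * s ^ 4 := by
      calc N * (N * (n * (9 * n + 9) + 3 * N + 10) + 10) ≤ s * (41 * s ^ 3) :=
            Nat.mul_le_mul hN (by have := hp 3; omega)
        _ = _ := by ring
    have := hp 4
    unfold preTime; omega
  unfold tspTime; omega

theorem rel_start (C : Ctx) : Rel C State.start ⟨fun _ => 0, fun _ _ => 0, []⟩ where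
  v_le _ := by simp
  a_le _ _ := by simp
  var _ := rfl
  arr _ _ := rfl
  tmp _ _ := by simp [State.start]
  zero r hr := (hr rfl).elim
  out_eq := rfl

/-- Logarithms to the base `e` and to the base `2` differ by a factor less than `2`. -/
theorem size_le_log {n : ℕ} (hn : 1 ≤ n) : (n.size : ℝ) ≤ 2 * Real.log n + 1 := by
  have h0 : 0 < n.size := Nat.size_pos.2 hn
  have h1 : 2 ^ (n.size - 1) ≤ n := Nat.lt_size.1 (by omega)
  have h2 : ((n.size - 1 : ℕ) : ℝ) * Real.log 2 ≤ Real.log n := by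
    rw [← Real.log_pow]
    exact Real.log_le_log (by positivity) (by exact_mod_cast h1)
  have h3 := Real.log_two_gt_d9
  have h4 : ((n.size - 1 : ℕ) : ℝ) = n.size - 1 := by push_cast [Nat.cast_sub h0]; ring
  rw [h4] at h2
  have h5 : (0 : ℝ) ≤ n.size - 1 := by rw [← h4]; positivity
  nlinarith

variable {n N : ℕ} {G : SimpleGraph (Fin n)} {c : Sym2 (Fin n) → ℕ} {D : TreeDecomposition G N}

/-- The bound for the space, in terms of logarithms. -/
theorem space_le_log (hw : 1 ≤ D.width) :
    ((40000 * (D.depth * unit G c D) + 6400 * N.size : ℕ) : ℝ) ≤ 200000 *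
      ((max (TSP.totalWeight G c) 1 : ℕ) * D.depth * D.width * n * Real.log n + Real.log N) := by
  have hn := D.two_le_n hw
  have hN : 1 ≤ N := D.root.pos
  have h1 := size_le_log (show 1 ≤ n by omega)
  have h2 := size_le_log hN
  have h3 : (0.69 : ℝ) ≤ Real.log n := by
    have := Real.log_two_gt_d9
    have h4 : Real.log 2 ≤ Real.log n := Real.log_le_log (by norm_num) (by exact_mod_cast hn)
    linarith
  have hd : 2 ≤ D.depth := by have := D.width_lt_depth hw; omega
  have hlN : 0 ≤ Real.log N := Real.log_natCast_nonneg _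
  set q : ℝ := (max (TSP.totalWeight G c) 1 : ℕ) * D.depth * D.width * n with hq
  have hq1 : 4 ≤ q := by
    have : 4 ≤ max (TSP.totalWeight G c) 1 * D.depth * D.width * n := by
      calc 4 = 1 * 2 * 1 * 2 := by norm_num
        _ ≤ _ := by gcongr; exact le_max_right _ _
    rw [hq]; exact_mod_cast this
  have e : ((D.depth * unit G c D : ℕ) : ℝ) = q * n.size := by
    rw [hq, unit]; push_cast; ring
  have h5 : q * n.size ≤ 4 * (q * Real.log n) := by nlinarith
  have h6 : 0.69 * 4 ≤ q * Real.log n := by nlinarith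
  have e2 : ((40000 * (D.depth * unit G c D) + 6400 * N.size : ℕ) : ℝ) =
      40000 * ((D.depth * unit G c D : ℕ) : ℝ) + 6400 * N.size := by push_cast; ring
  rw [e2, e]
  nlinarith

theorem space_le_pow (hw : 1 ≤ D.width) :
    40000 * (D.depth * unit G c D) + 6400 * N.size ≤
      46400 * (n + N + TSP.totalWeight G c) ^ 5 := by
  have hn := D.two_le_n hw
  set v := n + N + TSP.totalWeight G c with hv
  have hv1 : 1 ≤ v := by omega
  have hwd := D.width_lt_depth hw
  have hd := D.depth_le
  have hL : n.size ≤ v := (Nat.size_le.2 Nat.lt_two_pow_self).trans (by omega : n ≤ v)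
  have hLN : N.size ≤ v := (Nat.size_le.2 Nat.lt_two_pow_self).trans (by omega : N ≤ v)
  have h1 : D.depth * unit G c D ≤ v ^ 5 := by
    calc D.depth * unit G c D ≤ v * (v * v * v * v) := by
          unfold unit
          refine Nat.mul_le_mul (by omega) (Nat.mul_le_mul (Nat.mul_le_mul (Nat.mul_le_mul ?_ ?_) ?_) hL)
          · exact max_le (by omega) hv1
          · omega
          · omega
      _ = _ := by ring
  have h2 : v ≤ v ^ 5 := Nat.le_self_pow (by norm_num) v
  omega

end RAM

theorem theorem2 :
    ∃ (P : RAM.Prog) (C k : ℕ), ∀ (n N : ℕ) (G : SimpleGraph (Fin n)) (c : Sym2 (Fin n) → ℕ)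
      (D : TreeDecomposition G N), 1 ≤ D.width →
      ∃ (f : RAM.State) (t b m : ℕ),
        RAM.Run (TSP.encode G c D) P RAM.State.start f t b m ∧
        TSP.IsAnswer G c f.out ∧
        t ≤ C * (4 * D.width) ^ D.depth * (n + N) ^ k ∧
        b ≤ C * (4 * D.width) ^ D.depth * (n + N + TSP.totalWeight G c) ^ k ∧
        (m : ℝ) ≤ C * ((max (TSP.totalWeight G c) 1 : ℕ) * D.depth * D.width * n * Real.log n
          + Real.log N) := by
  -- A unit of time stands for `2000` machine steps, and `1100 * 2000 = 2200000`. The exponent `18` is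
  -- the sum of `8` for the number of steps and of `10` for the square of the space per step.
  set R := RAM.tspP.litLen with hR
  set C₀ := 2200000 * ((3 * R + 3) * 100000 ^ 2) with hC₀
  have hC₀1 : 2200000 ≤ C₀ := by rw [hC₀]; exact Nat.le_mul_of_pos_right _ (by positivity)
  refine ⟨RAM.tspP, C₀, 18, fun n N G c D hw => ?_⟩
  obtain ⟨C, ord, F, hinp, hset, hM⟩ := RAM.exists_setup G c D hw
  obtain ⟨f, τ, ⟨t, b, m, hrun, ht, hm⟩, hrel, hans⟩ := hset.tspP_ok _ (RAM.rel_start C)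
  rw [hinp] at hrun
  have hn := D.two_le_n hw
  have hwd := D.width_lt_depth hw
  have hdn := D.depth_le
  have hA : 1 ≤ (4 * D.width) ^ D.depth := Nat.one_le_pow _ _ (by omega)
  have hE : (Elim.edges n (Elim.nbrs G ord (D.pred ord))).card + 1 ≤ (n + N) ^ 2 := by
    have h1 := Elim.card_edges_le (n := n) (N := Elim.nbrs G ord (D.pred ord)) (fun v _ => Elim.nbrs_subset v)
      fun v hv => hset.order.card_pred_le hw hv
    have h2 : n * D.width + 1 ≤ n * n := by nlinarith
    calc _ ≤ n * n := by omega
      _ ≤ _ := by rw [sq]; exact Nat.mul_le_mul (by omega) (by omega)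
  have hT := RAM.tspTime_le (n := n) (N := N) (s := n + N) (by omega) (by omega) (by omega) hA
    (RAM.solveTime_le (n := n) (w := D.width) (d := D.depth) (by omega) hw (by omega) (by omega) hE)
  have ht' : t ≤ 2200000 * ((4 * D.width) ^ D.depth * (n + N) ^ 8) := by omega
  have hp8 : (n + N) ^ 8 ≤ (n + N) ^ 18 := Nat.pow_le_pow_right (by omega) (by norm_num)
  refine ⟨f, t, b, m, hrun, hrel.out_eq ▸ hans, ?_, ?_, ?_⟩
  · calc t ≤ 2200000 * ((4 * D.width) ^ D.depth * (n + N) ^ 8) := ht'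
      _ ≤ C₀ * ((4 * D.width) ^ D.depth * (n + N) ^ 18) := by gcongr
      _ = _ := by ring
  · set v := n + N + TSP.totalWeight G c with hv
    have hCv : C.M ≤ 46400 * v ^ 5 := hM.trans (RAM.space_le_pow hw)
    have hβ : C.β + 2 ≤ C.M := by
      have : 64 * (9 + 100 * C.β) ≤ C.M := Nat.le_add_right _ _
      omega
    have hv5 : 1 ≤ v ^ 5 := Nat.one_le_pow _ _ (by omega)
    have hbits := hrun.bits_le (Y := 100000 * v ^ 5) (R := R) (fun j => ?_) (by omega) le_rfl
    · have h8 : (n + N) ^ 8 ≤ v ^ 8 := Nat.pow_le_pow_left (by omega) 8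
      calc b ≤ t * ((3 * R + 3) * (100000 * v ^ 5) ^ 2) := hbits
        _ ≤ 2200000 * ((4 * D.width) ^ D.depth * v ^ 8) * ((3 * R + 3) * (100000 * v ^ 5) ^ 2) := by
          refine Nat.mul_le_mul_right _ (ht'.trans ?_)
          gcongr
        _ = _ := by rw [hC₀]; ring
    · have h1 := C.inp_le j
      rw [hinp] at h1
      have := RAM.size_le_of_abs_le_pow (z := ((TSP.encode G c D).getD j 0 : ℕ)) (m := C.β)
        (by rw [Nat.abs_cast]; exact_mod_cast h1)
      unfold RAM.len
      omega
  · have hpos : 0 ≤ (max (TSP.totalWeight G c) 1 : ℕ) * D.depth * D.width * n * Real.log n +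
        Real.log N :=
      add_nonneg (mul_nonneg (by positivity) (Real.log_natCast_nonneg _)) (Real.log_natCast_nonneg _)
    calc (m : ℝ) ≤ ((40000 * (D.depth * RAM.unit G c D) + 6400 * N.size : ℕ) : ℝ) := by
          exact_mod_cast hm.trans hM
      _ ≤ _ := RAM.space_le_log hw
      _ ≤ _ := mul_le_mul_of_nonneg_right (by
          have : ((2200000 : ℕ) : ℝ) ≤ C₀ := by exact_mod_cast hC₀1
          push_cast at this
          linarith) hpos
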